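/- **Setting.** A signature $\Sigma$ is a finite set of letters with arities which contains a constant; $k$ is its maximal arity. Ground terms are the terms over $\Sigma$; a ground context is a ground term over $\Sigma\cup\{\Omega\}$ with exactly one occurrence of the extra constant $\Omega$ (the hole); $\Omega$ is the empty context. Terms are built from letters, variables $x$ (used as constants) and context variables $X$ (used as unary symbols). A context equation is a pair $u=v$ of terms; its size is $n=|u|+|v|$, the number of symbols. A solution assigns a ground term $S(x)$ to each variable and a ground context $S(X)$ to each context variable, where $S(Xt)$ is $S(X)$ with $\Omega$ replaced by $S(t)$, such that $S(u)=S(v)$; its size is $|S(u)|$, and it is size-minimal if no solution has smaller size. The equation is satisfiable if it has a solution. **The algorithm.** The nondeterministic algorithm $\mathrm{SolveEq}$ first reads the input (coding symbols by names of its choice) and removes from it a guessed set of context variables (each $X(t)$ becomes $t$). While one of the sides has size greater than $1$ it performs a *phase*, which consists of two identical *subphases*. Below, 'pop' means a replacement throughout the equation. Each pop is optional, according to a guess; after a pop from $X$, $X$ may be removed (each $X(t)$ becomes $t$), according to a guess that its value became empty; new letters are letters that do not occur in the equation, and different patterns are replaced by different letters. A subphase does the following. 1. *Chains.* Let $\Gamma$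 be the set of unary letters in the equation. For each $X$ (each $x$) pop up a guessed chain: replace $X$ by $a^\ell X$ (respectively $x$ by $a^\ell x$), $a\in\Gamma$, $\ell\ge 1$; then for each $X$ pop down a guessed chain: replace $X$ by $Xb^r$, $b\in\Gamma$, $r\ge 1$. Popped chains are stored as pairs (letter, exponent in binary). Then replace each maximal chain $a^\ell$, $a\in\Gamma$, by a new unary letter $a_\ell$. 2. *Pairs.* Guess a partition of the set of unary letters in the equation into $\Gamma_1,\Gamma_2$. For each $X$ pop down a letter $a\in\Gamma_1$ (replace $X$ by $Xa$); then for each $X$ (each $x$) pop up a letter $b\in\Gamma_2$ (replace $X$ by $bX$, respectively $x$ by $bx$). Then replace each chain $ab$ with $a\in\Gamma_1$, $b\in\Gamma_2$ by a new unary letter, which depends on $a,b$ only. 3. *Leaves.* Let $\Gamma_{\ge1}$ consist of the letters of positive arity in the equation and one new letter of each arity $i$ with $1<i\le k$, and $\Gamma_0$ of the constants in the equation and one new constant. Replace each $x$ by a constant from $\Gamma_0$; then, for each $X$ for which $X(a)$ with some $a\in\Gamma_0$ is a subterm of the equation, replace $X$ by $Xf(x_1,\dots,x_{i-1},\Omega,x_{i+1},\dots,x_m)$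 for a letter $f\in\Gamma_{\ge1}$ of arity $m$, a position $i$ and fresh variables $x_j$; then replace each of the fresh variables by a constant from $\Gamma_0$ (all these replacements are optional as above). Then every node labelled with $f\in\Gamma_{\ge1}$ that has children which are constants in $\Gamma_0$ absorbs all of them: they are deleted and $f$ is replaced by a new letter, which depends on $f$ and on the absorbed constants with their positions only. When both sides have size $1$ the algorithm answers YES if one of them is a variable or both are the same constant, and NO otherwise. The length of the stored equation is its number of symbols, a compressed chain $a^\ell$ counting as one; the memory is the total number of bits that encode the equation (including names and exponents of chains), the sets $\Gamma,\Gamma_1,\Gamma_2,\Gamma_{\ge 1},\Gamma_0$ and the loop lists. **Theorem.** There is an absolute constant $C$ such that for every signature $\Sigma$ and every context equation $u=v$ over $\Sigma$, with $n$ and $k$ as above and $k'=\max(k,1)$: * if $u=v$ is not satisfiable, then every halting run of $\mathrm{SolveEq}$ on $u=v$ answers NO; * if $u=v$ is satisfiable and $N$ is the size of a size-minimal solution, then for suitable nondeterministic choices $\mathrm{SolveEq}$ answers YES after at most $C\log N$ phases, and all the time during this run the stored equation has length at most $C\,n k'$ and the memory is at most $C\,n^2k'^2$ bits. -/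

import Mathlib

/-! ### Ground terms and ground contexts

A letter is a pair `(f, m)` of a name `f` and an arity `m`.  In a tree a node named `f` with `m`
children carries the letter `(f, m)`, so every tree is well-formed. -/

namespace ContextUnif

/-- Ground terms. -/
inductive Tree : Type
  | node (f : ℕ) (ts : List Tree) : Tree

/-- Ground contexts: ground terms with exactly one occurrence of the hole `Ω`. -/
inductive Ctx : Type
  | hole : Ctx
  | node (f : ℕ) (left : List Tree) (c : Ctx) (right : List Tree) : Ctx

/-- The number of nodes. -/
def Tree.size : Tree → ℕ
  | .node _ ts => (ts.map Tree.size).sum + 1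

/-- All letters belong to the signature `Sg`. -/
def Tree.Over (Sg : Finset (ℕ × ℕ)) : Tree → Prop
  | .node f ts => (f, ts.length) ∈ Sg ∧ ∀ t ∈ ts, Tree.Over Sg t

def Ctx.Over (Sg : Finset (ℕ × ℕ)) : Ctx → Prop
  | .hole => True
  | .node f l c r => (f, l.length + 1 + r.length) ∈ Sg ∧
      (∀ t ∈ l, t.Over Sg) ∧ c.Over Sg ∧ ∀ t ∈ r, t.Over Sg

/-- Replace the hole by a tree. -/
def Ctx.fill : Ctx → Tree → Tree
  | .hole, t => t
  | .node f l c r, t => .node f (l ++ c.fill t :: r)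

/-! ### Terms with variables, context equations, solutions -/

/-- Terms with variables `var x` and context variables `cvar X` (applied to one argument).
The constructor `pow a l t` is the compressed storage of the term `a^l t`, for a unary letter `a`;
it is used by the algorithm only and never occurs in an input. -/
inductive Term : Type
  | var (x : ℕ) : Term
  | cvar (X : ℕ) (t : Term) : Term
  | node (f : ℕ) (ts : List Term) : Term
  | pow (a : ℕ) (l : ℕ) (t : Term) : Term

namespace Term

/-- The number of symbols; a chain `a^l` stored as a pair `(a, l)` is one symbol. -/
def size : Term → ℕ
  | .var _ => 1
  | .cvar _ t => t.size + 1
  | .node _ ts => (ts.map size).sum + 1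
  | .pow _ _ t => t.size + 1

/-- The term is an ordinary term (no compressed chains) with letters from `Sg`. -/
def Over (Sg : Finset (ℕ × ℕ)) : Term → Prop
  | .var _ => True
  | .cvar _ t => t.Over Sg
  | .node f ts => (f, ts.length) ∈ Sg ∧ ∀ t ∈ ts, Over Sg t
  | .pow _ _ _ => False

/-- Occurrences of letters. -/
def letters : Term → List (ℕ × ℕ)
  | .var _ => []
  | .cvar _ t => t.letters
  | .node f ts => (f, ts.length) :: (ts.map letters).flatten
  | .pow a _ t => (a, 1) :: t.letters

/-- Occurrences of variables. -/
def vars : Term → List ℕ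
  | .var x => [x]
  | .cvar _ t => t.vars
  | .node _ ts => (ts.map vars).flatten
  | .pow _ _ t => t.vars

/-- Occurrences of context variables. -/
def cvars : Term → List ℕ
  | .var _ => []
  | .cvar X t => X :: t.cvars
  | .node _ ts => (ts.map cvars).flatten
  | .pow _ _ t => t.cvars

/-- Replace every occurrence of the variable `x` by `s`. -/
def substV (x : ℕ) (s : Term) : Term → Term
  | .var y => if y = x then s else .var y
  | .cvar X t => .cvar X (substV x s t)
  | .node f ts => .node f (ts.map (substV x s))
  | .pow a l t => .pow a l (substV x s t)

/-- Replace every subterm `X t` by `F t`. -/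
def substC (X : ℕ) (F : Term → Term) : Term → Term
  | .var y => .var y
  | .cvar Y t => if Y = X then F (t.substC X F) else .cvar Y (t.substC X F)
  | .node f ts => .node f (ts.map (substC X F))
  | .pow a l t => .pow a l (t.substC X F)

/-- The constant of `G0` that the term consists of, if it does. -/
def constIn (G0 : Finset ℕ) : Term → Option ℕ
  | .node c [] => if c ∈ G0 then some c else none
  | _ => none

/-- `X a` is a subpattern for some constant `a ∈ G0`. -/
def AppliedToConst (X : ℕ) (G0 : Finset ℕ) : Term → Prop
  | .var _ => False
  | .cvar Y t => (Y = X ∧ (t.constIn G0).isSome) ∨ t.AppliedToConst X G0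
  | .node _ ts => ∃ t, ∃ _ : t ∈ ts, AppliedToConst X G0 t
  | .pow _ _ t => t.AppliedToConst X G0

end Term

/-- A substitution. -/
structure Subst where
  var : ℕ → Tree
  ctx : ℕ → Ctx

/-- The substitution uses the letters of `Sg` only. -/
def Subst.Over (Sg : Finset (ℕ × ℕ)) (S : Subst) : Prop :=
  (∀ x, (S.var x).Over Sg) ∧ ∀ X, (S.ctx X).Over Sg

/-- The value of a term under a substitution. -/
def Subst.eval (S : Subst) : Term → Tree
  | .var x => S.var x
  | .cvar X t => (S.ctx X).fill (S.eval t)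
  | .node f ts => .node f (ts.map S.eval)
  | .pow a l t => (fun s => Tree.node a [s])^[l] (S.eval t)

/-- Solutions of `u = v` over the signature `Sg`. -/
def IsSolution (Sg : Finset (ℕ × ℕ)) (u v : Term) (S : Subst) : Prop :=
  S.Over Sg ∧ S.eval u = S.eval v

def Satisfiable (Sg : Finset (ℕ × ℕ)) (u v : Term) : Prop :=
  ∃ S, IsSolution Sg u v S

def IsSizeMinimal (Sg : Finset (ℕ × ℕ)) (u v : Term) (S : Subst) : Prop :=
  IsSolution Sg u v S ∧ ∀ S', IsSolution Sg u v S' → (S.eval u).size ≤ (S'.eval u).size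

/-- The maximal arity of the letters of a signature. -/
def maxArity (Sg : Finset (ℕ × ℕ)) : ℕ := Sg.sup Prod.snd

/-! ### The compression procedures

They act on a context equation by acting on its two sides.  The argument `nu` is the assignment of
names to the letters that replace the compressed patterns. -/

namespace Term

/-- Write down the maximal chain `b^m` in front of `s` as the single letter `nu b m`. -/
def closeChain (nu : ℕ → ℕ → ℕ) : Option (ℕ × ℕ) × Term → Term
  | (none, s) => s
  | (some (b, m), s) => .node (nu b m) [s]

/-- Put `a^l` in front of a partially compressed term. -/
def addChain (nu : ℕ → ℕ → ℕ) (a l : ℕ) : Option (ℕ × ℕ) × Term → Option (ℕ × ℕ) × Term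
  | (none, s) => (some (a, l), s)
  | (some (b, m), s) => if b = a then (some (a, l + m), s) else (some (a, l), .node (nu b m) [s])

/-- Chain compression of a term; a maximal chain `a^l`, `a ∈ G`, at the top of the term is
returned separately as `some (a, l)`. -/
def chainSplit (nu : ℕ → ℕ → ℕ) (G : Finset ℕ) : Term → Option (ℕ × ℕ) × Term
  | .var x => (none, .var x)
  | .cvar X t => (none, .cvar X (closeChain nu (t.chainSplit nu G)))
  | .node a [t] =>
      if a ∈ G then addChain nu a 1 (t.chainSplit nu G)
      else (none, .node a [closeChain nu (t.chainSplit nu G)])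
  | .node f ts => (none, .node f (ts.map fun t => closeChain nu (chainSplit nu G t)))
  | .pow a l t =>
      if a ∈ G then addChain nu a l (t.chainSplit nu G)
      else (none, .pow a l (closeChain nu (t.chainSplit nu G)))

/-- Chain compression: every maximal chain `a^l` with `a ∈ G` becomes the letter `nu a l`. -/
def chainComp (nu : ℕ → ℕ → ℕ) (G : Finset ℕ) (t : Term) : Term :=
  closeChain nu (t.chainSplit nu G)

/-- Put the unary letter `a` in front of `s`; a pair `ab` with `a ∈ G1`, `b ∈ G2` becomes
`nu a b`. -/
def consPair (nu : ℕ → ℕ → ℕ) (G1 G2 : Finset ℕ) (a : ℕ) : Term → Term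
  | .node b [s] => if a ∈ G1 ∧ b ∈ G2 then .node (nu a b) [s] else .node a [.node b [s]]
  | s => .node a [s]

/-- Pair compression for disjoint `G1`, `G2`. -/
def pairComp (nu : ℕ → ℕ → ℕ) (G1 G2 : Finset ℕ) : Term → Term
  | .var x => .var x
  | .cvar X t => .cvar X (t.pairComp nu G1 G2)
  | .node a [t] => consPair nu G1 G2 a (t.pairComp nu G1 G2)
  | .node f ts => .node f (ts.map (pairComp nu G1 G2))
  | .pow a l t => .pow a l (t.pairComp nu G1 G2)

/-- Leaf compression: a node with letter in `G` absorbs all its children that are constants from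
`G0`; the new letter is named after the old one and the list of the absorbed constants (with
`none` at the positions of the remaining children).  Nodes without such children are kept. -/
def leafComp (nu : ℕ → List (Option ℕ) → ℕ) (G : Finset (ℕ × ℕ)) (G0 : Finset ℕ) : Term → Term
  | .var x => .var x
  | .cvar X t => .cvar X (t.leafComp nu G G0)
  | .node f ts =>
      if (f, ts.length) ∈ G ∧ ∃ t ∈ ts, (t.constIn G0).isSome then
        .node (nu f (ts.map (constIn G0)))
          (ts.attach.filterMap fun t =>
            if (t.1.constIn G0).isSome then none else some (leafComp nu G G0 t.1))
      else .node f (ts.map (leafComp nu G G0))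
  | .pow a l t => .pow a l (t.leafComp nu G G0)
termination_by t => sizeOf t
decreasing_by
  all_goals simp_wf
  all_goals first
    | omega
    | (have h := List.sizeOf_lt_of_mem t.2; omega)
    | (have h := List.sizeOf_lt_of_mem ‹_ ∈ ts›; omega)

end Term

/-! ### Configurations of the algorithm -/

/-- The stored context equation. -/
structure Eqn where
  lhs : Term
  rhs : Term

namespace Eqn

def map (F : Term → Term) (e : Eqn) : Eqn := ⟨F e.lhs, F e.rhs⟩

def size (e : Eqn) : ℕ := e.lhs.size + e.rhs.size

def letters (e : Eqn) : Finset (ℕ × ℕ) := (e.lhs.letters ++ e.rhs.letters).toFinset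

/-- The variables of the equation, each listed once. -/
def vars (e : Eqn) : List ℕ := (e.lhs.vars ++ e.rhs.vars).dedup

/-- The context variables of the equation, each listed once. -/
def cvars (e : Eqn) : List ℕ := (e.lhs.cvars ++ e.rhs.cvars).dedup

/-- The unary letters of the equation. -/
def unary (e : Eqn) : Finset ℕ := (e.letters.filter fun p => p.2 = 1).image Prod.fst

/-- The constants of the equation. -/
def consts (e : Eqn) : Finset ℕ := (e.letters.filter fun p => p.2 = 0).image Prod.fst

/-- The letters of positive arity of the equation. -/
def nonConsts (e : Eqn) : Finset (ℕ × ℕ) := e.letters.filter fun p => p.2 ≠ 0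

/-- The outcome of popping from the context variable `X`: either `X` stays in the
equation `e` or its remaining value is guessed to be empty and each `X t` is replaced by `t`. -/
def MayDrop (X : ℕ) (e e' : Eqn) : Prop := e' = e ∨ e' = e.map (Term.substC X id)

/-- The naive solution of an equation with both sides of size `1`: it is solvable if and only if
a side is a variable or both sides are the same constant. -/
def NaivelySolvable (e : Eqn) : Prop :=
  (∃ x, e.lhs = .var x) ∨ (∃ x, e.rhs = .var x) ∨ e.lhs = e.rhs

end Eqn

/-- Program counter with the local data.  The lists are the (context) variables which the current
loop still has to process. -/
inductive Stage : Type
  /-- the test of the main loop -/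
  | test
  /-- beginning of a subphase -/
  | start
  /-- uncrossing chains: prefixes of context variables, of variables; suffixes -/
  | prefC (G : Finset ℕ) (todo : List ℕ)
  | prefV (G : Finset ℕ) (todo : List ℕ)
  | suff (G : Finset ℕ) (todo : List ℕ)
  /-- chain compression -/
  | chain (G : Finset ℕ)
  /-- guessing the partition -/
  | part
  /-- uncrossing the partition: last letters, first letters of context variables, of variables -/
  | popDown (G1 G2 : Finset ℕ) (todo : List ℕ)
  | popUpC (G1 G2 : Finset ℕ) (todo : List ℕ)
  | popUpV (G1 G2 : Finset ℕ) (todo : List ℕ)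
  /-- pair compression -/
  | pair (G1 G2 : Finset ℕ)
  /-- choosing the letters for the leaf compression -/
  | choose
  /-- uncrossing father-leaf pairs; `new` lists the variables introduced so far -/
  | constV (G : Finset (ℕ × ℕ)) (G0 : Finset ℕ) (todo : List ℕ)
  | genDown (G : Finset (ℕ × ℕ)) (G0 : Finset ℕ) (todo new : List ℕ)
  | constNew (G : Finset (ℕ × ℕ)) (G0 : Finset ℕ) (todo : List ℕ)
  /-- leaf compression -/
  | leaf (G : Finset (ℕ × ℕ)) (G0 : Finset ℕ)
  /-- halting with the answer YES (`true`) or NO (`false`) -/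
  | halt (answer : Bool)

/-- A configuration; `second` tells whether the algorithm is in the second subphase. -/
structure Config where
  second : Bool
  stage : Stage
  eqn : Eqn

/-! ### Memory -/

/-- Length of a self-delimiting binary code of a number. -/
def numBits (m : ℕ) : ℕ := 2 * Nat.size m + 2

/-- Number of bits that store a term: for each symbol its kind, its name, the number of its children
and, for a compressed chain, its length. -/
def Term.bits : Term → ℕ
  | .var x => 2 + numBits x
  | .cvar X t => 2 + numBits X + t.bits
  | .node f ts => 2 + numBits f + numBits ts.length + (ts.map Term.bits).sum
  | .pow a l t => 2 + numBits a + numBits l + t.bits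

def listBits (l : List ℕ) : ℕ := numBits l.length + (l.map numBits).sum

def setBits (G : Finset ℕ) : ℕ := numBits G.card + ∑ a ∈ G, numBits a

def letterSetBits (G : Finset (ℕ × ℕ)) : ℕ :=
  numBits G.card + ∑ p ∈ G, (numBits p.1 + numBits p.2)

/-- Number of bits for the program counter and the local data. -/
def Stage.bits : Stage → ℕ
  | .prefC G l | .prefV G l | .suff G l => 5 + setBits G + listBits l
  | .chain G => 5 + setBits G
  | .popDown G1 G2 l | .popUpC G1 G2 l | .popUpV G1 G2 l =>
      5 + setBits G1 + setBits G2 + listBits l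
  | .pair G1 G2 => 5 + setBits G1 + setBits G2
  | .constV G G0 l | .constNew G G0 l => 5 + letterSetBits G + setBits G0 + listBits l
  | .genDown G G0 l l' => 5 + letterSetBits G + setBits G0 + listBits l + listBits l'
  | .leaf G G0 => 5 + letterSetBits G + setBits G0
  | .test | .start | .part | .choose | .halt _ => 5

/-- Total number of bits of the memory in a configuration. -/
def Config.bits (c : Config) : ℕ :=
  1 + c.stage.bits + c.eqn.lhs.bits + c.eqn.rhs.bits

/-! ### The algorithm -/

/-- Names for the letters replacing chains, or pairs: different patterns get different names,
outside `G`. -/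
def FreshNames (G : Finset ℕ) (nu : ℕ → ℕ → ℕ) : Prop :=
  (∀ a b a' b', nu a b = nu a' b' → a = a' ∧ b = b') ∧ ∀ a b, nu a b ∉ G

/-- Names for the letters introduced by leaf compression: different patterns get different
names, and the new letters are outside `G` and `G0`.  The arity of a new letter is the number of
children that remain. -/
def FreshLeafNames (G : Finset (ℕ × ℕ)) (G0 : Finset ℕ) (nu : ℕ → List (Option ℕ) → ℕ) : Prop :=
  (∀ f p f' p', nu f p = nu f' p' → f = f' ∧ p = p') ∧
    ∀ f p, (nu f p, p.count none) ∉ G ∧ (p.count none = 0 → nu f p ∉ G0)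

open Term in
/-- One step of the nondeterministic algorithm `SolveEq`, where `k` is the maximal arity of the
input signature. -/
inductive Step (k : ℕ) : Config → Config → Prop
  -- main loop
  | enter (i e) : (1 < e.lhs.size ∨ 1 < e.rhs.size) →
      Step k ⟨i, .test, e⟩ ⟨false, .start, e⟩
  | yes (i e) : ¬ (1 < e.lhs.size ∨ 1 < e.rhs.size) → e.NaivelySolvable →
      Step k ⟨i, .test, e⟩ ⟨i, .halt true, e⟩
  | no (i e) : ¬ (1 < e.lhs.size ∨ 1 < e.rhs.size) → ¬ e.NaivelySolvable →
      Step k ⟨i, .test, e⟩ ⟨i, .halt false, e⟩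
  -- uncrossing the chains of all unary letters of the equation
  | start (i e) : Step k ⟨i, .start, e⟩ ⟨i, .prefC e.unary e.cvars, e⟩
  | prefCSkip (i e G X todo) :
      Step k ⟨i, .prefC G (X :: todo), e⟩ ⟨i, .prefC G todo, e⟩
  | prefCPop (i e e' G X todo a l) : a ∈ G → 1 ≤ l →
      Eqn.MayDrop X (e.map (substC X fun t => .pow a l (.cvar X t))) e' →
      Step k ⟨i, .prefC G (X :: todo), e⟩ ⟨i, .prefC G todo, e'⟩
  | prefCDone (i e G) : Step k ⟨i, .prefC G [], e⟩ ⟨i, .prefV G e.vars, e⟩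
  | prefVSkip (i e G x todo) :
      Step k ⟨i, .prefV G (x :: todo), e⟩ ⟨i, .prefV G todo, e⟩
  | prefVPop (i e G x todo a l) : a ∈ G → 1 ≤ l →
      Step k ⟨i, .prefV G (x :: todo), e⟩
        ⟨i, .prefV G todo, e.map (substV x (.pow a l (.var x)))⟩
  | prefVDone (i e G) : Step k ⟨i, .prefV G [], e⟩ ⟨i, .suff G e.cvars, e⟩
  | suffSkip (i e G X todo) :
      Step k ⟨i, .suff G (X :: todo), e⟩ ⟨i, .suff G todo, e⟩
  | suffPop (i e e' G X todo b r) : b ∈ G → 1 ≤ r →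
      Eqn.MayDrop X (e.map (substC X fun t => .cvar X (.pow b r t))) e' →
      Step k ⟨i, .suff G (X :: todo), e⟩ ⟨i, .suff G todo, e'⟩
  | suffDone (i e G) : Step k ⟨i, .suff G [], e⟩ ⟨i, .chain G, e⟩
  -- chain compression
  | chain (i e G nu) : FreshNames G nu →
      Step k ⟨i, .chain G, e⟩ ⟨i, .part, e.map (chainComp nu G)⟩
  -- guessing a partition of the unary letters, and uncrossing it
  | part (i e G1 G2) : Disjoint G1 G2 → G1 ∪ G2 = e.unary →
      Step k ⟨i, .part, e⟩ ⟨i, .popDown G1 G2 e.cvars, e⟩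
  | popDownSkip (i e G1 G2 X todo) :
      Step k ⟨i, .popDown G1 G2 (X :: todo), e⟩ ⟨i, .popDown G1 G2 todo, e⟩
  | popDownPop (i e e' G1 G2 X todo a) : a ∈ G1 →
      Eqn.MayDrop X (e.map (substC X fun t => .cvar X (.node a [t]))) e' →
      Step k ⟨i, .popDown G1 G2 (X :: todo), e⟩ ⟨i, .popDown G1 G2 todo, e'⟩
  | popDownDone (i e G1 G2) :
      Step k ⟨i, .popDown G1 G2 [], e⟩ ⟨i, .popUpC G1 G2 e.cvars, e⟩
  | popUpCSkip (i e G1 G2 X todo) :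
      Step k ⟨i, .popUpC G1 G2 (X :: todo), e⟩ ⟨i, .popUpC G1 G2 todo, e⟩
  | popUpCPop (i e e' G1 G2 X todo b) : b ∈ G2 →
      Eqn.MayDrop X (e.map (substC X fun t => .node b [.cvar X t])) e' →
      Step k ⟨i, .popUpC G1 G2 (X :: todo), e⟩ ⟨i, .popUpC G1 G2 todo, e'⟩
  | popUpCDone (i e G1 G2) :
      Step k ⟨i, .popUpC G1 G2 [], e⟩ ⟨i, .popUpV G1 G2 e.vars, e⟩
  | popUpVSkip (i e G1 G2 x todo) :
      Step k ⟨i, .popUpV G1 G2 (x :: todo), e⟩ ⟨i, .popUpV G1 G2 todo, e⟩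
  | popUpVPop (i e G1 G2 x todo b) : b ∈ G2 →
      Step k ⟨i, .popUpV G1 G2 (x :: todo), e⟩
        ⟨i, .popUpV G1 G2 todo, e.map (substV x (.node b [.var x]))⟩
  | popUpVDone (i e G1 G2) : Step k ⟨i, .popUpV G1 G2 [], e⟩ ⟨i, .pair G1 G2, e⟩
  -- pair compression
  | pair (i e G1 G2 nu) : FreshNames (G1 ∪ G2) nu →
      Step k ⟨i, .pair G1 G2, e⟩ ⟨i, .choose, e.map (pairComp nu G1 G2)⟩
  -- the letters of the equation, a fresh letter of each arity `1 < j ≤ k` and a fresh constant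
  | choose (i e) (g : ℕ → ℕ) (c : ℕ) : (∀ j, 1 < j → j ≤ k → (g j, j) ∉ e.letters) →
      c ∉ e.consts →
      Step k ⟨i, .choose, e⟩
        ⟨i, .constV (e.nonConsts ∪ (Finset.Ioc 1 k).image fun j => (g j, j))
          (insert c e.consts) e.vars, e⟩
  -- uncrossing father-leaf pairs
  | constVSkip (i e G G0 x todo) :
      Step k ⟨i, .constV G G0 (x :: todo), e⟩ ⟨i, .constV G G0 todo, e⟩
  | constVPop (i e G G0 x todo a) : a ∈ G0 →
      Step k ⟨i, .constV G G0 (x :: todo), e⟩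
        ⟨i, .constV G G0 todo, e.map (substV x (.node a []))⟩
  | constVDone (i e G G0) :
      Step k ⟨i, .constV G G0 [], e⟩ ⟨i, .genDown G G0 e.cvars [], e⟩
  | genDownSkip (i e G G0 X todo new) :
      Step k ⟨i, .genDown G G0 (X :: todo) new, e⟩ ⟨i, .genDown G G0 todo new, e⟩
  | genDownPop (i e e' G G0 X todo new f) (xs ys : List ℕ) :
      (e.lhs.AppliedToConst X G0 ∨ e.rhs.AppliedToConst X G0) →
      (f, xs.length + 1 + ys.length) ∈ G →
      (xs ++ ys).Nodup → (∀ x ∈ xs ++ ys, x ∉ e.vars) →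
      Eqn.MayDrop X (e.map (substC X fun t =>
        .cvar X (.node f (xs.map .var ++ t :: ys.map .var)))) e' →
      Step k ⟨i, .genDown G G0 (X :: todo) new, e⟩
        ⟨i, .genDown G G0 todo (xs ++ ys ++ new), e'⟩
  | genDownDone (i e G G0 new) :
      Step k ⟨i, .genDown G G0 [] new, e⟩ ⟨i, .constNew G G0 new, e⟩
  | constNewSkip (i e G G0 x todo) :
      Step k ⟨i, .constNew G G0 (x :: todo), e⟩ ⟨i, .constNew G G0 todo, e⟩
  | constNewPop (i e G G0 x todo a) : a ∈ G0 →
      Step k ⟨i, .constNew G G0 (x :: todo), e⟩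
        ⟨i, .constNew G G0 todo, e.map (substV x (.node a []))⟩
  | constNewDone (i e G G0) : Step k ⟨i, .constNew G G0 [], e⟩ ⟨i, .leaf G G0, e⟩
  -- leaf compression, end of the subphase
  | leafFirst (e G G0 nu) : FreshLeafNames G G0 nu →
      Step k ⟨false, .leaf G G0, e⟩ ⟨true, .start, e.map (leafComp nu G G0)⟩
  | leafSecond (e G G0 nu) : FreshLeafNames G G0 nu →
      Step k ⟨true, .leaf G G0, e⟩ ⟨false, .test, e.map (leafComp nu G G0)⟩

/-- Reading the input: the letters, variables and context variables are given names (by `rho m` for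
the letters of arity `m`, by `sig` and `tau`) and the context variables in `E`, those that are
guessed to have an empty value, are removed. -/
def Term.load (rho : ℕ → ℕ → ℕ) (sig tau : ℕ → ℕ) (E : Finset ℕ) : Term → Term
  | .var x => .var (sig x)
  | .cvar X t => if X ∈ E then t.load rho sig tau E else .cvar (tau X) (t.load rho sig tau E)
  | .node f ts => .node (rho ts.length f) (ts.map (Term.load rho sig tau E))
  | .pow a l t => .pow (rho 1 a) l (t.load rho sig tau E)

/-- The configurations in which the algorithm may start on the input `u = v`. -/
def IsInitial (u v : Term) (c : Config) : Prop :=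
  ∃ (rho : ℕ → ℕ → ℕ) (sig tau : ℕ → ℕ) (E : Finset ℕ),
    (∀ m, Function.Injective (rho m)) ∧ Function.Injective sig ∧ Function.Injective tau ∧
    c = ⟨false, .test, ⟨u.load rho sig tau E, v.load rho sig tau E⟩⟩

/-- `r` is the sequence of configurations of a (partial) run of the algorithm on the context
equation `u = v` over the signature `Sg`. -/
def IsRun (Sg : Finset (ℕ × ℕ)) (u v : Term) (r : List Config) : Prop :=
  (∃ c ∈ r.head?, IsInitial u v c) ∧ r.IsChain (Step (maxArity Sg))

/-- The run halts with the given answer. -/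
def Returns (r : List Config) (answer : Bool) : Prop :=
  ∃ c ∈ r.getLast?, c.stage = .halt answer

/-- The configuration is the beginning of a phase. -/
def Config.startsPhase : Config → Bool
  | ⟨false, .start, _⟩ => true
  | _ => false

/-- The number of phases begun in a run. -/
def numPhases (r : List Config) : ℕ := r.countP Config.startsPhase

end ContextUnif

/-! Soundness: every step can be undone on solutions. A pop substitutes a template for a (context)
variable, and a solution of the new equation composed with the templates solves the old one,
whatever was guessed (`eval_sub`). A compression is undone by expanding the new letters. The
expansion is a linear homomorphism of trees (`Hom`), so it acts on contexts as well and turns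
solutions of the compressed equation into solutions of the old one (`Solves.hom`); for this the
compressed sets must cover the letters of the equation, which is the invariant `Stage.Inv`. A run
that answers YES thus yields a solution over letters of arity at most `k`, and `Solves.satisfiable`
replaces the foreign letters by letters of the signature.

Completeness: the guesses follow a solution `S`. When the pops are such that no pattern of the value
lies partly inside and partly outside the value of a variable, compressing the equation amounts to
compressing the value (`chainCommutes_sub`, `pairCommutes_sub`, `leafCommutes`). Only letters of the
equation are compressed as chains and pairs, so `S` must not use other unary letters. This is
ensured by keeping `S` minimal for a weight in which each letter counts the original symbols it
stands for (`Good`): foreign unary letters could be deleted (`Good.unary`), the other foreign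
letters can share one new name (`Good.normalize`), and minimality survives compression because
competitors decode to competitors (`Good.transfer`).

Popped chains may be long. Their exponents are treated as unknowns; the coincidences between lengths
of chains form a homogeneous linear system, and the weight of the value is an affine function of the
exponents. The positive solutions of least weight are closed under small shifts by kernel vectors,
and a pigeonhole argument in the style of Siegel's lemma finds one whose entries are at most
exponential in the size of the equation (`exists_small_solution`, `exists_small_valuation`). In
binary such exponents take linearly many bits.

Counting: context variables are never created. Variables are created only below an `X` that is
applied to a constant somewhere. Each variable owned by `X` occurs in all arguments of `X`, so at
that moment `X` owns none; hence it never owns more than `k - 1` variables for each of its original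
occurrences (`Owned`). With `A = n * max 1 k` a subphase therefore adds at most `10 * A` symbols.
After chain compression neighbouring unary letters differ, so some partition covers a quarter of the
pairs (`exists_partition`), while leaf compression absorbs constants. Consequently a subphase
shrinks by the factor 3/4, depending on the chosen partition, either the equation (up to an additive
multiple of `A`) or the value of its sides (`State.subphase`). The first subphase of each phase
keeps the equation at size `O(A)`, the second one makes the number of phases logarithmic. Names are
chosen among small numbers (`exists_small_names`), so the memory is quadratic in `A`. -/

namespace ContextUnif

open List Term Function

variable {k Q X y g m : ℕ} {p q : ℕ × ℕ → Prop} {w w' : ℕ × ℕ → ℕ} {z : ℕ → ℕ} {nu : ℕ → ℕ → ℕ}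
  {G G0 G1 G2 : Finset ℕ} {Sg : Finset (ℕ × ℕ)} {F : Term → Term} {S : Subst} {e e' : Eqn}
  (f : ℕ) (c : Ctx) (t : Term)

/-! ### Induction principles -/

@[induction_eliminator]
theorem Tree.induct {P : Tree → Prop} (h : ∀ f ts, (∀ t ∈ ts, P t) → P (.node f ts)) : ∀ t, P t
  | .node f ts => h f ts fun t _ => Tree.induct h t

@[induction_eliminator]
theorem Term.induct {P : Term → Prop} (hv : ∀ x, P (.var x)) (hc : ∀ X t, P t → P (.cvar X t))
    (hn : ∀ f ts, (∀ t ∈ ts, P t) → P (.node f ts)) (hp : ∀ a l t, P t → P (.pow a l t)) :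
    ∀ t, P t
  | .var x => hv x
  | .cvar X t => hc X t (Term.induct hv hc hn hp t)
  | .node f ts => hn f ts fun t _ => Term.induct hv hc hn hp t
  | .pow a l t => hp a l t (Term.induct hv hc hn hp t)

attribute [grind =] Term.size Term.letters Term.vars Term.cvars Subst.eval Ctx.fill Tree.size
  Term.closeChain Term.addChain Term.chainSplit Term.consPair Term.pairComp Term.AppliedToConst
  Eqn.map Eqn.size

abbrev Eqn.varOcc (e : Eqn) : List ℕ := e.lhs.vars ++ e.rhs.vars

abbrev Eqn.cvarOcc (e : Eqn) : List ℕ := e.lhs.cvars ++ e.rhs.cvars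

/-! ### Weights and letters of trees -/

/-- The sum of the weights of the letters. -/
@[grind =] def Tree.weight (w : ℕ × ℕ → ℕ) : Tree → ℕ
  | .node f ts => w (f, ts.length) + (ts.map (Tree.weight w)).sum

theorem Tree.weight_node (w : ℕ × ℕ → ℕ) (f : ℕ) (ts : List Tree) :
    (Tree.node f ts).weight w = w (f, ts.length) + (ts.map (Tree.weight w)).sum := by
  grind

@[grind =] def Ctx.weight (w : ℕ × ℕ → ℕ) : Ctx → ℕ
  | .hole => 0
  | .node f l c r => w (f, l.length + 1 + r.length) + (l.map (Tree.weight w)).sum + c.weight w +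
      (r.map (Tree.weight w)).sum

/-- All letters satisfy `p`. -/
@[grind =] def Tree.All (p : ℕ × ℕ → Prop) : Tree → Prop
  | .node f ts => p (f, ts.length) ∧ ∀ t ∈ ts, Tree.All p t

theorem Tree.all_node {f : ℕ} {ts : List Tree} :
    (Tree.node f ts).All p ↔ p (f, ts.length) ∧ ∀ t ∈ ts, Tree.All p t := by
  grind

@[grind =] def Ctx.All (p : ℕ × ℕ → Prop) : Ctx → Prop
  | .hole => True
  | .node f l c r => p (f, l.length + 1 + r.length) ∧
      (∀ t ∈ l, t.All p) ∧ c.All p ∧ ∀ t ∈ r, t.All p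

def Subst.All (p : ℕ × ℕ → Prop) (S : Subst) : Prop :=
  (∀ x, (S.var x).All p) ∧ ∀ X, (S.ctx X).All p

theorem Ctx.weight_fill (w : ℕ × ℕ → ℕ) (c : Ctx) (t : Tree) :
    (c.fill t).weight w = c.weight w + t.weight w := by
  induction c with
  | hole => grind
  | node f l c r ih =>
    grind

theorem Ctx.all_fill (t : Tree) : (c.fill t).All p ↔ c.All p ∧ t.All p := by
  induction c with
  | hole => grind
  | node f l c r ih =>
    grind

theorem Tree.All.mono (h : ∀ a, p a → q a) {t : Tree} (ht : t.All p) : t.All q := by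
  induction t with
  | h f ts ih =>
    grind

theorem Ctx.All.mono (h : ∀ a, p a → q a) {c : Ctx} (hc : c.All p) : c.All q := by
  induction c with
  | hole => trivial
  | node f l c r ih =>
    exact ⟨h _ hc.1, fun t ht => (hc.2.1 t ht).mono h, ih hc.2.2.1,
      fun t ht => (hc.2.2.2 t ht).mono h⟩

theorem Tree.over_iff_all {t : Tree} : t.Over Sg ↔ t.All (· ∈ Sg) := by
  induction t with
  | h f ts ih =>
    simp only [Tree.Over, Tree.All]
    grind

theorem Ctx.over_iff_all {c : Ctx} : c.Over Sg ↔ c.All (· ∈ Sg) := by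
  induction c with
  | hole => simp [Ctx.Over, Ctx.All]
  | node f l c r ih => simp only [Ctx.Over, Ctx.All, ih, Tree.over_iff_all]

theorem Subst.over_iff_all : S.Over Sg ↔ S.All (· ∈ Sg) := by
  simp only [Subst.Over, Subst.All, Tree.over_iff_all, Ctx.over_iff_all]

theorem Tree.size_eq_weight (t : Tree) : t.size = t.weight fun _ => 1 := by
  induction t with
  | h f ts ih =>
    simp only [Tree.size, Tree.weight]
    rw [map_congr_left ih, Nat.add_comm]

theorem Tree.weight_add (w w' : ℕ × ℕ → ℕ) (t : Tree) :
    t.weight (fun p => w p + w' p) = t.weight w + t.weight w' := by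
  induction t with
  | h f ts ih =>
    simp only [Tree.weight]
    rw [map_congr_left ih, sum_map_add]
    omega

theorem Tree.weight_le (h : ∀ a, p a → w a ≤ w' a) {t : Tree} (ht : t.All p) : t.weight w ≤ t.weight
    w' := by
  induction t with
  | h f ts ih =>
    rw [Tree.all_node] at ht
    simp only [Tree.weight]
    exact Nat.add_le_add (h _ ht.1) (sum_le_sum fun t hm => ih t hm (ht.2 t hm))

theorem Tree.one_le_size (t : Tree) : 1 ≤ t.size := by cases t; simp [Tree.size]

theorem Term.one_le_size : 1 ≤ t.size := by cases t <;> simp [size]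

/-! ### Composition of contexts -/

@[grind =] def Ctx.comp : Ctx → Ctx → Ctx
  | .hole, d => d
  | .node f l c r, d => .node f l (c.comp d) r

theorem Ctx.fill_comp (d : Ctx) (t : Tree) : (c.comp d).fill t = c.fill (d.fill t) := by
  induction c with
  | hole => rfl
  | node f l c r ih => grind

theorem Ctx.comp_all {c d : Ctx} (hc : c.All p) (hd : d.All p) : (c.comp d).All p := by
  induction c with
  | hole => exact hd
  | node f l c r ih => grind

theorem Ctx.comp_hole : c.comp .hole = c := by
  induction c with
  | hole => rfl
  | node f l c r ih => grind

/-- The context `a^l c`. -/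
def Ctx.up (a l : ℕ) (c : Ctx) : Ctx := (fun d => .node a [] d [])^[l] c

theorem Ctx.up_zero (a : ℕ) (c : Ctx) : Ctx.up a 0 c = c := rfl

theorem Ctx.up_succ (a l : ℕ) (c : Ctx) : Ctx.up a (l + 1) c = .node a [] (Ctx.up a l c) [] := by
  simp only [Ctx.up, iterate_succ', Function.comp]

theorem Ctx.fill_up (a l : ℕ) (c : Ctx) (t : Tree) :
    (Ctx.up a l c).fill t = (fun s => Tree.node a [s])^[l] (c.fill t) := by
  induction l with
  | zero => rfl
  | succ l ih => rw [Ctx.up_succ, iterate_succ', Function.comp, ← ih]; rfl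

theorem Ctx.up_comp (a l : ℕ) (c d : Ctx) : (Ctx.up a l c).comp d = Ctx.up a l (c.comp d) := by
  induction l with
  | zero => rfl
  | succ l ih => rw [Ctx.up_succ, Ctx.up_succ, ← ih]; rfl

theorem Ctx.up_all {a l : ℕ} {c : Ctx} (ha : p (a, 1)) (hc : c.All p) : (Ctx.up a l c).All p := by
  induction l with
  | zero => exact hc
  | succ l ih =>
    rw [Ctx.up_succ]
    grind

theorem Ctx.up_weight (w : ℕ × ℕ → ℕ) (a l : ℕ) (c : Ctx) :
    (Ctx.up a l c).weight w = l * w (a, 1) + c.weight w := by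
  induction l with
  | zero => simp [Ctx.up_zero]
  | succ l ih =>
    rw [Ctx.up_succ]
    grind

/-! ### Linear homomorphisms of trees -/

/-- An interpretation of letters by linear operations on trees. -/
structure Hom where
  node : ℕ → List Tree → Tree
  ctx : ℕ → List Tree → Ctx → List Tree → Ctx
  fill : ∀ f l c r t, (ctx f l c r).fill t = node f (l ++ c.fill t :: r)

namespace Hom

variable (H : Hom)

@[grind =] def tree : Tree → Tree
  | .node f ts => H.node f (ts.map tree)

@[grind =] def cx : Ctx → Ctx
  | .hole => .hole
  | .node f l c r => H.ctx f (l.map H.tree) (cx c) (r.map H.tree)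

/-- Linearity, in the form of the field `fill`, gives contexts an image and makes the homomorphism
commute with filling the hole. -/
theorem tree_fill (c : Ctx) (t : Tree) : H.tree (c.fill t) = (H.cx c).fill (H.tree t) := by
  induction c with
  | hole => rfl
  | node f l c r ih => simp [Ctx.fill, cx, tree, H.fill, ih]

def subst (S : Subst) : Subst := ⟨fun x => H.tree (S.var x), fun X => H.cx (S.ctx X)⟩

/-- The value of a term whose letters are interpreted by `H`. -/
@[grind =] def eval (S : Subst) : Term → Tree
  | .var x => S.var x
  | .cvar X t => (S.ctx X).fill (eval S t)
  | .node f ts => H.node f (ts.map (eval S))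
  | .pow a l t => (fun s => H.node a [s])^[l] (eval S t)

/-- Mapping the values of the variables by `H` and interpreting the letters by `H` has the same
effect as mapping the result. For a compressed term the right side is what the decoding lemmas
`eval_chainComp`, `eval_pairComp` and `eval_leafComp` compute. -/
theorem tree_eval (S : Subst) (t : Term) : H.tree (S.eval t) = H.eval (H.subst S) t := by
  induction t with
  | hv x => simp [Subst.eval, eval, subst]
  | hc X t ih => simp [Subst.eval, eval, tree_fill, ih, subst]
  | hn f ts ih =>
    simp only [Subst.eval, eval, tree, map_map]
    congr 1
    exact map_congr_left ih
  | hp a l t ih =>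
    simp only [Subst.eval, eval]
    rw [← ih]
    clear ih
    generalize S.eval t = s
    induction l generalizing s with
    | zero => rfl
    | succ l ih => simp only [iterate_succ, Function.comp]; rw [ih]; simp [tree]

theorem eval_eq_of_trivial (S : Subst) (t : Term)
    (h : ∀ p ∈ t.letters, ∀ ts : List Tree, ts.length = p.2 → H.node p.1 ts = .node p.1 ts) :
    H.eval S t = S.eval t := by
  induction t with
  | hv x => grind
  | hc X t ih => grind
  | hn f ts ih =>
    simp only [Term.letters, mem_cons, mem_flatten, mem_map] at h
    simp only [Subst.eval, eval]
    rw [h _ (Or.inl rfl) _ (by simp)]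
    congr 1
    exact map_congr_left fun t ht => ih t ht fun p hp => h p (Or.inr ⟨_, ⟨t, ht, rfl⟩, hp⟩)
  | hp a l t ih =>
    simp only [Term.letters, mem_cons] at h
    simp only [Subst.eval, eval]
    rw [ih fun p hp => h p (Or.inr hp)]
    have : (fun s => H.node a [s]) = fun s => Tree.node a [s] :=
      funext fun s => h (a, 1) (Or.inl rfl) [s] rfl
    rw [this]

theorem weight_tree_le
    (h : ∀ f ts, p (f, ts.length) → (H.node f ts).weight w ≤ w' (f, ts.length) + (ts.map
      (Tree.weight w)).sum) {t : Tree} (ht : t.All p) : (H.tree t).weight w ≤ t.weight w' := by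
  induction t with
  | h f ts ih =>
    rw [Tree.all_node] at ht
    simp only [tree, Tree.weight]
    refine (h f _ (by simpa using ht.1)).trans ?_
    simp only [length_map, map_map]
    exact Nat.add_le_add_left (sum_le_sum fun t hm => ih t hm (ht.2 t hm)) _

theorem all_tree (h : ∀ f ts, p (f, ts.length) → (∀ t ∈ ts, t.All q) → (H.node f ts).All q)
    {t : Tree} (ht : t.All p) : (H.tree t).All q := by
  induction t with
  | h f ts ih =>
    grind

/-- The hypothesis on `H` speaks of trees only, so the hole is filled with some admissible tree,
which `hq` provides. -/
theorem all_cx (hq : ∃ t : Tree, t.All q)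
    (h : ∀ f ts, p (f, ts.length) → (∀ t ∈ ts, t.All q) → (H.node f ts).All q) {c : Ctx}
    (hc : c.All p) : (H.cx c).All q := by
  induction c with
  | hole => trivial
  | node f l c r ih =>
    obtain ⟨t, ht⟩ := hq
    have h1 := ih hc.2.2.1
    have h2 : ((H.cx (.node f l c r)).fill t).All q := by
      simp only [cx, H.fill]
      refine h _ _ ?_ ?_
      · grind
      · simp only [mem_append, mem_cons, mem_map]
        rintro s (⟨t, hm, rfl⟩ | rfl | ⟨t, hm, rfl⟩)
        · exact H.all_tree h (hc.2.1 t hm)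
        · exact (Ctx.all_fill _ _).2 ⟨h1, ht⟩
        · exact H.all_tree h (hc.2.2.2 t hm)
    exact ((Ctx.all_fill _ _).1 h2).1

theorem all_subst (h : ∀ f ts, p (f, ts.length) → (∀ t ∈ ts, t.All q) → (H.node f ts).All q)
    (hS : S.All p) : (H.subst S).All q :=
  ⟨fun x => H.all_tree h (hS.1 x), fun X => H.all_cx ⟨_, H.all_tree h (hS.1 0)⟩ h (hS.2 X)⟩

/-- The homomorphism that interprets each unary letter by a context and keeps other letters. -/
def unary (U : ℕ → Ctx) : Hom where
  node f ts := match ts with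
    | [t] => (U f).fill t
    | ts => .node f ts
  ctx f l c r := match l, r with
    | [], [] => (U f).comp c
    | l, r => .node f l c r
  fill f l c r t := by
    rcases l with _ | ⟨y, l⟩ <;> rcases r with _ | ⟨z, r⟩
    · simp [Ctx.fill_comp]
    · simp [Ctx.fill]
    · cases l <;> simp [Ctx.fill]
    · cases l <;> simp [Ctx.fill]

theorem unary_node_one (U : ℕ → Ctx) (f : ℕ) (t : Tree) : (unary U).node f [t] = (U f).fill t := rfl

theorem unary_node_ne (U : ℕ → Ctx) (f : ℕ) (ts : List Tree) (h : ts.length ≠ 1) :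
    (unary U).node f ts = .node f ts := by
  rcases ts with _ | ⟨t, _ | ⟨s, ts⟩⟩
  · rfl
  · simp at h
  · rfl

end Hom

/-- Insert constants between the given trees, as told by a pattern. -/
def weave : List (Option ℕ) → List Tree → List Tree
  | [], ts => ts
  | some c :: p, ts => .node c [] :: weave p ts
  | none :: p, t :: ts => t :: weave p ts
  | none :: p, [] => weave p []

/-- The result of `weave` to the left and to the right of a given entry. -/
def weaveSplit : List (Option ℕ) → List Tree → List Tree → List Tree × List Tree
  | [], l, r => (l, r)
  | some c :: p, l, r => (.node c [] :: (weaveSplit p l r).1, (weaveSplit p l r).2)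
  | none :: p, t :: l, r => (t :: (weaveSplit p l r).1, (weaveSplit p l r).2)
  | none :: p, [], r => ([], weave p r)

/-- This is the law `fill` for the homomorphisms `ofPattern`: inserting constants keeps the other
arguments on their side of the hole. -/
theorem weave_split (p : List (Option ℕ)) (l r : List Tree) (t : Tree) :
    weave p (l ++ t :: r) = (weaveSplit p l r).1 ++ t :: (weaveSplit p l r).2 := by
  induction p generalizing l with
  | nil => rfl
  | cons o p ih =>
    rcases o with _ | c
    · rcases l with _ | ⟨y, l⟩
      · simp [weave, weaveSplit]
      · simp [weave, weaveSplit, ih]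
    · simp [weave, weaveSplit, ih]

theorem weave_length (p : List (Option ℕ)) (ts : List Tree) (h : ts.length = p.count none) :
    (weave p ts).length = p.length := by
  induction p generalizing ts with
  | nil => simpa [weave] using h
  | cons o p ih =>
    rcases o with _ | c
    · rcases ts with _ | ⟨t, ts⟩
      · simp at h
      · simp only [weave, length_cons]
        grind
    · simp only [weave, length_cons]
      grind

theorem weave_weight (w : ℕ × ℕ → ℕ) (p : List (Option ℕ)) (ts : List Tree)
    (h : ts.length = p.count none) :
    ((weave p ts).map (Tree.weight w)).sum =
      (p.map fun o => o.elim 0 fun c => w (c, 0)).sum + (ts.map (Tree.weight w)).sum := by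
  induction p generalizing ts with
  | nil => simp [weave]
  | cons o p ih =>
    rcases o with _ | c
    · rcases ts with _ | ⟨t, ts⟩
      · simp at h
      · simp only [weave, map_cons, sum_cons]
        grind
    · simp only [weave, map_cons, sum_cons]
      grind

theorem weave_all (p : List (Option ℕ)) (ts : List Tree) (hp : ∀ c, some c ∈ p → q (c, 0))
    (h : ∀ t ∈ ts, t.All q) : ∀ t ∈ weave p ts, t.All q := by
  induction p generalizing ts with
  | nil => simpa [weave] using h
  | cons o p ih =>
    have hp' : ∀ c, some c ∈ p → q (c, 0) := fun c hc => hp c (mem_cons_of_mem _ hc)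
    rcases o with _ | c
    · rcases ts with _ | ⟨t, ts⟩
      · exact ih [] hp' (by simp)
      · simp only [weave, mem_cons, forall_eq_or_imp] at h ⊢
        grind
    · simp only [weave, mem_cons, forall_eq_or_imp]
      grind

theorem weave_replicate (m : ℕ) (ts : List Tree) : weave (List.replicate m none) ts = ts := by
  induction m generalizing ts with
  | zero => rfl
  | succ m ih =>
    rcases ts with _ | ⟨t, ts⟩
    · simp [replicate_succ, weave, ih]
    · simp [replicate_succ, weave, ih]

namespace Hom

/-- The homomorphism that replaces a letter according to a pattern, or deletes it if it is unary
and there is no pattern. -/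
def ofPattern (T : ℕ → ℕ → Option (ℕ × List (Option ℕ))) : Hom where
  node f ts := match T f ts.length with
    | some (g, p) => .node g (weave p ts)
    | none => match ts with
      | [t] => t
      | ts => .node f ts
  ctx f l c r := match T f (l.length + 1 + r.length) with
    | some (g, p) => .node g (weaveSplit p l r).1 c (weaveSplit p l r).2
    | none => match l, r with
      | [], [] => c
      | l, r => .node f l c r
  fill f l c r t := by
    have e : (l ++ c.fill t :: r).length = l.length + 1 + r.length := by simp; omega
    rw [e]
    rcases T f (l.length + 1 + r.length) with _ | ⟨g, p⟩
    · rcases l with _ | ⟨y, l⟩ <;> rcases r with _ | ⟨z, r⟩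
      · simp
      · simp [Ctx.fill]
      · cases l <;> simp [Ctx.fill]
      · cases l <;> simp [Ctx.fill]
    · simp [Ctx.fill, weave_split]

theorem ofPattern_some {T : ℕ → ℕ → Option (ℕ × List (Option ℕ))} {f : ℕ} {p : List (Option ℕ)}
    {ts : List Tree} (h : T f ts.length = some (g, p)) :
    (ofPattern T).node f ts = .node g (weave p ts) := by
  simp [ofPattern, h]

theorem ofPattern_none {T : ℕ → ℕ → Option (ℕ × List (Option ℕ))} {f : ℕ} {t : Tree}
    (h : T f 1 = none) : (ofPattern T).node f [t] = t := by
  simp [ofPattern, h]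

end Hom

/-! ### Substitution of templates -/

/-- One-hole terms of height one. -/
inductive Layer : Type
  | pow (a l : ℕ) : Layer
  | nd (f : ℕ) (xs ys : List ℕ) : Layer

@[grind =] def Layer.app : Layer → Term → Term
  | .pow a l, t => .pow a l t
  | .nd f xs ys, t => .node f (xs.map .var ++ t :: ys.map .var)

@[grind =] def Layer.vars : Layer → List ℕ
  | .pow _ _ => []
  | .nd _ xs ys => xs ++ ys

@[grind =] def Layer.letter : Layer → ℕ × ℕ
  | .pow a _ => (a, 1)
  | .nd f xs ys => (f, xs.length + 1 + ys.length)

@[grind =] def wrap (ls : List Layer) (t : Term) : Term := ls.foldr Layer.app t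

theorem wrap_nil : wrap [] t = t := rfl
theorem wrap_cons (L : Layer) (ls : List Layer) (t : Term) :
    wrap (L :: ls) t = L.app (wrap ls t) := rfl
theorem wrap_append (ls ms : List Layer) (t : Term) : wrap (ls ++ ms) t = wrap ls (wrap ms t) := by
  simp [wrap]

/-- What a context variable is replaced by: `pre X post`, or `pre post` if it is not kept. -/
@[ext]
structure CTmpl where
  pre : List Layer
  keep : Bool
  post : List Layer

/-- What a variable is replaced by: `pre x`, or `pre c` for a constant `c`. -/
@[ext]
structure VTmpl where
  pre : List Layer
  const : Option ℕ

@[grind =] def CTmpl.triv : CTmpl := ⟨[], true, []⟩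
@[grind =] def VTmpl.triv : VTmpl := ⟨[], none⟩

@[grind =] def CTmpl.app (c : CTmpl) (X : ℕ) (t : Term) : Term :=
  wrap c.pre (bif c.keep then .cvar X (wrap c.post t) else wrap c.post t)

@[grind =] def VTmpl.app (v : VTmpl) (x : ℕ) : Term :=
  wrap v.pre (v.const.elim (.var x) fun c => .node c [])

/-- The simultaneous substitution of templates. -/
@[grind =] def sub (V : ℕ → VTmpl) (C : ℕ → CTmpl) : Term → Term
  | .var x => (V x).app x
  | .cvar X t => (C X).app X (sub V C t)
  | .node f ts => .node f (ts.map (sub V C))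
  | .pow a l t => .pow a l (sub V C t)

def CTmpl.comp (c d : CTmpl) : CTmpl :=
  bif c.keep then ⟨c.pre ++ d.pre, d.keep, d.post ++ c.post⟩ else c

def VTmpl.comp (v w : VTmpl) : VTmpl :=
  v.const.elim ⟨v.pre ++ w.pre, w.const⟩ fun _ => v

/-- Popped layers may contain fresh variables; a later substitution passes through them as long as
it does not touch these variables. -/
theorem sub_wrap (V : ℕ → VTmpl) (C : ℕ → CTmpl) (ls : List Layer)
    (h : ∀ L ∈ ls, ∀ x ∈ L.vars, V x = .triv) (t : Term) :
    sub V C (wrap ls t) = wrap ls (sub V C t) := by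
  induction ls with
  | nil => rfl
  | cons L ls ih =>
    simp only [mem_cons, forall_eq_or_imp] at h
    rw [wrap_cons, wrap_cons, ← ih h.2]
    rcases L with ⟨a, l⟩ | ⟨f, xs, ys⟩
    · grind
    · have h1 := h.1
      simp only [Layer.vars, mem_append] at h1
      simp only [Layer.app, sub, map_append, map_cons, map_map]
      congr 1
      congr 1
      · refine map_congr_left fun x hx => ?_
        grind
      · congr 1
        refine map_congr_left fun x hx => ?_
        grind

/-- Merges the successive loops of the algorithm into one simultaneous substitution. The side
conditions say that the second substitution leaves alone the variables introduced by the first. -/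
theorem sub_sub (V V' : ℕ → VTmpl) (C C' : ℕ → CTmpl) (t : Term)
    (hV : ∀ x ∈ t.vars, ∀ L ∈ (V x).pre, ∀ y ∈ L.vars, V' y = .triv)
    (hC : ∀ X ∈ t.cvars, ∀ L ∈ (C X).pre ++ (C X).post, ∀ y ∈ L.vars, V' y = .triv) :
    sub V' C' (sub V C t) = sub (fun x => (V x).comp (V' x)) (fun X => (C X).comp (C' X)) t := by
  induction t with
  | hv x =>
    simp only [sub, VTmpl.app]
    rw [sub_wrap _ _ _ (hV x (by simp [vars]))]
    rcases hc : (V x).const with _ | c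
    · simp [VTmpl.comp, hc, sub, VTmpl.app, wrap_append]
    · simp [VTmpl.comp, hc, sub]
  | hc X t ih =>
    have h1 : ∀ L ∈ (C X).pre, ∀ y ∈ L.vars, V' y = .triv :=
      fun L hL => hC X (by simp [cvars]) L (mem_append_left _ hL)
    have h2 : ∀ L ∈ (C X).post, ∀ y ∈ L.vars, V' y = .triv :=
      fun L hL => hC X (by simp [cvars]) L (mem_append_right _ hL)
    simp only [sub, CTmpl.app]
    rw [sub_wrap _ _ _ h1, ← ih (fun x hx => hV x (by simpa [vars] using hx))
      fun Y hY => hC Y (by simp [cvars, hY])]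
    rcases hk : (C X).keep with _ | _
    · simp only [cond_false, CTmpl.comp, hk]
      rw [sub_wrap _ _ _ h2]
    · simp only [cond_true, CTmpl.comp, hk, sub, CTmpl.app, wrap_append]
      rw [sub_wrap _ _ _ h2]
  | hn f ts ih =>
    simp only [sub, map_map, vars, cvars, mem_flatten, mem_map] at hV hC ⊢
    congr 1
    exact map_congr_left fun t ht => ih t ht (fun x hx => hV x ⟨_, ⟨t, ht, rfl⟩, hx⟩)
      fun X hX => hC X ⟨_, ⟨t, ht, rfl⟩, hX⟩
  | hp a l t ih => grind

theorem sub_congr {V V' : ℕ → VTmpl} {C C' : ℕ → CTmpl} (hV : ∀ x ∈ t.vars, V x = V' x)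
    (hC : ∀ X ∈ t.cvars, C X = C' X) :
    sub V C t = sub V' C' t := by
  induction t with
  | hv x => grind
  | hc X t ih =>
    grind
  | hn f ts ih =>
    simp only [vars, cvars, mem_flatten, mem_map] at hV hC
    simp only [sub]
    congr 1
    exact map_congr_left fun t ht => ih t ht
      (fun x hx => hV x ⟨_, ⟨t, ht, rfl⟩, hx⟩) (fun x hx => hC x ⟨_, ⟨t, ht, rfl⟩, hx⟩)
  | hp a l t ih =>
    grind

theorem sub_triv : sub (fun _ => .triv) (fun _ => .triv) t = t := by
  induction t with
  | hv x => grind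
  | hc X t ih => grind
  | hn f ts ih =>
    simp only [sub]; congr 1
    conv_rhs => rw [← List.map_id ts]
    exact map_congr_left ih
  | hp a l t ih => grind

theorem substC_eq_sub (X : ℕ) (F : Term → Term) (c : CTmpl) (h : ∀ t, F t = c.app X t) (t : Term) :
    t.substC X F = sub (fun _ => .triv) (update (fun _ => .triv) X c) t := by
  induction t with
  | hv x => simp [substC, sub, VTmpl.app, VTmpl.triv, wrap_nil]
  | hc Y t ih =>
    rw [substC, sub, ih]
    grind
  | hn f ts ih => simp only [substC, sub]; congr 1; exact map_congr_left ih
  | hp a l t ih => simp only [substC, sub, ih]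

theorem substV_eq_sub (x : ℕ) (v : VTmpl) (t : Term) :
    substV x (v.app x) t = sub (update (fun _ => .triv) x v) (fun _ => .triv) t := by
  induction t with
  | hv y =>
    by_cases e : y = x
    · subst e; simp [substV, sub]
    · simp [substV, sub, e, VTmpl.app, VTmpl.triv, wrap_nil]
  | hc Y t ih => rw [substV, sub, ih]; simp [CTmpl.app, CTmpl.triv, wrap_nil]
  | hn f ts ih => simp only [substV, sub]; congr 1; exact map_congr_left ih
  | hp a l t ih => simp only [substV, sub, ih]

theorem substC_drop (X : ℕ) (F : Term → Term) (c : CTmpl) (h : ∀ t, F t = c.app X t) (t : Term)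
    (hk : c.keep = true) :
    (t.substC X F).substC X id =
      sub (fun _ => .triv) (update (fun _ => .triv) X ⟨c.pre, false, c.post⟩) t := by
  rw [substC_eq_sub X id ⟨[], false, []⟩ (fun t => rfl), substC_eq_sub X F c h, sub_sub]
  · refine sub_congr _ (fun x _ => rfl) fun Y _ => ?_
    by_cases e : Y = X
    · subst e; simp [CTmpl.comp, hk]
    · simp [update_of_ne e, CTmpl.comp, CTmpl.triv]
  · intros; rfl
  · intros; rfl

/-- Popping from a context variable is a substitution of a template. -/
theorem mayDrop_iff {c : CTmpl} (h : ∀ t, F t = c.app X t) (hk : c.keep = true) (e e' : Eqn) :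
    Eqn.MayDrop X (e.map (substC X F)) e' ↔ ∃ b : Bool,
      e' = e.map (sub (fun _ => .triv) (update (fun _ => .triv) X ⟨c.pre, b, c.post⟩)) := by
  have h1 : e.map (substC X F) =
      e.map (sub (fun _ => .triv) (update (fun _ => .triv) X ⟨c.pre, true, c.post⟩)) := by
    have hc : (⟨c.pre, true, c.post⟩ : CTmpl) = c := by ext1 <;> simp [hk]
    simp only [Eqn.map, substC_eq_sub X F c h, hc]
  have h2 : (e.map (substC X F)).map (substC X id) =
      e.map (sub (fun _ => .triv) (update (fun _ => .triv) X ⟨c.pre, false, c.post⟩)) := by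
    simp only [Eqn.map, substC_drop X F c h _ hk]
  unfold Eqn.MayDrop
  rw [h2, h1]
  constructor
  · grind
  · rintro ⟨_ | _, h⟩
    · grind
    · grind

/-! ### Values of terms after a substitution of templates -/

def Layer.ctx (S : Subst) : Layer → Ctx
  | .pow a l => Ctx.up a l .hole
  | .nd f xs ys => .node f (xs.map S.var) .hole (ys.map S.var)

def layersCtx (S : Subst) (ls : List Layer) : Ctx := ls.foldr (fun L c => (L.ctx S).comp c) .hole

theorem eval_wrap (S : Subst) (ls : List Layer) (t : Term) :
    S.eval (wrap ls t) = (layersCtx S ls).fill (S.eval t) := by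
  induction ls with
  | nil => rfl
  | cons L ls ih =>
    have : layersCtx S (L :: ls) = (L.ctx S).comp (layersCtx S ls) := rfl
    rw [wrap_cons, this, Ctx.fill_comp, ← ih]
    rcases L with ⟨a, l⟩ | ⟨f, xs, ys⟩
    · simp [Layer.app, Layer.ctx, Subst.eval, Ctx.fill_up, Ctx.fill]
    · simp [Layer.app, Layer.ctx, Subst.eval, Ctx.fill, Function.comp_def]

def CTmpl.ctx (S : Subst) (X : ℕ) (c : CTmpl) : Ctx :=
  (layersCtx S c.pre).comp
    (bif c.keep then (S.ctx X).comp (layersCtx S c.post) else layersCtx S c.post)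

/-- The substitution that corresponds to `S` before the substitution of templates. -/
def pull (V : ℕ → VTmpl) (C : ℕ → CTmpl) (S : Subst) : Subst :=
  ⟨fun x => S.eval ((V x).app x), fun X => (C X).ctx S X⟩

/-- Undoing pops: a solution of the popped equation gives one of the old equation for arbitrary
templates, so no guess of a pop can be unsound. -/
theorem eval_sub (V : ℕ → VTmpl) (C : ℕ → CTmpl) (S : Subst) (t : Term) :
    S.eval (sub V C t) = (pull V C S).eval t := by
  induction t with
  | hv x => simp [sub, Subst.eval, pull]
  | hc X t ih =>
    simp only [sub, CTmpl.app, eval_wrap, Subst.eval, pull, CTmpl.ctx, Ctx.fill_comp] at ih ⊢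
    rcases (C X).keep with _ | _
    · simp [eval_wrap, ih]
    · simp [Subst.eval, eval_wrap, ih, Ctx.fill_comp]
  | hn f ts ih =>
    simp only [sub, Subst.eval, map_map]
    congr 1
    exact map_congr_left ih
  | hp a l t ih => grind

theorem eval_congr {S' : Subst} (hv : ∀ x ∈ t.vars, S.var x = S'.var x)
    (hc : ∀ X ∈ t.cvars, S.ctx X = S'.ctx X) : S.eval t = S'.eval t := by
  induction t with
  | hv x => grind
  | hc X t ih =>
    grind
  | hn f ts ih =>
    simp only [vars, cvars, mem_flatten, mem_map] at hv hc
    simp only [Subst.eval]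
    congr 1
    exact map_congr_left fun t ht => ih t ht
      (fun x hx => hv x ⟨_, ⟨t, ht, rfl⟩, hx⟩) (fun x hx => hc x ⟨_, ⟨t, ht, rfl⟩, hx⟩)
  | hp a l t ih =>
    grind

theorem layersCtx_all (hS : S.All p) (ls : List Layer) (h : ∀ L ∈ ls, p L.letter) :
    (layersCtx S ls).All p := by
  induction ls with
  | nil => trivial
  | cons L ls ih =>
    simp only [mem_cons, forall_eq_or_imp] at h
    refine Ctx.comp_all ?_ (ih h.2)
    rcases L with ⟨a, l⟩ | ⟨f, xs, ys⟩
    · exact Ctx.up_all h.1 trivial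
    · refine ⟨by simpa [Layer.letter] using h.1, ?_, trivial, ?_⟩ <;>
      · simp only [mem_map]
        rintro _ ⟨x, _, rfl⟩
        exact hS.1 x

@[grind =] def VTmpl.Letters (p : ℕ × ℕ → Prop) (v : VTmpl) : Prop :=
  (∀ L ∈ v.pre, p L.letter) ∧ ∀ c ∈ v.const, p (c, 0)

@[grind =] def CTmpl.Letters (p : ℕ × ℕ → Prop) (c : CTmpl) : Prop :=
  ∀ L ∈ c.pre ++ c.post, p L.letter

theorem pull_all {V : ℕ → VTmpl} {C : ℕ → CTmpl} (hS : S.All p) (hV : ∀ x, (V x).Letters p)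
    (hC : ∀ X, (C X).Letters p) : (pull V C S).All p := by
  constructor
  · intro x
    simp only [pull, VTmpl.app, eval_wrap]
    refine (Ctx.all_fill _ _).2 ⟨layersCtx_all hS _ (hV x).1, ?_⟩
    rcases hc : (V x).const with _ | c
    · simpa [Subst.eval] using hS.1 x
    · grind
  · intro X
    simp only [pull, CTmpl.ctx]
    have h1 := layersCtx_all hS _ fun L hL => hC X L (mem_append_left _ hL)
    have h2 := layersCtx_all hS _ fun L hL => hC X L (mem_append_right _ hL)
    refine Ctx.comp_all h1 ?_
    rcases (C X).keep with _ | _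
    · exact h2
    · exact Ctx.comp_all (hS.2 X) h2

variable {V V' : ℕ → VTmpl} {C C' : ℕ → CTmpl} {H : Hom} (L : Layer) (ls : List Layer)

/-! ### Decoding compressed terms -/

theorem Term.letters_node (ts : List Term) :
    (Term.node f ts).letters = (f, ts.length) :: (ts.map letters).flatten := by
  grind

theorem Term.mem_letters_node {q : ℕ × ℕ} {f : ℕ} {ts : List Term} :
    q ∈ (Term.node f ts).letters ↔ q = (f, ts.length) ∨ ∃ t ∈ ts, q ∈ t.letters := by
  grind

theorem length_one_cases {α : Type*} (ts : List α) : (∃ t, ts = [t]) ∨ ts.length ≠ 1 := by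
  rcases ts with _ | ⟨t, _ | ⟨s, ts⟩⟩
  · right; simp
  · grind
  · right; simp

/-! ### Decoding of chain compression -/

section Chain

variable (nu : ℕ → ℕ → ℕ) (G : Finset ℕ)

theorem Term.chainSplit_one (a : ℕ) (t : Term) (ha : a ∈ G) :
    (Term.node a [t]).chainSplit nu G = addChain nu a 1 (t.chainSplit nu G) := by
  grind

theorem Term.chainSplit_ne (f : ℕ) (ts : List Term) (h : ts.length ≠ 1) :
    (Term.node f ts).chainSplit nu G = (none, .node f (ts.map (chainComp nu G))) := by
  rcases ts with _ | ⟨t, _ | ⟨s, ts⟩⟩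
  · grind
  · simp at h
  · simp [chainSplit, chainComp]

/-- The value of a partially compressed term. -/
def Hom.openEval (H : Hom) (S : Subst) : Option (ℕ × ℕ) × Term → Tree
  | (none, s) => H.eval S s
  | (some (a, l), s) => (fun r => Tree.node a [r])^[l] (H.eval S s)

variable {nu} {G}

theorem Hom.eval_closeChain (hd : ∀ a l s, H.node (nu a l) [s] = (fun r => Tree.node a [r])^[l] s)
    (p : Option (ℕ × ℕ) × Term) : H.eval S (Term.closeChain nu p) = H.openEval S p := by
  rcases p with ⟨_ | ⟨b, m⟩, s⟩
  · rfl
  · simp only [Term.closeChain, Hom.eval, Hom.openEval, map_cons, map_nil, hd]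

theorem Hom.openEval_addChain (hd : ∀ a l s, H.node (nu a l) [s] = (fun r => Tree.node a [r])^[l] s)
    (a l : ℕ) (p : Option (ℕ × ℕ) × Term) :
    H.openEval S (Term.addChain nu a l p) = (fun r => Tree.node a [r])^[l] (H.openEval S p) := by
  rcases p with ⟨_ | ⟨b, m⟩, s⟩
  · rfl
  · by_cases e : b = a
    · subst e
      simp [Term.addChain, Hom.openEval, Function.iterate_add]
    · simp only [Term.addChain, e, if_false, Hom.openEval, Hom.eval, map_cons, map_nil, hd]

/-- All unary letters of the term are in `G`, so each unary letter of the compressed term is a new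
one and `hd` decodes it. -/
theorem Hom.openEval_chainSplit
    (hd : ∀ a l s, H.node (nu a l) [s] = (fun r => Tree.node a [r])^[l] s) (t : Term)
    (hG : ∀ a, (a, 1) ∈ t.letters → a ∈ G)
    (hk : ∀ f, ∀ ts : List Tree, ts.length ≠ 1 → H.node f ts = .node f ts) :
    H.openEval S (t.chainSplit nu G) = S.eval t := by
  induction t with
  | hv x => simp [Term.chainSplit, Hom.openEval, Hom.eval, Subst.eval]
  | hc X t ih =>
    simp only [Term.chainSplit, Term.letters] at hG ⊢
    simp only [Hom.openEval, Hom.eval, Subst.eval]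
    rw [Hom.eval_closeChain hd, ih hG]
  | hn f ts ih =>
    rcases length_one_cases ts with ⟨t, rfl⟩ | h1
    · simp only [Term.mem_letters_node, mem_singleton, exists_eq_left] at hG
      have hf : f ∈ G := hG f (Or.inl (by simp))
      rw [Term.chainSplit_one nu G f t hf, Hom.openEval_addChain hd,
        ih t (by simp) (fun a ha => hG a (Or.inr ha))]
      simp [Subst.eval]
    · simp only [Term.mem_letters_node] at hG
      rw [Term.chainSplit_ne nu G f ts h1]
      simp only [Hom.openEval, Hom.eval, Subst.eval, map_map]
      rw [hk f _ (by simpa using h1)]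
      congr 1
      refine map_congr_left fun t ht => ?_
      simp only [Function.comp]
      rw [Term.chainComp, Hom.eval_closeChain hd]
      grind
  | hp a l t ih =>
    simp only [Term.letters, mem_cons] at hG
    have ha : a ∈ G := hG a (Or.inl rfl)
    simp only [Term.chainSplit, ha, if_true]
    rw [Hom.openEval_addChain hd, ih (fun a ha => hG a (Or.inr ha))]
    grind

/-- Chain compression is undone by a homomorphism that decodes the new letters. -/
theorem Hom.eval_chainComp (hd : ∀ a l s, H.node (nu a l) [s] = (fun r => Tree.node a [r])^[l] s)
    (t : Term) (hG : ∀ a, (a, 1) ∈ t.letters → a ∈ G)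
    (hk : ∀ f, ∀ ts : List Tree, ts.length ≠ 1 → H.node f ts = .node f ts) :
    H.eval S (t.chainComp nu G) = S.eval t := by
  rw [Term.chainComp, Hom.eval_closeChain hd]
  exact Hom.openEval_chainSplit hd t hG hk

end Chain

/-! ### Decoding of pair compression -/

section Pair

variable {nu : ℕ → ℕ → ℕ} {G1 G2 : Finset ℕ}

theorem Term.pairComp_one (a : ℕ) (t : Term) :
    (Term.node a [t]).pairComp nu G1 G2 = consPair nu G1 G2 a (t.pairComp nu G1 G2) := by
  grind

theorem Term.pairComp_ne (ts : List Term) (h : ts.length ≠ 1) :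
    (Term.node f ts).pairComp nu G1 G2 = .node f (ts.map (pairComp nu G1 G2)) := by
  rcases ts with _ | ⟨t, _ | ⟨s, ts⟩⟩
  · simp [pairComp]
  · simp at h
  · simp [pairComp]

theorem Term.consPair_cases (nu : ℕ → ℕ → ℕ) (G1 G2 : Finset ℕ) (a : ℕ) (s : Term) :
    (∃ b r, s = .node b [r] ∧ a ∈ G1 ∧ b ∈ G2 ∧ consPair nu G1 G2 a s = .node (nu a b) [r]) ∨
    ((∀ b r, s = .node b [r] → ¬ (a ∈ G1 ∧ b ∈ G2)) ∧
      consPair nu G1 G2 a s = .node a [s]) := by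
  rcases s with x | ⟨X, s⟩ | ⟨b, ts⟩ | ⟨b, l, s⟩
  · right; simp [consPair]
  · right; simp [consPair]
  · rcases ts with _ | ⟨t, _ | ⟨s, ts⟩⟩
    · right; simp [consPair]
    · by_cases h : a ∈ G1 ∧ b ∈ G2
      · left; exact ⟨b, t, rfl, h.1, h.2, by simp [consPair, h]⟩
      · right
        refine ⟨?_, by simp only [consPair, if_neg h]⟩
        grind
    · right; simp [consPair]
  · right; simp [consPair]

/-- Pair compression is undone by a homomorphism that decodes the new letters. -/
theorem Hom.eval_pairComp
    (hd : ∀ a ∈ G1, ∀ b ∈ G2, ∀ s, H.node (nu a b) [s] = .node a [.node b [s]])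
    (hG2 : ∀ b ∈ G1 ∪ G2, ∀ s, H.node b [s] = .node b [s])
    (hk : ∀ f, ∀ ts : List Tree, ts.length ≠ 1 → H.node f ts = .node f ts) (t : Term)
    (hG : ∀ a, (a, 1) ∈ t.letters → a ∈ G1 ∪ G2) :
    H.eval S (t.pairComp nu G1 G2) = S.eval t := by
  induction t with
  | hv x => grind
  | hc X t ih =>
    grind
  | hn f ts ih =>
    simp only [Term.mem_letters_node] at hG
    rcases length_one_cases ts with ⟨t, rfl⟩ | h1
    · have hf : f ∈ G1 ∪ G2 := hG f (Or.inl (by simp))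
      have key := ih t (by simp) (fun a ha => hG a (Or.inr ⟨t, by simp, ha⟩))
      rw [Term.pairComp_one]
      rcases Term.consPair_cases nu G1 G2 f (t.pairComp nu G1 G2) with
        ⟨b, r, h1, ha, hb, h2⟩ | ⟨_, h2⟩
      · grind
      · grind
    · rw [Term.pairComp_ne f ts h1]
      simp only [Hom.eval, Subst.eval, map_map]
      rw [hk f _ (by simpa using h1)]
      congr 1
      exact map_congr_left fun t ht => ih t ht fun a ha => hG a (Or.inr ⟨t, ht, ha⟩)
  | hp a l t ih =>
    grind

end Pair

/-! ### Decoding of leaf compression -/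

section Leaf

variable {nu : ℕ → List (Option ℕ) → ℕ} {G : Finset (ℕ × ℕ)} {G0 : Finset ℕ}

theorem Term.constIn_eq_some {t : Term} {c : ℕ} :
    t.constIn G0 = some c ↔ t = .node c [] ∧ c ∈ G0 := by
  rcases t with x | ⟨X, s⟩ | ⟨b, _ | ⟨t, ts⟩⟩ | ⟨b, l, s⟩ <;> simp [constIn]
  grind

theorem Term.leafComp_absorb (f : ℕ) (ts : List Term)
    (h : (f, ts.length) ∈ G ∧ ∃ t ∈ ts, (t.constIn G0).isSome) :
    (Term.node f ts).leafComp nu G G0 = .node (nu f (ts.map (constIn G0)))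
      ((ts.filter fun t => (t.constIn G0).isNone).map (leafComp nu G G0)) := by
  rw [leafComp, if_pos h]
  congr 1
  clear h
  have : ∀ l : List {t // t ∈ ts}, l.filterMap (fun t =>
      if (t.1.constIn G0).isSome then none else some (leafComp nu G G0 t.1)) =
      ((l.map Subtype.val).filter fun t => (t.constIn G0).isNone).map (leafComp nu G G0) := by
    intro l
    induction l with
    | nil => rfl
    | cons t l ih =>
      simp only [filterMap_cons, map_cons, filter_cons]
      rcases h : t.1.constIn G0 with _ | c
      · grind
      · grind
  rw [this, attach_map_subtype_val]

theorem Term.leafComp_keep (f : ℕ) (ts : List Term)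
    (h : ¬ ((f, ts.length) ∈ G ∧ ∃ t ∈ ts, (t.constIn G0).isSome)) :
    (Term.node f ts).leafComp nu G G0 = .node f (ts.map (leafComp nu G G0)) := by
  rw [leafComp, if_neg h]

theorem count_none_constIn (ts : List Term) : (ts.map (constIn G0)).count none =
      (ts.filter fun t => (t.constIn G0).isNone).length := by
  rw [List.count, countP_map, countP_eq_length_filter]
  congr 1
  refine filter_congr fun t _ => ?_
  rcases h : t.constIn G0 <;> simp [h]

/-- Leaf compression is undone by a homomorphism that decodes the new letters. -/
theorem Hom.eval_leafComp
    (hd : ∀ f p (ts : List Tree), (f, p.length) ∈ G → ts.length = p.count none → H.node (nu f p) ts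
      = .node f (weave p ts)) (t : Term)
    (hk : ∀ f m, (f, m) ∈ t.letters → ∀ ts : List Tree, ts.length = m → H.node f ts = .node f ts) :
    H.eval S (t.leafComp nu G G0) = S.eval t := by
  induction t with
  | hv x => simp [Term.leafComp, Hom.eval, Subst.eval]
  | hc X t ih =>
    simp only [Term.leafComp, Term.letters] at hk ⊢
    grind
  | hn f ts ih =>
    simp only [Term.mem_letters_node] at hk
    have ih' : ∀ t ∈ ts, H.eval S (t.leafComp nu G G0) = S.eval t := fun t ht =>
      ih t ht fun g m hg => hk g m (Or.inr ⟨t, ht, hg⟩)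
    by_cases h : (f, ts.length) ∈ G ∧ ∃ t ∈ ts, (t.constIn G0).isSome
    · rw [Term.leafComp_absorb f ts h]
      simp only [Hom.eval, Subst.eval, map_map]
      rw [hd _ _ _ (by simpa using h.1) (by rw [count_none_constIn]; simp)]
      congr 1
      clear h hk ih
      induction ts with
      | nil => rfl
      | cons t ts ih2 =>
        simp only [mem_cons, forall_eq_or_imp] at ih'
        have := ih2 ih'.2
        rcases hc : t.constIn G0 with _ | c
        · simp only [map_cons, filter_cons, hc, Option.isNone_none, if_true, weave]
          grind
        · simp only [map_cons, filter_cons, hc, Option.isNone_some, weave]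
          have e := (Term.constIn_eq_some.1 hc).1
          grind
    · rw [Term.leafComp_keep f ts h]
      simp only [Hom.eval, Subst.eval, map_map]
      rw [hk f _ (Or.inl rfl) _ (by simp)]
      congr 1
      exact map_congr_left ih'
  | hp a l t ih =>
    simp only [Term.letters, mem_cons] at hk
    simp only [Term.leafComp, Hom.eval, Subst.eval]
    grind

end Leaf
/-! ### Letters of compressed terms -/

theorem mem_letters_closeChain {q : ℕ × ℕ} {p : Option (ℕ × ℕ) × Term} :
    q ∈ (closeChain nu p).letters ↔
      q ∈ p.2.letters ∨ ∃ a l, p.1 = some (a, l) ∧ q = (nu a l, 1) := by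
  rcases p with ⟨_ | ⟨b, m⟩, s⟩
  · grind
  · grind

/-- The letters of a partly compressed term come from letters with the property `p`. -/
def OpenLetters (nu : ℕ → ℕ → ℕ) (p : ℕ × ℕ → Prop) (r : Option (ℕ × ℕ) × Term) : Prop :=
  (∀ q ∈ r.2.letters, (p q ∧ q.2 ≠ 1) ∨ ∃ a l, p (a, 1) ∧ q = (nu a l, 1)) ∧
    ∀ a l, r.1 = some (a, l) → p (a, 1)

theorem OpenLetters.mono {r : Option (ℕ × ℕ) × Term} (h : OpenLetters nu p r)
    (hq : ∀ a, p a → q a) : OpenLetters nu q r := by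
  grind [OpenLetters]

theorem OpenLetters.close {r : Option (ℕ × ℕ) × Term} (h : OpenLetters nu p r) :
    ∀ q ∈ (closeChain nu r).letters, (p q ∧ q.2 ≠ 1) ∨ ∃ a l, p (a, 1) ∧ q = (nu a l, 1) := by
  grind [OpenLetters, mem_letters_closeChain]

theorem OpenLetters.add {r : Option (ℕ × ℕ) × Term} (h : OpenLetters nu p r) {a l : ℕ}
    (ha : p (a, 1)) : OpenLetters nu p (addChain nu a l r) := by
  rcases r with ⟨_ | ⟨b, m⟩, s⟩
  · exact ⟨h.1, by grind⟩
  · have hb := h.2 b m rfl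
    simp only [addChain]
    split_ifs
    · exact ⟨h.1, by grind⟩
    · exact ⟨fun q hq => (mem_letters_node.1 hq).elim (fun hq => Or.inr ⟨b, m, hb, hq⟩)
        fun hq => h.1 q (by simpa using hq), by grind⟩

theorem openLetters_chainSplit (hG : ∀ a, (a, 1) ∈ t.letters → a ∈ G) :
    OpenLetters nu (· ∈ t.letters) (t.chainSplit nu G) := by
  induction t with
  | hv x => simp [chainSplit, letters, OpenLetters]
  | hc X t ih =>
    simp only [letters, chainSplit] at hG ⊢
    exact ⟨by simpa only [letters] using (ih hG).close, by simp⟩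
  | hn f ts ih =>
    simp only [mem_letters_node] at hG
    have ih t ht := ih t ht fun a ha => hG a (Or.inr ⟨t, ht, ha⟩)
    rcases length_one_cases ts with ⟨t, rfl⟩ | h1
    · rw [chainSplit_one nu G f t (hG f (Or.inl rfl))]
      exact ((ih t (by simp)).mono (by simp [letters_node]; tauto)).add (by simp [letters_node])
    · rw [chainSplit_ne nu G f ts h1]
      refine ⟨fun q hq => ?_, by simp⟩
      simp only [mem_letters_node, mem_map, length_map] at hq ⊢
      rcases hq with rfl | ⟨_, ⟨t, ht, rfl⟩, hq⟩
      · grind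
      · grind [(ih t ht).close q hq]
  | hp a l t ih =>
    simp only [letters, mem_cons] at hG ⊢
    simp only [chainSplit, hG a (Or.inl rfl), if_true]
    exact ((ih fun a ha => hG a (Or.inr ha)).mono fun _ => Or.inr).add (Or.inl rfl)

theorem mem_letters_chainComp {t : Term} (hG : ∀ a, (a, 1) ∈ t.letters → a ∈ G) {q : ℕ × ℕ}
    (hq : q ∈ (t.chainComp nu G).letters) :
    (q ∈ t.letters ∧ q.2 ≠ 1) ∨ ∃ a l, (a, 1) ∈ t.letters ∧ q = (nu a l, 1) :=
  (openLetters_chainSplit t hG).close q hq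

theorem mem_letters_pairComp : ∀ q ∈ (t.pairComp nu G1 G2).letters, q ∈ t.letters ∨
      ∃ a ∈ G1, ∃ b ∈ G2, (a, 1) ∈ t.letters ∧ q = (nu a b, 1) := by
  induction t with
  | hv x => simp [pairComp, letters]
  | hc X t ih => simpa only [pairComp, letters] using ih
  | hn f ts ih =>
    intro q hq
    simp only [mem_letters_node]
    rcases length_one_cases ts with ⟨t, rfl⟩ | h1
    · rw [pairComp_one] at hq
      have key : ∀ q ∈ (t.pairComp nu G1 G2).letters, (q = (f, [t].length) ∨ ∃ s ∈ [t], q ∈ s.letters) ∨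
          ∃ a ∈ G1, ∃ b ∈ G2, ((a, 1) = (f, [t].length) ∨ ∃ s ∈ [t], (a, 1) ∈ s.letters) ∧
            q = (nu a b, 1) := fun q hq =>
        (ih t (by simp) q hq).imp (fun h => Or.inr ⟨t, by simp, h⟩)
          fun ⟨a, ha, b, hb, h1, h2⟩ => ⟨a, ha, b, hb, Or.inr ⟨t, by simp, h1⟩, h2⟩
      rcases consPair_cases nu G1 G2 f (t.pairComp nu G1 G2) with
        ⟨b, r, h1, ha, hb, h2⟩ | ⟨_, h2⟩
      · rw [h2, mem_letters_node] at hq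
        rcases hq with rfl | ⟨_, hr, hq⟩
        · exact Or.inr ⟨f, ha, b, hb, Or.inl rfl, rfl⟩
        · refine key q ?_
          rw [h1, mem_letters_node]
          grind
      · rw [h2, mem_letters_node] at hq
        grind
    · rw [pairComp_ne f ts h1, mem_letters_node] at hq
      grind
  | hp a l t ih =>
    simp only [pairComp, letters, mem_cons]
    grind

/-- The nodes of a term with the constants among their children. -/
@[grind =] def Term.nodePats (G0 : Finset ℕ) : Term → List (ℕ × List (Option ℕ))
  | .var _ => []
  | .cvar _ t => t.nodePats G0
  | .node f ts => (f, ts.map (constIn G0)) :: (ts.map (nodePats G0)).flatten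
  | .pow _ _ t => t.nodePats G0

theorem mem_letters_leafComp {nu : ℕ → List (Option ℕ) → ℕ} {G : Finset (ℕ × ℕ)} :
    ∀ q ∈ (t.leafComp nu G G0).letters, q ∈ t.letters ∨
      ∃ f p, (f, p.length) ∈ G ∧ (∀ c, some c ∈ p → c ∈ G0) ∧ (f, p) ∈ t.nodePats G0 ∧
        q = (nu f p, p.count none) := by
  induction t with
  | hv x => simp [leafComp, letters]
  | hc X t ih => simpa only [leafComp, letters, nodePats] using ih
  | hn f ts ih =>
    intro q hq
    simp only [mem_letters_node]
    by_cases h : (f, ts.length) ∈ G ∧ ∃ t ∈ ts, (t.constIn G0).isSome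
    · rw [leafComp_absorb f ts h, mem_letters_node] at hq
      rcases hq with rfl | ⟨_, hr, hq⟩
      · refine Or.inr ⟨f, ts.map (constIn G0), by simpa using h.1, ?_,
          by simp [nodePats], by rw [count_none_constIn]; simp⟩
        intro c hc
        obtain ⟨t, _, h2⟩ := mem_map.1 hc
        exact (constIn_eq_some.1 h2).2
      · grind
    · rw [leafComp_keep f ts h, mem_letters_node] at hq
      grind
  | hp a l t ih =>
    simp only [leafComp, letters, mem_cons, nodePats]
    grind

theorem letters_wrap (t : Term) :
    (∀ q ∈ (wrap ls t).letters, p q) ↔ (∀ L ∈ ls, p L.letter) ∧ ∀ q ∈ t.letters, p q := by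
  induction ls with
  | nil => grind
  | cons L ls ih =>
    simp only [wrap_cons, mem_cons, forall_eq_or_imp, and_assoc, ← ih]
    rcases L with ⟨a, l⟩ | ⟨f, xs, ys⟩
    · grind
    · grind

theorem letters_sub_iff (V : ℕ → VTmpl) (C : ℕ → CTmpl) (t : Term) :
    (∀ q ∈ (sub V C t).letters, p q) ↔ (∀ q ∈ t.letters, p q) ∧
      (∀ x ∈ t.vars, (V x).Letters p) ∧ ∀ X ∈ t.cvars, (C X).Letters p := by
  induction t with
  | hv x =>
    simp only [sub, VTmpl.app, letters_wrap, letters, vars, cvars, VTmpl.Letters]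
    rcases h : (V x).const with _ | c <;> simp [letters, h]
  | hc X t ih =>
    simp only [sub, CTmpl.app, letters_wrap, letters, vars, cvars, CTmpl.Letters,
      forall_mem_cons, forall_mem_append]
    rcases (C X).keep with _ | _
    · simp only [cond_false, letters_wrap, ih, CTmpl.Letters, forall_mem_append]; tauto
    · simp only [cond_true, letters_wrap, ih, letters, CTmpl.Letters, forall_mem_append]
      tauto
  | hn f ts ih =>
    simp only [sub, mem_letters_node, length_map, forall_eq_or_imp, vars, cvars,
      mem_flatten, mem_map]
    grind
  | hp a l t ih =>
    grind

theorem Eqn.mem_letters {q : ℕ × ℕ} : q ∈ e.letters ↔ q ∈ e.lhs.letters ∨ q ∈ e.rhs.letters := by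
  simp [Eqn.letters]

theorem Eqn.mem_unary {a : ℕ} : a ∈ e.unary ↔ (a, 1) ∈ e.letters := by simp [Eqn.unary]

theorem Eqn.mem_consts {a : ℕ} : a ∈ e.consts ↔ (a, 0) ∈ e.letters := by simp [Eqn.consts]

theorem Eqn.mem_nonConsts {p : ℕ × ℕ} : p ∈ e.nonConsts ↔ p ∈ e.letters ∧ p.2 ≠ 0 := by
  simp [Eqn.nonConsts]

theorem Eqn.letters_sub (he : ∀ q ∈ e.letters, p q) (hV : ∀ x, (V x).Letters p)
    (hC : ∀ X, (C X).Letters p) :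
    ∀ q ∈ (e.map (sub V C)).letters, p q := by
  simp only [Eqn.mem_letters, or_imp, forall_and, Eqn.map] at he ⊢
  exact ⟨(letters_sub_iff V C _).2 ⟨he.1, fun x _ => hV x, fun X _ => hC X⟩,
    (letters_sub_iff V C _).2 ⟨he.2, fun x _ => hV x, fun X _ => hC X⟩⟩

/-! ### Pulling back solutions -/

/-- `S` is a solution all whose letters have arity at most `k`. -/
def Solves (k : ℕ) (e : Eqn) (S : Subst) : Prop :=
  S.All (fun p => p.2 ≤ k) ∧ S.eval e.lhs = S.eval e.rhs

theorem Solves.pull (h : Solves k (e.map (sub V C)) S) (hV : ∀ x, (V x).Letters fun p => p.2 ≤ k)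
    (hC : ∀ X, (C X).Letters fun p => p.2 ≤ k) : Solves k e (pull V C S) := by
  refine ⟨pull_all h.1 hV hC, ?_⟩
  rw [← eval_sub, ← eval_sub]
  exact h.2

/-- The common form of the soundness of the three compressions: `H` expands the new letters, and
`hl`, `hr` say that expanding the compressed sides gives back the old ones. -/
theorem Solves.hom (H : Hom) (h : Solves k e' S)
    (hall : ∀ f (ts : List Tree), ts.length ≤ k → (∀ t ∈ ts, t.All fun p => p.2 ≤ k) → (H.node f
      ts).All fun p => p.2 ≤ k) (hl : H.eval (H.subst S) e'.lhs = (H.subst S).eval e.lhs)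
    (hr : H.eval (H.subst S) e'.rhs = (H.subst S).eval e.rhs) : Solves k e (H.subst S) := by
  refine ⟨H.all_subst hall h.1, ?_⟩
  rw [← hl, ← hr, ← H.tree_eval, ← H.tree_eval, h.2]

/-! ### Soundness of the steps -/

open Classical in
/-- The context that a unary letter introduced by chain compression stands for. -/
noncomputable def chainDecode (nu : ℕ → ℕ → ℕ) (f : ℕ) : Ctx :=
  if h : ∃ p : ℕ × ℕ, nu p.1 p.2 = f then Ctx.up h.choose.1 h.choose.2 .hole
  else .node f [] .hole []

theorem chainDecode_apply (hnu : ∀ a b a' b', nu a b = nu a' b' → a = a' ∧ b = b') (a l : ℕ) :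
    chainDecode nu (nu a l) = Ctx.up a l .hole := by
  have h : ∃ p : ℕ × ℕ, nu p.1 p.2 = nu a l := ⟨(a, l), rfl⟩
  have := hnu _ _ _ _ h.choose_spec
  rw [chainDecode, dif_pos h, this.1, this.2]

theorem chainDecode_all (nu : ℕ → ℕ → ℕ) (f : ℕ) (hk : 1 ≤ k) :
    (chainDecode nu f).All fun p => p.2 ≤ k := by
  unfold chainDecode
  split_ifs
  · exact Ctx.up_all hk trivial
  · grind

/-- The contexts matter only if a unary letter is present, and then `1 ≤ k`; for `k = 0` decoding
contexts would violate the arity bound. -/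
theorem Hom.unary_all {U : ℕ → Ctx} (hU : 1 ≤ k → ∀ f, (U f).All fun p => p.2 ≤ k) (f : ℕ)
    (ts : List Tree) (hl : ts.length ≤ k) (h : ∀ t ∈ ts, t.All fun p => p.2 ≤ k) :
    ((Hom.unary U).node f ts).All fun p => p.2 ≤ k := by
  rcases length_one_cases ts with ⟨t, rfl⟩ | h1
  · rw [Hom.unary_node_one]
    exact (Ctx.all_fill _ _).2 ⟨hU (by simpa using hl) f, h t (by simp)⟩
  · rw [Hom.unary_node_ne _ _ _ h1]
    grind

theorem Solves.of_chainComp (hnu : FreshNames G nu) (hG : ∀ a, (a, 1) ∈ e.letters → a ∈ G)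
    (h : Solves k (e.map (Term.chainComp nu G)) S) : ∃ S', Solves k e S' := by
  have key : ∀ t : Term, (∀ a, (a, 1) ∈ t.letters → a ∈ G) → ∀ S,
      (Hom.unary (chainDecode nu)).eval S (t.chainComp nu G) = S.eval t := fun t ht S =>
    Hom.eval_chainComp (fun a l s => by
      rw [Hom.unary_node_one, chainDecode_apply hnu.1, Ctx.fill_up, Ctx.fill]) t ht
      fun f ts => Hom.unary_node_ne _ f ts
  simp only [Eqn.mem_letters] at hG
  exact ⟨_, h.hom (Hom.unary (chainDecode nu)) (Hom.unary_all fun hk f => chainDecode_all nu f hk)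
    (key _ (fun a ha => hG a (Or.inl ha)) _) (key _ (fun a ha => hG a (Or.inr ha)) _)⟩

open Classical in
/-- The context that a unary letter introduced by pair compression stands for. -/
noncomputable def pairDecode (nu : ℕ → ℕ → ℕ) (G1 G2 : Finset ℕ) (f : ℕ) : Ctx :=
  if h : ∃ p : ℕ × ℕ, nu p.1 p.2 = f ∧ p.1 ∈ G1 ∧ p.2 ∈ G2 then
    .node h.choose.1 [] (.node h.choose.2 [] .hole []) []
  else .node f [] .hole []

theorem pairDecode_apply (hnu : ∀ a b a' b', nu a b = nu a' b' → a = a' ∧ b = b') {a b : ℕ}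
    (ha : a ∈ G1) (hb : b ∈ G2) :
    pairDecode nu G1 G2 (nu a b) = .node a [] (.node b [] .hole []) [] := by
  have h : ∃ p : ℕ × ℕ, nu p.1 p.2 = nu a b ∧ p.1 ∈ G1 ∧ p.2 ∈ G2 := ⟨(a, b), rfl, ha, hb⟩
  have := hnu _ _ _ _ h.choose_spec.1
  rw [pairDecode, dif_pos h, this.1, this.2]

theorem pairDecode_old {f : ℕ} (h : ∀ a b, nu a b ≠ f) :
    pairDecode nu G1 G2 f = .node f [] .hole [] := by
  rw [pairDecode, dif_neg]
  grind

theorem pairDecode_all (nu : ℕ → ℕ → ℕ) (G1 G2 : Finset ℕ) (f : ℕ) (hk : 1 ≤ k) :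
    (pairDecode nu G1 G2 f).All fun p => p.2 ≤ k := by
  unfold pairDecode
  split_ifs
  · grind
  · grind

theorem eval_pairDecode (hnu : FreshNames (G1 ∪ G2) nu) (t : Term)
    (ht : ∀ a, (a, 1) ∈ t.letters → a ∈ G1 ∪ G2) (S : Subst) :
    (Hom.unary (pairDecode nu G1 G2)).eval S (t.pairComp nu G1 G2) = S.eval t := by
  refine Hom.eval_pairComp ?_ ?_ (fun f ts => Hom.unary_node_ne _ f ts) t ht
  · intro a ha b hb s
    rw [Hom.unary_node_one, pairDecode_apply hnu.1 ha hb]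
    rfl
  · intro b hb s
    rw [Hom.unary_node_one, pairDecode_old (f := b) fun a c h => hnu.2 a c (by rwa [h])]
    rfl

theorem Solves.of_pairComp (hnu : FreshNames (G1 ∪ G2) nu)
    (hG : ∀ a, (a, 1) ∈ e.letters → a ∈ G1 ∪ G2) (h : Solves k (e.map (Term.pairComp nu G1 G2)) S) :
    ∃ S', Solves k e S' := by
  simp only [Eqn.mem_letters] at hG
  exact ⟨_, h.hom (Hom.unary (pairDecode nu G1 G2))
    (Hom.unary_all fun hk f => pairDecode_all nu G1 G2 f hk)
    (eval_pairDecode hnu _ (fun a ha => hG a (Or.inl ha)) _)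
    (eval_pairDecode hnu _ (fun a ha => hG a (Or.inr ha)) _)⟩

open Classical in
/-- The pattern that a letter introduced by leaf compression stands for. -/
noncomputable def leafDecode (nu : ℕ → List (Option ℕ) → ℕ) (G : Finset (ℕ × ℕ)) (h m : ℕ) :
    ℕ × List (Option ℕ) :=
  if hp : ∃ q : ℕ × List (Option ℕ), nu q.1 q.2 = h ∧ q.2.count none = m ∧ (q.1, q.2.length) ∈ G then
    hp.choose
  else (h, List.replicate m none)

theorem leafDecode_apply {nu : ℕ → List (Option ℕ) → ℕ} {G : Finset (ℕ × ℕ)}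
    (hnu : ∀ f p f' p', nu f p = nu f' p' → f = f' ∧ p = p') {f : ℕ} {p : List (Option ℕ)}
    (hp : (f, p.length) ∈ G) : leafDecode nu G (nu f p) (p.count none) = (f, p) := by
  have h : ∃ q : ℕ × List (Option ℕ), nu q.1 q.2 = nu f p ∧ q.2.count none = p.count none ∧
    (q.1, q.2.length) ∈ G := ⟨(f, p), rfl, rfl, hp⟩
  have := hnu _ _ _ _ h.choose_spec.1
  rw [leafDecode, dif_pos h]
  grind

theorem leafDecode_old {nu : ℕ → List (Option ℕ) → ℕ} {G : Finset (ℕ × ℕ)} {h : ℕ}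
    (hp : ∀ f p, p.count none = m → nu f p ≠ h) :
    leafDecode nu G h m = (h, List.replicate m none) := by
  rw [leafDecode, dif_neg]
  grind

theorem leafDecode_count (nu : ℕ → List (Option ℕ) → ℕ) (G : Finset (ℕ × ℕ)) (h m : ℕ) :
    (leafDecode nu G h m).2.count none = m := by
  unfold leafDecode
  split_ifs with hp
  · grind
  · simp

theorem leafDecode_length (nu : ℕ → List (Option ℕ) → ℕ) {G : Finset (ℕ × ℕ)}
    (hG : ∀ q ∈ G, q.2 ≤ k) (h m : ℕ) (hm : m ≤ k) : (leafDecode nu G h m).2.length ≤ k := by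
  unfold leafDecode
  split_ifs with hp
  · grind
  · grind

theorem eval_leafDecode {nu : ℕ → List (Option ℕ) → ℕ} {G : Finset (ℕ × ℕ)}
    (hnu : FreshLeafNames G G0 nu) (t : Term)
    (ht : ∀ f m, (f, m) ∈ t.letters → (f, m) ∈ G ∨ m = 0 ∧ f ∈ G0) (S : Subst) :
    (Hom.ofPattern fun h m => some (leafDecode nu G h m)).eval S (t.leafComp nu G G0) =
      S.eval t := by
  refine Hom.eval_leafComp ?_ t ?_
  · intro f p ts hp hl
    have e : leafDecode nu G (nu f p) ts.length = (f, p) := by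
      rw [hl]; exact leafDecode_apply hnu.1 hp
    exact Hom.ofPattern_some (by rw [e])
  · intro f m hf ts hl
    have e : leafDecode nu G f ts.length = (f, List.replicate ts.length none) := by
      -- By freshness an old letter is not a new name of the same arity, so it decodes to the
      -- pattern without constants.
      refine leafDecode_old fun g p hp hg => ?_
      have h1 := hnu.2 g p
      grind
    rw [Hom.ofPattern_some (by rw [e]), weave_replicate]

theorem Solves.of_leafComp {nu : ℕ → List (Option ℕ) → ℕ} {G : Finset (ℕ × ℕ)}
    (hnu : FreshLeafNames G G0 nu) (hk : ∀ q ∈ G, q.2 ≤ k)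
    (hG : ∀ f m, (f, m) ∈ e.letters → (f, m) ∈ G ∨ m = 0 ∧ f ∈ G0)
    (h : Solves k (e.map (Term.leafComp nu G G0)) S) : ∃ S', Solves k e S' := by
  simp only [Eqn.mem_letters] at hG
  refine ⟨_, h.hom (Hom.ofPattern fun h m => some (leafDecode nu G h m)) ?_
    (eval_leafDecode hnu _ (fun a m ha => hG a m (Or.inl ha)) _)
    (eval_leafDecode hnu _ (fun a m ha => hG a m (Or.inr ha)) _)⟩
  intro f ts hl hts
  rw [Hom.ofPattern_some (g := (leafDecode nu G f ts.length).1)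
    (p := (leafDecode nu G f ts.length).2) rfl, Tree.all_node,
    weave_length _ _ (leafDecode_count nu G f ts.length).symm]
  exact ⟨leafDecode_length nu hk f _ hl, weave_all _ _ (fun c _ => Nat.zero_le _) hts⟩

theorem Term.size_one_cases {t : Term} (h : ¬ 1 < t.size) :
    (∃ x, t = .var x) ∨ ∃ c, t = .node c [] := by
  rcases t with x | ⟨X, s⟩ | ⟨b, _ | ⟨s, ts⟩⟩ | ⟨b, l, s⟩
  · grind
  · have := s.one_le_size; simp only [size] at h; omega
  · grind
  · have := s.one_le_size; simp only [size, map_cons, sum_cons] at h; omega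
  · have := s.one_le_size; simp only [size] at h; omega

theorem Eqn.NaivelySolvable.solves (hs : ¬ (1 < e.lhs.size ∨ 1 < e.rhs.size))
    (h : e.NaivelySolvable) : ∃ S, Solves k e S := by
  push Not at hs
  have hl := Term.size_one_cases (not_lt.2 hs.1)
  have hr := Term.size_one_cases (not_lt.2 hs.2)
  have ht : ∀ c : ℕ, (Tree.node c []).All fun p => p.2 ≤ k := fun c =>
    Tree.all_node.2 ⟨Nat.zero_le _, by simp⟩
  have hsol : ∀ c : ℕ, (⟨fun _ => .node c [], fun _ => .hole⟩ : Subst).All fun p => p.2 ≤ k :=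
    fun c => ⟨fun _ => ht c, fun _ => trivial⟩
  rcases e with ⟨l, r⟩
  simp only at hl hr
  rcases hl with ⟨x, rfl⟩ | ⟨c, rfl⟩ <;> rcases hr with ⟨y, rfl⟩ | ⟨d, rfl⟩
  · exact ⟨_, hsol 0, by simp [Subst.eval]⟩
  · exact ⟨_, hsol d, by simp [Subst.eval]⟩
  · exact ⟨_, hsol c, by simp [Subst.eval]⟩
  · refine ⟨_, hsol c, ?_⟩
    simp only [Eqn.NaivelySolvable, reduceCtorEq, exists_false, false_or] at h
    rw [h]

/-- The invariant of the runs that is needed for soundness. -/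
def Stage.Inv (k : ℕ) (e : Eqn) : Stage → Prop
  | .prefC G _ | .prefV G _ | .suff G _ | .chain G =>
      (∀ a, (a, 1) ∈ e.letters → a ∈ G) ∧ ∀ a ∈ G, 1 ≤ k
  | .popDown G1 G2 _ | .popUpC G1 G2 _ | .popUpV G1 G2 _ | .pair G1 G2 =>
      (∀ a, (a, 1) ∈ e.letters → a ∈ G1 ∪ G2) ∧ ∀ a ∈ G1 ∪ G2, 1 ≤ k
  | .constV G G0 _ | .genDown G G0 _ _ | .constNew G G0 _ | .leaf G G0 =>
      (∀ f m, (f, m) ∈ e.letters → (f, m) ∈ G ∨ m = 0 ∧ f ∈ G0) ∧ ∀ q ∈ G, q.2 ≤ k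
  | .halt answer => answer = true → ∃ S, Solves k e S
  | .test | .start | .part | .choose => True

def Config.Inv (k : ℕ) (c : Config) : Prop :=
  (∀ q ∈ c.eqn.letters, q.2 ≤ k) ∧ c.stage.Inv k c.eqn

theorem CTmpl.letters_update {c : CTmpl} (h : c.Letters p) (Y : ℕ) :
    (update (fun _ => CTmpl.triv) X c Y).Letters p := by
  grind

theorem VTmpl.letters_update {x : ℕ} {v : VTmpl} (h : v.Letters p) (y : ℕ) :
    (update (fun _ => VTmpl.triv) x v y).Letters p := by
  grind

theorem VTmpl.letters_triv : VTmpl.triv.Letters p := by simp [VTmpl.Letters, VTmpl.triv]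

theorem CTmpl.letters_triv : CTmpl.triv.Letters p := by simp [CTmpl.Letters, CTmpl.triv]

/-- Popping one layer from a context variable. -/
theorem pop_sound {c : CTmpl} (hF : ∀ t, F t = c.app X t) (hkeep : c.keep = true)
    (h : Eqn.MayDrop X (e.map (substC X F)) e') (he : ∀ q ∈ e.letters, q.2 ≤ k)
    (hep : ∀ q ∈ e.letters, p q) (hc : c.Letters fun q => q.2 ≤ k) (hcp : c.Letters p) :
    (∀ q ∈ e'.letters, q.2 ≤ k) ∧ (∀ q ∈ e'.letters, p q) ∧
      ((∃ S, Solves k e' S) → ∃ S, Solves k e S) := by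
  obtain ⟨b, rfl⟩ := (mayDrop_iff hF hkeep e e').1 h
  have h1 := CTmpl.letters_update (X := X) (c := ⟨c.pre, b, c.post⟩) (p := fun q => q.2 ≤ k) hc
  have h2 := CTmpl.letters_update (X := X) (c := ⟨c.pre, b, c.post⟩) (p := p) hcp
  exact ⟨Eqn.letters_sub he (fun _ => VTmpl.letters_triv) h1,
    Eqn.letters_sub hep (fun _ => VTmpl.letters_triv) h2,
    fun ⟨S, hS⟩ => ⟨_, hS.pull (fun _ => VTmpl.letters_triv) h1⟩⟩

theorem popV_sound {x : ℕ} {v : VTmpl} (he : ∀ q ∈ e.letters, q.2 ≤ k) (hep : ∀ q ∈ e.letters, p q)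
    (hc : v.Letters fun q => q.2 ≤ k) (hcp : v.Letters p) :
    (∀ q ∈ (e.map (substV x (v.app x))).letters, q.2 ≤ k) ∧
      (∀ q ∈ (e.map (substV x (v.app x))).letters, p q) ∧
      ((∃ S, Solves k (e.map (substV x (v.app x))) S) → ∃ S, Solves k e S) := by
  have e1 : substV x (v.app x) = sub (update (fun _ => .triv) x v) fun _ => .triv :=
    funext fun t => substV_eq_sub x v t
  rw [e1]
  exact ⟨Eqn.letters_sub he (VTmpl.letters_update hc) (fun _ => CTmpl.letters_triv),
    Eqn.letters_sub hep (VTmpl.letters_update hcp) (fun _ => CTmpl.letters_triv),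
    fun ⟨S, hS⟩ => ⟨_, hS.pull (VTmpl.letters_update hc) (fun _ => CTmpl.letters_triv)⟩⟩

/-- The invariant is carried forwards along a run and solvability backwards. -/
theorem Step.sound {c d : Config} (h : Step k c d) (hc : c.Inv k) :
    d.Inv k ∧ ((∃ S, Solves k d.eqn S) → ∃ S, Solves k c.eqn S) := by
  -- The invariant reads the same at all stages of the uncrossing of chains and, with `G1 ∪ G2` in
  -- place of `G`, of pairs, and it ignores the first component. So the stage `.chain` stands for
  -- all of them.
  have popC : ∀ {e e' : Eqn} {X a : ℕ} {G : Finset ℕ} (c : CTmpl), a ∈ G →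
      Eqn.MayDrop X (e.map (substC X (c.app X))) e' → Config.Inv k ⟨true, .chain G, e⟩ →
      c.keep = true → (∀ L ∈ c.pre ++ c.post, L.letter = (a, 1)) →
      Config.Inv k ⟨true, .chain G, e'⟩ ∧ ((∃ S, Solves k e' S) → ∃ S, Solves k e S) := by
    intro e e' X a G c ha hd ⟨h1, h2, h3⟩ hk hL
    have := pop_sound (p := fun q => q.2 = 1 → q.1 ∈ G) (fun t => rfl) hk hd h1 (by grind)
      (by grind [CTmpl.Letters]) (by grind [CTmpl.Letters])
    exact ⟨⟨this.1, fun a ha => this.2.1 _ ha rfl, h3⟩, this.2.2⟩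
  have popV : ∀ {e : Eqn} {x a : ℕ} {G : Finset ℕ} (L : Layer), a ∈ G →
      Config.Inv k ⟨true, .chain G, e⟩ → L.letter = (a, 1) →
      Config.Inv k ⟨true, .chain G, e.map (substV x (L.app (.var x)))⟩ ∧
        ((∃ S, Solves k (e.map (substV x (L.app (.var x)))) S) → ∃ S, Solves k e S) := by
    intro e x a G L ha ⟨h1, h2, h3⟩ hL
    have := popV_sound (x := x) (v := ⟨[L], none⟩) (p := fun q => q.2 = 1 → q.1 ∈ G) h1 (by grind)
      (by grind [VTmpl.Letters]) (by grind [VTmpl.Letters])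
    exact ⟨⟨this.1, fun a ha => this.2.1 _ ha rfl, h3⟩, this.2.2⟩
  cases h with
  | enter => exact ⟨⟨hc.1, trivial⟩, id⟩
  | yes i e hs hn => exact ⟨⟨hc.1, fun _ => hn.solves hs⟩, id⟩
  | no => exact ⟨⟨hc.1, by simp [Stage.Inv]⟩, id⟩
  | start i e =>
    exact ⟨⟨hc.1, fun a ha => Eqn.mem_unary.2 ha, fun a ha => hc.1 _ (Eqn.mem_unary.1 ha)⟩, id⟩
  | prefCSkip | prefCDone | prefVSkip | prefVDone | suffSkip | suffDone | popDownSkip | popDownDone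
  | popUpCSkip | popUpCDone | popUpVSkip | popUpVDone | constVSkip | constVDone | genDownSkip
  | genDownDone | constNewSkip | constNewDone => exact ⟨hc, id⟩
  | prefCPop i e e' G X todo a l ha hl hd =>
    exact popC ⟨[.pow a l], true, []⟩ ha hd hc rfl (by simp [Layer.letter])
  | prefVPop i e G x todo a l ha hl => exact popV (.pow a l) ha hc rfl
  | suffPop i e e' G X todo a l ha hl hd =>
    exact popC ⟨[], true, [.pow a l]⟩ ha hd hc rfl (by simp [Layer.letter])
  | chain i e G nu hnu =>
    obtain ⟨h1, h2, h3⟩ := hc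
    refine ⟨⟨fun q hq => ?_, trivial⟩, fun ⟨S, hS⟩ => hS.of_chainComp hnu h2⟩
    simp only [Eqn.mem_letters, Eqn.map] at hq h1 h2
    rcases hq with hq | hq
    · grind [mem_letters_chainComp (fun a ha => h2 a (Or.inl ha)) hq]
    · grind [mem_letters_chainComp (fun a ha => h2 a (Or.inr ha)) hq]
  | part i e G1 G2 hdj hu =>
    exact ⟨⟨hc.1, fun a ha => hu ▸ Eqn.mem_unary.2 ha,
      fun a ha => hc.1 _ (Eqn.mem_unary.1 (hu ▸ ha))⟩, id⟩
  | popDownPop i e e' G1 G2 X todo a ha hd =>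
    exact popC ⟨[], true, [.nd a [] []]⟩ (Finset.mem_union_left G2 ha) hd hc rfl
      (by simp [Layer.letter])
  | popUpCPop i e e' G1 G2 X todo a ha hd =>
    exact popC ⟨[.nd a [] []], true, []⟩ (Finset.mem_union_right G1 ha) hd hc rfl
      (by simp [Layer.letter])
  | popUpVPop i e G1 G2 x todo a ha =>
    exact popV (.nd a [] []) (Finset.mem_union_right G1 ha) hc rfl
  | pair i e G1 G2 nu hnu =>
    obtain ⟨h1, h2, h3⟩ := hc
    refine ⟨⟨fun q hq => ?_, trivial⟩, fun ⟨S, hS⟩ => hS.of_pairComp hnu h2⟩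
    simp only [Eqn.mem_letters, Eqn.map] at hq h1
    rcases hq with hq | hq <;> grind [mem_letters_pairComp _ q hq]
  | choose i e g c hg hc0 =>
    refine ⟨⟨hc.1, fun f m hf => ?_, fun q hq => ?_⟩, id⟩
    · grind [Eqn.mem_consts, Eqn.mem_nonConsts]
    · have := hc.1 q
      grind [Eqn.mem_nonConsts]
  | constVPop i e G G0 x todo a ha | constNewPop i e G G0 x todo a ha =>
    obtain ⟨h1, h2, h3⟩ := hc
    have := popV_sound (x := x) (v := ⟨[], some a⟩) (p := fun q => q ∈ G ∨ q.2 = 0 ∧ q.1 ∈ G0)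
      h1 (fun q hq => h2 q.1 q.2 hq) (by simp [VTmpl.Letters]) (by simp [VTmpl.Letters, ha])
    exact ⟨⟨this.1, fun f m hf => this.2.1 _ hf, h3⟩, this.2.2⟩
  | genDownPop i e e' G G0 X todo new f xs ys hX hf hnd hfr hd =>
    obtain ⟨h1, h2, h3⟩ := hc
    have := pop_sound (c := ⟨[], true, [.nd f xs ys]⟩) (p := fun q => q ∈ G ∨ q.2 = 0 ∧ q.1 ∈ G0)
      (fun t => rfl) rfl hd h1 (fun q hq => h2 q.1 q.2 hq)
      (by simpa [CTmpl.Letters, Layer.letter] using h3 _ hf)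
      (by simp [CTmpl.Letters, Layer.letter, hf])
    exact ⟨⟨this.1, fun f m hf => this.2.1 _ hf, h3⟩, this.2.2⟩
  | leafFirst e G G0 nu hnu | leafSecond e G G0 nu hnu =>
    obtain ⟨h1, h2, h3⟩ := hc
    refine ⟨⟨fun q hq => ?_, trivial⟩, fun ⟨S, hS⟩ => hS.of_leafComp hnu h3 h2⟩
    simp only [Eqn.mem_letters, Eqn.map] at hq h1
    rcases hq with hq | hq <;> grind [mem_letters_leafComp _ q hq]

/-! ### Soundness of the algorithm -/

/-- Renaming of the letters of arity `m` by `r m`. -/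
def Hom.relabel (r : ℕ → ℕ → ℕ) : Hom where
  node f ts := .node (r ts.length f) ts
  ctx f l c s := .node (r (l.length + 1 + s.length) f) l c s
  fill f l c s t := by simp [Ctx.fill, add_assoc, add_comm 1]

theorem Hom.relabel_all (r : ℕ → ℕ → ℕ) (f : ℕ) (ts : List Tree) (h1 : ts.length ≤ k)
    (h2 : ∀ t ∈ ts, t.All fun p => p.2 ≤ k) : ((relabel r).node f ts).All fun p => p.2 ≤ k :=
  Tree.all_node.2 ⟨h1, h2⟩

theorem Hom.relabel_size (r : ℕ → ℕ → ℕ) (t : Tree) : ((relabel r).tree t).size = t.size := by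
  induction t with
  | h f ts ih =>
    simp only [Hom.tree, relabel, Tree.size, map_map]
    rw [map_congr_left (g := Tree.size) (fun t ht => by simpa [relabel] using ih t ht)]

/-- The renaming of letters is injective for each arity and hence has a left inverse; the context
variables guessed away get the hole as their value. The size is recorded for the comparison of
minimal solutions. -/
theorem Solves.of_load {u v : Term} {rho : ℕ → ℕ → ℕ} {sig tau : ℕ → ℕ} {E : Finset ℕ}
    (hrho : ∀ m, Injective (rho m)) (h : Solves k ⟨u.load rho sig tau E, v.load rho sig tau E⟩ S) :
    ∃ T, Solves k ⟨u, v⟩ T ∧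
      (T.eval u).size = (S.eval (u.load rho sig tau E)).size := by
  set H := Hom.relabel fun m => Function.invFun (rho m) with hH
  have hinv : ∀ m f, Function.invFun (rho m) (rho m f) = f := fun m f =>
    Function.leftInverse_invFun (hrho m) f
  let T : Subst := ⟨fun x => H.tree (S.var (sig x)),
    fun X => if X ∈ E then .hole else H.cx (S.ctx (tau X))⟩
  have key : ∀ t : Term, T.eval t = H.tree (S.eval (t.load rho sig tau E)) := by
    intro t
    rw [H.tree_eval]
    induction t with
    | hv x => simp [Subst.eval, Term.load, Hom.eval, Hom.subst, T]
    | hc X t ih =>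
      by_cases hX : X ∈ E
      · simp only [Subst.eval, Term.load, hX, if_true, T, Ctx.fill]
        exact ih
      · simp only [Subst.eval, Term.load, hX, if_false, T, Hom.eval, Hom.subst]
        rw [← Hom.subst, ← ih]
    | hn f ts ih =>
      simp only [Subst.eval, Term.load, Hom.eval, hH, Hom.relabel, length_map, hinv, map_map]
      congr 1
      exact map_congr_left ih
    | hp a l t ih =>
      simp only [Subst.eval, Term.load, Hom.eval, hH, Hom.relabel, length_singleton, hinv, ih]
  refine ⟨T, ⟨⟨fun x => H.all_tree (Hom.relabel_all _) (h.1.1 _), fun X => ?_⟩, ?_⟩, ?_⟩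
  · by_cases hX : X ∈ E
    · grind
    · simp only [hX, if_false, T]
      exact H.all_cx ⟨_, H.all_tree (Hom.relabel_all _) (h.1.1 0)⟩ (Hom.relabel_all _) (h.1.2 _)
  · rw [key, key, h.2]
  · rw [key, Hom.relabel_size]

theorem Term.over_letters {t : Term} (h : t.Over Sg) : ∀ q ∈ t.letters, q ∈ Sg := by
  induction t with
  | hv x => grind
  | hc X t ih => simp only [Term.Over, letters] at h ⊢; exact ih h
  | hn f ts ih =>
    simp only [Term.Over] at h
    grind
  | hp a l t ih => simp [Term.Over] at h

-- Decoded solutions may use letters outside the signature. A foreign constant is replaced by `c`,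
-- any other foreign letter by a letter of maximal arity whose missing arguments are filled with
-- `c`. Both sides of the equation use only letters of the signature, so they are unaffected.
open Classical in
theorem Solves.satisfiable {u v : Term} (hc : ∃ c, (c, 0) ∈ Sg) (hu : u.Over Sg) (hv : v.Over Sg)
    (h : Solves (maxArity Sg) ⟨u, v⟩ S) :
    Satisfiable Sg u v := by
  obtain ⟨c, hc⟩ := hc
  obtain ⟨⟨g, k⟩, hg, hk⟩ := Finset.exists_mem_eq_sup Sg ⟨_, hc⟩ Prod.snd
  have hk' : maxArity Sg = k := hk
  rw [hk'] at h
  -- Letters of the signature get the pattern without constants, that is, they are kept; `g` has the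
  -- maximal arity `k`, so there is always room for the arguments.
  let T : ℕ → ℕ → Option (ℕ × List (Option ℕ)) := fun f m =>
    if (f, m) ∈ Sg then some (f, List.replicate m none)
    else if m = 0 then some (c, [])
    else some (g, List.replicate m none ++ List.replicate (k - m) (some c))
  let H := Hom.ofPattern T
  have hall : ∀ f (ts : List Tree), ts.length ≤ k → (∀ t ∈ ts, t.All (· ∈ Sg)) →
      (H.node f ts).All (· ∈ Sg) := by
    intro f ts hl hts
    by_cases h1 : (f, ts.length) ∈ Sg
    · have : T f ts.length = some (f, List.replicate ts.length none) := by simp only [T, h1, if_true]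
      rw [Hom.ofPattern_some this, weave_replicate]
      grind
    · by_cases h0 : ts.length = 0
      · have : T f ts.length = some (c, []) := by  simp only [T, h0, if_true] at h1 ⊢; simp [h1]
        rw [Hom.ofPattern_some this, length_eq_zero_iff.1 h0]
        exact Tree.all_node.2 ⟨hc, by simp [weave]⟩
      · have : T f ts.length = some (g, List.replicate ts.length none ++
            List.replicate (k - ts.length) (some c)) := by simp only [T, h1, h0, if_false]
        rw [Hom.ofPattern_some this, Tree.all_node, weave_length]
        · refine ⟨?_, weave_all _ _ ?_ hts⟩
          · grind
          · grind
        · grind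
  have key : ∀ t : Term, t.Over Sg → H.tree (S.eval t) = (H.subst S).eval t := by
    intro t ht
    rw [H.tree_eval]
    refine H.eval_eq_of_trivial _ t ?_
    rintro ⟨f, m⟩ hp ts rfl
    have : T f ts.length = some (f, List.replicate ts.length none) := by
      simp only [T, Term.over_letters ht _ hp, if_true]
    rw [Hom.ofPattern_some this, weave_replicate]
  refine ⟨H.subst S, Subst.over_iff_all.2 (H.all_subst hall h.1), ?_⟩
  rw [← key u hu, ← key v hv]
  exact congrArg _ h.2

theorem Term.letters_load {rho : ℕ → ℕ → ℕ} {sig tau : ℕ → ℕ} {E : Finset ℕ} :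
    ∀ q ∈ (t.load rho sig tau E).letters, ∃ f, (f, q.2) ∈ t.letters ∧ q.1 = rho q.2 f := by
  induction t with
  | hv x => simp [load, letters]
  | hc X t ih =>
    intro q hq
    rw [load] at hq
    grind
  | hn f ts ih =>
    intro q hq
    rw [load] at hq
    grind
  | hp a l t ih =>
    intro q hq
    simp only [load, letters, mem_cons] at hq ⊢
    grind

/-- At a halt with answer YES the invariant itself provides a solution, which is then pulled back
step by step to the first configuration. -/
theorem isChain_sound : ∀ (r : List Config) (c : Config), r.head? = some c →
    r.IsChain (Step k) → c.Inv k → Returns r true → ∃ S, Solves k c.eqn S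
  | [], c, h, _, _, _ => by simp at h
  | [d], c, h, _, hi, hr => by
    obtain ⟨b, hb, hs⟩ := hr
    simp only [List.head?_cons, Option.some.injEq] at h
    subst h
    simp only [List.getLast?_singleton, Option.mem_def, Option.some.injEq] at hb
    subst hb
    have := hi.2
    rw [hs] at this
    exact this rfl
  | d :: d' :: r, c, h, hch, hi, hr => by
    simp only [List.head?_cons, Option.some.injEq] at h
    subst h
    rw [isChain_cons_cons] at hch
    have h1 := hch.1.sound hi
    refine h1.2 (isChain_sound (d' :: r) d' rfl hch.2 h1.1 ?_)
    simpa [Returns] using hr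

theorem run_sound {u v : Term} (hc : ∃ c, (c, 0) ∈ Sg) (hu : u.Over Sg) (hv : v.Over Sg)
    {r : List Config} (hr : IsRun Sg u v r) (ht : Returns r true) :
    Satisfiable Sg u v := by
  obtain ⟨⟨c, hc1, rho, sig, tau, E, hrho, -, -, rfl⟩, hch⟩ := hr
  have hmax : ∀ q ∈ Sg, q.2 ≤ maxArity Sg := fun q hq => Finset.le_sup (f := Prod.snd) hq
  have hinv : ∀ t : Term, t.Over Sg → ∀ q ∈ (t.load rho sig tau E).letters, q.2 ≤ maxArity Sg := by
    intro t ht q hq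
    obtain ⟨f, h1, _⟩ := letters_load t q hq
    exact hmax (f, q.2) (over_letters ht _ h1)
  have h0 : Config.Inv (maxArity Sg)
      ⟨false, .test, ⟨u.load rho sig tau E, v.load rho sig tau E⟩⟩ := by
    refine ⟨fun q hq => ?_, trivial⟩
    rcases Eqn.mem_letters.1 hq with hq | hq
    · grind
    · grind
  obtain ⟨S, hS⟩ := isChain_sound r _ hc1 hch h0 ht
  obtain ⟨T, hT, _⟩ := hS.of_load hrho
  exact hT.satisfiable hc hu hv

/-! ### Names -/

/-- Injectivity on the whole type is what `FreshNames` asks for, but smallness is needed only for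
the finitely many patterns `P` that really occur. -/
theorem exists_small_names {α : Type*} [Countable α] (P : Finset α) (B : Finset ℕ) :
    ∃ nu : α → ℕ, Injective nu ∧ (∀ a, nu a ∉ B) ∧ ∀ a ∈ P, nu a ≤ P.card + B.card := by
  classical
  obtain ⟨enc, henc⟩ := Countable.exists_injective_nat α
  -- The elements of `P` are numbered first and all others behind them; then the numbers outside `B`
  -- are used in increasing order.
  let idx : α → ℕ := fun a => if h : a ∈ P then (P.equivFin ⟨a, h⟩ : ℕ) else P.card + enc a
  have hidx : Injective idx := by
    intro a b hab
    simp only [idx] at hab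
    split_ifs at hab with h1 h2 h2
    · have := P.equivFin.injective (Fin.ext hab)
      grind
    · grind
    · grind
    · grind
  have hinf : {n | n ∉ B}.Infinite := B.finite_toSet.infinite_compl
  refine ⟨fun a => Nat.nth (· ∉ B) (idx a), (Nat.nth_injective hinf).comp hidx,
    fun a => Nat.nth_mem_of_infinite hinf _, fun a ha => ?_⟩
  have h1 : idx a < P.card := by grind
  have h2 : P.card ≤ Nat.count (· ∉ B) (P.card + B.card) := by
    rw [Nat.count_eq_card_filter_range]
    have h3 := Finset.card_filter_add_card_filter_not (s := Finset.range (P.card + B.card)) (· ∉ B)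
    have h4 : ((Finset.range (P.card + B.card)).filter (fun n => ¬ n ∉ B)).card ≤ B.card :=
      Finset.card_le_card fun n hn => by simpa using (Finset.mem_filter.1 hn).2
    grind
  exact (Nat.nth_lt_of_lt_count (h1.trans_le h2)).le

/-! ### Partitions -/

-- The greedy bound for the maximum cut: half of the edges can be cut.
open Classical in
theorem exists_cut (U : Finset ℕ) : ∀ L : List (ℕ × ℕ), (∀ p ∈ L, p.1 ≠ p.2 ∧ p.1 ∈ U ∧ p.2 ∈ U) →
    ∃ A ⊆ U, L.length ≤ 2 * L.countP fun p => decide (¬ (p.1 ∈ A ↔ p.2 ∈ A)) := by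
  induction U using Finset.induction_on with
  | empty =>
    intro L hL
    refine ⟨∅, subset_rfl, ?_⟩
    rcases L with _ | ⟨p, L⟩
    · simp
    · grind
  | insert c U hc ih =>
    intro L hL
    -- The edges at the new vertex `c` are set aside; the other ones are cut by induction.
    let Q : ℕ × ℕ → Bool := fun p => decide (p.1 = c ∨ p.2 = c)
    obtain ⟨A, hA, hcut⟩ := ih (L.filter fun p => !Q p) (by
      intro p hp
      obtain ⟨h1, h2⟩ := mem_filter.1 hp
      have h3 := hL p h1
      simp only [Q, Bool.not_eq_true', decide_eq_false_iff_not, not_or] at h2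
      exact ⟨h3.1, (Finset.mem_insert.1 h3.2.1).resolve_left h2.1,
        (Finset.mem_insert.1 h3.2.2).resolve_left h2.2⟩)
    have hcA : c ∉ A := fun h => hc (hA h)
    have hlen : L.length = (L.filter Q).length + (L.filter fun p => !Q p).length := by
      rw [← countP_eq_length_filter, ← countP_eq_length_filter]
      rw [length_eq_countP_add_countP Q]
      congr 1
      exact countP_congr fun p _ => by simp
    have hsplit : ∀ R : ℕ × ℕ → Bool, L.countP R =
        (L.filter Q).countP R + (L.filter fun p => !Q p).countP R := by
      intro R
      rw [countP_filter, countP_filter]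
      induction L with
      | nil => rfl
      | cons p L ihL =>
        clear hlen hcut ihL
        clear hL
        induction (p :: L) with
        | nil => rfl
        | cons q M ihM => grind
    have hsame : (L.filter fun p => !Q p).countP
        (fun p => decide (¬ (p.1 ∈ insert c A ↔ p.2 ∈ insert c A))) =
        (L.filter fun p => !Q p).countP (fun p => decide (¬ (p.1 ∈ A ↔ p.2 ∈ A))) := by
      refine countP_congr fun p hp => ?_
      grind
    -- An edge at `c` is no loop, so it is cut by exactly one of `A` and `insert c A`; the better of
    -- the two sides cuts half of these edges.
    have hflip : (L.filter Q).length = (L.filter Q).countP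
        (fun p => decide (¬ (p.1 ∈ insert c A ↔ p.2 ∈ insert c A))) +
        (L.filter Q).countP (fun p => decide (¬ (p.1 ∈ A ↔ p.2 ∈ A))) := by
      rw [length_eq_countP_add_countP (fun p => decide (¬ (p.1 ∈ insert c A ↔ p.2 ∈ insert c A)))]
      congr 1
      refine countP_congr fun p hp => ?_
      grind
    by_cases hle : (L.filter Q).length ≤
        2 * (L.filter Q).countP (fun p => decide (¬ (p.1 ∈ A ↔ p.2 ∈ A)))
    · refine ⟨A, hA.trans (Finset.subset_insert _ _), ?_⟩
      grind
    · refine ⟨insert c A, Finset.insert_subset_insert _ hA, ?_⟩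
      grind

/-- There is a partition that covers a quarter of the pairs. -/
theorem exists_partition (U : Finset ℕ) (L : List (ℕ × ℕ))
    (hL : ∀ p ∈ L, p.1 ≠ p.2 ∧ p.1 ∈ U ∧ p.2 ∈ U) :
    ∃ G1 G2 : Finset ℕ, Disjoint G1 G2 ∧ G1 ∪ G2 = U ∧
      L.length ≤ 4 * L.countP fun p => decide (p.1 ∈ G1 ∧ p.2 ∈ G2) := by
  classical
  obtain ⟨A, hA, hcut⟩ := exists_cut U L hL
  -- A cut pair goes in one of the two directions across the cut. Orienting the partition by the
  -- more frequent direction keeps half of the cut, a quarter of all pairs.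
  have hsum : L.countP (fun p => decide (¬ (p.1 ∈ A ↔ p.2 ∈ A))) ≤
      L.countP (fun p => decide (p.1 ∈ A ∧ p.2 ∈ U \ A)) +
      L.countP (fun p => decide (p.1 ∈ U \ A ∧ p.2 ∈ A)) := by
    clear hcut
    induction L with
    | nil => simp
    | cons p L ih =>
      have h1 := ih fun q hq => hL q (mem_cons_of_mem _ hq)
      grind
  by_cases h : L.countP (fun p => decide (p.1 ∈ U \ A ∧ p.2 ∈ A)) ≤
      L.countP (fun p => decide (p.1 ∈ A ∧ p.2 ∈ U \ A))
  · exact ⟨A, U \ A, Finset.disjoint_sdiff, Finset.union_sdiff_of_subset hA, by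
      convert (by omega : L.length ≤ 4 * L.countP (fun p => decide (p.1 ∈ A ∧ p.2 ∈ U \ A))) using 4⟩
  · exact ⟨U \ A, A, Finset.sdiff_disjoint, Finset.sdiff_union_of_subset hA, by
      convert (by omega : L.length ≤ 4 * L.countP (fun p => decide (p.1 ∈ U \ A ∧ p.2 ∈ A))) using 4⟩

/-! ### Small solutions of linear equations -/

/-- A version of Siegel's lemma: if a system of linear equations has a nonzero solution then
it has one inside a sufficiently large box. -/
theorem exists_small_kernel {ι κ : Type*} [Fintype ι] [Finite κ] (a : κ → ι → ℤ)
    (x : ι → ℤ) (hx : x ≠ 0) (hax : ∀ i, ∑ j, a i j * x j = 0) (h : ι → ℕ)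
    (hbox : ∀ R : Finset κ, R.card < Fintype.card ι →
      ∏ i ∈ R, (∑ j, (a i j).natAbs * h j + 1) < ∏ j, (h j + 1)) :
    ∃ y : ι → ℤ, y ≠ 0 ∧ (∀ j, (y j).natAbs ≤ h j) ∧ ∀ i, ∑ j, a i j * y j = 0 := by
  classical
  let v : κ → ι → ℚ := fun i j => a i j
  -- Only a maximal independent set of rows matters; there are fewer of them than unknowns because
  -- `x` is a nonzero kernel vector.
  obtain ⟨κ', g, hg, hspan, hind⟩ := exists_linearIndependent' ℚ v
  have : Finite κ' := Finite.of_injective g hg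
  have := Fintype.ofFinite κ'
  have hcard : Fintype.card κ' < Fintype.card ι := by
    have h1 := hind.fintype_card_le_finrank
    rw [Module.finrank_fintype_fun_eq_card] at h1
    refine lt_of_le_of_ne h1 fun h2 => hx ?_
    have h3 : Submodule.span ℚ (Set.range (v ∘ g)) = ⊤ :=
      hind.span_eq_top_of_card_eq_finrank' (by rw [Module.finrank_fintype_fun_eq_card, h2])
    have h4 : ∀ w ∈ Submodule.span ℚ (Set.range (v ∘ g)), ∑ j, w j * (x j : ℚ) = 0 := by
      intro w hw
      induction hw using Submodule.span_induction with
      | mem w hw =>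
        obtain ⟨i, rfl⟩ := hw
        have := hax (g i)
        simp only [v, Function.comp]
        exact_mod_cast this
      | zero => simp
      | add w w' _ _ hw hw' => simp [add_mul, Finset.sum_add_distrib, hw, hw']
      | smul c w _ hw => simp [mul_assoc, ← Finset.mul_sum, hw]
    funext j
    have := h4 (Pi.single j 1) (by rw [h3]; trivial)
    simp only [Pi.single_apply, ite_mul, one_mul, zero_mul, Finset.sum_ite_eq', Finset.mem_univ,
      if_true] at this
    exact_mod_cast this
  let R : Finset κ := Finset.univ.image g
  have hR : R.card < Fintype.card ι := by grind
  let dom : Finset (ι → ℤ) := Fintype.piFinset fun j => Finset.Icc (0 : ℤ) (h j)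
  -- The summand with `max` shifts each linear form so that on the box it takes values between 0 and
  -- the sum of `|a| * h`.
  let f : (ι → ℤ) → κ' → ℤ := fun y i => ∑ j, (a (g i) j * y j + max (-a (g i) j) 0 * h j)
  let cod : Finset (κ' → ℤ) := Fintype.piFinset fun i =>
    Finset.Icc (0 : ℤ) ((∑ j, (a (g i) j).natAbs * h j : ℕ))
  have hmaps : ∀ y ∈ dom, f y ∈ cod := by
    intro y hy
    rw [Fintype.mem_piFinset] at hy ⊢
    intro i
    have hterm : ∀ j, 0 ≤ a (g i) j * y j + max (-a (g i) j) 0 * h j ∧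
        a (g i) j * y j + max (-a (g i) j) 0 * h j ≤ (((a (g i) j).natAbs * h j : ℕ) : ℤ) := by
      intro j
      obtain ⟨h1, h2⟩ := Finset.mem_Icc.1 (hy j)
      push_cast
      rcases le_total 0 (a (g i) j) with h3 | h3
      · rw [max_eq_right (by linarith), abs_of_nonneg h3]
        constructor
        · nlinarith
        · nlinarith
      · rw [max_eq_left (by linarith), abs_of_nonpos h3]
        constructor
        · nlinarith
        · nlinarith
    rw [Finset.mem_Icc]
    refine ⟨Finset.sum_nonneg fun j _ => (hterm j).1, ?_⟩
    rw [Nat.cast_sum]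
    exact Finset.sum_le_sum fun j _ => (hterm j).2
  have hlt : cod.card < dom.card := by
    have h1 := hbox R hR
    rw [Finset.prod_image (fun _ _ _ _ h => hg h)] at h1
    simp only [cod, dom, Fintype.card_piFinset, Int.card_Icc]
    grind
  -- Pigeonhole: two points of the box have the same image, and their difference is the required
  -- vector.
  obtain ⟨y, hy, y', hy', hne, heq⟩ := Finset.exists_ne_map_eq_of_card_lt_of_maps_to hlt hmaps
  refine ⟨y - y', sub_ne_zero.2 hne, ?_, ?_⟩
  · intro j
    have h1 := Finset.mem_Icc.1 (Fintype.mem_piFinset.1 hy j)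
    have h2 := Finset.mem_Icc.1 (Fintype.mem_piFinset.1 hy' j)
    simp only [Pi.sub_apply]
    omega
  · have h1 : ∀ i, ∑ j, a (g i) j * (y - y') j = 0 := by
      intro i
      have := congrFun heq i
      simp only [f, Finset.sum_add_distrib] at this
      simp only [Pi.sub_apply, mul_sub, Finset.sum_sub_distrib]
      linarith
    -- The difference is annihilated by the chosen rows and therefore by their span, which contains
    -- all rows.
    have h2 : ∀ w ∈ Submodule.span ℚ (Set.range (v ∘ g)), ∑ j, w j * (((y - y') j : ℤ) : ℚ) = 0 := by
      intro w hw
      induction hw using Submodule.span_induction with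
      | mem w hw =>
        obtain ⟨i, rfl⟩ := hw
        have := h1 i
        simp only [v, Function.comp]
        exact_mod_cast this
      | zero => simp
      | add w w' _ _ hw hw' => simp only [Pi.add_apply, add_mul, Finset.sum_add_distrib, hw, hw', add_zero]
      | smul c w _ hw => simp only [Pi.smul_apply, smul_eq_mul, mul_assoc, ← Finset.mul_sum, hw, mul_zero]
    intro i
    have := h2 (v i) (by rw [hspan]; exact Submodule.subset_span ⟨i, rfl⟩)
    simp only [v] at this
    exact_mod_cast this

theorem mul_add_one_le_four_pow (r H : ℕ) : r * H + 1 ≤ 4 ^ r * (H + 1) := by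
  have h1 : r + 1 ≤ 4 ^ r := by
    have := Nat.lt_pow_self (n := r) (a := 4) (by norm_num); omega
  nlinarith

/-- Counts the values in the pigeonhole argument: the row norms cost one factor `4 ^ ∑ r`, no matter
how large the box is. -/
theorem prod_box_le {κ : Type*} [Fintype κ] (R : Finset κ) (b r : κ → ℕ) (H : ℕ)
    (hb : ∀ i, b i ≤ r i * H) : ∏ i ∈ R, (b i + 1) ≤ 4 ^ (∑ i, r i) * (H + 1) ^ R.card := by
  calc ∏ i ∈ R, (b i + 1) ≤ ∏ i ∈ R, (4 ^ r i * (H + 1)) :=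
        Finset.prod_le_prod' fun i _ => (Nat.add_le_add_right (hb i) 1).trans
          (mul_add_one_le_four_pow _ _)
    _ = 4 ^ (∑ i ∈ R, r i) * (H + 1) ^ R.card := by
        rw [Finset.prod_mul_distrib, Finset.prod_pow_eq_pow_sum, Finset.prod_const]
    _ ≤ 4 ^ (∑ i, r i) * (H + 1) ^ R.card := by
        refine Nat.mul_le_mul_right _ (Nat.pow_le_pow_right (by norm_num) ?_)
        exact Finset.sum_le_sum_of_subset (Finset.subset_univ _)

/-- A nonempty set of positive solutions of a homogeneous system of linear equations that is closed
under small changes contains a solution that is at most exponential. -/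
theorem exists_small_solution {d : ℕ} {κ : Type*} [Fintype κ] (a : κ → Fin d → ℤ)
    (M : (Fin d → ℕ) → Prop) (hM : ∃ z, M z) (hker : ∀ z, M z → ∀ i, ∑ j, a i j * (z j : ℤ) = 0)
    (hclosed : ∀ z, M z → ∀ y : Fin d → ℤ, (∀ i, ∑ j, a i j * y j = 0) →
      (∀ j, y j = 0 ∨ 1 < z j ∧ (y j).natAbs < z j) → M fun j => (z j + y j).toNat) :
    ∃ z, M z ∧ ∀ j, z j ≤ 2 ^ (4 * ∑ i, ∑ j, (a i j).natAbs) := by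
  classical
  set r : κ → ℕ := fun i => ∑ j, (a i j).natAbs with hr
  set D := 4 ^ (∑ i, r i) with hD
  have hD1 : 1 ≤ D := Nat.one_le_pow _ _ (by norm_num)
  -- The lexicographically least element of `M` turns out to be small.
  obtain ⟨z, hz, hmin⟩ := WellFounded.has_min (r := fun x y : Fin d → ℕ => toLex x < toLex y)
    (InvImage.wf toLex (wellFounded_lt (α := Lex (Fin d → ℕ)))) {z | M z} hM
  refine ⟨z, hz, ?_⟩
  -- The large coordinates; a shift by at most `D` is admissible exactly there without further
  -- inspection.
  let L := {j : Fin d // D < z j}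
  have hcoef : ∀ i, ∑ j : L, (a i j).natAbs ≤ r i := by
    intro i
    have : ∑ j : L, (a i j).natAbs = ∑ j ∈ Finset.univ.filter (fun j => D < z j), (a i j).natAbs :=
      (Finset.sum_subtype _ (by simp) (fun j => (a i j).natAbs)).symm
    rw [this]
    exact Finset.sum_le_sum_of_subset (Finset.filter_subset _ _)
  -- On the large coordinates the system has no nonzero solution: otherwise it has one with entries
  -- at most `D`, by `D * (D + 1) ^ r < (D + 1) ^ (r + 1)`, and shifting by it or by its negative
  -- contradicts the choice of `z`.
  have hinj : ∀ y : L → ℤ, (∀ i, ∑ j : L, a i j * y j = 0) → y = 0 := by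
    intro y hy
    by_contra hne
    obtain ⟨y, hne, hyD, hy⟩ := exists_small_kernel (fun i (j : L) => a i j) y hne hy (fun _ => D)
      (by
        intro R hR
        refine (prod_box_le R _ r D fun i => ?_).trans_lt ?_
        · rw [← Finset.sum_mul]; exact Nat.mul_le_mul_right _ (hcoef i)
        · rw [Finset.prod_const, Finset.card_univ, ← hD]
          calc D * (D + 1) ^ R.card < (D + 1) * (D + 1) ^ R.card :=
                Nat.mul_lt_mul_of_pos_right (Nat.lt_succ_self _) (by positivity)
            _ = (D + 1) ^ (R.card + 1) := by rw [pow_succ, mul_comm]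
            _ ≤ _ := Nat.pow_le_pow_right (by omega) hR)
    let Y : Fin d → ℤ := fun j => if h : D < z j then y ⟨j, h⟩ else 0
    have hYsum : ∀ i, ∑ j, a i j * Y j = 0 := by
      intro i
      have h1 : ∑ j : L, a i j * y j = ∑ j ∈ Finset.univ.filter (fun j => D < z j), a i j * Y j := by
        rw [Finset.sum_subtype (p := fun j => D < z j) _ (by simp) _]
        refine Finset.sum_congr rfl fun j _ => ?_
        grind
      rw [← hy i, h1]
      refine (Finset.sum_subset (Finset.filter_subset _ _) fun j _ hj => ?_).symm
      grind
    have hYb : ∀ j, Y j = 0 ∨ 1 < z j ∧ (Y j).natAbs < z j := by grind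
    have hYne : ∃ j, Y j ≠ 0 := by
      obtain ⟨j, hj⟩ := Function.ne_iff.1 hne
      exact ⟨j.1, by simp only [Y, dif_pos j.2]; exact hj⟩
    let S : Finset (Fin d) := Finset.univ.filter fun j => Y j ≠ 0
    have hS : S.Nonempty := by obtain ⟨j, hj⟩ := hYne; exact ⟨j, by simpa [S] using hj⟩
    have hm := S.min'_mem hS
    set m := S.min' hS
    have hm0 : Y m ≠ 0 := by simpa [S] using hm
    have hlt0 : ∀ j < m, Y j = 0 := by
      intro j hj
      by_contra h
      exact absurd (S.min'_le j (by simpa [S] using h)) (not_le.2 hj)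
    -- A kernel vector whose first nonzero entry is negative leads to a lexicographically smaller
    -- element of `M`. One of `Y` and `-Y` has this form.
    have hcontra : ∀ W : Fin d → ℤ, (∀ i, ∑ j, a i j * W j = 0) →
        (∀ j, W j = 0 ∨ 1 < z j ∧ (W j).natAbs < z j) → (∀ j < m, W j = 0) → W m < 0 → False := by
      intro W h1 h2 h3 h4
      refine hmin _ (hclosed z hz W h1 h2) ?_
      refine ⟨m, fun j hj => ?_, ?_⟩
      · simp [h3 j hj]
      · have := h2 m
        simp only [Pi.toLex_apply]
        omega
    rcases lt_or_gt_of_ne hm0 with h | h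
    · exact hcontra Y hYsum hYb hlt0 h
    · refine hcontra (fun j => -Y j) (fun i => by simp [hYsum i]) (fun j => by simpa using hYb j)
        (fun j hj => by simp [hlt0 j hj]) (by simpa using h)
  -- The small coordinates are collected into one extra column, so that `(1, z)` with `z` restricted
  -- to the large coordinates is a kernel vector of the augmented system.
  let c : κ → ℤ := fun i => ∑ j ∈ Finset.univ.filter (fun j => ¬ D < z j), a i j * (z j : ℤ)
  have hzc : ∀ i, ∑ j : L, a i j * (z j : ℤ) + c i = 0 := by
    intro i
    rw [← hker z hz i, ← Finset.sum_filter_add_sum_filter_not Finset.univ (fun j => D < z j)]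
    congr 1
    exact (Finset.sum_subtype _ (by simp) (fun j => a i j * (z j : ℤ))).symm
  have hc : ∀ i, (c i).natAbs ≤
      (∑ j ∈ Finset.univ.filter (fun j => ¬ D < z j), (a i j).natAbs) * D := by
    intro i
    refine (Int.natAbs_sum_le _ _).trans ?_
    rw [Finset.sum_mul]
    refine Finset.sum_le_sum fun j hj => ?_
    rw [Int.natAbs_mul, Int.natAbs_natCast]
    exact Nat.mul_le_mul_left _ (by simpa using hj)
  -- The extra column has entries up to `D` times a row norm. A box of side `D` in its direction and
  -- `D * D` in the others makes both contributions comparable.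
  let H := D * D
  obtain ⟨y, hne, hyb, hy⟩ := exists_small_kernel
    (fun i (j : Option L) => j.elim (c i) fun j => a i j)
    (fun j => j.elim 1 fun j => (z j : ℤ)) (by intro h; have := congrFun h none; simp at this)
    (by
      intro i
      rw [Fintype.sum_option]
      simp only [Option.elim]
      rw [← hzc i]; ring) (fun j => j.elim D fun _ => H)
    (by
      intro R hR
      refine (prod_box_le R _ r H fun i => ?_).trans_lt ?_
      · rw [Fintype.sum_option]
        simp only [Option.elim]
        rw [← Finset.sum_mul]
        have h1 : ∑ j : L, (a i j).natAbs +
            ∑ j ∈ Finset.univ.filter (fun j => ¬ D < z j), (a i j).natAbs = r i := by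
          rw [hr]
          simp only
          rw [← Finset.sum_filter_add_sum_filter_not Finset.univ (fun j => D < z j)]
          congr 1
          exact (Finset.sum_subtype _ (by simp) (fun j => (a i j).natAbs)).symm
        have h2 := Nat.mul_le_mul_right D (hc i)
        rw [← h1, add_mul, mul_assoc] at *
        grind
      · rw [Fintype.prod_option]
        simp only [Option.elim]
        rw [Finset.prod_const, Finset.card_univ, ← hD]
        rw [Fintype.card_option] at hR
        calc D * (H + 1) ^ R.card < (D + 1) * (H + 1) ^ R.card :=
              Nat.mul_lt_mul_of_pos_right (Nat.lt_succ_self _) (by positivity)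
          _ ≤ _ := Nat.mul_le_mul_left _ (Nat.pow_le_pow_right (by omega) (by omega)))
  -- By `hinj` the small kernel vector is a multiple of `(1, z)`. The factor is a nonzero integer,
  -- so each `z j` is at most the side `D * D` of the box.
  have hyt : ∀ j : L, y (some j) = y none * z j := by
    have := hinj (fun j => y (some j) - y none * z j) (by
      intro i
      have h1 := hy i
      rw [Fintype.sum_option] at h1
      simp only [Option.elim] at h1
      have h2 := hzc i
      have h3 : ∑ j : L, a i j * (y (some j) - y none * z j) =
          ∑ j : L, a i j * y (some j) - y none * ∑ j : L, a i j * (z j : ℤ) := by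
        rw [Finset.mul_sum, ← Finset.sum_sub_distrib]
        grind
      rw [h3]
      have h4 : ∑ j : L, a i j * (z j : ℤ) = - c i := by linarith
      rw [h4]
      linarith)
    intro j
    have := congrFun this j
    simp only [Pi.zero_apply] at this
    linarith
  have ht : y none ≠ 0 := by
    intro h
    apply hne
    funext j
    rcases j with _ | j
    · exact h
    · simp [hyt j, h]
  have hfin : D * D = 2 ^ (4 * ∑ i, r i) := by
    rw [hD, ← pow_add, show (4 : ℕ) = 2 ^ 2 by norm_num, ← pow_mul]
    grind
  intro j
  rw [← hfin]
  by_cases h : D < z j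
  · have h1 := hyb (some ⟨j, h⟩)
    rw [hyt] at h1
    simp only [Option.elim, Int.natAbs_mul, Int.natAbs_natCast] at h1
    have h2 : 1 ≤ (y none).natAbs := Int.natAbs_pos.2 ht
    exact (Nat.le_mul_of_pos_left _ h2).trans h1
  · nlinarith
/-! ### Counting symbols -/

namespace Term

/-- The exponents of the compressed chains. -/
@[grind =] def exps : Term → List ℕ
  | .var _ => []
  | .cvar _ t => t.exps
  | .node _ ts => (ts.map exps).flatten
  | .pow _ l t => l :: t.exps

/-- The number of constants. -/
def numConsts (t : Term) : ℕ := t.letters.countP fun q => q.2 == 0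

/-- The number of unary letters. -/
def numUnary (t : Term) : ℕ := t.letters.countP fun q => q.2 == 1

/-- The number of letters of arity at least two. -/
def numBranch (t : Term) : ℕ := t.letters.countP fun q => decide (2 ≤ q.2)

@[grind =] def rootUnary : Term → Option ℕ
  | .node a [_] => some a
  | _ => none

/-- The pairs of unary letters of which the second one is the child of the first one. -/
@[grind =] def unaryPairs : Term → List (ℕ × ℕ)
  | .var _ => []
  | .cvar _ t => t.unaryPairs
  | .node f ts => (if ts.length = 1 then (ts.filterMap rootUnary).map fun b => (f, b) else []) ++
      (ts.map unaryPairs).flatten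
  | .pow _ _ t => t.unaryPairs

theorem rootUnary_one (a : ℕ) (t : Term) : (Term.node a [t]).rootUnary = some a := rfl

theorem rootUnary_ne (ts : List Term) (h : ts.length ≠ 1) : (Term.node f ts).rootUnary = none := by
  rcases ts with _ | ⟨t, _ | ⟨s, ts⟩⟩
  · rfl
  · simp at h
  · rfl

theorem rootUnary_eq_some {t : Term} {a : ℕ} : t.rootUnary = some a ↔ ∃ s, t = .node a [s] := by
  rcases t with x | ⟨X, s⟩ | ⟨b, _ | ⟨s, _ | ⟨s', ts⟩⟩⟩ | ⟨b, l, s⟩ <;> simp [rootUnary]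

theorem unaryPairs_one : (Term.node f [t]).unaryPairs =
    t.rootUnary.elim [] (fun b => [(f, b)]) ++ t.unaryPairs := by
  grind

theorem unaryPairs_ne (ts : List Term) (h : ts.length ≠ 1) :
    (Term.node f ts).unaryPairs = (ts.map unaryPairs).flatten := by
  grind

theorem numConsts_node (ts : List Term) : (Term.node f ts).numConsts =
    (ts.map numConsts).sum + if ts.length = 0 then 1 else 0 := by
  simp only [numConsts, letters_node, countP_cons, countP_flatten, map_map,
    Function.comp_def, beq_iff_eq]
  rfl

theorem numUnary_node (ts : List Term) : (Term.node f ts).numUnary =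
    (ts.map numUnary).sum + if ts.length = 1 then 1 else 0 := by
  simp only [numUnary, letters_node, countP_cons, countP_flatten, map_map,
    Function.comp_def, beq_iff_eq]
  rfl

theorem numBranch_node (ts : List Term) : (Term.node f ts).numBranch =
    (ts.map numBranch).sum + if 2 ≤ ts.length then 1 else 0 := by
  simp only [numBranch, letters_node, countP_cons, countP_flatten, map_map,
    Function.comp_def, decide_eq_true_eq]
  rfl

theorem vars_length_node (ts : List Term) : (Term.node f ts).vars.length =
    (ts.map fun t => t.vars.length).sum := by
  simp [vars, length_flatten, Function.comp_def]

theorem cvars_length_node (ts : List Term) : (Term.node f ts).cvars.length =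
    (ts.map fun t => t.cvars.length).sum := by
  simp [cvars, length_flatten, Function.comp_def]

theorem letters_length_node (ts : List Term) : (Term.node f ts).letters.length =
    (ts.map fun t => t.letters.length).sum + 1 := by
  simp [letters_node, length_flatten, Function.comp_def]

theorem size_eq : t.size = t.letters.length + t.vars.length + t.cvars.length := by
  induction t with
  | hv x => grind
  | hc X t ih => grind
  | hn f ts ih =>
    rw [size, map_congr_left ih, letters_length_node, vars_length_node, cvars_length_node,
      sum_map_add, sum_map_add]
    omega
  | hp a l t ih => grind

theorem letters_length_eq : t.letters.length = t.numConsts + t.numUnary + t.numBranch := by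
  unfold numConsts numUnary numBranch
  induction t.letters with
  | nil => rfl
  | cons q l ih => grind

/-- A tree has more leaves than branching nodes, and the leaves are the constants and the variables.
-/
theorem numBranch_lt : t.numBranch + 1 ≤ t.numConsts + t.vars.length := by
  induction t with
  | hv x => simp [numBranch, numConsts, letters, vars]
  | hc X t ih => simpa [numBranch, numConsts, letters, vars] using ih
  | hn f ts ih =>
    rw [numBranch_node, numConsts_node, vars_length_node]
    have h : (ts.map fun t => t.numBranch + 1).sum ≤
        (ts.map fun t => t.numConsts + t.vars.length).sum := sum_le_sum ih
    rw [sum_map_add, sum_map_add] at h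
    simp only [map_const', sum_replicate, smul_eq_mul, mul_one] at h
    grind
  | hp a l t ih => simpa [numBranch, numConsts, letters, vars] using ih

/-- A unary letter whose child is not a unary letter is charged to that child. The extra summand on
the left is available because the root is nobody's child. -/
theorem numUnary_le (ht : t.exps = []) : t.numUnary + (if t.rootUnary = none then 1 else 0) ≤
    t.unaryPairs.length + (t.numConsts + t.numBranch + t.vars.length + t.cvars.length) := by
  induction t with
  | hv x => simp [numUnary, numBranch, numConsts, letters, vars, cvars, rootUnary]
  | hc X t ih =>
    have := ih (by simpa [exps] using ht)
    simp only [numUnary, numBranch, numConsts, letters, vars, cvars, rootUnary, unaryPairs,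
      length_cons] at this ⊢
    grind
  | hn f ts ih =>
    have ht' : ∀ t ∈ ts, t.exps = [] := by simpa [exps] using ht
    rcases length_one_cases ts with ⟨t, rfl⟩ | h1
    · have := ih t (by simp) (ht' t (by simp))
      rw [numUnary_node, numConsts_node, numBranch_node, vars_length_node, cvars_length_node,
        unaryPairs_one, rootUnary_one]
      rcases h : t.rootUnary <;> simp [h] at this ⊢ <;> omega
    · have h : (ts.map numUnary).sum ≤ (ts.map fun t => t.unaryPairs.length +
          (t.numConsts + t.numBranch + t.vars.length + t.cvars.length)).sum :=
        sum_le_sum fun t hm => by have := ih t hm (ht' t hm); omega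
      rw [numUnary_node, numConsts_node, numBranch_node, vars_length_node, cvars_length_node,
        unaryPairs_ne f ts h1, rootUnary_ne f ts h1]
      simp only [sum_map_add] at h
      simp only [length_flatten, map_map, Function.comp_def, h1, if_true, if_false]
      have h2 : (if ts.length = 0 then 1 else 0) + (if 2 ≤ ts.length then 1 else 0) = 1 := by grind
      omega
  | hp a l t ih => grind

/-! ### Counting under compression -/

/-! ### Pair compression: sizes and symbols -/

section Pair

variable {nu : ℕ → ℕ → ℕ} {G1 G2 : Finset ℕ}

/-- A letter of `G2` at the root cannot start a pair, because it is not in `G1`; and no new letter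
lies in `G2`. -/
theorem rootUnary_pairComp (hd : Disjoint G1 G2) (hnu : ∀ a b, nu a b ∉ G1 ∪ G2) (t : Term) (b : ℕ)
    (hb : b ∈ G2) : (t.pairComp nu G1 G2).rootUnary = some b ↔ t.rootUnary = some b := by
  rcases t with x | ⟨X, s⟩ | ⟨f, ts⟩ | ⟨f, l, s⟩
  · grind
  · grind
  · rcases length_one_cases ts with ⟨t, rfl⟩ | h1
    · rw [pairComp_one, rootUnary_one]
      rcases consPair_cases nu G1 G2 f (t.pairComp nu G1 G2) with
        ⟨c, r, h1, ha, hc, h2⟩ | ⟨_, h2⟩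
      · rw [h2, rootUnary_one]
        simp only [Option.some.injEq]
        constructor
        · grind
        · intro h; exact absurd hb (Finset.disjoint_left.1 hd (h ▸ ha))
      · grind
    · rw [pairComp_ne f ts h1, rootUnary_ne f _ (by simpa using h1), rootUnary_ne f ts h1]
  · grind

/-- Each covered pair loses one symbol. Covered pairs do not overlap, because `G1` and `G2` are
disjoint and the new names belong to neither. -/
theorem size_pairComp (hd : Disjoint G1 G2) (hnu : ∀ a b, nu a b ∉ G1 ∪ G2) (t : Term) :
    (t.pairComp nu G1 G2).size +
      t.unaryPairs.countP (fun p => decide (p.1 ∈ G1 ∧ p.2 ∈ G2)) = t.size := by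
  induction t with
  | hv x => grind
  | hc X t ih => grind
  | hn f ts ih =>
    rcases length_one_cases ts with ⟨t, rfl⟩ | h1
    · have := ih t (by simp)
      rw [pairComp_one, unaryPairs_one, countP_append]
      rcases consPair_cases nu G1 G2 f (t.pairComp nu G1 G2) with
        ⟨c, r, h1, ha, hc, h2⟩ | ⟨h3, h2⟩
      · have hr := (rootUnary_pairComp hd hnu t c hc).1 (by rw [h1, rootUnary_one])
        grind
      · rw [h2]
        have h0 : (t.rootUnary.elim [] (fun b => [(f, b)])).countP
            (fun p => decide (p.1 ∈ G1 ∧ p.2 ∈ G2)) = 0 := by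
          rcases h : t.rootUnary with _ | b
          · rfl
          · by_cases hb : b ∈ G2
            · obtain ⟨s, hs⟩ := rootUnary_eq_some.1 ((rootUnary_pairComp hd hnu t b hb).2 h)
              grind
            · simp [hb]
        grind
    · rw [pairComp_ne f ts h1, unaryPairs_ne f ts h1, size, size, countP_flatten, map_map,
        map_map, ← map_congr_left ih, sum_map_add]
      simp only [Function.comp_def]
      omega
  | hp a l t ih => grind

theorem numConsts_pairComp : (t.pairComp nu G1 G2).numConsts = t.numConsts := by
  induction t with
  | hv x => grind
  | hc X t ih => simpa [pairComp, numConsts, letters] using ih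
  | hn f ts ih =>
    rcases length_one_cases ts with ⟨t, rfl⟩ | h1
    · have := ih t (by simp)
      rw [pairComp_one]
      rcases consPair_cases nu G1 G2 f (t.pairComp nu G1 G2) with
        ⟨c, r, h1, ha, hc, h2⟩ | ⟨h3, h2⟩
      · rw [h2, numConsts_node, numConsts_node]
        rw [h1, numConsts_node] at this
        grind
      · rw [h2, numConsts_node, numConsts_node]
        grind
    · rw [pairComp_ne f ts h1, numConsts_node, numConsts_node, map_map, length_map,
        ← map_congr_left ih]
      rfl
  | hp a l t ih => simpa [pairComp, numConsts, letters] using ih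

theorem vars_pairComp : (t.pairComp nu G1 G2).vars = t.vars ∧
    (t.pairComp nu G1 G2).cvars = t.cvars ∧ (t.pairComp nu G1 G2).exps = t.exps := by
  induction t with
  | hv x => grind
  | hc X t ih => grind
  | hn f ts ih =>
    rcases length_one_cases ts with ⟨t, rfl⟩ | h1
    · have := ih t (by simp)
      rw [pairComp_one]
      rcases consPair_cases nu G1 G2 f (t.pairComp nu G1 G2) with
        ⟨c, r, h1, ha, hc, h2⟩ | ⟨h3, h2⟩
      · grind
      · grind
    · rw [pairComp_ne f ts h1]
      simp only [vars, cvars, exps, map_map]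
      refine ⟨congrArg _ (map_congr_left fun t ht => (ih t ht).1),
        congrArg _ (map_congr_left fun t ht => (ih t ht).2.1),
        congrArg _ (map_congr_left fun t ht => (ih t ht).2.2)⟩
  | hp a l t ih => grind

/-- The new letters of pair compression come from consecutive letters. -/
theorem mem_letters_pairComp_pairs (hd : Disjoint G1 G2) (hnu : ∀ a b, nu a b ∉ G1 ∪ G2) (t : Term)
    :
    ∀ q ∈ (t.pairComp nu G1 G2).letters, q ∈ t.letters ∨
      ∃ p ∈ t.unaryPairs, q = (nu p.1 p.2, 1) := by
  induction t with
  | hv x => grind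
  | hc X t ih => grind
  | hn f ts ih =>
    intro q hq
    simp only [mem_letters_node]
    rcases length_one_cases ts with ⟨t, rfl⟩ | h1
    · rw [pairComp_one] at hq
      rw [unaryPairs_one]
      have key : ∀ q ∈ (t.pairComp nu G1 G2).letters, (q = (f, [t].length) ∨ ∃ s ∈ [t], q ∈ s.letters) ∨
          ∃ p ∈ t.rootUnary.elim [] (fun b => [(f, b)]) ++ t.unaryPairs, q = (nu p.1 p.2, 1) :=
        fun q hq => (ih t (by simp) q hq).imp (fun h => Or.inr ⟨t, by simp, h⟩)
          fun ⟨p, h1, h2⟩ => ⟨p, mem_append_right _ h1, h2⟩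
      rcases consPair_cases nu G1 G2 f (t.pairComp nu G1 G2) with
        ⟨b, r, h1, ha, hb, h2⟩ | ⟨_, h2⟩
      · rw [h2, mem_letters_node] at hq
        have hr := (rootUnary_pairComp hd hnu t b hb).1 (by rw [h1, rootUnary_one])
        rcases hq with rfl | ⟨_, hr', hq⟩
        · exact Or.inr ⟨(f, b), by simp [hr], rfl⟩
        · refine key q ?_
          grind
      · rw [h2, mem_letters_node] at hq
        grind
    · rw [unaryPairs_ne f ts h1]
      rw [pairComp_ne f ts h1, mem_letters_node] at hq
      rcases hq with rfl | ⟨_, hr, hq⟩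
      · grind
      · obtain ⟨t, ht, rfl⟩ := mem_map.1 hr
        refine (ih t ht q hq).imp (fun h => Or.inr ⟨t, ht, h⟩) fun ⟨p, h1, h2⟩ => ⟨p, ?_, h2⟩
        grind
  | hp a l t ih =>
    grind

end Pair

theorem unaryPairs_length_le : t.unaryPairs.length ≤ t.numUnary := by
  induction t with
  | hv x => grind
  | hc X t ih => simpa [unaryPairs, numUnary, letters] using ih
  | hn f ts ih =>
    rw [numUnary_node]
    rcases length_one_cases ts with ⟨t, rfl⟩ | h1
    · grind
    · rw [unaryPairs_ne f ts h1, length_flatten, map_map]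
      have := sum_le_sum ih
      simp only [Function.comp_def]
      omega
  | hp a l t ih =>
    have : (Term.pow a l t).numUnary = t.numUnary + 1 := by simp [numUnary, letters]
    grind

/-! ### Leaf compression: sizes and symbols -/

section Leaf

variable {nu : ℕ → List (Option ℕ) → ℕ} {G : Finset (ℕ × ℕ)} {G0 : Finset ℕ}

-- Every constant is absorbed by its father, unless it is the argument of a context variable or the
-- whole term; the last two summands pay for these cases.
open Classical in
theorem size_leafComp (t : Term) (ht : t.exps = [])
    (hG : ∀ f m, (f, m) ∈ t.letters → m ≠ 0 → (f, m) ∈ G)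
    (hG0 : ∀ c, (c, 0) ∈ t.letters → c ∈ G0) :
    (t.leafComp nu G G0).size + t.numConsts ≤
      t.size + t.cvars.length + if ∃ c, t = .node c [] then 1 else 0 := by
  induction t with
  | hv x => simp [leafComp, numConsts, letters, size]
  | hc X t ih =>
    have := ih (by simpa [exps] using ht) (by simpa only [letters] using hG)
      (by simpa only [letters] using hG0)
    simp only [leafComp, size, numConsts, letters, cvars, length_cons] at this ⊢
    split_ifs at this ⊢ <;> omega
  | hn f ts ih =>
    have ht' : ∀ t ∈ ts, t.exps = [] := by simpa [exps] using ht
    simp only [mem_letters_node] at hG hG0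
    have hG' : ∀ t ∈ ts, ∀ f m, (f, m) ∈ t.letters → m ≠ 0 → (f, m) ∈ G :=
      fun t ht f m hf => hG f m (Or.inr ⟨t, ht, hf⟩)
    have hG0' : ∀ t ∈ ts, ∀ c, (c, 0) ∈ t.letters → c ∈ G0 :=
      fun t ht c hc => hG0 c (Or.inr ⟨t, ht, hc⟩)
    rcases ts with _ | ⟨t0, ts0⟩
    · rw [leafComp_keep _ _ (by simp)]
      simp [size, numConsts_node, cvars]
    · set ts := t0 :: ts0 with hts
      have hne : ts.length ≠ 0 := by simp [hts]
      have hf : (f, ts.length) ∈ G := hG f _ (Or.inl rfl) hne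
      have hic : (if ∃ c, Term.node f ts = .node c [] then 1 else 0) = 0 := by simp [hts]
      rw [hic, numConsts_node, if_neg hne, cvars_length_node, size]
      have key : ∀ t ∈ ts, (if (t.constIn G0).isNone then (t.leafComp nu G G0).size else 0) +
          t.numConsts ≤ t.size + t.cvars.length := by
        intro t hm
        have := ih t hm (ht' t hm) (hG' t hm) (hG0' t hm)
        rcases hc : t.constIn G0 with _ | c
        · have hnc : ¬ ∃ c, t = .node c [] := by
            rintro ⟨c, rfl⟩
            have hcG : c ∈ G0 := hG0' _ hm c (by simp [letters_node])
            simp [constIn, hcG] at hc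
          grind
        · obtain ⟨rfl, _⟩ := constIn_eq_some.1 hc
          simp [numConsts_node, size, cvars]
      have hsum := sum_le_sum key
      simp only [sum_map_add] at hsum
      have hsz : ((Term.node f ts).leafComp nu G G0).size = (ts.map fun t =>
          if (t.constIn G0).isNone then (t.leafComp nu G G0).size else 0).sum + 1 := by
        by_cases h : ∃ t ∈ ts, (t.constIn G0).isSome
        · rw [leafComp_absorb f ts ⟨hf, h⟩, size, map_map]
          congr 1
          clear_value ts
          clear hts hne hf hic key hsum h ih ht hG hG0 ht' hG' hG0'
          induction ts with
          | nil => rfl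
          | cons t ts ih => grind
        · rw [leafComp_keep f ts (fun h' => h h'.2), size, map_map]
          congr 2
          refine map_congr_left fun t hm => ?_
          have : (t.constIn G0).isNone := by
            by_contra h2
            exact h ⟨t, hm, by simpa [Option.isSome_iff_ne_none] using h2⟩
          simp [this]
      grind
  | hp a l t ih => grind

theorem vars_leafComp (t : Term) : (t.leafComp nu G G0).vars = t.vars ∧
    (t.leafComp nu G G0).cvars = t.cvars ∧ (t.leafComp nu G G0).exps = t.exps := by
  induction t with
  | hv x => simp [leafComp]
  | hc X t ih => simpa [leafComp, vars, cvars, exps] using ih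
  | hn f ts ih =>
    by_cases h : (f, ts.length) ∈ G ∧ ∃ t ∈ ts, (t.constIn G0).isSome
    · rw [leafComp_absorb f ts h]
      simp only [vars, cvars, exps, map_map]
      clear h
      induction ts with
      | nil => simp
      | cons t ts ih2 =>
        have h1 := ih2 fun s hs => ih s (mem_cons_of_mem _ hs)
        have h2 := ih t (by simp)
        rcases hc : t.constIn G0 with _ | c
        · grind
        · obtain ⟨rfl, _⟩ := constIn_eq_some.1 hc
          grind
    · rw [leafComp_keep f ts h]
      simp only [vars, cvars, exps, map_map]
      refine ⟨congrArg _ (map_congr_left fun t ht => (ih t ht).1),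
        congrArg _ (map_congr_left fun t ht => (ih t ht).2.1),
        congrArg _ (map_congr_left fun t ht => (ih t ht).2.2)⟩
  | hp a l t ih => simpa [leafComp, vars, cvars, exps] using ih

theorem nodePats_length_le (t : Term) : (t.nodePats G0).length ≤ t.size := by
  induction t with
  | hv x => simp [nodePats]
  | hc X t ih => simp only [nodePats, size]; omega
  | hn f ts ih =>
    simp only [nodePats, size, length_cons, length_flatten, map_map]
    have := sum_le_sum ih
    simp only [Function.comp_def]
    omega
  | hp a l t ih => simp only [nodePats, size]; omega

end Leaf

end Term
namespace Term

/-- The context variables together with the variables of their arguments. -/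
@[grind =] def cargs : Term → List (ℕ × List ℕ)
  | .var _ => []
  | .cvar X t => (X, t.vars) :: t.cargs
  | .node _ ts => (ts.map cargs).flatten
  | .pow _ _ t => t.cargs

theorem cargs_pairComp : (t.pairComp nu G1 G2).cargs = t.cargs := by
  induction t with
  | hv x => grind
  | hc X t ih => simp [pairComp, cargs, ih, (vars_pairComp t).1]
  | hn f ts ih =>
    rcases length_one_cases ts with ⟨t, rfl⟩ | h1
    · have := ih t (by simp)
      rw [pairComp_one]
      rcases consPair_cases nu G1 G2 f (t.pairComp nu G1 G2) with
        ⟨c, r, h1, ha, hc, h2⟩ | ⟨h3, h2⟩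
      · grind
      · grind
    · rw [pairComp_ne f ts h1]
      simp only [cargs, map_map]
      exact congrArg _ (map_congr_left ih)
  | hp a l t ih => grind

theorem cargs_leafComp {nu : ℕ → List (Option ℕ) → ℕ} {G : Finset (ℕ × ℕ)} :
    (t.leafComp nu G G0).cargs = t.cargs := by
  induction t with
  | hv x => simp [leafComp]
  | hc X t ih => simp [leafComp, cargs, ih, (vars_leafComp t).1]
  | hn f ts ih =>
    by_cases h : (f, ts.length) ∈ G ∧ ∃ t ∈ ts, (t.constIn G0).isSome
    · rw [leafComp_absorb f ts h]
      simp only [cargs, map_map]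
      clear h
      induction ts with
      | nil => simp
      | cons t ts ih2 =>
        have h1 := ih2 fun s hs => ih s (mem_cons_of_mem _ hs)
        have h2 := ih t (by simp)
        rcases hc : t.constIn G0 with _ | c
        · grind
        · obtain ⟨rfl, _⟩ := constIn_eq_some.1 hc
          grind
    · rw [leafComp_keep f ts h]
      simp only [cargs, map_map]
      exact congrArg _ (map_congr_left ih)
  | hp a l t ih => simpa [leafComp, cargs] using ih

/-! ### Chain compression: sizes, symbols and neighbouring letters -/

section Chain

variable {nu : ℕ → ℕ → ℕ} {G : Finset ℕ}

/-- For quantities `μ` that do not see unary letters, such as lists of variables. -/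
theorem closeChain_inv {α : Type*} {μ : Term → α} (h : ∀ f s, μ (.node f [s]) = μ s)
    (p : Option (ℕ × ℕ) × Term) : μ (closeChain nu p) = μ p.2 := by
  rcases p with ⟨_ | ⟨b, m⟩, s⟩
  · rfl
  · exact h _ _

theorem addChain_inv {α : Type*} {μ : Term → α} (h : ∀ f s, μ (.node f [s]) = μ s) (a l : ℕ)
    (p : Option (ℕ × ℕ) × Term) : μ (addChain nu a l p).2 = μ p.2 := by
  rcases p with ⟨_ | ⟨b, m⟩, s⟩
  · rfl
  · grind

/-- One induction serves both `cvars` and `cargs`. The variables of arguments enter `cargs`, whence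
the hypothesis `hv`. -/
theorem chainSplit_inv {α : Type*} {μ : Term → α} (h1 : ∀ f s, μ (.node f [s]) = μ s)
    (hc : ∀ X s t, μ s = μ t → s.vars = t.vars → μ (.cvar X s) = μ (.cvar X t))
    (hn : ∀ f (ts : List Term) (F : Term → Term), (∀ t ∈ ts, μ (F t) = μ t) →
      μ (.node f (ts.map F)) = μ (.node f ts))
    (hp : ∀ a l s, μ (.pow a l s) = μ s)
    (t : Term) (hG : ∀ a, (a, 1) ∈ t.letters → a ∈ G)
    (hv : ∀ s : Term, (∀ a, (a, 1) ∈ s.letters → a ∈ G) → (s.chainComp nu G).vars = s.vars) :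
    μ (t.chainSplit nu G).2 = μ t := by
  induction t with
  | hv x => grind
  | hc X t ih =>
    simp only [chainSplit]
    refine hc _ _ _ ?_ (hv t (by simpa only [letters] using hG))
    rw [closeChain_inv h1]
    grind
  | hn f ts ih =>
    have hG' : ∀ t ∈ ts, ∀ a, (a, 1) ∈ t.letters → a ∈ G :=
      fun t ht a ha => hG a (mem_letters_node.2 (Or.inr ⟨t, ht, ha⟩))
    rcases length_one_cases ts with ⟨t, rfl⟩ | h2
    · rw [chainSplit_one _ _ _ _ (hG f (mem_letters_node.2 (Or.inl rfl))), addChain_inv h1, h1]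
      grind
    · rw [chainSplit_ne _ _ f ts h2]
      refine hn f ts _ fun t ht => ?_
      rw [chainComp, closeChain_inv h1]
      grind
  | hp a l t ih =>
    have ha : a ∈ G := hG a (by simp [letters])
    simp only [chainSplit, ha, if_true]
    rw [addChain_inv h1, hp]
    grind

theorem vars_chainComp (hG : ∀ a, (a, 1) ∈ t.letters → a ∈ G) :
    (t.chainComp nu G).vars = t.vars := by
  induction t with
  | hv x => simp [chainComp, chainSplit, closeChain]
  | hc X t ih =>
    have := ih (by simpa only [letters] using hG)
    simpa only [chainComp, chainSplit, closeChain, vars] using this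
  | hn f ts ih =>
    have hG' : ∀ t ∈ ts, ∀ a, (a, 1) ∈ t.letters → a ∈ G :=
      fun t ht a ha => hG a (mem_letters_node.2 (Or.inr ⟨t, ht, ha⟩))
    have h1 : ∀ f s, (Term.node f [s]).vars = s.vars := by simp [vars]
    rcases length_one_cases ts with ⟨t, rfl⟩ | h2
    · rw [chainComp, closeChain_inv h1, chainSplit_one _ _ _ _ (hG f (mem_letters_node.2 (Or.inl rfl))),
        addChain_inv h1, h1, ← ih t (by simp) (hG' t (by simp)), chainComp, closeChain_inv h1]
    · rw [chainComp, chainSplit_ne _ _ f ts h2, closeChain]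
      simp only [vars, map_map]
      exact congrArg _ (map_congr_left fun t ht => ih t ht (hG' t ht))
  | hp a l t ih =>
    have h1 : ∀ f s, (Term.node f [s]).vars = s.vars := by simp [vars]
    have ha : a ∈ G := hG a (by simp [letters])
    simp only [chainComp, chainSplit, ha, if_true]
    rw [closeChain_inv h1, addChain_inv h1, vars,
      ← ih fun b hb => hG b (by simp [letters, hb]), chainComp, closeChain_inv h1]

theorem cvars_chainComp (hG : ∀ a, (a, 1) ∈ t.letters → a ∈ G) :
    (t.chainComp nu G).cvars = t.cvars := by
  rw [chainComp, closeChain_inv (μ := cvars) (by simp [cvars])]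
  refine chainSplit_inv (μ := cvars) (by simp [cvars]) (fun X s t h _ => by simp [cvars, h])
    (fun f ts F h => ?_) (by simp [cvars]) t hG (fun s => vars_chainComp s)
  simp only [cvars, map_map]
  exact congrArg _ (map_congr_left h)

theorem cargs_chainComp (hG : ∀ a, (a, 1) ∈ t.letters → a ∈ G) :
    (t.chainComp nu G).cargs = t.cargs := by
  rw [chainComp, closeChain_inv (μ := cargs) (by simp [cargs])]
  refine chainSplit_inv (μ := cargs) (by simp [cargs]) (fun X s t h h' => by simp [cargs, h, h'])
    (fun f ts F h => ?_) (by simp [cargs]) t hG (fun s => vars_chainComp s)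
  simp only [cargs, map_map]
  exact congrArg _ (map_congr_left h)

theorem exps_chainComp (hG : ∀ a, (a, 1) ∈ t.letters → a ∈ G) : (t.chainComp nu G).exps = [] := by
  have h1 : ∀ f s, (Term.node f [s]).exps = s.exps := by simp [exps]
  rw [chainComp, closeChain_inv h1]
  induction t with
  | hv x => grind
  | hc X t ih =>
    simp only [chainSplit, exps]
    rw [closeChain_inv h1]
    grind
  | hn f ts ih =>
    have hG' : ∀ t ∈ ts, ∀ a, (a, 1) ∈ t.letters → a ∈ G :=
      fun t ht a ha => hG a (mem_letters_node.2 (Or.inr ⟨t, ht, ha⟩))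
    rcases length_one_cases ts with ⟨t, rfl⟩ | h2
    · rw [chainSplit_one _ _ _ _ (hG f (mem_letters_node.2 (Or.inl rfl))), addChain_inv h1]
      grind
    · rw [chainSplit_ne _ _ f ts h2]
      simp only [exps, map_map, flatten_eq_nil_iff, mem_map, Function.comp]
      rintro _ ⟨t, ht, rfl⟩
      rw [chainComp, closeChain_inv h1]
      grind
  | hp a l t ih =>
    have ha : a ∈ G := hG a (by simp [letters])
    simp only [chainSplit, ha, if_true]
    rw [addChain_inv h1]
    grind

theorem size_addChain (a l : ℕ) (p : Option (ℕ × ℕ) × Term) :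
    (closeChain nu (addChain nu a l p)).size ≤ (closeChain nu p).size + 1 := by
  rcases p with ⟨_ | ⟨b, m⟩, s⟩
  · simp [closeChain, addChain, size]
  · grind

theorem size_chainComp (hG : ∀ a, (a, 1) ∈ t.letters → a ∈ G) :
    (t.chainComp nu G).size ≤ t.size := by
  induction t with
  | hv x => simp [chainComp, chainSplit, closeChain]
  | hc X t ih =>
    have := ih (by simpa only [letters] using hG)
    simp only [chainComp, chainSplit, closeChain, size] at this ⊢
    omega
  | hn f ts ih =>
    have hG' : ∀ t ∈ ts, ∀ a, (a, 1) ∈ t.letters → a ∈ G :=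
      fun t ht a ha => hG a (mem_letters_node.2 (Or.inr ⟨t, ht, ha⟩))
    rcases length_one_cases ts with ⟨t, rfl⟩ | h2
    · rw [chainComp, chainSplit_one _ _ _ _ (hG f (mem_letters_node.2 (Or.inl rfl)))]
      refine (size_addChain _ _ _).trans ?_
      have := ih t (by simp) (hG' t (by simp))
      rw [chainComp] at this
      grind
    · rw [chainComp, chainSplit_ne _ _ f ts h2, closeChain]
      simp only [size, map_map, add_le_add_iff_right]
      exact sum_le_sum fun t ht => ih t ht (hG' t ht)
  | hp a l t ih =>
    have ha : a ∈ G := hG a (by simp [letters])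
    simp only [chainComp, chainSplit, ha, if_true]
    refine (size_addChain _ _ _).trans ?_
    have := ih fun b hb => hG b (by simp [letters, hb])
    rw [chainComp] at this
    grind

/-- Consecutive unary letters stand for chains of different letters. -/
def Alternating (nu : ℕ → ℕ → ℕ) (t : Term) : Prop :=
  ∀ p ∈ t.unaryPairs, ∃ a l b m, a ≠ b ∧ p = (nu a l, nu b m)

/-- The invariant of partially compressed terms. -/
def OpenAlternating (nu : ℕ → ℕ → ℕ) (p : Option (ℕ × ℕ) × Term) : Prop :=
  Alternating nu p.2 ∧ p.1.elim (p.2.rootUnary = none)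
    fun q => ∀ c, p.2.rootUnary = some c → ∃ b m, q.1 ≠ b ∧ c = nu b m

theorem OpenAlternating.close {p : Option (ℕ × ℕ) × Term} (h : OpenAlternating nu p) :
    Alternating nu (closeChain nu p) := by
  rcases p with ⟨_ | ⟨a, l⟩, s⟩
  · exact h.1
  · intro q hq
    simp only [closeChain, unaryPairs_one, mem_append] at hq
    rcases hq with hq | hq
    · rcases hr : s.rootUnary with _ | c
      · grind
      · obtain ⟨b, m, hb, rfl⟩ := h.2 c hr
        grind
    · exact h.1 q hq

theorem OpenAlternating.add {p : Option (ℕ × ℕ) × Term} (h : OpenAlternating nu p) (a l : ℕ) :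
    OpenAlternating nu (addChain nu a l p) := by
  rcases p with ⟨_ | ⟨b, m⟩, s⟩
  · have h2 : s.rootUnary = none := h.2
    exact ⟨h.1, fun c hc => by simp [h2, addChain] at hc⟩
  · simp only [addChain]
    split_ifs with hab
    · subst hab
      exact ⟨h.1, h.2⟩
    · refine ⟨h.close, fun c hc => ⟨b, m, fun h => hab h.symm, ?_⟩⟩
      grind

theorem openAlternating_chainSplit (hG : ∀ a, (a, 1) ∈ t.letters → a ∈ G) :
    OpenAlternating nu (t.chainSplit nu G) := by
  induction t with
  | hv x => exact ⟨by simp [Alternating, chainSplit, unaryPairs], by simp [chainSplit, rootUnary]⟩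
  | hc X t ih =>
    have := (ih (by simpa only [letters] using hG)).close
    exact ⟨by simpa only [Alternating, chainSplit, unaryPairs] using this,
      by simp [chainSplit, rootUnary]⟩
  | hn f ts ih =>
    have hG' : ∀ t ∈ ts, ∀ a, (a, 1) ∈ t.letters → a ∈ G :=
      fun t ht a ha => hG a (mem_letters_node.2 (Or.inr ⟨t, ht, ha⟩))
    rcases length_one_cases ts with ⟨t, rfl⟩ | h2
    · rw [chainSplit_one _ _ _ _ (hG f (mem_letters_node.2 (Or.inl rfl)))]
      exact (ih t (by simp) (hG' t (by simp))).add _ _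
    · rw [chainSplit_ne _ _ f ts h2]
      refine ⟨?_, rootUnary_ne f _ (by simpa using h2)⟩
      intro q hq
      rw [unaryPairs_ne f _ (by simpa using h2), map_map, mem_flatten] at hq
      obtain ⟨_, hl, hq⟩ := hq
      obtain ⟨t, ht, rfl⟩ := mem_map.1 hl
      exact (ih t ht (hG' t ht)).close q hq
  | hp a l t ih =>
    have ha : a ∈ G := hG a (by simp [letters])
    simp only [chainSplit, ha, if_true]
    exact (ih fun b hb => hG b (by simp [letters, hb])).add _ _

/-- The compressed chains are maximal, so neighbours come from different letters. Under injective
names each pair then consists of two different letters, as `exists_partition` requires. -/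
theorem alternating_chainComp (hG : ∀ a, (a, 1) ∈ t.letters → a ∈ G) :
    Alternating nu (t.chainComp nu G) := (openAlternating_chainSplit t hG).close

end Chain

end Term

/-! ### Counting under popping -/

@[grind =] def Layer.size : Layer → ℕ
  | .pow _ _ => 1
  | .nd _ xs ys => 1 + xs.length + ys.length

@[grind =] def layersSize (ls : List Layer) : ℕ := (ls.map Layer.size).sum

theorem size_layer (t : Term) : (L.app t).size = L.size + t.size := by
  rcases L with ⟨a, l⟩ | ⟨f, xs, ys⟩
  · grind
  · simp [Layer.app, Layer.size, size, Function.comp_def]; omega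

theorem size_wrap (t : Term) : (wrap ls t).size = layersSize ls + t.size := by
  induction ls with
  | nil => grind
  | cons L ls ih =>
    rw [wrap_cons, size_layer, ih]
    grind

theorem size_sub_le {p q : ℕ} (hV : ∀ x ∈ t.vars, layersSize (V x).pre ≤ p)
    (hC : ∀ X ∈ t.cvars, layersSize (C X).pre + layersSize (C X).post ≤ q) :
    (sub V C t).size ≤ t.size + p * t.vars.length + q * t.cvars.length := by
  induction t with
  | hv x =>
    have := hV x (by simp [vars])
    have h1 : ((V x).const.elim (Term.var x) fun c => .node c []).size = 1 := by
      rcases (V x).const <;> simp [size]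
    simp only [sub, VTmpl.app, size_wrap, h1, size, vars, length_singleton, cvars, length_nil]
    omega
  | hc X t ih =>
    have h1 := ih (by simpa only [vars] using hV) (fun Y hY => hC Y (by simp [cvars, hY]))
    have h2 := hC X (by simp [cvars])
    have h3 : (sub V C (.cvar X t)).size ≤
        layersSize (C X).pre + layersSize (C X).post + (sub V C t).size + 1 := by
      simp only [sub, CTmpl.app, size_wrap]
      cases (C X).keep <;> simp [size, size_wrap] <;> omega
    simp only [size, vars, cvars, length_cons, Nat.mul_add, mul_one]
    omega
  | hn f ts ih =>
    have h : (ts.map fun t => (sub V C t).size).sum ≤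
        (ts.map fun t => t.size + p * t.vars.length + q * t.cvars.length).sum := by
      refine sum_le_sum fun t ht => ih t ht (fun x hx => hV x ?_) fun X hX => hC X ?_
      · grind
      · grind
    simp only [sum_map_add, sum_map_mul_left] at h
    rw [sub, size, size, vars_length_node, cvars_length_node, map_map]
    simp only [Function.comp_def]
    grind
  | hp a l t ih =>
    grind

theorem numConsts_layer (t : Term) : (L.app t).numConsts = t.numConsts := by
  rcases L with ⟨a, l⟩ | ⟨f, xs, ys⟩
  · simp [Layer.app, numConsts, letters]
  · have h : ∀ zs : List ℕ, (zs.map (numConsts ∘ Term.var)).sum = 0 := by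
      intro zs; simp [Function.comp_def, numConsts, letters]
    simp [Layer.app, numConsts_node, h]

theorem numConsts_wrap (t : Term) : (wrap ls t).numConsts = t.numConsts := by
  induction ls with
  | nil => rfl
  | cons L ls ih => rw [wrap_cons, numConsts_layer, ih]

theorem numConsts_sub_le (V : ℕ → VTmpl) (C : ℕ → CTmpl) (t : Term) :
    t.numConsts ≤ (sub V C t).numConsts := by
  induction t with
  | hv x => simp [numConsts, letters]
  | hc X t ih =>
    have h1 : (Term.cvar X t).numConsts = t.numConsts := by simp [numConsts, letters]
    rw [h1, sub, CTmpl.app, numConsts_wrap]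
    cases (C X).keep
    · simpa [numConsts_wrap] using ih
    · simp only [cond_true]
      rw [show ∀ s, (Term.cvar X s).numConsts = s.numConsts by
        simp [numConsts, letters], numConsts_wrap]
      exact ih
  | hn f ts ih =>
    rw [sub, numConsts_node, numConsts_node, length_map, map_map]
    have := sum_le_sum ih
    simp only [Function.comp_def]
    grind
  | hp a l t ih => simpa [sub, numConsts, letters] using ih

theorem countP_unaryPairs_layer (p : ℕ × ℕ → Bool) (L : Layer) (t : Term) :
    t.unaryPairs.countP p ≤ (L.app t).unaryPairs.countP p := by
  rcases L with ⟨a, l⟩ | ⟨f, xs, ys⟩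
  · grind
  · grind

theorem countP_unaryPairs_wrap (p : ℕ × ℕ → Bool) (ls : List Layer) (t : Term) :
    t.unaryPairs.countP p ≤ (wrap ls t).unaryPairs.countP p := by
  induction ls with
  | nil => rfl
  | cons L ls ih => exact ih.trans (countP_unaryPairs_layer p L _)

/-- Templates are inserted at variables only, never between two consecutive letters, so the explicit
pairs survive the uncrossing. -/
theorem countP_unaryPairs_sub (p : ℕ × ℕ → Bool) (V : ℕ → VTmpl) (C : ℕ → CTmpl) (t : Term) :
    t.unaryPairs.countP p ≤ (sub V C t).unaryPairs.countP p := by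
  induction t with
  | hv x => simp [unaryPairs]
  | hc X t ih =>
    rw [sub, CTmpl.app, unaryPairs]
    refine le_trans ?_ (countP_unaryPairs_wrap p _ _)
    cases (C X).keep
    · exact ih.trans (countP_unaryPairs_wrap p _ _)
    · simp only [cond_true, unaryPairs]
      exact ih.trans (countP_unaryPairs_wrap p _ _)
  | hn f ts ih =>
    rw [sub]
    rcases length_one_cases ts with ⟨t, rfl⟩ | h2
    · simp only [map_cons, map_nil, unaryPairs_one, countP_append]
      have h1 := ih t (by simp)
      rcases h : t.rootUnary with _ | b
      · simp; omega
      · obtain ⟨s, rfl⟩ := rootUnary_eq_some.1 h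
        have : (sub V C (.node b [s])).rootUnary = some b := by simp [sub, rootUnary]
        grind
    · rw [unaryPairs_ne f _ h2, unaryPairs_ne f _ (by simpa using h2)]
      simp only [countP_flatten, map_map]
      exact sum_le_sum ih
  | hp a l t ih => simpa [sub, unaryPairs] using ih

theorem cvars_layer (t : Term) : (L.app t).cvars = t.cvars := by
  have h : ∀ zs : List ℕ, (zs.map (cvars ∘ Term.var)).flatten = [] := by
    intro zs; simp [Function.comp_def, cvars]
  rcases L with ⟨a, l⟩ | ⟨f, xs, ys⟩
  · grind
  · simp [Layer.app, cvars, h]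

theorem cvars_wrap (t : Term) : (wrap ls t).cvars = t.cvars := by
  induction ls with
  | nil => rfl
  | cons L ls ih => rw [wrap_cons, cvars_layer, ih]

theorem cvars_sub (V : ℕ → VTmpl) (C : ℕ → CTmpl) (t : Term) :
    (sub V C t).cvars = t.cvars.filter fun X => (C X).keep := by
  induction t with
  | hv x =>
    rw [sub, VTmpl.app, cvars_wrap]
    rcases (V x).const <;> simp [cvars]
  | hc X t ih =>
    rw [sub, CTmpl.app, cvars_wrap]
    rcases h : (C X).keep <;> simp [cvars, cvars_wrap, ih, h]
  | hn f ts ih =>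
    simp only [sub, cvars, map_map, filter_flatten]
    exact congrArg _ (map_congr_left ih)
  | hp a l t ih => grind

@[grind =] def layersVars (ls : List Layer) : List ℕ := (ls.map Layer.vars).flatten

theorem vars_layer (p : ℕ → Bool) (L : Layer) (t : Term) :
    (L.app t).vars.countP p = L.vars.countP p + t.vars.countP p := by
  have h : ∀ zs : List ℕ, (zs.map (vars ∘ Term.var)).flatten = zs := by
    intro zs
    induction zs with
    | nil => rfl
    | cons z zs ih => grind
  rcases L with ⟨a, l⟩ | ⟨f, xs, ys⟩
  · grind
  · simp [Layer.app, Layer.vars, vars, h]; omega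

theorem vars_wrap (p : ℕ → Bool) (ls : List Layer) (t : Term) :
    (wrap ls t).vars.countP p = (layersVars ls).countP p + t.vars.countP p := by
  induction ls with
  | nil => grind
  | cons L ls ih =>
    rw [wrap_cons, vars_layer, ih]
    grind

/-- Counting by an arbitrary predicate covers membership as well as the number of variables with a
given owner. -/
theorem countP_vars_sub (p : ℕ → Bool) (V : ℕ → VTmpl) (C : ℕ → CTmpl) (t : Term) :
    (sub V C t).vars.countP p = (t.vars.map fun x => ((V x).app x).vars.countP p).sum +
      (t.cvars.map fun X => (layersVars (C X).pre ++ layersVars (C X).post).countP p).sum := by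
  induction t with
  | hv x => grind
  | hc X t ih =>
    have : (sub V C (.cvar X t)).vars.countP p =
        (layersVars (C X).pre ++ layersVars (C X).post).countP p + (sub V C t).vars.countP p := by
      rw [sub, CTmpl.app, vars_wrap]
      rcases h : (C X).keep <;> simp [vars, vars_wrap] <;> omega
    grind
  | hn f ts ih =>
    simp only [sub, vars, cvars, map_map, countP_flatten, map_flatten, sum_flatten]
    rw [← sum_map_add]
    exact congrArg _ (map_congr_left ih)
  | hp a l t ih => grind

theorem mem_vars_wrap {ls : List Layer} {t : Term} :
    y ∈ (wrap ls t).vars ↔ y ∈ layersVars ls ∨ y ∈ t.vars := by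
  have := vars_wrap (fun z => z == y) ls t
  have h : ∀ l : List ℕ, y ∈ l ↔ 0 < l.countP fun z => z == y := fun l => count_pos_iff.symm
  grind

theorem mem_vars_sub {t : Term} : y ∈ (sub V C t).vars ↔ (∃ x ∈ t.vars, y ∈ ((V x).app x).vars) ∨
      ∃ X ∈ t.cvars, y ∈ layersVars (C X).pre ++ layersVars (C X).post := by
  have h : ∀ l : List ℕ, y ∈ l ↔ 0 < l.countP fun z => z == y := fun l => count_pos_iff.symm
  rw [h, countP_vars_sub, Nat.add_pos_iff_pos_or_pos, List.sum_pos_iff_exists_pos_nat,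
    List.sum_pos_iff_exists_pos_nat]
  simp only [mem_map, h]
  grind

theorem cargs_layer (t : Term) : (L.app t).cargs = t.cargs := by
  have h : ∀ zs : List ℕ, (zs.map (cargs ∘ Term.var)).flatten = [] := by
    intro zs; simp [Function.comp_def, cargs]
  rcases L with ⟨a, l⟩ | ⟨f, xs, ys⟩
  · grind
  · simp [Layer.app, cargs, h]

theorem cargs_wrap (t : Term) : (wrap ls t).cargs = t.cargs := by
  induction ls with
  | nil => rfl
  | cons L ls ih => rw [wrap_cons, cargs_layer, ih]

/-- What `Owned` needs: the variables popped down from `X` land in every argument of `X`, and those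
already in an argument stay there up to their own templates. -/
theorem cargs_sub (V : ℕ → VTmpl) (C : ℕ → CTmpl) (t : Term) :
    ∀ q ∈ (sub V C t).cargs, (C q.1).keep = true ∧ ∃ vs, (q.1, vs) ∈ t.cargs ∧
      ∀ y, (y ∈ layersVars (C q.1).post ∨ ∃ x ∈ vs, y ∈ ((V x).app x).vars) → y ∈ q.2 := by
  induction t with
  | hv x =>
    rw [sub, VTmpl.app, cargs_wrap]
    rcases (V x).const <;> simp [cargs]
  | hc X t ih =>
    have key : ∀ q ∈ (sub V C t).cargs, (C q.1).keep = true ∧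
        ∃ vs, (q.1, vs) ∈ (Term.cvar X t).cargs ∧
        ∀ y, (y ∈ layersVars (C q.1).post ∨ ∃ x ∈ vs, y ∈ ((V x).app x).vars) → y ∈ q.2 := by
      grind
    intro q hq
    rw [sub, CTmpl.app, cargs_wrap] at hq
    rcases h : (C X).keep
    · rw [h] at hq
      simp only [cond_false, cargs_wrap] at hq
      grind
    · rw [h] at hq
      simp only [cond_true, cargs, mem_cons, cargs_wrap] at hq
      rcases hq with rfl | hq
      · refine ⟨h, t.vars, by simp [cargs], fun y hy => ?_⟩
        rw [mem_vars_wrap, mem_vars_sub]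
        grind
      · grind
  | hn f ts ih =>
    grind
  | hp a l t ih => grind

/-! ### Memory bounds -/

/-- All names and arities are at most `Q`, all exponents at most `2 ^ Q`. -/
@[grind =] def Term.Fits (Q : ℕ) : Term → Prop
  | .var x => x ≤ Q
  | .cvar X t => X ≤ Q ∧ t.Fits Q
  | .node f ts => f ≤ Q ∧ ts.length ≤ Q ∧ ∀ t ∈ ts, Fits Q t
  | .pow a l t => a ≤ Q ∧ l ≤ 2 ^ Q ∧ t.Fits Q

theorem Term.fits_node {f : ℕ} {ts : List Term} :
    (Term.node f ts).Fits Q ↔ f ≤ Q ∧ ts.length ≤ Q ∧ ∀ t ∈ ts, t.Fits Q := by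
  grind

/-- A number has at most as many binary digits as its value. This crude bound is enough, since
quadratic memory allows linearly many bits for each of linearly many symbols. -/
theorem numBits_le (h : m ≤ Q) : numBits m ≤ 2 * Q + 2 := by
  have : Nat.size m ≤ m := Nat.size_le.2 Nat.lt_two_pow_self
  unfold numBits; omega

theorem numBits_pow_le (h : m ≤ 2 ^ Q) : numBits m ≤ 2 * Q + 4 := by
  have : Nat.size m ≤ Q + 1 := Nat.size_le.2 (by rw [pow_succ]; have := Nat.two_pow_pos Q; omega)
  unfold numBits; omega

theorem Term.Fits.bits_le (h : t.Fits Q) : t.bits ≤ (4 * Q + 8) * t.size := by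
  induction t with
  | hv x =>
    simp only [Fits] at h
    have := numBits_le h
    simp only [bits, size]; omega
  | hc X t ih =>
    simp only [Fits] at h
    have := numBits_le h.1
    have := ih h.2
    simp only [bits, size, mul_add]; omega
  | hn f ts ih =>
    simp only [Fits] at h
    have h1 := numBits_le h.1
    have h2 := numBits_le h.2.1
    have : (ts.map bits).sum ≤ (ts.map fun t => (4 * Q + 8) * t.size).sum :=
      sum_le_sum fun t ht => ih t ht (h.2.2 t ht)
    rw [sum_map_mul_left] at this
    simp only [bits, size, mul_add, add_mul]
    grind
  | hp a l t ih =>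
    simp only [Fits] at h
    have := numBits_le h.1
    have := numBits_pow_le h.2.1
    have := ih h.2.2
    simp only [bits, size, mul_add]; omega

theorem Term.fits_of (hl : ∀ q ∈ t.letters, q.1 ≤ Q ∧ q.2 ≤ Q) (hv : ∀ x ∈ t.vars, x ≤ Q)
    (hc : ∀ X ∈ t.cvars, X ≤ Q) (he : t.exps = []) : t.Fits Q := by
  induction t with
  | hv x => grind
  | hc X t ih =>
    simp only [letters, vars, cvars, exps, mem_cons, forall_eq_or_imp] at hl hv hc he
    grind
  | hn f ts ih =>
    simp only [mem_letters_node] at hl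
    simp only [vars, cvars, exps, mem_flatten, mem_map, flatten_eq_nil_iff] at hv hc he
    have h := hl _ (Or.inl rfl)
    refine fits_node.2 ⟨h.1, h.2, fun t ht => ih t ht (fun q hq => hl q (Or.inr ⟨t, ht, hq⟩))
      (fun x hx => hv x ⟨_, ⟨t, ht, rfl⟩, hx⟩) (fun x hx => hc x ⟨_, ⟨t, ht, rfl⟩, hx⟩)
      (he _ ⟨t, ht, rfl⟩)⟩
  | hp a l t ih => grind

theorem Term.Fits.symbols (h : t.Fits Q) :
    (∀ q ∈ t.letters, q.1 ≤ Q) ∧ (∀ x ∈ t.vars, x ≤ Q) ∧ ∀ X ∈ t.cvars, X ≤ Q := by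
  induction t with
  | hv x => grind
  | hc X t ih =>
    grind
  | hn f ts ih =>
    grind
  | hp a l t ih =>
    grind

@[grind =] def Layer.Fits (Q : ℕ) : Layer → Prop
  | .pow a l => a ≤ Q ∧ l ≤ 2 ^ Q
  | .nd f xs ys => f ≤ Q ∧ xs.length + 1 + ys.length ≤ Q ∧ ∀ x ∈ xs ++ ys, x ≤ Q

theorem fits_wrap {ls : List Layer} {t : Term} (h : ∀ L ∈ ls, L.Fits Q) (ht : t.Fits Q) :
    (wrap ls t).Fits Q := by
  induction ls with
  | nil => exact ht
  | cons L ls ih =>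
    have h1 := h L (by simp)
    have h2 := ih fun L hL => h L (by simp [hL])
    rw [wrap_cons]
    rcases L with ⟨a, l⟩ | ⟨f, xs, ys⟩
    · grind
    · grind

theorem fits_sub (ht : t.Fits Q)
    (hV : ∀ x ∈ t.vars, (∀ L ∈ (V x).pre, L.Fits Q) ∧ ∀ c ∈ (V x).const, c ≤ Q)
    (hC : ∀ X ∈ t.cvars, ∀ L ∈ (C X).pre ++ (C X).post, L.Fits Q) : (sub V C t).Fits Q := by
  induction t with
  | hv x =>
    obtain ⟨h1, h2⟩ := hV x (by simp [vars])
    rw [sub, VTmpl.app]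
    refine fits_wrap h1 ?_
    rcases h : (V x).const with _ | c
    · exact ht
    · grind
  | hc X t ih =>
    simp only [Term.Fits] at ht
    have h := hC X (by simp [cvars])
    have h1 := ih ht.2 (by simpa only [vars] using hV) fun Y hY => hC Y (by simp [cvars, hY])
    have h2 := fits_wrap (fun L hL => h L (mem_append_right _ hL)) h1
    rw [sub, CTmpl.app]
    refine fits_wrap (fun L hL => h L (mem_append_left _ hL)) ?_
    grind
  | hn f ts ih =>
    rw [fits_node] at ht
    rw [sub, fits_node, length_map]
    refine ⟨ht.1, ht.2.1, fun s hs => ?_⟩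
    obtain ⟨t, hm, rfl⟩ := mem_map.1 hs
    refine ih t hm (ht.2.2 t hm) (fun x hx => hV x ?_) fun X hX => hC X ?_
    · grind
    · grind
  | hp a l t ih =>
    simp only [Term.Fits] at ht
    simp only [sub, Term.Fits]
    exact ⟨ht.1, ht.2.1, ih ht.2.2 (by simpa only [vars] using hV) (by simpa only [cvars] using hC)⟩

/-- The layer is not a compressed chain. -/
@[grind =] def Layer.Plain : Layer → Prop
  | .pow _ _ => False
  | .nd _ _ _ => True

theorem exps_wrap {ls : List Layer} {t : Term} (h : ∀ L ∈ ls, L.Plain) :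
    (wrap ls t).exps = t.exps := by
  have hz : ∀ zs : List ℕ, (zs.map (exps ∘ Term.var)).flatten = [] := by
    intro zs; simp [Function.comp_def, exps]
  induction ls with
  | nil => rfl
  | cons L ls ih =>
    have h1 := h L (by simp)
    rw [wrap_cons]
    rcases L with ⟨a, l⟩ | ⟨f, xs, ys⟩
    · grind
    · grind

theorem exps_sub (hV : ∀ x, ∀ L ∈ (V x).pre, L.Plain)
    (hC : ∀ X, ∀ L ∈ (C X).pre ++ (C X).post, L.Plain) (t : Term) :
    (sub V C t).exps = t.exps := by
  induction t with
  | hv x =>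
    rw [sub, VTmpl.app, exps_wrap (hV x)]
    rcases (V x).const <;> simp [exps]
  | hc X t ih =>
    rw [sub, CTmpl.app, exps_wrap fun L hL => hC X L (mem_append_left _ hL)]
    have := exps_wrap (t := sub V C t) fun L hL => hC X L (mem_append_right _ hL)
    grind
  | hn f ts ih =>
    simp only [sub, exps, map_map]
    exact congrArg _ (map_congr_left ih)
  | hp a l t ih => grind

/-! ### Compression of ground terms -/

/-- A ground term as a term. -/
@[grind =] def Tree.toTerm : Tree → Term
  | .node f ts => .node f (ts.map toTerm)

theorem Tree.eval_toTerm (S : Subst) (t : Tree) : S.eval t.toTerm = t := by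
  induction t with
  | h f ts ih =>
    simp only [toTerm, Subst.eval, map_map]
    congr 1
    exact (map_congr_left ih).trans (List.map_id _)

theorem Hom.eval_toTerm (H : Hom) (S : Subst) (t : Tree) : H.eval S t.toTerm = H.tree t := by
  induction t with
  | h f ts ih =>
    simp only [Tree.toTerm, Hom.eval, map_map, Hom.tree]
    congr 1
    exact map_congr_left ih

theorem Tree.size_toTerm (t : Tree) : t.toTerm.size = t.size := by
  induction t with
  | h f ts ih =>
    simp only [toTerm, Term.size, map_map, Tree.size]
    congr 2
    exact map_congr_left ih

theorem Tree.symbols_toTerm (t : Tree) :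
    t.toTerm.vars = [] ∧ t.toTerm.cvars = [] ∧ t.toTerm.exps = [] := by
  induction t with
  | h f ts ih =>
    simp only [toTerm, Term.vars, Term.cvars, Term.exps, map_map, flatten_eq_nil_iff,
      mem_map, Function.comp]
    grind

theorem Tree.all_iff_toTerm (t : Tree) : t.All p ↔ ∀ q ∈ t.toTerm.letters, p q := by
  induction t with
  | h f ts ih =>
    grind

@[grind =] def Tree.rootUnary : Tree → Option ℕ
  | .node a [_] => some a
  | _ => none

theorem Tree.rootUnary_one (a : ℕ) (t : Tree) : (Tree.node a [t]).rootUnary = some a := rfl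

theorem Tree.rootUnary_ne (ts : List Tree) (h : ts.length ≠ 1) :
    (Tree.node f ts).rootUnary = none := by
  rcases ts with _ | ⟨t, _ | ⟨s, ts⟩⟩
  · rfl
  · simp at h
  · rfl

theorem Tree.rootUnary_toTerm (t : Tree) : t.toTerm.rootUnary = t.rootUnary := by
  rcases t with ⟨f, ts⟩
  rcases length_one_cases ts with ⟨t, rfl⟩ | h
  · grind
  · rw [toTerm, rootUnary_ne f ts h, Term.rootUnary_ne _ _ (by simpa using h)]

/-- The unary letter at the top of a context. -/
@[grind =] def Ctx.topUnary : Ctx → Option ℕ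
  | .node a [] _ [] => some a
  | _ => none

/-- The unary letter just above the hole of a context. -/
@[grind =] def Ctx.botUnary : Ctx → Option ℕ
  | .hole => none
  | .node a [] .hole [] => some a
  | .node _ _ c _ => c.botUnary

theorem Ctx.topUnary_ne (l : List Tree) (c : Ctx) (r : List Tree) (h : l.length + r.length ≠ 0) :
    (Ctx.node f l c r).topUnary = none := by
  rcases l with _ | ⟨y, l⟩ <;> rcases r with _ | ⟨z, r⟩
  · simp at h
  all_goals rfl

theorem Ctx.rootUnary_fill {c : Ctx} (h : c ≠ .hole) (t : Tree) :
    (c.fill t).rootUnary = c.topUnary := by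
  rcases c with _ | ⟨f, l, c, r⟩
  · grind
  · by_cases hl : l.length + r.length = 0
    · obtain ⟨rfl, rfl⟩ : l = [] ∧ r = [] := by
        constructor <;> apply eq_nil_of_length_eq_zero <;> omega
      rfl
    · rw [topUnary_ne _ _ _ _ hl, fill, Tree.rootUnary_ne]
      simp; omega

theorem Ctx.botUnary_node (l : List Tree) {c : Ctx} (r : List Tree) (h : c ≠ .hole) :
    (Ctx.node f l c r).botUnary = c.botUnary := by
  grind

/-! ### Chain compression of ground terms and the uncrossing of chains -/

section Chain

variable (nu : ℕ → ℕ → ℕ)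

@[grind =] def Tree.closeChain : Option (ℕ × ℕ) × Tree → Tree
  | (none, s) => s
  | (some (b, m), s) => .node (nu b m) [s]

@[grind =] def Tree.addChain (a l : ℕ) : Option (ℕ × ℕ) × Tree → Option (ℕ × ℕ) × Tree
  | (none, s) => (some (a, l), s)
  | (some (b, m), s) => if b = a then (some (a, l + m), s) else (some (a, l), .node (nu b m) [s])

/-- Chain compression of a ground term, with the chain at the top separated. -/
@[grind =] def Tree.chainSplit : Tree → Option (ℕ × ℕ) × Tree
  | .node a [t] => Tree.addChain nu a 1 t.chainSplit
  | .node f ts => (none, .node f (ts.map fun t => Tree.closeChain nu (chainSplit t)))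

@[grind =] def Tree.chainComp (t : Tree) : Tree := Tree.closeChain nu (t.chainSplit nu)

@[grind =] def Ctx.closeChain : Option (ℕ × ℕ) × Ctx → Ctx
  | (none, c) => c
  | (some (b, m), c) => .node (nu b m) [] c []

@[grind =] def Ctx.addChain (a l : ℕ) : Option (ℕ × ℕ) × Ctx → Option (ℕ × ℕ) × Ctx
  | (none, c) => (some (a, l), c)
  | (some (b, m), c) => if b = a then (some (a, l + m), c) else (some (a, l), .node (nu b m) [] c [])

/-- Chain compression of a ground context, with the chain at the top separated. -/
@[grind =] def Ctx.chainSplit : Ctx → Option (ℕ × ℕ) × Ctx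
  | .hole => (none, .hole)
  | .node f l c r => if l.length + r.length = 0 then Ctx.addChain nu f 1 c.chainSplit
      else (none, .node f (l.map (Tree.chainComp nu)) (Ctx.closeChain nu c.chainSplit)
        (r.map (Tree.chainComp nu)))

@[grind =] def Ctx.chainComp (c : Ctx) : Ctx := Ctx.closeChain nu (c.chainSplit nu)

def Subst.chainComp (S : Subst) : Subst :=
  ⟨fun x => (S.var x).chainComp nu, fun X => (S.ctx X).chainComp nu⟩

variable {nu}

theorem Tree.chainSplit_one (a : ℕ) (t : Tree) :
    (Tree.node a [t]).chainSplit nu = Tree.addChain nu a 1 (t.chainSplit nu) := by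
  grind

theorem Tree.chainSplit_ne (ts : List Tree) (h : ts.length ≠ 1) :
    (Tree.node f ts).chainSplit nu = (none, .node f (ts.map (Tree.chainComp nu))) := by
  rcases ts with _ | ⟨t, _ | ⟨s, ts⟩⟩
  · grind
  · simp at h
  · simp [Tree.chainSplit, Tree.chainComp]

theorem Tree.addChain_fst (a l : ℕ) (p : Option (ℕ × ℕ) × Tree) :
    ∃ m, (Tree.addChain nu a l p).1 = some (a, m) := by
  rcases p with ⟨_ | ⟨b, m⟩, s⟩
  · exact ⟨l, rfl⟩
  · simp only [addChain]
    split_ifs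
    · grind
    · grind

theorem Tree.chainSplit_fst (t : Tree) : (t.chainSplit nu).1.map Prod.fst = t.rootUnary := by
  rcases t with ⟨f, ts⟩
  rcases length_one_cases ts with ⟨t, rfl⟩ | h
  · rw [chainSplit_one, rootUnary_one]
    obtain ⟨m, hm⟩ := Tree.addChain_fst (nu := nu) f 1 (t.chainSplit nu)
    grind
  · rw [chainSplit_ne f ts h, rootUnary_ne f ts h]; rfl

theorem Tree.addChain_of_ne {a l : ℕ} {p : Option (ℕ × ℕ) × Tree}
    (h : p.1.map Prod.fst ≠ some a) : Tree.addChain nu a l p = (some (a, l), Tree.closeChain nu p) := by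
  rcases p with ⟨_ | ⟨b, m⟩, s⟩
  · rfl
  · grind

theorem Tree.addChain_addChain (a l m : ℕ) (p : Option (ℕ × ℕ) × Tree) :
    Tree.addChain nu a l (Tree.addChain nu a m p) = Tree.addChain nu a (l + m) p := by
  rcases p with ⟨_ | ⟨b, m'⟩, s⟩
  · grind
  · grind

theorem Tree.chainSplit_iterate (a l : ℕ) (hl : 1 ≤ l) (t : Tree) :
    ((fun s => Tree.node a [s])^[l] t).chainSplit nu = Tree.addChain nu a l (t.chainSplit nu) := by
  induction l, hl using Nat.le_induction with
  | base => exact chainSplit_one a t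
  | succ l hl ih => rw [iterate_succ_apply', chainSplit_one, ih, addChain_addChain, add_comm]

/-- The hypothesis `hb` excludes a chain that runs through the hole; every other chain lies entirely
in `c` or in `t`. -/
theorem Ctx.chainSplit_fill {c : Ctx} (h : c ≠ .hole) (t : Tree)
    (hb : ∀ b, c.botUnary = some b → t.rootUnary ≠ some b) :
    (c.fill t).chainSplit nu = ((c.chainSplit nu).1, (c.chainSplit nu).2.fill (t.chainComp nu)) := by
  induction c with
  | hole => grind
  | node f l c r ih =>
    have h0 : c ≠ .hole → (c.fill t).chainSplit nu =
        ((c.chainSplit nu).1, (c.chainSplit nu).2.fill (t.chainComp nu)) :=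
      fun hc => ih hc fun b hbot => hb b (by rw [botUnary_node _ _ _ hc, hbot])
    have h1 : (c.fill t).chainComp nu = (c.chainComp nu).fill (t.chainComp nu) := by
      by_cases hc : c = .hole
      · grind
      · rw [Tree.chainComp, h0 hc, Ctx.chainComp]
        rcases c.chainSplit nu with ⟨_ | ⟨b, m⟩, d⟩ <;> rfl
    by_cases hl : l.length + r.length = 0
    · obtain ⟨rfl, rfl⟩ : l = [] ∧ r = [] := by
        constructor <;> apply eq_nil_of_length_eq_zero <;> omega
      simp only [chainSplit, fill, nil_append, length_nil, add_zero, if_true]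
      rw [Tree.chainSplit_one]
      by_cases hc : c = .hole
      · subst hc
        rw [fill, Tree.addChain_of_ne]
        · rfl
        · rw [Tree.chainSplit_fst]; exact hb f rfl
      · rw [h0 hc]
        rcases c.chainSplit nu with ⟨_ | ⟨b, m⟩, d⟩
        · rfl
        · grind
    · simp only [chainSplit, hl, if_false, fill]
      rw [Tree.chainSplit_ne _ _ (by simp; omega)]
      grind

/-- Through this identification the lemmas on compressed terms also apply to the values of the
sides. -/
theorem Tree.toTerm_chainSplit (t : Tree) (hG : ∀ a, (a, 1) ∈ t.toTerm.letters → a ∈ G) :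
    t.toTerm.chainSplit nu G = ((t.chainSplit nu).1, (t.chainSplit nu).2.toTerm) := by
  induction t with
  | h f ts ih =>
    have hG' : ∀ t ∈ ts, ∀ a, (a, 1) ∈ t.toTerm.letters → a ∈ G := by
      grind
    rcases length_one_cases ts with ⟨t, rfl⟩ | h
    · have hf : f ∈ G := hG f (by rw [toTerm, Term.mem_letters_node]; exact Or.inl rfl)
      rw [toTerm, map_singleton, Term.chainSplit_one _ _ _ _ hf, chainSplit_one,
        ih t (by simp) (hG' t (by simp))]
      rcases t.chainSplit nu with ⟨_ | ⟨b, m⟩, d⟩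
      · rfl
      · simp only [Term.addChain, addChain]
        grind
    · rw [toTerm, Term.chainSplit_ne _ _ _ _ (by simpa using h), chainSplit_ne f ts h]
      simp only [toTerm, map_map]
      congr 2
      refine map_congr_left fun t ht => ?_
      simp only [Function.comp, Term.chainComp, chainComp, ih t ht (hG' t ht)]
      rcases t.chainSplit nu with ⟨_ | ⟨b, m⟩, d⟩ <;> simp [Term.closeChain, closeChain, toTerm]

theorem Tree.toTerm_chainComp (t : Tree) (hG : ∀ a, (a, 1) ∈ t.toTerm.letters → a ∈ G) :
    t.toTerm.chainComp nu G = (t.chainComp nu).toTerm := by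
  rw [Term.chainComp, toTerm_chainSplit t hG, chainComp]
  rcases t.chainSplit nu with ⟨_ | ⟨b, m⟩, d⟩ <;> simp [Term.closeChain, closeChain, toTerm]

/-- The part of a value that remains after a pop is not continued by the popped chain. -/
def Uncrossed (ls : List Layer) (o : Option ℕ) : Prop :=
  (ls = [] ∧ o = none) ∨ ∃ a l, 1 ≤ l ∧ ls = [Layer.pow a l] ∧ o ≠ some a

/-- The templates uncross all chains. -/
structure ChainUncrossed (V : ℕ → VTmpl) (C : ℕ → CTmpl) (S : Subst) (t : Term) : Prop where
  var : ∀ x ∈ t.vars, (V x).const = none ∧ Uncrossed (V x).pre (S.var x).rootUnary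
  ctx : ∀ X ∈ t.cvars, (∃ o, Uncrossed (C X).pre o) ∧ (∃ o, Uncrossed (C X).post o) ∧
    ((C X).keep = true → S.ctx X ≠ .hole ∧ Uncrossed (C X).pre (S.ctx X).topUnary ∧
      Uncrossed (C X).post (S.ctx X).botUnary)

/-- Chain compression commutes with evaluation. -/
def ChainCommutes (nu : ℕ → ℕ → ℕ) (G : Finset ℕ) (S : Subst) (t : Term) : Prop :=
  (S.eval t).chainSplit nu =
    ((t.chainSplit nu G).1, (S.chainComp nu).eval (t.chainSplit nu G).2)

variable {G : Finset ℕ} {S : Subst}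

theorem ChainCommutes.comp {t : Term} (h : ChainCommutes nu G S t) :
    (S.eval t).chainComp nu = (S.chainComp nu).eval (t.chainComp nu G) := by
  rw [Tree.chainComp, h, Term.chainComp]
  rcases t.chainSplit nu G with ⟨_ | ⟨b, m⟩, d⟩
  · rfl
  · grind

theorem ChainCommutes.pow {t : Term} (h : ChainCommutes nu G S t) {a l : ℕ} (ha : a ∈ G)
    (hl : 1 ≤ l) : ChainCommutes nu G S (.pow a l t) := by
  rw [ChainCommutes, Subst.eval, Tree.chainSplit_iterate a l hl, h, Term.chainSplit, if_pos ha]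
  rcases t.chainSplit nu G with ⟨_ | ⟨b, m⟩, d⟩
  · rfl
  · grind

theorem ChainCommutes.node {t : Term} (h : ChainCommutes nu G S t) {a : ℕ} (ha : a ∈ G) :
    ChainCommutes nu G S (.node a [t]) := by
  have := h.pow ha le_rfl
  simpa [ChainCommutes, Subst.eval, Term.chainSplit, ha] using this

theorem ChainCommutes.wrap {t : Term} (h : ChainCommutes nu G S t) {ls : List Layer} {o : Option ℕ}
    (hls : Uncrossed ls o) (hG : ∀ L ∈ ls, L.letter.1 ∈ G) : ChainCommutes nu G S (wrap ls t) := by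
  rcases hls with ⟨rfl, _⟩ | ⟨a, l, hl, rfl, _⟩
  · exact h
  · exact h.pow (hG (.pow a l) (by simp)) hl

/-- Meant for a (context) variable behind its popped prefix: its value may start with a chain, but
not with one that continues the popped chain. If nothing is popped, its value does not start with a
unary letter at all. -/
theorem ChainCommutes.wrap_of_comp {t : Term} (h0 : (t.chainSplit nu G).1 = none)
    (h : (S.eval t).chainComp nu = (S.chainComp nu).eval (t.chainComp nu G)) {ls : List Layer}
    (hls : Uncrossed ls (S.eval t).rootUnary) (hG : ∀ L ∈ ls, L.letter.1 ∈ G) :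
    ChainCommutes nu G S (ContextUnif.wrap ls t) := by
  have h2 : t.chainComp nu G = (t.chainSplit nu G).2 := by
    rw [Term.chainComp]
    grind
  have h3 := Tree.chainSplit_fst (nu := nu) (S.eval t)
  rcases hls with ⟨rfl, ho⟩ | ⟨a, l, hl, rfl, ho⟩
  · rw [ho] at h3
    rw [wrap_nil, ChainCommutes, h0, ← h2, ← h, Tree.chainComp]
    rcases hh : (S.eval t).chainSplit nu with ⟨_ | ⟨b, m⟩, d⟩
    · rfl
    · grind
  · have ha : a ∈ G := hG (.pow a l) (by simp)
    rw [← h3] at ho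
    rw [wrap_cons, wrap_nil, Layer.app, ChainCommutes, Subst.eval, Tree.chainSplit_iterate a l hl,
      Tree.addChain_of_ne ho, Term.chainSplit, if_pos ha]
    grind

/-- After the pops each maximal chain of the value is either explicit in the equation or inside the
value of one (context) variable, so compressing the value splits accordingly. The separated chain at
the top of a term has to be tracked in the induction because it may continue upwards. -/
theorem chainCommutes_sub (hu : ChainUncrossed V C S t) (ht : t.exps = [])
    (hG : ∀ a, (a, 1) ∈ t.letters → a ∈ G) (hV : ∀ x ∈ t.vars, ∀ L ∈ (V x).pre, L.letter.1 ∈ G)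
    (hC : ∀ X ∈ t.cvars, ∀ L ∈ (C X).pre ++ (C X).post, L.letter.1 ∈ G) :
    ChainCommutes nu G S (sub V C t) := by
  induction t with
  | hv x =>
    obtain ⟨h1, h2⟩ := hu.var x (by simp [vars])
    rw [sub, VTmpl.app, h1]
    exact ChainCommutes.wrap_of_comp (by simp [chainSplit])
      (by simp [Subst.eval, Subst.chainComp, chainComp, chainSplit, closeChain])
      (by simpa [Subst.eval] using h2) (hV x (by simp [vars]))
  | hc X t ih =>
    have h1 := ih ⟨by simpa only [vars] using hu.var,
        fun Y hY => hu.ctx Y (by simp [cvars, hY])⟩ (by simpa only [exps] using ht)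
      (by simpa only [letters] using hG) (by simpa only [vars] using hV)
      fun Y hY => hC Y (by simp [cvars, hY])
    obtain ⟨⟨o1, ho1⟩, ⟨o2, ho2⟩, h3⟩ := hu.ctx X (by simp [cvars])
    have hCX := hC X (by simp [cvars])
    have h2 := h1.wrap ho2 fun L hL => hCX L (mem_append_right _ hL)
    have hpre : ∀ L ∈ (C X).pre, L.letter.1 ∈ G := fun L hL => hCX L (mem_append_left _ hL)
    rw [sub, CTmpl.app]
    rcases hk : (C X).keep
    · exact h2.wrap ho1 hpre
    · obtain ⟨h4, h5, h6⟩ := h3 hk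
      refine ChainCommutes.wrap_of_comp (by simp [chainSplit]) ?_ ?_ hpre
      · have e : (Term.cvar X (wrap (C X).post (sub V C t))).chainComp nu G =
            .cvar X ((wrap (C X).post (sub V C t)).chainComp nu G) := by
          rw [chainComp, chainSplit]; rfl
        rw [cond_true, e, Subst.eval, Subst.eval, ← h2.comp, Tree.chainComp, Ctx.chainSplit_fill h4]
        · simp only [Subst.chainComp, Ctx.chainComp]
          rcases (S.ctx X).chainSplit nu with ⟨_ | ⟨b, m⟩, d⟩ <;> rfl
        · intro b hb
          rcases h6 with ⟨_, h6⟩ | ⟨a, l, hl, h7, h6⟩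
          · grind
          · rw [h7, wrap_cons, wrap_nil, Layer.app, Subst.eval]
            obtain ⟨l, rfl⟩ := Nat.exists_eq_add_of_le' hl
            rw [iterate_succ_apply', Tree.rootUnary_one, ← hb]
            grind
      · rw [cond_true, Subst.eval, Ctx.rootUnary_fill h4]
        exact h5
  | hn f ts ih =>
    have h1 : ∀ t ∈ ts, ChainCommutes nu G S (sub V C t) := by
      intro t hm
      have hmv : ∀ x ∈ t.vars, x ∈ (Term.node f ts).vars := fun x hx => by
        grind
      have hmc : ∀ x ∈ t.cvars, x ∈ (Term.node f ts).cvars := fun x hx => by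
        grind
      refine ih t hm ⟨fun x hx => hu.var x (hmv x hx), fun X hX => hu.ctx X (hmc X hX)⟩ ?_
        (fun a ha => hG a (mem_letters_node.2 (Or.inr ⟨t, hm, ha⟩)))
        (fun x hx => hV x (hmv x hx)) (fun X hX => hC X (hmc X hX))
      simp only [exps, flatten_eq_nil_iff, mem_map] at ht
      exact ht _ ⟨t, hm, rfl⟩
    rw [sub]
    rcases length_one_cases ts with ⟨t, rfl⟩ | h
    · exact (h1 t (by simp)).node (hG f (mem_letters_node.2 (Or.inl rfl)))
    · rw [ChainCommutes, Subst.eval, Tree.chainSplit_ne _ _ (by simpa using h),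
        chainSplit_ne _ _ _ _ (by simpa using h)]
      simp only [Subst.eval, map_map]
      congr 2
      exact map_congr_left fun t hm => (h1 t hm).comp
  | hp a l t ih => grind

end Chain

/-! ### Pair compression of ground terms and the uncrossing of partitions -/

section Pair

variable (nu : ℕ → ℕ → ℕ) (G1 G2 : Finset ℕ)

@[grind =] def Tree.consPair (a : ℕ) : Tree → Tree
  | .node b [s] => if a ∈ G1 ∧ b ∈ G2 then .node (nu a b) [s] else .node a [.node b [s]]
  | s => .node a [s]

/-- Pair compression of a ground term. -/
@[grind =] def Tree.pairComp : Tree → Tree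
  | .node a [t] => Tree.consPair nu G1 G2 a t.pairComp
  | .node f ts => .node f (ts.map pairComp)

@[grind =] def Ctx.consPair (a : ℕ) : Ctx → Ctx
  | .node b [] c [] =>
      if a ∈ G1 ∧ b ∈ G2 then .node (nu a b) [] c [] else .node a [] (.node b [] c []) []
  | c => .node a [] c []

/-- Pair compression of a ground context. -/
@[grind =] def Ctx.pairComp : Ctx → Ctx
  | .hole => .hole
  | .node f l c r => if l.length + r.length = 0 then Ctx.consPair nu G1 G2 f c.pairComp
      else .node f (l.map (Tree.pairComp nu G1 G2)) c.pairComp (r.map (Tree.pairComp nu G1 G2))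

def Subst.pairComp (S : Subst) : Subst :=
  ⟨fun x => (S.var x).pairComp nu G1 G2, fun X => (S.ctx X).pairComp nu G1 G2⟩

variable {nu G1 G2}

theorem Tree.pairComp_one (a : ℕ) (t : Tree) :
    (Tree.node a [t]).pairComp nu G1 G2 = Tree.consPair nu G1 G2 a (t.pairComp nu G1 G2) := by
  grind

theorem Tree.pairComp_ne (ts : List Tree) (h : ts.length ≠ 1) :
    (Tree.node f ts).pairComp nu G1 G2 = .node f (ts.map (Tree.pairComp nu G1 G2)) := by
  rcases ts with _ | ⟨t, _ | ⟨s, ts⟩⟩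
  · grind
  · simp at h
  · grind

theorem Tree.consPair_of_not {a : ℕ} {s : Tree}
    (h : ∀ b, s.rootUnary = some b → ¬ (a ∈ G1 ∧ b ∈ G2)) :
    Tree.consPair nu G1 G2 a s = .node a [s] := by
  rcases s with ⟨b, _ | ⟨t, _ | ⟨t', ts⟩⟩⟩
  · rfl
  · grind
  · rfl

theorem Tree.toTerm_pairComp (t : Tree) :
    t.toTerm.pairComp nu G1 G2 = (t.pairComp nu G1 G2).toTerm := by
  induction t with
  | h f ts ih =>
    rcases length_one_cases ts with ⟨t, rfl⟩ | h
    · rw [toTerm, map_singleton, Term.pairComp_one, pairComp_one, ih t (by simp)]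
      rcases t.pairComp nu G1 G2 with ⟨b, _ | ⟨t, _ | ⟨t', ts⟩⟩⟩
      · simp [toTerm, consPair, Term.consPair]
      · simp only [toTerm, consPair, Term.consPair, map_cons, map_nil]
        split_ifs <;> simp [toTerm]
      · simp [toTerm, consPair, Term.consPair]
    · rw [toTerm, Term.pairComp_ne _ _ (by simpa using h), pairComp_ne f ts h, toTerm]
      simp only [map_map]
      congr 1
      exact map_congr_left ih

theorem Tree.rootUnary_pairComp (hd : Disjoint G1 G2) (hnu : ∀ a b, nu a b ∉ G1 ∪ G2) (t : Tree)
    (b : ℕ) (hb : b ∈ G2) :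
    (t.pairComp nu G1 G2).rootUnary = some b ↔ t.rootUnary = some b := by
  rw [← rootUnary_toTerm, ← toTerm_pairComp, Term.rootUnary_pairComp hd hnu _ b hb,
    rootUnary_toTerm]

theorem Ctx.pairComp_ne_hole {c : Ctx} (h : c ≠ .hole) : c.pairComp nu G1 G2 ≠ .hole := by
  rcases c with _ | ⟨f, l, c, r⟩
  · grind
  · rw [pairComp]
    split_ifs
    · rcases c.pairComp nu G1 G2 with _ | ⟨g, _ | ⟨y, l'⟩, d, _ | ⟨z, r'⟩⟩ <;> simp only [consPair]
      · simp
      · grind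
      all_goals simp
    · simp

/-- The hypothesis `hb` excludes a covered pair whose first letter is above the hole and whose
second letter is below it. -/
theorem Ctx.pairComp_fill (hd : Disjoint G1 G2) (hnu : ∀ a b, nu a b ∉ G1 ∪ G2) (c : Ctx) (t : Tree)
    (hb : ∀ a ∈ G1, c.botUnary = some a → ∀ b ∈ G2, t.rootUnary ≠ some b) :
    (c.fill t).pairComp nu G1 G2 = (c.pairComp nu G1 G2).fill (t.pairComp nu G1 G2) := by
  induction c with
  | hole => rfl
  | node f l c r ih =>
    have h1 : (c.fill t).pairComp nu G1 G2 = (c.pairComp nu G1 G2).fill (t.pairComp nu G1 G2) := by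
      grind
    by_cases hl : l.length + r.length = 0
    · obtain ⟨rfl, rfl⟩ : l = [] ∧ r = [] := by
        constructor <;> apply eq_nil_of_length_eq_zero <;> omega
      rw [fill, nil_append, Tree.pairComp_one, h1, pairComp, if_pos (by simp)]
      by_cases hc : c = .hole
      · subst hc
        rw [pairComp, consPair, fill, fill, fill, Tree.consPair_of_not]
        · rfl
        · rintro b hb' ⟨hf, hb2⟩
          rw [Tree.rootUnary_pairComp hd hnu _ b hb2] at hb'
          grind
        grind
      · have := pairComp_ne_hole (nu := nu) (G1 := G1) (G2 := G2) hc
        generalize c.pairComp nu G1 G2 = d' at this ⊢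
        rcases d' with _ | ⟨g, _ | ⟨y, l'⟩, d, _ | ⟨z, r'⟩⟩
        · grind
        · grind
        · simp [fill, Tree.consPair, consPair]
        · cases l' <;> simp [fill, Tree.consPair, consPair]
        · cases l' <;> simp [fill, Tree.consPair, consPair]
    · rw [fill, Tree.pairComp_ne _ _ (by simp; omega), pairComp, if_neg hl]
      grind

/-- A pop of a letter of `G` leaves a value that does not cross. -/
@[grind =] def PairPop (G : Finset ℕ) (ls : List Layer) (o : Option ℕ) : Prop :=
  (ls = [] ∧ ∀ b ∈ G, o ≠ some b) ∨ ∃ b ∈ G, ls = [Layer.nd b [] []]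

/-- The templates uncross the partition. -/
structure PairUncrossed (G1 G2 : Finset ℕ) (V : ℕ → VTmpl) (C : ℕ → CTmpl) (S : Subst) (t : Term) :
    Prop where
  var : ∀ x ∈ t.vars, (V x).const = none ∧ PairPop G2 (V x).pre (S.var x).rootUnary
  ctx : ∀ X ∈ t.cvars, (∃ o, PairPop G2 (C X).pre o) ∧ (∃ o, PairPop G1 (C X).post o) ∧
    ((C X).keep = true → S.ctx X ≠ .hole ∧ PairPop G2 (C X).pre (S.ctx X).topUnary ∧
      PairPop G1 (C X).post (S.ctx X).botUnary)

def PairCommutes (nu : ℕ → ℕ → ℕ) (G1 G2 : Finset ℕ) (S : Subst) (t : Term) : Prop :=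
  (S.eval t).pairComp nu G1 G2 = (S.pairComp nu G1 G2).eval (t.pairComp nu G1 G2)

/-- A letter of `G` at the root of the value is explicit. -/
def RootExplicit (G : Finset ℕ) (S : Subst) (t : Term) : Prop :=
  ∀ b ∈ G, (S.eval t).rootUnary = some b → t.rootUnary = some b

variable {S : Subst}

/-- A letter `a` of `G1` forms a pair with its child in the value exactly when it does so in the
term, because a letter of `G2` below it is explicit. -/
theorem PairCommutes.node (hd : Disjoint G1 G2) (hnu : ∀ a b, nu a b ∉ G1 ∪ G2)
    {t : Term} (h : PairCommutes nu G1 G2 S t) {a : ℕ}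
    (hr : a ∈ G1 → RootExplicit G2 S t) : PairCommutes nu G1 G2 S (.node a [t]) := by
  rw [PairCommutes, Subst.eval, Term.pairComp_one, map_singleton, Tree.pairComp_one, h]
  rcases Term.consPair_cases nu G1 G2 a (t.pairComp nu G1 G2) with
    ⟨b, r, h1, ha, hb, h2⟩ | ⟨h3, h2⟩
  · grind
  · rw [h2, ← h, Tree.consPair_of_not, Subst.eval, map_singleton, ← h]
    rintro b hb ⟨ha, hb2⟩
    rw [Tree.rootUnary_pairComp hd hnu _ b hb2] at hb
    have := hr ha b hb2 hb
    obtain ⟨s, hs⟩ := Term.rootUnary_eq_some.1 ((Term.rootUnary_pairComp hd hnu t b hb2).2 this)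
    grind

theorem rootExplicit_node (S : Subst) (G : Finset ℕ) (f : ℕ) (ts : List Term) :
    RootExplicit G S (.node f ts) := by
  intro b _ hb
  rcases length_one_cases ts with ⟨t, rfl⟩ | h
  · grind
  · rw [Subst.eval, Tree.rootUnary_ne _ _ (by simpa using h)] at hb
    simp at hb

/-- Letters of `G2` have been popped up, so values start with a letter of `G2` only explicitly;
letters of `G1` have been popped down, so no pair leaves a context through its hole. The second
conjunct is needed to continue the induction at a letter of `G1`. -/
theorem pairCommutes_sub (hd : Disjoint G1 G2) (hnu : ∀ a b, nu a b ∉ G1 ∪ G2) (t : Term)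
    (hu : PairUncrossed G1 G2 V C S t) (ht : t.exps = []) :
    PairCommutes nu G1 G2 S (sub V C t) ∧ RootExplicit G2 S (sub V C t) := by
  have hpre : ∀ (ls : List Layer) (s : Term), PairPop G2 ls (S.eval s).rootUnary →
      PairCommutes nu G1 G2 S s →
      PairCommutes nu G1 G2 S (wrap ls s) ∧ RootExplicit G2 S (wrap ls s) := by
    rintro ls s (⟨rfl, h⟩ | ⟨b, hb, rfl⟩) hs
    · exact ⟨hs, fun b hb h' => absurd h' (h b hb)⟩
    · exact ⟨hs.node hd hnu fun h => absurd hb (Finset.disjoint_left.1 hd h),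
        rootExplicit_node _ _ _ _⟩
  induction t with
  | hv x =>
    obtain ⟨h1, h2⟩ := hu.var x (by simp [vars])
    rw [sub, VTmpl.app, h1]
    refine hpre _ _ (by simpa [Subst.eval] using h2) ?_
    simp [PairCommutes, Subst.eval, pairComp, Subst.pairComp]
  | hc X t ih =>
    obtain ⟨h1, h1'⟩ := ih ⟨by simpa only [vars] using hu.var,
        fun Y hY => hu.ctx Y (by simp [cvars, hY])⟩ (by simpa only [exps] using ht)
    obtain ⟨⟨o1, ho1⟩, ⟨o2, ho2⟩, h3⟩ := hu.ctx X (by simp [cvars])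
    have h2 : PairCommutes nu G1 G2 S (wrap (C X).post (sub V C t)) ∧
        RootExplicit G2 S (wrap (C X).post (sub V C t)) := by
      rcases ho2 with ⟨h, _⟩ | ⟨b, hb, h⟩
      · grind
      · rw [h]; exact ⟨h1.node hd hnu fun _ => h1', rootExplicit_node _ _ _ _⟩
    rw [sub, CTmpl.app]
    rcases hk : (C X).keep
    · grind
    · obtain ⟨h4, h5, h6⟩ := h3 hk
      refine hpre _ _ ?_ ?_
      · rw [cond_true, Subst.eval, Ctx.rootUnary_fill h4]
        exact h5
      · rw [cond_true, PairCommutes, Subst.eval, Ctx.pairComp_fill hd hnu, h2.1, pairComp,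
          Subst.eval]
        · rfl
        · intro a ha hbot b hb hr
          rcases h6 with ⟨_, h6⟩ | ⟨a', ha', h6⟩
          · grind
          · rw [h6, wrap_cons, wrap_nil, Layer.app] at hr
            simp only [map_nil, nil_append, Subst.eval, map_cons,
              Tree.rootUnary_one, Option.some.injEq] at hr
            exact Finset.disjoint_left.1 hd ha' (hr ▸ hb)
  | hn f ts ih =>
    have h1 : ∀ t ∈ ts, PairCommutes nu G1 G2 S (sub V C t) ∧ RootExplicit G2 S (sub V C t) := by
      intro t hm
      have hmv : ∀ x ∈ t.vars, x ∈ (Term.node f ts).vars := fun x hx => by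
        grind
      have hmc : ∀ x ∈ t.cvars, x ∈ (Term.node f ts).cvars := fun x hx => by
        grind
      refine ih t hm ⟨fun x hx => hu.var x (hmv x hx), fun X hX => hu.ctx X (hmc X hX)⟩ ?_
      simp only [exps, flatten_eq_nil_iff, mem_map] at ht
      exact ht _ ⟨t, hm, rfl⟩
    rw [sub]
    refine ⟨?_, rootExplicit_node _ _ _ _⟩
    rcases length_one_cases ts with ⟨t, rfl⟩ | h
    · exact (h1 t (by simp)).1.node hd hnu fun _ => (h1 t (by simp)).2
    · rw [PairCommutes, Subst.eval, Tree.pairComp_ne _ _ (by simpa using h),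
        pairComp_ne _ _ (by simpa using h), Subst.eval]
      simp only [map_map]
      congr 1
      exact map_congr_left fun t hm => (h1 t hm).1
  | hp a l t ih => grind

end Pair

/-! ### Leaf compression of ground terms and uncrossed father-leaf pairs -/

section Leaf

variable (nu : ℕ → List (Option ℕ) → ℕ) (G : Finset (ℕ × ℕ)) (G0 : Finset ℕ)

@[grind =] def Tree.constIn : Tree → Option ℕ
  | .node c [] => if c ∈ G0 then some c else none
  | _ => none

/-- Leaf compression of a ground term. -/
def Tree.leafComp : Tree → Tree
  | .node f ts =>
      if (f, ts.length) ∈ G ∧ ∃ t ∈ ts, (t.constIn G0).isSome then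
        .node (nu f (ts.map (Tree.constIn G0)))
          ((ts.map fun t => (t.constIn G0, leafComp t)).filterMap fun p =>
            if p.1.isSome then none else some p.2)
      else .node f (ts.map leafComp)

/-- Leaf compression of a ground context. -/
def Ctx.leafComp : Ctx → Ctx
  | .hole => .hole
  | .node f l c r =>
      if (f, l.length + 1 + r.length) ∈ G ∧ ∃ t ∈ l ++ r, (t.constIn G0).isSome then
        .node (nu f (l.map (Tree.constIn G0) ++ none :: r.map (Tree.constIn G0)))
          ((l.filter fun t => (t.constIn G0).isNone).map (Tree.leafComp nu G G0)) c.leafComp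
          ((r.filter fun t => (t.constIn G0).isNone).map (Tree.leafComp nu G G0))
      else .node f (l.map (Tree.leafComp nu G G0)) c.leafComp (r.map (Tree.leafComp nu G G0))

def Subst.leafComp (S : Subst) : Subst :=
  ⟨fun x => (S.var x).leafComp nu G G0, fun X => (S.ctx X).leafComp nu G G0⟩

variable {nu G G0}

theorem Tree.leafComp_absorb (f : ℕ) (ts : List Tree)
    (h : (f, ts.length) ∈ G ∧ ∃ t ∈ ts, (t.constIn G0).isSome) :
    (Tree.node f ts).leafComp nu G G0 = .node (nu f (ts.map (Tree.constIn G0)))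
      ((ts.filter fun t => (t.constIn G0).isNone).map (Tree.leafComp nu G G0)) := by
  rw [leafComp, if_pos h]
  congr 1
  clear h
  induction ts with
  | nil => rfl
  | cons t ts ih => rcases h : t.constIn G0 <;> simp_all

theorem Tree.leafComp_keep (f : ℕ) (ts : List Tree)
    (h : ¬ ((f, ts.length) ∈ G ∧ ∃ t ∈ ts, (t.constIn G0).isSome)) :
    (Tree.node f ts).leafComp nu G G0 = .node f (ts.map (Tree.leafComp nu G G0)) := by
  rw [leafComp, if_neg h]

theorem Tree.constIn_toTerm (t : Tree) : t.toTerm.constIn G0 = t.constIn G0 := by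
  rcases t with ⟨f, _ | ⟨t, ts⟩⟩ <;> simp [toTerm, Term.constIn, constIn]

theorem Tree.constIn_cons (f : ℕ) (ts : List Tree) (h : ts ≠ []) :
    (Tree.node f ts).constIn G0 = none := by
  rcases ts with _ | ⟨t, ts⟩
  · grind
  · rfl

theorem Tree.toTerm_leafComp (t : Tree) :
    t.toTerm.leafComp nu G G0 = (t.leafComp nu G G0).toTerm := by
  induction t with
  | h f ts ih =>
    rw [toTerm]
    have e : (∃ t ∈ ts.map toTerm, (t.constIn G0).isSome) ↔ ∃ t ∈ ts, (t.constIn G0).isSome := by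
      simp [constIn_toTerm]
    by_cases h : (f, ts.length) ∈ G ∧ ∃ t ∈ ts, (t.constIn G0).isSome
    · rw [Term.leafComp_absorb _ _ (by rw [e]; simpa using h), leafComp_absorb f ts h, toTerm]
      simp only [map_map, filter_map, Function.comp_def, constIn_toTerm]
      congr 1
      exact map_congr_left fun t ht => ih t (mem_filter.1 ht).1
    · rw [Term.leafComp_keep _ _ (by rw [e]; simpa using h), leafComp_keep f ts h, toTerm,
        map_map, map_map]
      congr 1
      exact map_congr_left ih

theorem Ctx.leafComp_ne_hole {c : Ctx} (h : c ≠ .hole) : c.leafComp nu G G0 ≠ .hole := by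
  rcases c with _ | ⟨f, l, c, r⟩
  · grind
  · rw [leafComp]; split_ifs <;> simp

theorem Ctx.constIn_fill {c : Ctx} (t : Tree) (h : c ≠ .hole ∨ t.constIn G0 = none) :
    (c.fill t).constIn G0 = none := by
  rcases c with _ | ⟨f, l, c, r⟩
  · grind
  · exact Tree.constIn_cons _ _ (by simp)

/-- If `t` is not an absorbable constant, neither is any context filled with `t`; so a node of `c`
absorbs exactly the constants beside the path to the hole. -/
theorem Ctx.leafComp_fill (c : Ctx) (t : Tree) (h : t.constIn G0 = none) :
    (c.fill t).leafComp nu G G0 = (c.leafComp nu G G0).fill (t.leafComp nu G G0) := by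
  induction c with
  | hole => rfl
  | node f l c r ih =>
    have h1 : (c.fill t).constIn G0 = none := Ctx.constIn_fill t (Or.inr h)
    have e1 : (l ++ c.fill t :: r).length = l.length + 1 + r.length := by simp; omega
    have e2 : (∃ s ∈ l ++ c.fill t :: r, (s.constIn G0).isSome) ↔
        ∃ s ∈ l ++ r, (s.constIn G0).isSome := by
      grind
    rw [fill, leafComp]
    split_ifs with hh
    · rw [Tree.leafComp_absorb _ _ (by rw [e1, e2]; exact hh)]
      grind
    · rw [Tree.leafComp_keep _ _ (by rw [e1, e2]; exact hh)]
      grind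

/-- Father-leaf pairs do not cross. -/
structure LeafUncrossed (G0 : Finset ℕ) (S : Subst) (t : Term) : Prop where
  var : ∀ x ∈ t.vars, (S.var x).constIn G0 = none
  ctx : ∀ X ∈ t.cvars, S.ctx X ≠ .hole ∧ ¬ t.AppliedToConst X G0

/-- The second conjunct carries the induction: whether a child is an absorbable constant can be read
off from the term. -/
theorem leafCommutes (t : Term) (hu : LeafUncrossed G0 S t) (ht : t.exps = []) :
    (S.eval t).leafComp nu G G0 = (S.leafComp nu G G0).eval (t.leafComp nu G G0) ∧
      (S.eval t).constIn G0 = t.constIn G0 := by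
  induction t with
  | hv x =>
    have := hu.var x (by simp [vars])
    simp [Subst.eval, leafComp, Subst.leafComp, this, constIn]
  | hc X t ih =>
    obtain ⟨h1, h2⟩ := hu.ctx X (by simp [cvars])
    simp only [Term.AppliedToConst, true_and, not_or] at h2
    obtain ⟨h3, h4⟩ := ih ⟨by simpa only [vars] using hu.var, fun Y hY => by
      obtain ⟨h5, h6⟩ := hu.ctx Y (by simp [cvars, hY])
      simp only [Term.AppliedToConst, not_or] at h6
      exact ⟨h5, h6.2⟩⟩ (by simpa only [exps] using ht)
    have h7 : t.constIn G0 = none := by simpa using h2.1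
    rw [h7] at h4
    refine ⟨?_, ?_⟩
    · rw [Subst.eval, Ctx.leafComp_fill _ _ h4, h3, leafComp, Subst.eval]
      rfl
    · rw [Subst.eval, Ctx.constIn_fill _ (Or.inl h1)]
      rfl
  | hn f ts ih =>
    have h1 : ∀ t ∈ ts, (S.eval t).leafComp nu G G0 =
        (S.leafComp nu G G0).eval (t.leafComp nu G G0) ∧ (S.eval t).constIn G0 = t.constIn G0 := by
      intro t hm
      have hmv : ∀ x ∈ t.vars, x ∈ (Term.node f ts).vars := fun x hx => by
        grind
      have hmc : ∀ x ∈ t.cvars, x ∈ (Term.node f ts).cvars := fun x hx => by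
        grind
      refine ih t hm ⟨fun x hx => hu.var x (hmv x hx), fun X hX => ?_⟩ ?_
      · obtain ⟨h5, h6⟩ := hu.ctx X (hmc X hX)
        grind
      · simp only [exps, flatten_eq_nil_iff, mem_map] at ht
        exact ht _ ⟨t, hm, rfl⟩
    constructor
    · have e : (∃ t ∈ ts.map S.eval, (t.constIn G0).isSome) ↔ ∃ t ∈ ts, (t.constIn G0).isSome := by
        grind
      rw [Subst.eval]
      by_cases h : (f, ts.length) ∈ G ∧ ∃ t ∈ ts, (t.constIn G0).isSome
      · rw [leafComp_absorb f ts h, Tree.leafComp_absorb _ _ (by rw [e]; simpa using h),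
          Subst.eval, map_map, map_map, filter_map, map_map]
        have e1 : ts.map (Tree.constIn G0 ∘ S.eval) = ts.map (constIn G0) :=
          map_congr_left fun t ht => (h1 t ht).2
        have e2 : ts.filter ((fun t => (t.constIn G0).isNone) ∘ S.eval) =
            ts.filter fun t => (t.constIn G0).isNone :=
          filter_congr fun t ht => by simp [(h1 t ht).2]
        rw [e1, e2]
        congr 1
        exact map_congr_left fun t ht => (h1 t (mem_filter.1 ht).1).1
      · rw [leafComp_keep f ts h, Tree.leafComp_keep _ _ (by rw [e]; simpa using h),
          Subst.eval, map_map, map_map]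
        congr 1
        exact map_congr_left fun t ht => (h1 t ht).1
    · rcases ts with _ | ⟨t, ts⟩ <;> simp [Subst.eval, Tree.constIn, constIn]
  | hp a l t ih => grind

end Leaf

/-! ### Minimal solutions -/

theorem Hom.weight_tree_eq (H : Hom)
    (h : ∀ f ts, (H.node f ts).weight w = w' (f, ts.length) + (ts.map (Tree.weight w)).sum)
    (t : Tree) : (H.tree t).weight w = t.weight w' := by
  induction t with
  | h f ts ih =>
    rw [Hom.tree, h, Tree.weight_node, length_map, map_map]
    congr 2
    exact map_congr_left ih

/-! ### The chain stage -/

theorem Tree.numConsts_toTerm (t : Tree) :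
    t.toTerm.numConsts = t.weight fun q => if q.2 = 0 then 1 else 0 := by
  induction t with
  | h f ts ih =>
    rw [toTerm, Term.numConsts_node, weight_node, length_map, map_map, add_comm]
    congr 2
    exact map_congr_left ih

theorem Subst.all_of_eval (h : (S.eval t).All p) :
    (∀ x ∈ t.vars, (S.var x).All p) ∧ ∀ X ∈ t.cvars, (S.ctx X).All p := by
  induction t with
  | hv x => grind
  | hc X t ih =>
    rw [Subst.eval, Ctx.all_fill] at h
    grind
  | hn f ts ih =>
    grind
  | hp a l t ih =>
    rw [Subst.eval] at h
    have : (S.eval t).All p := by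
      induction l with
      | zero => exact h
      | succ l ih2 =>
        rw [iterate_succ_apply', Tree.all_node] at h
        grind
    grind

/-! ### Foreign letters and solutions of minimal weight -/

theorem Tree.all_of_weight_eq_zero (t : Tree) (h : t.weight w = 0) : t.All fun q => w q = 0 := by
  induction t with
  | h f ts ih =>
    rw [weight_node, Nat.add_eq_zero_iff, sum_eq_zero_iff] at h
    exact all_node.2 ⟨h.1, fun t ht => ih t ht (h.2 _ (mem_map_of_mem ht))⟩

open Classical in
/-- Delete the unary letters foreign to the equation and rename the other foreign letters. -/
noncomputable def normHom (e : Eqn) (g : ℕ) : Hom := Hom.ofPattern fun f m =>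
  if (f, m) ∈ e.letters then some (f, List.replicate m none)
  else if m = 1 then none else some (g, List.replicate m none)

section Norm

variable {e : Eqn} {g : ℕ}

theorem normHom_old {f : ℕ} {ts : List Tree} (h : (f, ts.length) ∈ e.letters) :
    (normHom e g).node f ts = .node f ts := by
  rw [normHom, Hom.ofPattern_some (by rw [if_pos h]), weave_replicate]

theorem normHom_unary {f : ℕ} {t : Tree} (h : (f, 1) ∉ e.letters) :
    (normHom e g).node f [t] = t := by
  rw [normHom, Hom.ofPattern_none (by rw [if_neg h, if_pos rfl])]

theorem normHom_new {f : ℕ} {ts : List Tree} (h : (f, ts.length) ∉ e.letters)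
    (h1 : ts.length ≠ 1) : (normHom e g).node f ts = .node g ts := by
  rw [normHom, Hom.ofPattern_some (by rw [if_neg h, if_neg h1]), weave_replicate]

theorem normHom_cases (e : Eqn) (g f : ℕ) (ts : List Tree) :
    ((f, ts.length) ∈ e.letters ∧ (normHom e g).node f ts = .node f ts) ∨
    ((f, ts.length) ∉ e.letters ∧ ∃ t, ts = [t] ∧ (normHom e g).node f ts = t) ∨
    ((f, ts.length) ∉ e.letters ∧ ts.length ≠ 1 ∧ (normHom e g).node f ts = .node g ts) := by
  by_cases h : (f, ts.length) ∈ e.letters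
  · exact Or.inl ⟨h, normHom_old h⟩
  · rcases length_one_cases ts with ⟨t, rfl⟩ | h1
    · exact Or.inr (Or.inl ⟨h, t, rfl, normHom_unary h⟩)
    · exact Or.inr (Or.inr ⟨h, h1, normHom_new h h1⟩)

theorem eval_normHom {t : Term} (ht : ∀ q ∈ t.letters, q ∈ e.letters) :
    ((normHom e g).subst S).eval t = (normHom e g).tree (S.eval t) := by
  rw [Hom.tree_eval, Hom.eval_eq_of_trivial]
  intro q hq ts hts
  exact normHom_old (by rw [hts]; exact ht q hq)

theorem Solves.norm (h : Solves k e S) (g : ℕ) :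
    Solves k e ((normHom e g).subst S) := by
  refine Solves.hom _ h ?_ ?_ ?_
  · intro f ts hl hts
    rcases normHom_cases e g f ts with ⟨_, h⟩ | ⟨_, t, rfl, h⟩ | ⟨_, _, h⟩
    · grind
    · grind
    · grind
  all_goals
    rw [Hom.eval_eq_of_trivial]
    intro q hq ts hts
    exact normHom_old (by rw [hts, Eqn.mem_letters]; simp [hq])

theorem normHom_all (t : Tree) : ((normHom e g).tree t).All fun q =>
    q ∈ e.letters ∨ q.1 = g ∧ q.2 ≠ 1 := by
  refine Hom.all_tree (p := fun _ => True) _ ?_ ?_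
  · intro f ts _ hts
    rcases normHom_cases e g f ts with ⟨h1, h⟩ | ⟨_, t, rfl, h⟩ | ⟨_, h1, h⟩
    · grind
    · grind
    · grind
  · rw [Tree.all_iff_toTerm]; simp

-- Foreign letters and the letters named `g` have weight 1, so renaming is free, and each deleted
-- foreign unary letter gains 1.
open Classical in
theorem normHom_weight (hw : ∀ q, 1 ≤ w q) (hoff : ∀ q ∉ e.letters, w q = 1)
    (hg : ∀ m, (g, m) ∉ e.letters) (t : Tree) : ((normHom e g).tree t).weight w +
      t.weight (fun q => if q ∉ e.letters ∧ q.2 = 1 then 1 else 0) ≤ t.weight w := by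
  have : ((normHom e g).tree t).weight w ≤
      t.weight fun q => w q - if q ∉ e.letters ∧ q.2 = 1 then 1 else 0 := by
    refine Hom.weight_tree_le (p := fun _ => True) _ ?_ (by rw [Tree.all_iff_toTerm]; simp)
    intro f ts _
    rcases normHom_cases e g f ts with ⟨h1, h⟩ | ⟨_, t, rfl, h⟩ | ⟨h1, h2, h⟩
    · grind
    · grind
    · grind
  calc _ ≤ _ := Nat.add_le_add_right this _
    _ = _ := by
      rw [← Tree.weight_add]
      congr 1
      grind

end Norm

/-- The invariant of the run: a solution that is minimal for the weight of the letters that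
counts the symbols of the original signature they stand for. -/
structure Good (k : ℕ) (e : Eqn) (S : Subst) (w : ℕ × ℕ → ℕ) : Prop where
  sol : Solves k e S
  ar : ∀ q ∈ e.letters, q.2 ≤ k
  pf : e.lhs.exps = [] ∧ e.rhs.exps = []
  ne : ∀ X ∈ e.cvarOcc, S.ctx X ≠ .hole
  one : ∀ q, 1 ≤ w q
  off : ∀ q ∉ e.letters, w q = 1
  min : ∀ T, Solves k e T → (S.eval e.lhs).weight w ≤ (T.eval e.lhs).weight w

theorem Eqn.exists_fresh (e : Eqn) : ∃ g, ∀ m, (g, m) ∉ e.letters := by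
  obtain ⟨g, hg⟩ := Infinite.exists_notMem_finset (e.letters.image Prod.fst)
  exact ⟨g, fun m hm => hg (Finset.mem_image_of_mem Prod.fst hm)⟩

/-- Deleting the foreign unary letters preserves solutions and lowers the weight, so a minimal
solution has none. Hence compressing only the unary letters of the equation compresses all unary
letters of the value. -/
theorem Good.unary (h : Good k e S w) : (S.eval e.lhs).All fun q => q.2 = 1 → q ∈ e.letters := by
  classical
  obtain ⟨g, hg⟩ := e.exists_fresh
  have h1 := h.min _ (h.sol.norm g)
  rw [eval_normHom fun q hq => Eqn.mem_letters.2 (Or.inl hq)] at h1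
  have h2 := normHom_weight h.one h.off hg (S.eval e.lhs)
  refine (Tree.all_of_weight_eq_zero _ (w := fun q => if q ∉ e.letters ∧ q.2 = 1 then 1 else 0)
    (by omega)).mono ?_
  grind

theorem Good.parts_all (h : Good k e S w) (hp : (S.eval e.lhs).All p) :
    (∀ x ∈ e.varOcc, (S.var x).All p) ∧ ∀ X ∈ e.cvarOcc, (S.ctx X).All p := by
  have h1 := Subst.all_of_eval _ hp
  rw [h.sol.2] at hp
  have h2 := Subst.all_of_eval _ hp
  grind

theorem normHom_size (t : Tree) : ((normHom e g).tree t).size ≤ t.size := by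
  rw [Tree.size_eq_weight, Tree.size_eq_weight]
  refine Hom.weight_tree_le (p := fun _ => True) _ ?_ (by rw [Tree.all_iff_toTerm]; simp)
  intro f ts _
  rcases normHom_cases e g f ts with ⟨h1, h⟩ | ⟨_, t, rfl, h⟩ | ⟨h1, h2, h⟩
  · grind
  · grind
  · grind

/-- All foreign letters of the value get the single name `g`, so that one new letter of each arity
is enough for the leaf compression. -/
theorem Good.normalize (h : Good k e S w) (hg : ∀ m, (g, m) ∉ e.letters) : ∃ S', Good k e S' w ∧
      (S'.eval e.lhs).All (fun q => q ∈ e.letters ∨ q.1 = g ∧ q.2 ≠ 1) ∧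
      (S'.eval e.lhs).size ≤ (S.eval e.lhs).size ∧
      (S'.eval e.lhs).toTerm.numConsts = (S.eval e.lhs).toTerm.numConsts := by
  classical
  have hl : ((normHom e g).subst S).eval e.lhs = (normHom e g).tree (S.eval e.lhs) :=
    eval_normHom fun q hq => Eqn.mem_letters.2 (Or.inl hq)
  refine ⟨(normHom e g).subst S, ⟨h.sol.norm g, h.ar, h.pf, ?_, h.one, h.off, ?_⟩, ?_, ?_, ?_⟩
  · intro X hX
    have h1 := (h.parts_all h.unary).2 X hX
    have h2 := h.ne X hX
    have hfill := Hom.tree_fill (normHom e g) (S.ctx X)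
    show (normHom e g).cx (S.ctx X) ≠ .hole
    intro hc
    rcases hcx : S.ctx X with _ | ⟨f, l, c, r⟩
    · grind
    · rw [hcx] at h1 hfill hc
      rw [hc] at hfill
      simp only [Ctx.All] at h1
      have hf := hfill (.node f [])
      simp only [Ctx.fill, Hom.tree] at hf
      have hs : ∀ (t : Tree) (ts : List Tree), t ∈ ts → t.size < (ts.map Tree.size).sum + 1 :=
        fun t ts ht => Nat.lt_succ_of_le (single_le_sum (by simp) _ (mem_map_of_mem ht))
      -- No node of the value of `X` is deleted, since its unary letters occur in the equation. If
      -- the context became the hole, then the image of the filled context would be the image of the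
      -- filling, which is a proper part of it.
      have key : ∀ f' (ts : List Tree), (ts.length = 1 → (f', 1) ∈ e.letters) →
          ((normHom e g).node f' ts).size = (ts.map Tree.size).sum + 1 := by
        intro f' ts hu
        rcases normHom_cases e g f' ts with ⟨h1, h⟩ | ⟨h1, t, rfl, h⟩ | ⟨h1, h2, h⟩
        · grind
        · grind
        · grind
      have h3 := key f ((l ++ c.fill (.node f []) :: r).map (normHom e g).tree) (by
        intro hlen
        have : l.length + 1 + r.length = 1 := by simp at hlen; omega
        have := h1.1 (by simpa using this)
        have e1 : l.length + 1 + r.length = 1 := by simp at hlen; omega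
        rwa [e1] at this)
      rw [hf] at h3
      have h4 : ((normHom e g).tree (c.fill (.node f []))).size <
          ((((l ++ c.fill (.node f []) :: r).map (normHom e g).tree)).map Tree.size).sum + 1 :=
        hs _ _ (mem_map_of_mem (by simp))
      rw [Hom.tree_fill] at h4
      have h5 : ∀ (d : Ctx) (t : Tree), t.size ≤ (d.fill t).size := by
        intro d t
        rw [Tree.size_eq_weight, Tree.size_eq_weight, Ctx.weight_fill]; omega
      grind
  · intro T hT
    refine le_trans ?_ (h.min T hT)
    rw [hl]
    have := normHom_weight h.one h.off hg (S.eval e.lhs)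
    omega
  · rw [hl]; exact normHom_all _
  · rw [hl]; exact normHom_size _
  · rw [hl, Tree.numConsts_toTerm, Tree.numConsts_toTerm]
    refine Hom.weight_tree_eq _ (fun f ts => ?_) _
    rcases normHom_cases e g f ts with ⟨_, h⟩ | ⟨_, t, rfl, h⟩ | ⟨_, _, h⟩ <;>
      simp [h, Tree.weight_node]

/-- Minimality is preserved if every solution of the new equation is decoded to a solution of
the old one of at most the same weight. -/
theorem Good.transfer {S' : Subst} (h : Good k e S w) (sol : Solves k e' S')
    (ar : ∀ q ∈ e'.letters, q.2 ≤ k) (pf : e'.lhs.exps = [] ∧ e'.rhs.exps = [])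
    (ne : ∀ X ∈ e'.cvarOcc, S'.ctx X ≠ .hole) (one : ∀ q, 1 ≤ w' q)
    (off : ∀ q ∉ e'.letters, w' q = 1) (hle : (S'.eval e'.lhs).weight w' ≤ (S.eval e.lhs).weight w)
    (hg : ∀ m, (g, m) ∉ e'.letters)
    (hdec : ∀ T', Solves k e' T' → (T'.eval e'.lhs).All (fun q => q ∈ e'.letters ∨ q.1 = g ∧ q.2 ≠
      1) → ∃ T, Solves k e T ∧ (T.eval e.lhs).weight w ≤ (T'.eval e'.lhs).weight w') :
    Good k e' S' w' := by
  classical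
  refine ⟨sol, ar, pf, ne, one, off, fun T hT => ?_⟩
  have hl : ((normHom e' g).subst T).eval e'.lhs = (normHom e' g).tree (T.eval e'.lhs) :=
    eval_normHom fun q hq => Eqn.mem_letters.2 (Or.inl hq)
  -- A competitor is normalized before it is decoded; then its only foreign letters are non-unary
  -- and named `g`, and on these the old and the new weight can be compared.
  obtain ⟨T1, h1, h2⟩ := hdec _ (hT.norm g) (by rw [hl]; exact normHom_all _)
  have h3 := normHom_weight one off hg (T.eval e'.lhs)
  have h4 := h.min T1 h1
  grind

theorem Solves.decode {T : Subst} (h : Solves k e' T) (hV : ∀ x, (V x).Letters fun p => p.2 ≤ k)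
    (hC : ∀ X, (C X).Letters fun p => p.2 ≤ k)
    (hall : ∀ f (ts : List Tree), ts.length ≤ k → (∀ t ∈ ts, t.All fun p => p.2 ≤ k) → (H.node f
      ts).All fun p => p.2 ≤ k) (hl : ∀ S : Subst, H.eval S e'.lhs = S.eval (sub V C e.lhs))
    (hr : ∀ S : Subst, H.eval S e'.rhs = S.eval (sub V C e.rhs)) :
    Solves k e (ContextUnif.pull V C (H.subst T)) ∧
      (ContextUnif.pull V C (H.subst T)).eval e.lhs = H.tree (T.eval e'.lhs) := by
  constructor
  · exact Solves.pull (Solves.hom (e := e.map (sub V C)) H h hall (hl _) (hr _)) hV hC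
  · rw [← eval_sub, ← hl, Hom.tree_eval]

/-! ### Symbolic exponents -/

/-- Interpret the exponents as indices of the values `z`. -/
@[grind =] def Term.inst (z : ℕ → ℕ) : Term → Term
  | .var x => .var x
  | .cvar X t => .cvar X (t.inst z)
  | .node f ts => .node f (ts.map (inst z))
  | .pow a i t => .pow a (z i) (t.inst z)

@[grind =] def Layer.inst (z : ℕ → ℕ) : Layer → Layer
  | .pow a i => .pow a (z i)
  | .nd f xs ys => .nd f xs ys

def VTmpl.inst (z : ℕ → ℕ) (v : VTmpl) : VTmpl := ⟨v.pre.map (Layer.inst z), v.const⟩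

def CTmpl.inst (z : ℕ → ℕ) (c : CTmpl) : CTmpl :=
  ⟨c.pre.map (Layer.inst z), c.keep, c.post.map (Layer.inst z)⟩

theorem inst_wrap (z : ℕ → ℕ) (ls : List Layer) (t : Term) :
    (wrap ls t).inst z = wrap (ls.map (Layer.inst z)) (t.inst z) := by
  have hz : ∀ zs : List ℕ, zs.map (inst z ∘ Term.var) = zs.map Term.var := by
    intro zs; simp [Function.comp_def, inst]
  induction ls with
  | nil => rfl
  | cons L ls ih =>
    rw [wrap_cons, map_cons, wrap_cons, ← ih]
    rcases L with ⟨a, l⟩ | ⟨f, xs, ys⟩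
    · grind
    · grind

theorem inst_sub (z : ℕ → ℕ) (V : ℕ → VTmpl) (C : ℕ → CTmpl) (t : Term) (ht : t.exps = []) :
    (sub V C t).inst z = sub (fun x => (V x).inst z) (fun X => (C X).inst z) t := by
  induction t with
  | hv x =>
    rw [sub, sub, VTmpl.app, VTmpl.app, inst_wrap]
    simp only [VTmpl.inst]
    rcases (V x).const <;> simp [inst]
  | hc X t ih =>
    have := ih (by simpa only [exps] using ht)
    rw [sub, sub, CTmpl.app, CTmpl.app, inst_wrap]
    simp only [CTmpl.inst]
    cases (C X).keep <;> simp [inst, inst_wrap, this]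
    all_goals rfl
  | hn f ts ih =>
    simp only [exps, flatten_eq_nil_iff, mem_map] at ht
    simp only [sub, inst, map_map]
    congr 1
    exact map_congr_left fun t hm => ih t hm (ht _ ⟨t, hm, rfl⟩)
  | hp a l t ih => grind

/-- A chain with a symbolic exponent: the letter and the list of the indices of its parts. -/
abbrev Form := ℕ × List ℕ

@[grind =] def symClose : Option Form × List Form → List Form
  | (none, L) => L
  | (some p, L) => p :: L

@[grind =] def symAdd (a i : ℕ) : Option Form × List Form → Option Form × List Form
  | (none, L) => (some (a, [i]), L)
  | (some (b, F), L) => if b = a then (some (a, i :: F), L) else (some (a, [i]), (b, F) :: L)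

/-- The maximal chains of a term, with symbolic exponents; the index `0` stands for a letter. -/
@[grind =] def Term.symSplit : Term → Option Form × List Form
  | .var _ => (none, [])
  | .cvar _ t => (none, symClose t.symSplit)
  | .node a [t] => symAdd a 0 t.symSplit
  | .node _ ts => (none, (ts.map fun t => symClose (symSplit t)).flatten)
  | .pow a i t => symAdd a i t.symSplit

def Term.forms (t : Term) : List Form := symClose t.symSplit

theorem Term.symSplit_one (a : ℕ) (t : Term) : (Term.node a [t]).symSplit = symAdd a 0 t.symSplit :=
    by
  grind

theorem Term.symSplit_ne (ts : List Term) (h : ts.length ≠ 1) :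
    (Term.node f ts).symSplit = (none, (ts.map forms).flatten) := by
  rcases ts with _ | ⟨t, _ | ⟨s, ts⟩⟩
  · grind
  · simp at h
  · simp only [symSplit]; rfl

@[grind =] def formVal (z : ℕ → ℕ) (F : List ℕ) : ℕ := (F.map z).sum

theorem mem_symClose {p : Form} {s : Option Form × List Form} :
    p ∈ symClose s ↔ s.1 = some p ∨ p ∈ s.2 := by
  rcases s with ⟨_ | q, L⟩
  · grind
  · grind

theorem symAdd_closed {a i : ℕ} {s : Option Form × List Form} {p : Form} (h : p ∈ s.2) :
    p ∈ (symAdd a i s).2 := by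
  rcases s with ⟨_ | ⟨b, F⟩, L⟩
  · exact h
  · grind

/-! ### Chain compression under two valuations of the exponents -/

section Relabel

variable {G : Finset ℕ} {z0 z : ℕ → ℕ} {nu nu' : ℕ → ℕ → ℕ} {R : Hom} {S : Subst}

/-- Corresponding states of the compression for two valuations. -/
structure Matches (z0 z : ℕ → ℕ) (R : Hom) (S : Subst) (p0 p : Option (ℕ × ℕ) × Term)
    (s : Option Form × List Form) : Prop where
  fst0 : p0.1 = s.1.map fun q => (q.1, formVal z0 q.2)
  fst : p.1 = s.1.map fun q => (q.1, formVal z q.2)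
  eval : R.eval S p0.2 = S.eval p.2

theorem Matches.close {p0 p : Option (ℕ × ℕ) × Term} {s : Option Form × List Form}
    (h : Matches z0 z R S p0 p s) (hR : ∀ q ∈ symClose s, ∀ t,
      R.node (nu q.1 (formVal z0 q.2)) [t] = .node (nu' q.1 (formVal z q.2)) [t]) :
    R.eval S (Term.closeChain nu p0) = S.eval (Term.closeChain nu' p) := by
  obtain ⟨h1, h2, h3⟩ := h
  rcases p0 with ⟨o0, t0⟩
  rcases p with ⟨o, t⟩
  rcases s with ⟨_ | ⟨b, F⟩, L⟩
  · grind
  · simp only [Option.map_some] at h1 h2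
    subst h1 h2
    simp only [Term.closeChain, Hom.eval, Subst.eval, map_cons, map_nil]
    rw [hR (b, F) (by simp [symClose]), h3]

theorem Matches.add {p0 p : Option (ℕ × ℕ) × Term} {s : Option Form × List Form}
    (h : Matches z0 z R S p0 p s) (a i : ℕ) (hR : ∀ q ∈ (symAdd a i s).2, ∀ t,
      R.node (nu q.1 (formVal z0 q.2)) [t] = .node (nu' q.1 (formVal z q.2)) [t]) :
    Matches z0 z R S (Term.addChain nu a (z0 i) p0) (Term.addChain nu' a (z i) p)
      (symAdd a i s) := by
  obtain ⟨h1, h2, h3⟩ := h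
  rcases p0 with ⟨o0, t0⟩
  rcases p with ⟨o, t⟩
  rcases s with ⟨_ | ⟨b, F⟩, L⟩
  · simp only [Option.map_none] at h1 h2
    subst h1 h2
    exact ⟨by simp [Term.addChain, symAdd, formVal], by simp [Term.addChain, symAdd, formVal], h3⟩
  · simp only [Option.map_some] at h1 h2
    subst h1 h2
    by_cases hab : b = a
    · simp only [Term.addChain, symAdd, hab, if_true]
      exact ⟨by simp [formVal], by simp [formVal], h3⟩
    · simp only [symAdd, hab, if_false] at hR
      simp only [Term.addChain, symAdd, hab, if_false]
      refine ⟨by simp [formVal], by simp [formVal], ?_⟩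
      simp only [Hom.eval, Subst.eval, map_cons, map_nil]
      rw [hR (b, F) (by simp), h3]

/-- Which chains are merged depends on the letters and not on the exponents. So the compressed terms
for two valuations have the same shape, and a renaming `R` of the chain letters turns one into the
other. -/
theorem matches_chainSplit (hz0 : z0 0 = 1) (hz : z 0 = 1)
    (hR1 : ∀ f (ts : List Tree), ts.length ≠ 1 → R.node f ts = .node f ts) (t : Term)
    (hG : ∀ a, (a, 1) ∈ t.letters → a ∈ G)
    (hR : ∀ q ∈ t.symSplit.2, ∀ s,
      R.node (nu q.1 (formVal z0 q.2)) [s] = .node (nu' q.1 (formVal z q.2)) [s]) :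
    Matches z0 z R S ((t.inst z0).chainSplit nu G) ((t.inst z).chainSplit nu' G) t.symSplit := by
  induction t with
  | hv x => exact ⟨by simp [inst, chainSplit, symSplit], by simp [inst, chainSplit, symSplit],
      by simp [inst, chainSplit, Hom.eval, Subst.eval]⟩
  | hc X t ih =>
    simp only [symSplit] at hR
    have := (ih (by simpa only [letters] using hG)
      fun q hq => hR q (mem_symClose.2 (Or.inr hq))).close hR
    refine ⟨by simp [inst, chainSplit, symSplit], by simp [inst, chainSplit, symSplit], ?_⟩
    grind
  | hn f ts ih =>
    have hG' : ∀ t ∈ ts, ∀ a, (a, 1) ∈ t.letters → a ∈ G :=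
      fun t ht a ha => hG a (mem_letters_node.2 (Or.inr ⟨t, ht, ha⟩))
    rcases length_one_cases ts with ⟨t, rfl⟩ | h
    · have hf : f ∈ G := hG f (mem_letters_node.2 (Or.inl rfl))
      rw [symSplit_one] at hR
      have := (ih t (by simp) (hG' t (by simp)) fun q hq => hR q (symAdd_closed hq)).add f 0 hR
      grind
    · rw [symSplit_ne f ts h] at hR
      simp only [inst]
      rw [chainSplit_ne _ _ _ _ (by simpa using h), chainSplit_ne _ _ _ _ (by simpa using h),
        symSplit_ne f ts h]
      refine ⟨rfl, rfl, ?_⟩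
      simp only [Hom.eval, Subst.eval, map_map]
      rw [hR1 _ _ (by simpa using h)]
      congr 1
      refine map_congr_left fun t ht => ?_
      have hR' : ∀ q ∈ t.forms, ∀ s,
          R.node (nu q.1 (formVal z0 q.2)) [s] = .node (nu' q.1 (formVal z q.2)) [s] :=
        fun q hq => hR q (mem_flatten.2 ⟨_, mem_map_of_mem ht, hq⟩)
      exact (ih t ht (hG' t ht) fun q hq => hR' q (mem_symClose.2 (Or.inr hq))).close hR'
  | hp a i t ih =>
    have ha : a ∈ G := hG a (by simp [letters])
    simp only [symSplit] at hR
    simp only [inst, chainSplit, ha, if_true, symSplit]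
    exact (ih (fun b hb => hG b (by simp [letters, hb]))
      fun q hq => hR q (symAdd_closed hq)).add a i hR

/-- This is how a solution for the true exponents becomes one for small exponents. The renaming `R`
is well defined as soon as chains that were equal remain equal. -/
theorem eval_relabel (hz0 : z0 0 = 1) (hz : z 0 = 1)
    (hR1 : ∀ f (ts : List Tree), ts.length ≠ 1 → R.node f ts = .node f ts) (t : Term)
    (hG : ∀ a, (a, 1) ∈ t.letters → a ∈ G)
    (hR : ∀ q ∈ t.forms, ∀ s,
      R.node (nu q.1 (formVal z0 q.2)) [s] = .node (nu' q.1 (formVal z q.2)) [s]) :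
    R.eval S ((t.inst z0).chainComp nu G) = S.eval ((t.inst z).chainComp nu' G) :=
  (matches_chainSplit hz0 hz hR1 t hG fun q hq => hR q (mem_symClose.2 (Or.inr hq))).close hR

end Relabel

theorem symAdd_length (a i : ℕ) (s : Option Form × List Form) :
    ((symClose (symAdd a i s)).map fun p => p.2.length).sum =
      ((symClose s).map fun p => p.2.length).sum + 1 := by
  rcases s with ⟨_ | ⟨b, F⟩, L⟩
  · grind
  · grind

theorem symAdd_ne_nil {a i : ℕ} {s : Option Form × List Form} (h : ∀ p ∈ symClose s, p.2 ≠ []) :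
    ∀ p ∈ symClose (symAdd a i s), p.2 ≠ [] := by
  rcases s with ⟨_ | ⟨b, F⟩, L⟩
  · grind
  · grind

theorem Term.forms_spec : (t.forms.map fun p => p.2.length).sum ≤ t.size ∧
    ∀ p ∈ t.forms, p.2 ≠ [] := by
  induction t with
  | hv x => simp [forms, symSplit, symClose]
  | hc X t ih =>
    have e : (Term.cvar X t).forms = t.forms := by simp only [forms, symSplit]; rfl
    grind
  | hn f ts ih =>
    rcases length_one_cases ts with ⟨t, rfl⟩ | h
    · obtain ⟨h1, h2⟩ := ih t (by simp)
      rw [forms, symSplit_one]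
      refine ⟨?_, symAdd_ne_nil h2⟩
      rw [symAdd_length]
      simpa [size, forms] using h1
    · rw [forms, symSplit_ne f ts h]
      simp only [symClose]
      constructor
      · rw [map_flatten, sum_flatten, map_map, map_map, size]
        refine le_trans ?_ (Nat.le_succ _)
        exact sum_le_sum fun t ht => (ih t ht).1
      · grind
  | hp a i t ih =>
    rw [forms, symSplit, size]
    refine ⟨?_, symAdd_ne_nil ih.2⟩
    rw [symAdd_length]
    exact Nat.succ_le_succ ih.1

theorem mem_letters_addChain {a l : ℕ} {p : Option (ℕ × ℕ) × Term} {q : ℕ × ℕ}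
    (h : q ∈ (addChain nu a l p).2.letters) :
    q ∈ p.2.letters ∨ ∃ b m, b ≠ a ∧ p.1 = some (b, m) ∧ q = (nu b m, 1) := by
  rcases p with ⟨_ | ⟨b, m⟩, s⟩
  · grind
  · grind

theorem chainSplit_inst_fst (hz : z 0 = 1) (t : Term) (hG : ∀ a, (a, 1) ∈ t.letters → a ∈ G) :
    ((t.inst z).chainSplit nu G).1 = t.symSplit.1.map fun q => (q.1, formVal z q.2) := by
  have key : ∀ (a i : ℕ) (p : Option (ℕ × ℕ) × Term) (s : Option Form × List Form),
      p.1 = (s.1.map fun q => (q.1, formVal z q.2)) →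
      (addChain nu a (z i) p).1 = (symAdd a i s).1.map fun q => (q.1, formVal z q.2) := by
    rintro a i ⟨o, p⟩ ⟨_ | ⟨b, F⟩, L⟩ h
    · grind
    · grind
  induction t with
  | hv x => grind
  | hc X t ih => grind
  | hn f ts ih =>
    rcases length_one_cases ts with ⟨t, rfl⟩ | h
    · grind
    · simp only [inst]
      rw [chainSplit_ne _ _ _ _ (by simpa using h), symSplit_ne f ts h]
      rfl
  | hp a i t ih =>
    grind

/-- The new unary letters come from finitely many forms, whose number is at most the size; so only
these patterns need small names. -/
theorem mem_letters_chainComp_inst (hz : z 0 = 1) (t : Term) (hG : ∀ a, (a, 1) ∈ t.letters → a ∈ G)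
    :
    ∀ q ∈ ((t.inst z).chainComp nu G).letters, (q ∈ t.letters ∧ q.2 ≠ 1) ∨
      ∃ p ∈ t.forms, q = (nu p.1 (formVal z p.2), 1) := by
  have close : ∀ t : Term, (∀ a, (a, 1) ∈ t.letters → a ∈ G) →
      (∀ q ∈ ((t.inst z).chainSplit nu G).2.letters, (q ∈ t.letters ∧ q.2 ≠ 1) ∨
        ∃ p ∈ t.symSplit.2, q = (nu p.1 (formVal z p.2), 1)) →
      ∀ q ∈ ((t.inst z).chainComp nu G).letters, (q ∈ t.letters ∧ q.2 ≠ 1) ∨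
        ∃ p ∈ t.forms, q = (nu p.1 (formVal z p.2), 1) := by
    intro t hG h q hq
    rcases mem_letters_closeChain.1 hq with hq | ⟨a, l, h1, rfl⟩
    · exact (h q hq).imp id fun ⟨p, h1, h2⟩ => ⟨p, mem_symClose.2 (Or.inr h1), h2⟩
    · rw [chainSplit_inst_fst hz t hG, Option.map_eq_some_iff] at h1
      obtain ⟨p, h1, h2⟩ := h1
      refine Or.inr ⟨p, mem_symClose.2 (Or.inl h1), ?_⟩
      grind
  have key : ∀ (a i : ℕ) (t : Term), (∀ a, (a, 1) ∈ t.letters → a ∈ G) →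
      (∀ q ∈ ((t.inst z).chainSplit nu G).2.letters, (q ∈ t.letters ∧ q.2 ≠ 1) ∨
        ∃ p ∈ t.symSplit.2, q = (nu p.1 (formVal z p.2), 1)) →
      ∀ q ∈ (addChain nu a (z i) ((t.inst z).chainSplit nu G)).2.letters,
        (q ∈ t.letters ∧ q.2 ≠ 1) ∨
        ∃ p ∈ (symAdd a i t.symSplit).2, q = (nu p.1 (formVal z p.2), 1) := by
    intro a i t hG h q hq
    rcases mem_letters_addChain hq with hq | ⟨b, m, hb, h1, rfl⟩
    · exact (h q hq).imp id fun ⟨p, h1, h2⟩ => ⟨p, symAdd_closed h1, h2⟩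
    · rw [chainSplit_inst_fst hz t hG, Option.map_eq_some_iff] at h1
      obtain ⟨⟨b', F⟩, h1, h2⟩ := h1
      simp only [Prod.mk.injEq] at h2
      refine Or.inr ⟨(b', F), ?_, by rw [h2.1, h2.2]⟩
      grind
  refine close t hG ?_
  induction t with
  | hv x => grind
  | hc X t ih =>
    have hG' : ∀ a, (a, 1) ∈ t.letters → a ∈ G := by simpa only [letters] using hG
    have := close t hG' (ih hG')
    simpa only [inst, chainSplit, letters, symSplit, forms, chainComp] using this
  | hn f ts ih =>
    have hG' : ∀ t ∈ ts, ∀ a, (a, 1) ∈ t.letters → a ∈ G :=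
      fun t ht a ha => hG a (mem_letters_node.2 (Or.inr ⟨t, ht, ha⟩))
    rcases length_one_cases ts with ⟨t, rfl⟩ | h
    · have hf : f ∈ G := hG f (mem_letters_node.2 (Or.inl rfl))
      simp only [inst, map_cons, map_nil]
      rw [chainSplit_one _ _ _ _ hf, symSplit_one, ← hz]
      intro q hq
      refine (key f 0 t (hG' t (by simp)) (ih t (by simp) (hG' t (by simp))) q hq).imp
        (fun h => ⟨mem_letters_node.2 (Or.inr ⟨t, by simp, h.1⟩), by rw [hz]; exact h.2⟩) ?_
      grind
    · simp only [inst]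
      rw [chainSplit_ne _ _ _ _ (by simpa using h), symSplit_ne f ts h]
      intro q hq
      rcases mem_letters_node.1 hq with rfl | ⟨s, hs, hq⟩
      · grind
      · rw [map_map] at hs
        obtain ⟨t, ht, rfl⟩ := mem_map.1 hs
        refine (close t (hG' t ht) (ih t ht (hG' t ht)) q hq).imp
          (fun h => ⟨mem_letters_node.2 (Or.inr ⟨t, ht, h.1⟩), h.2⟩) fun ⟨p, h1, h2⟩ => ⟨p, ?_, h2⟩
        grind
  | hp a i t ih =>
    grind

/-! ### Small exponents -/

theorem formVal_eq_sum {d : ℕ} (z : ℕ → ℕ) (F : List ℕ) (hF : ∀ i ∈ F, i < d) :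
    formVal z F = ∑ j : Fin d, F.count j.1 * z j := by
  induction F with
  | nil => simp [formVal]
  | cons i F ih =>
    have h1 := ih fun j hj => hF j (by simp [hj])
    have hi : i < d := hF i (by simp)
    simp only [formVal, map_cons, sum_cons, count_cons] at h1 ⊢
    simp only [add_mul, Finset.sum_add_distrib]
    rw [h1, add_comm]
    congr 1
    rw [Finset.sum_eq_single (⟨i, hi⟩ : Fin d)]
    · simp
    · intro j _ hj
      have : ¬ i = j.1 := fun h => hj (Fin.ext h.symm)
      simp [this]
    · simp

theorem formVal_pos (hz : ∀ i, 1 ≤ z i) {F : List ℕ} (hF : F ≠ []) : 1 ≤ formVal z F := by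
  rcases F with _ | ⟨i, F⟩
  · exact absurd rfl hF
  · have := hz i
    simp only [formVal, map_cons, sum_cons]; omega

/-- Linearity, applied to two valuations that are symmetric about `z`. -/
theorem formVal_add {z1 z2 : ℕ → ℕ} {F : List ℕ} (h : ∀ i ∈ F, z1 i + z2 i = 2 * z i) :
    formVal z1 F + formVal z2 F = 2 * formVal z F := by
  simp only [formVal]
  rw [← sum_map_add, ← sum_map_mul_left]
  exact congrArg _ (map_congr_left h)

/-- The weight of a compressed ground term in which the chain coded by `(a, l)` gets the
length `φ a l`. -/
def chainWeight (w : ℕ × ℕ → ℕ) (φ : ℕ → ℕ → ℕ) (q : ℕ × ℕ) : ℕ :=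
  if q.2 = 1 then w (q.1.unpair.1, 1) * φ q.1.unpair.1 q.1.unpair.2 else w q

/-- The representative of a class of forms of equal value is a shortest one, so that each equation
of the linear system has norm at most twice the length of its own form. -/
theorem exists_shortest (L : List Form) (z0 : ℕ → ℕ) (a l : ℕ)
    (h : ∃ p ∈ L, p.1 = a ∧ formVal z0 p.2 = l) : ∃ p ∈ L, (p.1 = a ∧ formVal z0 p.2 = l) ∧
      ∀ p' ∈ L, p'.1 = a ∧ formVal z0 p'.2 = l → p.2.length ≤ p'.2.length := by
  classical
  obtain ⟨p, hp, h1⟩ := h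
  obtain ⟨q, hq, h2⟩ := Finset.exists_min_image
    (L.toFinset.filter fun p => p.1 = a ∧ formVal z0 p.2 = l) (fun p => p.2.length)
    ⟨p, by simp [hp, h1]⟩
  simp only [Finset.mem_filter, mem_toFinset] at hq h2
  exact ⟨q, hq.1, hq.2, fun p' h3 h4 => h2 p' ⟨h3, h4⟩⟩

open Classical in
/-- The values of the chains under the valuation `z`, where `rep` represents the forms of equal
value. -/
noncomputable def chainValue (L : List Form) (z0 : ℕ → ℕ) (z : ℕ → ℕ) (a l : ℕ) : ℕ :=
  if h : ∃ p ∈ L, p.1 = a ∧ formVal z0 p.2 = l then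
    formVal z (exists_shortest L z0 a l h).choose.2 else l

/-- In the application `τ` is the value compressed with the true exponents `z0`, the letter
`Nat.pair a l` coding the chain `a^l`. Forms with the same letter and the same value under `z0` must
keep equal values; this is a homogeneous linear system, and `φ` is the induced change of lengths.
The weight of `τ` is affine in the valuation. The positive solutions of least weight are closed
under small shifts, so `exists_small_solution` finds a small one among them. -/
theorem exists_small_valuation (L : List Form) (hL : ∀ p ∈ L, p.2 ≠ []) {z0 : ℕ → ℕ}
    (hz0 : ∀ i, 1 ≤ z0 i) (h00 : z0 0 = 1) (τ : Tree) (w : ℕ × ℕ → ℕ) :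
    ∃ z : ℕ → ℕ, (∀ i, 1 ≤ z i) ∧ z 0 = 1 ∧ (∀ i, z i ≤ 2 ^ (8 * (L.map fun p => p.2.length).sum)) ∧
      ∃ φ : ℕ → ℕ → ℕ, (∀ p ∈ L, φ p.1 (formVal z0 p.2) = formVal z p.2) ∧
        (∀ a l, 1 ≤ l → 1 ≤ φ a l) ∧
        τ.weight (chainWeight w φ) ≤ τ.weight (chainWeight w fun _ l => l) := by
  classical
  obtain ⟨d, hd0, hd⟩ : ∃ d, 0 < d ∧ ∀ p ∈ L, ∀ i ∈ p.2, i < d := by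
    refine ⟨(L.map fun p => p.2.sum).sum + 1, by omega, fun p hp i hi => ?_⟩
    have h1 : i ≤ p.2.sum := single_le_sum (by simp) _ hi
    have h2 : p.2.sum ≤ (L.map fun p => p.2.sum).sum :=
      single_le_sum (by simp) _ (mem_map_of_mem hp)
    omega
  have hex : ∀ p ∈ L, ∃ p' ∈ L, p'.1 = p.1 ∧ formVal z0 p'.2 = formVal z0 p.2 :=
    fun p hp => ⟨p, hp, rfl, rfl⟩
  set rep : Form → Form := fun p => if h : ∃ p' ∈ L, p'.1 = p.1 ∧ formVal z0 p'.2 = formVal z0 p.2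
    then (exists_shortest L z0 p.1 (formVal z0 p.2) h).choose else p with hrep
  have hrep1 : ∀ p ∈ L, rep p ∈ L ∧ (rep p).2.length ≤ p.2.length ∧
      ∀ z, chainValue L z0 z p.1 (formVal z0 p.2) = formVal z (rep p).2 := by
    intro p hp
    have h := (exists_shortest L z0 p.1 (formVal z0 p.2) (hex p hp)).choose_spec
    simp only [hrep, dif_pos (hex p hp), chainValue]
    exact ⟨h.1, h.2.2 p hp ⟨rfl, rfl⟩, fun _ => trivial⟩
  have hval0 : ∀ a l, chainValue L z0 z0 a l = l := by
    intro a l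
    rw [chainValue]
    split_ifs with h
    · exact (exists_shortest L z0 a l h).choose_spec.2.1.2
    · rfl
  have hcv : ∀ a l, (∃ p ∈ L, ∀ z, chainValue L z0 z a l = formVal z p.2) ∨
      ∀ z, chainValue L z0 z a l = l := by
    intro a l
    by_cases h : ∃ p ∈ L, p.1 = a ∧ formVal z0 p.2 = l
    · exact Or.inl ⟨_, (exists_shortest L z0 a l h).choose_spec.1, fun z => by
        rw [chainValue, dif_pos h]⟩
    · exact Or.inr fun z => by rw [chainValue, dif_neg h]
  -- Indices from `d` on occur in no form; they get the default value 1.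
  let ext : (Fin d → ℕ) → ℕ → ℕ := fun z j => if h : j < d then z ⟨j, h⟩ else 1
  have hext : ∀ z (j : Fin d), ext z j = z j := fun z j => by simp [ext]
  -- One equation for each form: its value must remain equal to that of its representative.
  let A : Fin L.length → Fin d → ℤ := fun i j => (L[i].2.count j.1 : ℤ) - ((rep L[i]).2.count j.1 : ℤ)
  have hmem : ∀ i : Fin L.length, L[i] ∈ L := fun i => getElem_mem _
  have hA : ∀ (y : Fin d → ℤ) i, ∑ j, A i j * y j =
      ∑ j, (L[i].2.count j.1 : ℤ) * y j - ∑ j, ((rep L[i]).2.count j.1 : ℤ) * y j := by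
    intro y i
    rw [← Finset.sum_sub_distrib]
    exact Finset.sum_congr rfl fun j _ => by simp only [A]; ring
  have hform : ∀ (z : Fin d → ℕ) (F : List ℕ), (∀ i ∈ F, i < d) →
      (formVal (ext z) F : ℤ) = ∑ j : Fin d, (F.count j.1 : ℤ) * (z j : ℤ) := by
    intro z F hF
    rw [formVal_eq_sum _ F hF]
    push_cast
    exact Finset.sum_congr rfl fun j _ => by rw [hext]
  have hrow : ∀ (z : Fin d → ℕ) i, ∑ j, A i j * (z j : ℤ) = 0 ↔
      formVal (ext z) L[i].2 = formVal (ext z) (rep L[i]).2 := by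
    intro z i
    rw [hA, ← hform z _ (hd _ (hmem i)), ← hform z _ (hd _ (hrep1 _ (hmem i)).1)]
    omega
  let Z : (Fin d → ℕ) → Prop := fun z => (∀ j, 1 ≤ z j) ∧ z ⟨0, hd0⟩ = 1 ∧
    ∀ i, ∑ j, A i j * (z j : ℤ) = 0
  let W : (Fin d → ℕ) → ℕ := fun z => τ.weight (chainWeight w (chainValue L z0 (ext z)))
  let zi : Fin d → ℕ := fun j => z0 j
  have hcongr : ∀ p ∈ L, formVal (ext zi) p.2 = formVal z0 p.2 := by
    intro p hp
    simp only [formVal]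
    exact congrArg _ (map_congr_left fun i hi => by simp [ext, zi, hd p hp i hi])
  have hZi : Z zi := by
    refine ⟨fun j => hz0 j, h00, fun i => (hrow zi i).2 ?_⟩
    rw [hcongr _ (hmem i), hcongr _ (hrep1 _ (hmem i)).1, ← (hrep1 _ (hmem i)).2.2, hval0]
  have hWi : W zi = τ.weight (chainWeight w fun _ l => l) := by
    simp only [W]
    congr 2
    funext a l
    rcases hcv a l with ⟨p, hp, h⟩ | h
    · rw [h, hcongr p hp, ← h, hval0]
    · rw [h]
  obtain ⟨zm, hzm, hmin⟩ : ∃ z, Z z ∧ ∀ z', Z z' → W z ≤ W z' := by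
    have hne : ∃ n, ∃ z, Z z ∧ W z = n := ⟨_, zi, hZi, rfl⟩
    obtain ⟨z, h1, h2⟩ := Nat.find_spec hne
    exact ⟨z, h1, fun z' h3 => by rw [h2]; exact Nat.find_min' hne ⟨z', h3, rfl⟩⟩
  obtain ⟨z, ⟨hz, hzmin⟩, hzle⟩ := exists_small_solution A
    (fun z => Z z ∧ ∀ z', Z z' → W z ≤ W z') ⟨zm, hzm, hmin⟩ (fun z hz => hz.1.2.2) (by
    rintro z ⟨hz, hzmin⟩ y hy hyz
    have hshift : ∀ y : Fin d → ℤ, (∀ i, ∑ j, A i j * y j = 0) →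
        (∀ j, y j = 0 ∨ 1 < z j ∧ (y j).natAbs < z j) → Z fun j => (z j + y j).toNat := by
      intro y hy hyz
      have hnn : ∀ j, (((z j + y j).toNat : ℕ) : ℤ) = z j + y j := fun j => by
        have := hz.1 j
        rcases hyz j with h | h <;> omega
      refine ⟨fun j => ?_, ?_, fun i => ?_⟩
      · show 1 ≤ (z j + y j).toNat
        have := hz.1 j
        rcases hyz j with h | h <;> omega
      -- The index 0 stands for a single letter and has the value 1. It is never shifted, because a
      -- shift requires `1 < z j`.
      · show (z ⟨0, hd0⟩ + y ⟨0, hd0⟩).toNat = 1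
        have := hz.2.1
        rcases hyz ⟨0, hd0⟩ with h | h <;> omega
      · simp only [hnn, mul_add, Finset.sum_add_distrib, hy i, hz.2.2 i, add_zero]
    have h1 := hshift y hy hyz
    have h2 := hshift (fun j => - y j) (fun i => by simp [hy i]) (fun j => by simpa using hyz j)
    -- Both `z + y` and `z - y` are admissible and their weights average to the minimum `W z`, so
    -- both are minimal.
    have hsum : W (fun j => (z j + y j).toNat) + W (fun j => (z j + - y j).toNat) = 2 * W z := by
      simp only [W]
      rw [← Tree.weight_add, two_mul, ← Tree.weight_add]
      congr 1
      funext q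
      simp only [chainWeight]
      split_ifs
      · rw [← mul_add, ← mul_add]
        congr 1
        rcases hcv q.1.unpair.1 q.1.unpair.2 with ⟨p, hp, h⟩ | h
        · rw [h, h, h, formVal_add (z := ext z), two_mul]
          intro i hi
          have hid := hd p hp i hi
          simp only [ext, hid, dif_pos]
          rcases hyz ⟨i, hid⟩ with h | h <;> omega
        · rw [h, h, h]
      · rfl
    refine ⟨h1, fun z' hz' => ?_⟩
    have := hzmin z' hz'
    have := hzmin _ h1
    have := hzmin _ h2
    omega)
  -- Together with the factor 4 of `exists_small_solution` this gives the 8 in the exponent of the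
  -- bound.
  have hnorm : ∑ i, ∑ j, (A i j).natAbs ≤ 2 * (L.map fun p => p.2.length).sum := by
    have hlen : ∀ F : List ℕ, (∀ i ∈ F, i < d) → ∑ j : Fin d, F.count j.1 = F.length := by
      intro F hF
      have := formVal_eq_sum (fun _ => 1) F hF
      simp only [formVal, map_const', sum_replicate, smul_eq_mul, mul_one] at this
      exact this.symm
    have hi : ∀ i, ∑ j, (A i j).natAbs ≤ 2 * L[i].2.length := by
      intro i
      have h1 := hrep1 _ (hmem i)
      calc ∑ j, (A i j).natAbs ≤ ∑ j : Fin d, (L[i].2.count j.1 + (rep L[i]).2.count j.1) :=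
            Finset.sum_le_sum fun j _ => by simp only [A]; omega
        _ = L[i].2.length + (rep L[i]).2.length := by
            rw [Finset.sum_add_distrib, hlen _ (hd _ (hmem i)), hlen _ (hd _ h1.1)]
        _ ≤ _ := by have := h1.2.1; omega
    calc _ ≤ ∑ i : Fin L.length, 2 * L[i].2.length := Finset.sum_le_sum fun i _ => hi i
      _ = _ := by
        rw [← Finset.mul_sum]
        congr 1
        exact Fin.sum_univ_fun_getElem L fun p => p.2.length
  refine ⟨ext z, ?_, by simpa [ext, hd0] using hz.2.1, ?_, chainValue L z0 (ext z), ?_, ?_, ?_⟩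
  · intro i
    simp only [ext]
    split_ifs
    · exact hz.1 _
    · exact le_rfl
  · intro i
    simp only [ext]
    split_ifs
    · exact (hzle _).trans (Nat.pow_le_pow_right (by norm_num) (by omega))
    · exact Nat.one_le_two_pow
  · intro p hp
    obtain ⟨i, hi, rfl⟩ := getElem_of_mem hp
    rw [(hrep1 _ hp).2.2]
    exact ((hrow z ⟨i, hi⟩).1 (hz.2.2 ⟨i, hi⟩)).symm
  · intro a l hl
    rcases hcv a l with ⟨p, hp, h⟩ | h
    · rw [h]
      refine formVal_pos (fun i => ?_) (hL p hp)
      simp only [ext]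
      split_ifs
      · exact hz.1 _
      · exact le_rfl
    · rw [h]; exact hl
  · rw [← hWi]
    exact hzmin zi hZi

/-! ### Maximal chains of values -/

theorem Tree.exists_chain (t : Tree) (a : ℕ) (h : t.rootUnary = some a) :
    ∃ l s, 1 ≤ l ∧ t = (fun s => Tree.node a [s])^[l] s ∧ s.rootUnary ≠ some a := by
  induction t with
  | h f ts ih =>
    rcases length_one_cases ts with ⟨t, rfl⟩ | h1
    · rw [rootUnary_one, Option.some.injEq] at h
      subst h
      by_cases ht : t.rootUnary = some f
      · obtain ⟨l, s, hl, h1, h2⟩ := ih t (by simp) ht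
        exact ⟨l + 1, s, by omega, by rw [iterate_succ_apply', ← h1], h2⟩
      · exact ⟨1, t, le_rfl, rfl, ht⟩
    · rw [rootUnary_ne f ts h1] at h; simp at h

theorem Ctx.exists_chain_top (a : ℕ) (h : c.topUnary = some a) :
    ∃ l d, 1 ≤ l ∧ c = Ctx.up a l d ∧ d.topUnary ≠ some a := by
  induction c with
  | hole => simp [topUnary] at h
  | node f l c r ih =>
    by_cases hl : l.length + r.length = 0
    · obtain ⟨rfl, rfl⟩ : l = [] ∧ r = [] := by
        constructor <;> apply eq_nil_of_length_eq_zero <;> omega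
      simp only [topUnary, Option.some.injEq] at h
      subst h
      by_cases hc : c.topUnary = some f
      · obtain ⟨l, s, hl, h1, h2⟩ := ih hc
        exact ⟨l + 1, s, by omega, by rw [up_succ, ← h1], h2⟩
      · exact ⟨1, c, le_rfl, by rw [up_succ, up_zero], hc⟩
    · rw [topUnary_ne _ _ _ _ hl] at h; simp at h

theorem Ctx.botUnary_node_hole (l r : List Tree) (h : l.length + r.length ≠ 0) :
    (Ctx.node f l .hole r).botUnary = none := by
  rcases l with _ | ⟨y, l⟩ <;> rcases r with _ | ⟨z, r⟩
  · simp at h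
  all_goals simp [botUnary]

theorem Ctx.exists_chain_bot (b : ℕ) (h : c.botUnary = some b) :
    ∃ (r : ℕ) (d : Ctx), 1 ≤ r ∧ c = d.comp (Ctx.up b r .hole) ∧ d.botUnary ≠ some b := by
  induction c with
  | hole => simp [botUnary] at h
  | node f l c r ih =>
    by_cases hc : c = .hole
    · subst hc
      by_cases hl : l.length + r.length = 0
      · obtain ⟨rfl, rfl⟩ : l = [] ∧ r = [] := by
          constructor <;> apply eq_nil_of_length_eq_zero <;> omega
        simp only [botUnary, Option.some.injEq] at h
        subst h
        exact ⟨1, .hole, le_rfl, rfl, by simp [botUnary]⟩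
      · rw [botUnary_node_hole f l r hl] at h; simp at h
    · rw [botUnary_node _ _ _ hc] at h
      obtain ⟨m, d, hm, h1, h2⟩ := ih h
      by_cases hd : d = .hole
      · subst hd
        by_cases hf : (Ctx.node f l .hole r).botUnary = some b
        · have hl : l.length + r.length = 0 := by
            by_contra hl
            rw [botUnary_node_hole f l r hl] at hf; simp at hf
          obtain ⟨rfl, rfl⟩ : l = [] ∧ r = [] := by
            constructor <;> apply eq_nil_of_length_eq_zero <;> omega
          simp only [botUnary, Option.some.injEq] at hf
          subst hf
          exact ⟨m + 1, .hole, by omega, by rw [up_succ, h1]; rfl, by simp [botUnary]⟩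
        · exact ⟨m, .node f l .hole r, hm, by rw [h1]; rfl, hf⟩
      · exact ⟨m, .node f l d r, hm, by rw [h1]; rfl, by rw [botUnary_node _ _ _ hd]; exact h2⟩

theorem Ctx.topUnary_comp {d : Ctx} (h : d ≠ .hole) (c : Ctx) :
    (d.comp c).topUnary = d.topUnary := by
  rcases d with _ | ⟨f, l, d, r⟩
  · exact absurd rfl h
  · rcases l with _ | ⟨y, l⟩ <;> rcases r with _ | ⟨z, r⟩ <;> rfl

/-- The chain that is popped, if any. -/
def chainLayers (p : Option (ℕ × ℕ)) : List Layer := p.elim [] fun q => [Layer.pow q.1 q.2]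

theorem Tree.decompose (t : Tree) : ∃ (p : Option (ℕ × ℕ)) (s : Tree), (∀ q ∈ p, 1 ≤ q.2) ∧
    Uncrossed (chainLayers p) s.rootUnary ∧ ∀ S : Subst, (layersCtx S (chainLayers p)).fill s = t := by
  rcases h : t.rootUnary with _ | a
  · exact ⟨none, t, by simp, Or.inl ⟨rfl, h⟩, fun S => rfl⟩
  · obtain ⟨l, s, hl, rfl, h2⟩ := t.exists_chain a h
    refine ⟨some (a, l), s, by simpa using hl, Or.inr ⟨a, l, hl, rfl, h2⟩, fun S => ?_⟩
    simp [layersCtx, chainLayers, Layer.ctx, Ctx.comp_hole, Ctx.fill_up, Ctx.fill]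

/-- The chain at the top is split off first, then the chain above the hole of what remains. If
nothing remains, the context variable disappears and nothing is required of the remainder. -/
theorem Ctx.decompose : ∃ (p q : Option (ℕ × ℕ)) (d : Ctx), (∀ r ∈ p, 1 ≤ r.2) ∧
    (∀ r ∈ q, 1 ≤ r.2) ∧ (d ≠ .hole → Uncrossed (chainLayers p) d.topUnary ∧
      Uncrossed (chainLayers q) d.botUnary) ∧
    ∀ S : Subst, (layersCtx S (chainLayers p)).comp (d.comp (layersCtx S (chainLayers q))) = c := by
  obtain ⟨p, d1, hp, hu, h1⟩ : ∃ (p : Option (ℕ × ℕ)) (d : Ctx), (∀ r ∈ p, 1 ≤ r.2) ∧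
      Uncrossed (chainLayers p) d.topUnary ∧
      ∀ S : Subst, (layersCtx S (chainLayers p)).comp d = c := by
    rcases h : c.topUnary with _ | a
    · exact ⟨none, c, by simp, Or.inl ⟨rfl, h⟩, fun S => rfl⟩
    · obtain ⟨l, d, hl, rfl, h2⟩ := c.exists_chain_top a h
      refine ⟨some (a, l), d, by simpa using hl, Or.inr ⟨a, l, hl, rfl, h2⟩, fun S => ?_⟩
      simp [layersCtx, chainLayers, Layer.ctx, Ctx.comp_hole, Ctx.up_comp, Ctx.comp]
  rcases h : d1.botUnary with _ | b
  · refine ⟨p, none, d1, hp, by simp, fun _ => ⟨hu, Or.inl ⟨rfl, h⟩⟩, fun S => ?_⟩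
    simp only [chainLayers, Option.elim, layersCtx, foldr_nil, Ctx.comp_hole]
    exact h1 S
  · obtain ⟨r, d, hr, rfl, h2⟩ := d1.exists_chain_bot b h
    refine ⟨p, some (b, r), d, hp, by simpa using hr, fun hd => ⟨?_, Or.inr ⟨b, r, hr, rfl, h2⟩⟩,
      fun S => ?_⟩
    · rwa [Ctx.topUnary_comp hd] at hu
    · rw [← h1 S]
      simp [layersCtx, chainLayers, Layer.ctx, Ctx.comp_hole]

/-! ### Compressed values and renaming of unary letters -/

theorem Tree.chainComp_all (t : Tree) (h : t.All fun q => q.2 ≤ k) :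
    (t.chainComp nu).All fun q => q.2 ≤ k := by
  have hG : ∀ a, (a, 1) ∈ t.toTerm.letters → a ∈ (t.toTerm.letters.map Prod.fst).toFinset :=
    fun a ha => mem_toFinset.2 (mem_map.2 ⟨_, ha, rfl⟩)
  rw [all_iff_toTerm] at h ⊢
  rw [← toTerm_chainComp t hG]
  intro q hq
  rcases mem_letters_chainComp hG hq with ⟨h1, _⟩ | ⟨a, l, h1, rfl⟩
  · grind
  · grind

theorem Ctx.chainComp_fill (a : ℕ) :
    (c.fill (.node a [])).chainComp nu = (c.chainComp nu).fill (.node a []) := by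
  have e : (Tree.node a []).chainComp nu = .node a [] := by
    rw [Tree.chainComp, Tree.chainSplit_ne _ _ (by simp)]; rfl
  by_cases hc : c = .hole
  · subst hc; exact e
  · rw [Tree.chainComp, Ctx.chainSplit_fill hc _ (by simp [Tree.rootUnary]), e, Ctx.chainComp]
    rcases c.chainSplit nu with ⟨_ | ⟨b, m⟩, d⟩ <;> rfl

theorem Ctx.chainComp_all (h : c.All fun q => q.2 ≤ k) : (c.chainComp nu).All fun q => q.2 ≤ k := by
  have h1 := Tree.chainComp_all (nu := nu) (c.fill (.node 0 []))
    ((Ctx.all_fill _ _).2 ⟨h, Tree.all_node.2 ⟨by simp, by simp⟩⟩)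
  rw [Ctx.chainComp_fill, Ctx.all_fill] at h1
  exact h1.1

theorem Ctx.chainComp_ne_hole {c : Ctx} (h : c ≠ .hole) : c.chainComp nu ≠ .hole := by
  rcases c with _ | ⟨f, l, c, r⟩
  · grind
  · rw [chainComp, chainSplit]
    split_ifs
    · rcases c.chainSplit nu with ⟨_ | ⟨b, m⟩, d⟩
      · simp [addChain, closeChain]
      · simp only [addChain]
        split_ifs <;> simp [closeChain]
    · simp [closeChain]

theorem Term.inst_of_exps (h : t.exps = []) : t.inst z = t := by
  induction t with
  | hv x => simp [inst]
  | hc X t ih => simp [inst, ih (by simpa only [exps] using h)]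
  | hn f ts ih =>
    simp only [exps, flatten_eq_nil_iff, mem_map] at h
    simp only [inst]
    congr 1
    exact (map_congr_left fun t ht => ih t ht (h _ ⟨t, ht, rfl⟩)).trans (List.map_id _)
  | hp a l t ih => simp [exps] at h

/-- The chain letters of a compressed value code chains of positive length; for these the new
lengths `φ` are positive as well. -/
theorem Tree.chainComp_pair_pos (t : Tree) :
    (t.chainComp Nat.pair).All fun q => q.2 = 1 → 1 ≤ q.1.unpair.2 := by
  have hG : ∀ a, (a, 1) ∈ t.toTerm.letters → a ∈ (t.toTerm.letters.map Prod.fst).toFinset :=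
    fun a ha => mem_toFinset.2 (mem_map.2 ⟨_, ha, rfl⟩)
  rw [all_iff_toTerm, ← toTerm_chainComp t hG]
  intro q hq h1
  have e := Term.inst_of_exps (z := fun _ => 1) t.toTerm t.symbols_toTerm.2.2
  rcases mem_letters_chainComp_inst (z := fun _ => 1) rfl t.toTerm hG q
    (by rw [e]; exact hq) with ⟨_, h2⟩ | ⟨p, hp, rfl⟩
  · grind
  · simp only [Nat.unpair_pair]
    exact formVal_pos (fun _ => le_rfl) (t.toTerm.forms_spec.2 p hp)

/-- The renaming of unary letters. -/
def Hom.rename (ρ : ℕ → ℕ) : Hom := Hom.unary fun f => .node (ρ f) [] .hole []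

theorem Hom.rename_one (ρ : ℕ → ℕ) (f : ℕ) (t : Tree) :
    (Hom.rename ρ).node f [t] = .node (ρ f) [t] := rfl

theorem Hom.rename_ne (ρ : ℕ → ℕ) (f : ℕ) (ts : List Tree) (h : ts.length ≠ 1) :
    (Hom.rename ρ).node f ts = .node f ts := Hom.unary_node_ne _ f ts h

theorem Hom.rename_cx_ne_hole (ρ : ℕ → ℕ) {c : Ctx} (h : c ≠ .hole) :
    (Hom.rename ρ).cx c ≠ .hole := by
  rcases c with _ | ⟨f, l, c, r⟩
  · grind
  · rcases l with _ | ⟨y, l⟩ <;> rcases r with _ | ⟨z, r⟩ <;>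
      simp [Hom.cx, Hom.rename, Hom.unary, Ctx.comp]

theorem Hom.rename_all (ρ : ℕ → ℕ) (f : ℕ) (ts : List Tree) (hl : ts.length ≤ k)
    (h : ∀ t ∈ ts, t.All fun p => p.2 ≤ k) :
    ((Hom.rename ρ).node f ts).All fun p => p.2 ≤ k :=
  Hom.unary_all (fun hk f => by simpa [Ctx.All] using hk) f ts hl h

theorem Hom.rename_size (ρ : ℕ → ℕ) (t : Tree) : ((Hom.rename ρ).tree t).size = t.size := by
  rw [Tree.size_eq_weight, Tree.size_eq_weight]
  refine Hom.weight_tree_eq _ (fun f ts => ?_) t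
  rcases length_one_cases ts with ⟨t, rfl⟩ | h
  · rw [rename_one, Tree.weight_node]
  · rw [rename_ne _ _ _ h, Tree.weight_node]

theorem Hom.rootUnary_rename (ρ : ℕ → ℕ) (t : Tree) :
    ((Hom.rename ρ).tree t).rootUnary = t.rootUnary.map ρ := by
  rcases t with ⟨f, ts⟩
  rcases length_one_cases ts with ⟨t, rfl⟩ | h
  · rw [Hom.tree, map_singleton, rename_one, Tree.rootUnary_one, Tree.rootUnary_one]; rfl
  · rw [Hom.tree, rename_ne _ _ _ (by simpa using h), Tree.rootUnary_ne _ _ (by simpa using h),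
      Tree.rootUnary_ne _ _ h]; rfl

theorem Hom.unaryPairs_rename (ρ : ℕ → ℕ) (t : Tree) : ((Hom.rename ρ).tree t).toTerm.unaryPairs =
      t.toTerm.unaryPairs.map fun p => (ρ p.1, ρ p.2) := by
  induction t with
  | h f ts ih =>
    rcases length_one_cases ts with ⟨t, rfl⟩ | h
    · rw [Hom.tree, map_singleton, rename_one, Tree.toTerm, map_singleton,
        Term.unaryPairs_one, ih t (by simp), Tree.rootUnary_toTerm, rootUnary_rename, Tree.toTerm,
        map_singleton, Term.unaryPairs_one, Tree.rootUnary_toTerm]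
      rcases t.rootUnary <;> simp
    · rw [Hom.tree, rename_ne _ _ _ (by simpa using h), Tree.toTerm, Tree.toTerm,
        Term.unaryPairs_ne _ _ (by simpa using h), Term.unaryPairs_ne _ _ (by simpa using h),
        map_flatten]
      simp only [map_map]
      exact congrArg _ (map_congr_left ih)

/-- The chain that is popped, with a symbolic exponent. -/
def symLayers (p : Option (ℕ × ℕ)) (i : ℕ) : List Layer := p.elim [] fun q => [Layer.pow q.1 i]

theorem symLayers_inst (p : Option (ℕ × ℕ)) (i : ℕ) (z : ℕ → ℕ) :
    (symLayers p i).map (Layer.inst z) = p.elim [] fun q => [Layer.pow q.1 (z i)] := by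
  rcases p <;> simp [symLayers, Layer.inst]

theorem symLayers_inst_self {p : Option (ℕ × ℕ)} {i : ℕ} (h : ∀ q ∈ p, z i = q.2) :
    (symLayers p i).map (Layer.inst z) = chainLayers p := by
  rw [symLayers_inst]
  rcases p with _ | q
  · rfl
  · simp [chainLayers, h q rfl]

/-- A pop of a chain of letters of `G` with exponent at most `2 ^ Q`. -/
@[grind =] def ChainPop (G : Finset ℕ) (Q : ℕ) (ls : List Layer) : Prop :=
  ls = [] ∨ ∃ a ∈ G, ∃ l, 1 ≤ l ∧ l ≤ 2 ^ Q ∧ ls = [Layer.pow a l]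

theorem symLayers_size (p : Option (ℕ × ℕ)) (i : ℕ) : layersSize (symLayers p i) ≤ 1 := by
  rcases p <;> simp [symLayers, layersSize, Layer.size]

theorem mem_symLayers {p : Option (ℕ × ℕ)} {i : ℕ} {L : Layer} (h : L ∈ symLayers p i) :
    ∃ q, p = some q ∧ L = .pow q.1 i := by
  rcases p with _ | q
  · simp [symLayers] at h
  · exact ⟨q, rfl, by simpa [symLayers] using h⟩

/-- A popped letter with a positive exponent really occurs in the value, so properties of the
letters of the value pass to it. -/
theorem layersCtx_all_of {ls : List Layer} (h : (layersCtx S ls).All p)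
    (hl : ∀ a l, Layer.pow a l ∈ ls → 1 ≤ l) :
    ∀ a l, Layer.pow a l ∈ ls → p (a, 1) := by
  induction ls with
  | nil => simp
  | cons L ls ih =>
    have hc : ∀ c d : Ctx, (c.comp d).All p → c.All p ∧ d.All p := by
      intro c d
      induction c with
      | hole => intro h; exact ⟨trivial, h⟩
      | node f l c r ih =>
        simp only [Ctx.comp, Ctx.All]
        grind
    obtain ⟨h1, h2⟩ := hc _ _ h
    intro a l hm
    rcases mem_cons.1 hm with rfl | hm
    · obtain ⟨l, rfl⟩ := Nat.exists_eq_add_of_le' (hl a l (by simp))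
      rw [Layer.ctx, Ctx.up_succ] at h1
      simp only [Ctx.All] at h1
      exact h1.1
    · exact ih h2 (fun a l h => hl a l (by simp [h])) a l hm

theorem Ctx.all_comp_iff {c d : Ctx} : (c.comp d).All p ↔ c.All p ∧ d.All p := by
  refine ⟨fun h => ?_, fun h => comp_all h.1 h.2⟩
  induction c with
  | hole => exact ⟨trivial, h⟩
  | node f l c r ih =>
    simp only [Ctx.comp, Ctx.All] at h ⊢
    grind

/-! ### Completeness of chain compression -/

theorem Eqn.card_letters_le (e : Eqn) : e.letters.card ≤ e.size := by
  refine (toFinset_card_le _).trans ?_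
  rw [length_append, Eqn.size, Term.size_eq, Term.size_eq]
  omega

theorem Eqn.card_unary_le (e : Eqn) : e.unary.card ≤ e.size :=
  Finset.card_image_le.trans ((Finset.card_filter_le _ _).trans e.card_letters_le)

theorem Term.letters_inst (z : ℕ → ℕ) (t : Term) : (t.inst z).letters = t.letters := by
  induction t with
  | hv x => simp [inst, letters]
  | hc X t ih => simp [inst, letters, ih]
  | hn f ts ih =>
    simp only [inst, letters, length_map, map_map]
    congr 2
    exact map_congr_left ih
  | hp a l t ih => simp [inst, letters, ih]

-- The value is first compressed with the true exponents, with the codes `Nat.pair a l` as letters;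
-- then the codes are renamed according to small exponents. A new letter weighs as much as the chain
-- that it now stands for. The small exponents do not increase the weight of the value, and decoding
-- a competitor does not increase its weight either, so minimality is preserved.
open Classical in
theorem Good.chain (h : Good k e S w) :
    ∃ (V : ℕ → VTmpl) (C : ℕ → CTmpl) (nu : ℕ → ℕ → ℕ) (S' : Subst) (w' : ℕ × ℕ → ℕ) (e' : Eqn),
      e' = (e.map (sub V C)).map (Term.chainComp nu e.unary) ∧ FreshNames e.unary nu ∧
      (∀ x ∈ e.varOcc, (V x).const = none ∧ ChainPop e.unary (24 * e.size) (V x).pre) ∧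
      (∀ X ∈ e.cvarOcc, ChainPop e.unary (24 * e.size) (C X).pre ∧
        ChainPop e.unary (24 * e.size) (C X).post ∧
        ((C X).keep = false → (C X).pre ≠ [] ∨ (C X).post ≠ [])) ∧
      Good k e' S' w' ∧
      (∀ q ∈ e'.letters, (q ∈ e.letters ∧ q.2 ≠ 1) ∨ (q.2 = 1 ∧ q.1 ≤ 4 * e.size)) ∧
      (S'.eval e'.lhs).size ≤ (S.eval e.lhs).size ∧
      (∀ p ∈ e'.lhs.unaryPairs ++ e'.rhs.unaryPairs, p.1 ≠ p.2) ∧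
      ∀ p ∈ (S'.eval e'.lhs).toTerm.unaryPairs, p.1 ≠ p.2 := by
  choose pV sV hpV huV hfV using fun x => (S.var x).decompose
  choose pC qC dC hpC hqC huC hfC using fun X => (S.ctx X).decompose
  set G := e.unary with hGdef
  -- The index 0 stands for an explicit letter; the residues modulo 3 of the positive indices
  -- separate prefixes of context variables, suffixes of context variables, and prefixes of
  -- variables.
  obtain ⟨z0, hz0, h00, hzV, hzp, hzq⟩ : ∃ z0 : ℕ → ℕ, (∀ i, 1 ≤ z0 i) ∧ z0 0 = 1 ∧
      (∀ x, ∀ q ∈ pV x, z0 (3 * x + 3) = q.2) ∧ (∀ X, ∀ q ∈ pC X, z0 (3 * X + 1) = q.2) ∧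
      ∀ X, ∀ q ∈ qC X, z0 (3 * X + 2) = q.2 := by
    have hone : ∀ p : Option (ℕ × ℕ), (∀ q ∈ p, 1 ≤ q.2) → 1 ≤ p.elim 1 Prod.snd := by
      rintro (_ | q) hq
      · grind
      · grind
    refine ⟨fun i => if i = 0 then 1 else if i % 3 = 1 then (pC (i / 3)).elim 1 Prod.snd else
      if i % 3 = 2 then (qC (i / 3)).elim 1 Prod.snd else (pV (i / 3 - 1)).elim 1 Prod.snd,
      fun i => ?_, rfl, ?_, ?_, ?_⟩
    · grind
    · intro x q hq
      have h1 : (3 * x + 3) % 3 = 0 := by omega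
      have h2 : (3 * x + 3) / 3 - 1 = x := by omega
      have h3 : pV x = some q := hq
      grind
    · intro X q hq
      have h1 : (3 * X + 1) % 3 = 1 := by omega
      have h2 : (3 * X + 1) / 3 = X := by omega
      have h3 : pC X = some q := hq
      grind
    · intro X q hq
      have h1 : (3 * X + 2) % 3 = 2 := by omega
      have h2 : (3 * X + 2) / 3 = X := by omega
      have h3 : qC X = some q := hq
      grind
  let Vs : ℕ → VTmpl := fun x => ⟨symLayers (pV x) (3 * x + 3), none⟩
  let Cs : ℕ → CTmpl := fun X => ⟨symLayers (pC X) (3 * X + 1), decide (dC X ≠ .hole),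
    symLayers (qC X) (3 * X + 2)⟩
  let S1 : Subst := ⟨sV, dC⟩
  have hV0 : ∀ x, (Vs x).inst z0 = ⟨chainLayers (pV x), none⟩ := fun x => by
    simp only [VTmpl.inst, Vs, symLayers_inst_self (hzV x)]
  have hC0 : ∀ X, (Cs X).inst z0 = ⟨chainLayers (pC X), decide (dC X ≠ .hole),
      chainLayers (qC X)⟩ := fun X => by
    simp only [CTmpl.inst, Cs, symLayers_inst_self (hzp X), symLayers_inst_self (hzq X)]
  -- With the true exponents the templates undo the decomposition, so `S1` is the solution after the
  -- pops.
  have hpull : ContextUnif.pull (fun x => (Vs x).inst z0) (fun X => (Cs X).inst z0) S1 = S := by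
    have hv : ∀ x, S1.eval (((Vs x).inst z0).app x) = S.var x := by
      intro x
      rw [hV0, VTmpl.app, eval_wrap]
      simp only [Option.elim, Subst.eval]
      grind
    have hc : ∀ X, ((Cs X).inst z0).ctx S1 X = S.ctx X := by
      intro X
      rw [hC0, CTmpl.ctx, ← hfC X S1]
      by_cases hd : dC X = .hole
      · simp [hd, Ctx.comp]
      · grind
    simp only [ContextUnif.pull, hv, hc]
  have hev : ∀ t : Term, t.exps = [] → S1.eval ((sub Vs Cs t).inst z0) = S.eval t := by
    intro t ht
    rw [inst_sub z0 Vs Cs t ht, eval_sub, hpull]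
  -- the popped letters are letters of the equation
  have hun := h.parts_all h.unary
  have hVG : ∀ x ∈ e.varOcc, ∀ q ∈ pV x, q.1 ∈ G := by
    intro x hx q hq
    have h1 := hun.1 x hx
    rw [← hfV x S1, Ctx.all_fill] at h1
    have h2 : pV x = some q := hq
    refine Eqn.mem_unary.2 (layersCtx_all_of h1.1 ?_ q.1 q.2 (by simp [chainLayers, h2]) rfl)
    intro a l hm
    simp only [chainLayers, h2, Option.elim, mem_singleton, Layer.pow.injEq] at hm
    grind
  have hCG : ∀ X ∈ e.cvarOcc, (∀ q ∈ pC X, q.1 ∈ G) ∧ ∀ q ∈ qC X, q.1 ∈ G := by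
    intro X hX
    have h1 := hun.2 X hX
    rw [← hfC X S1, Ctx.all_comp_iff, Ctx.all_comp_iff] at h1
    constructor
    · intro q hq
      have h2 : pC X = some q := hq
      refine Eqn.mem_unary.2 (layersCtx_all_of h1.1 ?_ q.1 q.2 (by simp [chainLayers, h2]) rfl)
      intro a l hm
      simp only [chainLayers, h2, Option.elim, mem_singleton, Layer.pow.injEq] at hm
      grind
    · intro q hq
      have h2 : qC X = some q := hq
      refine Eqn.mem_unary.2 (layersCtx_all_of h1.2.2 ?_ q.1 q.2 (by simp [chainLayers, h2]) rfl)
      intro a l hm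
      simp only [chainLayers, h2, Option.elim, mem_singleton, Layer.pow.injEq] at hm
      grind
  have hk1 : ∀ a ∈ G, 1 ≤ k := fun a ha => h.ar (a, 1) (Eqn.mem_unary.1 ha)
  -- letters of the symbolic terms
  have hside : ∀ t : Term, (∀ q ∈ t.letters, q ∈ e.letters) → (∀ x ∈ t.vars, x ∈ e.varOcc) →
      (∀ X ∈ t.cvars, X ∈ e.cvarOcc) →
      ∀ q ∈ (sub Vs Cs t).letters, q ∈ e.letters := by
    intro t hl hv hc
    refine (letters_sub_iff Vs Cs t).2 ⟨hl, fun x hx => ⟨fun L hL => ?_, by simp [Vs]⟩,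
      fun X hX L hL => ?_⟩
    · obtain ⟨q, hq, rfl⟩ := mem_symLayers hL
      exact Eqn.mem_unary.1 (hVG x (hv x hx) q hq)
    · rcases mem_append.1 hL with hL | hL
      · obtain ⟨q, hq, rfl⟩ := mem_symLayers hL
        exact Eqn.mem_unary.1 ((hCG X (hc X hX)).1 q hq)
      · obtain ⟨q, hq, rfl⟩ := mem_symLayers hL
        exact Eqn.mem_unary.1 ((hCG X (hc X hX)).2 q hq)
  have hsl : ∀ q ∈ (sub Vs Cs e.lhs).letters, q ∈ e.letters :=
    hside e.lhs (fun q hq => Eqn.mem_letters.2 (Or.inl hq)) (by simp +contextual)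
      (by simp +contextual)
  have hsr : ∀ q ∈ (sub Vs Cs e.rhs).letters, q ∈ e.letters :=
    hside e.rhs (fun q hq => Eqn.mem_letters.2 (Or.inr hq)) (by simp +contextual)
      (by simp +contextual)
  have hGl : ∀ a, (a, 1) ∈ (sub Vs Cs e.lhs).letters → a ∈ G :=
    fun a ha => Eqn.mem_unary.2 (hsl _ ha)
  have hGr : ∀ a, (a, 1) ∈ (sub Vs Cs e.rhs).letters → a ∈ G :=
    fun a ha => Eqn.mem_unary.2 (hsr _ ha)
  -- the compressed ground term
  let τ : Tree := (S.eval e.lhs).chainComp Nat.pair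
  have hcomm : ∀ t : Term, t.exps = [] → (∀ q ∈ t.letters, q ∈ e.letters) →
      (∀ x ∈ t.vars, x ∈ e.varOcc) →
      (∀ X ∈ t.cvars, X ∈ e.cvarOcc) →
      (S1.chainComp Nat.pair).eval (((sub Vs Cs t).inst z0).chainComp Nat.pair G) =
        (S.eval t).chainComp Nat.pair := by
    intro t ht hl hv hc
    rw [← hev t ht, inst_sub z0 Vs Cs t ht]
    refine (ChainCommutes.comp (chainCommutes_sub t ⟨?_, ?_⟩ ht
      (fun a ha => Eqn.mem_unary.2 (hl _ ha)) ?_ ?_)).symm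
    · grind
    · intro X _
      rw [hC0]
      have hu : ∀ p : Option (ℕ × ℕ), (∀ q ∈ p, 1 ≤ q.2) → ∃ o, Uncrossed (chainLayers p) o := by
        rintro (_ | ⟨a, l⟩) hq
        · exact ⟨none, Or.inl ⟨rfl, rfl⟩⟩
        · exact ⟨none, Or.inr ⟨a, l, hq (a, l) rfl, rfl, by simp⟩⟩
      grind
    · intro x hx L hL
      rw [hV0] at hL
      rcases hp : pV x with _ | q
      · simp [hp, chainLayers] at hL
      · simp only [hp, chainLayers, Option.elim, mem_singleton] at hL
        rw [hL]; exact hVG x (hv x hx) q hp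
    · intro X hX L hL
      rw [hC0] at hL
      rcases mem_append.1 hL with hL | hL
      · rcases hp : pC X with _ | q
        · simp [hp, chainLayers] at hL
        · simp only [hp, chainLayers, Option.elim, mem_singleton] at hL
          rw [hL]; exact (hCG X (hc X hX)).1 q hp
      · rcases hp : qC X with _ | q
        · simp [hp, chainLayers] at hL
        · simp only [hp, chainLayers, Option.elim, mem_singleton] at hL
          rw [hL]; exact (hCG X (hc X hX)).2 q hp
  have hτl : (S1.chainComp Nat.pair).eval (((sub Vs Cs e.lhs).inst z0).chainComp Nat.pair G) = τ :=
    hcomm e.lhs h.pf.1 (fun q hq => Eqn.mem_letters.2 (Or.inl hq)) (by simp +contextual)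
      (by simp +contextual)
  have hτr : (S1.chainComp Nat.pair).eval
      (((sub Vs Cs e.rhs).inst z0).chainComp Nat.pair G) = τ := by
    rw [hcomm e.rhs h.pf.2 (fun q hq => Eqn.mem_letters.2 (Or.inr hq)) (by simp +contextual)
      (by simp +contextual), ← h.sol.2]
  -- small exponents
  let L : List Form := (sub Vs Cs e.lhs).forms ++ (sub Vs Cs e.rhs).forms
  -- A context variable adds at most two symbols and a variable at most one, so the size at most
  -- triples; with the 8 of `exists_small_valuation` this makes exponents up to `2 ^ (24 * e.size)`.
  have hLlen : (L.map fun p => p.2.length).sum ≤ 3 * e.size := by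
    have h1 := (sub Vs Cs e.lhs).forms_spec.1
    have h2 := (sub Vs Cs e.rhs).forms_spec.1
    have hs : ∀ t : Term, (sub Vs Cs t).size ≤ 3 * t.size := by
      intro t
      have := size_sub_le (V := Vs) (C := Cs) (p := 1) (q := 2) t
        (fun x _ => symLayers_size _ _) (fun X _ => Nat.add_le_add (symLayers_size _ _)
          (symLayers_size _ _))
      have := t.size_eq
      omega
    have h3 := hs e.lhs
    have h4 := hs e.rhs
    simp only [L, map_append, sum_append, Eqn.size]
    omega
  have hLne : ∀ p ∈ L, p.2 ≠ [] := by
    intro p hp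
    rcases mem_append.1 hp with hp | hp
    · exact (sub Vs Cs e.lhs).forms_spec.2 p hp
    · exact (sub Vs Cs e.rhs).forms_spec.2 p hp
  obtain ⟨z, hz1, hz00, hzle, φ, hφ, hφ1, hφw⟩ := exists_small_valuation L hLne hz0 h00 τ w
  have hzle' : ∀ i, z i ≤ 2 ^ (24 * e.size) := fun i =>
    (hzle i).trans (Nat.pow_le_pow_right (by norm_num) (by omega))
  -- names
  obtain ⟨nu1, hnu1, hnuG, hnule⟩ := exists_small_names
    ((L.map fun p => (p.1, formVal z p.2)).toFinset) G
  let nu : ℕ → ℕ → ℕ := fun a l => nu1 (a, l)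
  have hnu : ∀ a b a' b', nu a b = nu a' b' → a = a' ∧ b = b' := fun a b a' b' hab => by grind
  have hLcard : L.length ≤ 3 * e.size := by
    refine le_trans ?_ hLlen
    have : (L.map fun _ => 1).sum ≤ (L.map fun p => p.2.length).sum :=
      sum_le_sum fun p hp => length_pos_iff.2 (hLne p hp)
    simpa using this
  -- There are at most `3 * e.size` forms and at most `e.size` forbidden names.
  have hname : ∀ p ∈ L, nu p.1 (formVal z p.2) ≤ 4 * e.size := by
    intro p hp
    refine (hnule _ (mem_toFinset.2 (mem_map.2 ⟨p, hp, rfl⟩))).trans ?_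
    have h1 := toFinset_card_le (L.map fun p => (p.1, formVal z p.2))
    rw [length_map] at h1
    have h2 : G.card ≤ e.size := e.card_unary_le
    omega
  -- the new equation and its solution
  let R : Hom := Hom.rename fun f => nu f.unpair.1 (φ f.unpair.1 f.unpair.2)
  let V : ℕ → VTmpl := fun x => (Vs x).inst z
  let C : ℕ → CTmpl := fun X => (Cs X).inst z
  let S' : Subst := R.subst (S1.chainComp Nat.pair)
  let e' : Eqn := (e.map (sub V C)).map (Term.chainComp nu G)
  have hel : e'.lhs = ((sub Vs Cs e.lhs).inst z).chainComp nu G := by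
    simp only [e', Eqn.map, V, C, inst_sub z Vs Cs e.lhs h.pf.1]
  have her : e'.rhs = ((sub Vs Cs e.rhs).inst z).chainComp nu G := by
    simp only [e', Eqn.map, V, C, inst_sub z Vs Cs e.rhs h.pf.2]
  have hRn : ∀ q ∈ L, ∀ s, R.node (Nat.pair q.1 (formVal z0 q.2)) [s] =
      .node (nu q.1 (formVal z q.2)) [s] := by
    intro q hq s
    simp only [R, Hom.rename_one, Nat.unpair_pair, hφ q hq]
  have hSl : S'.eval e'.lhs = R.tree τ := by
    rw [hel, ← eval_relabel h00 hz00 (fun f ts => Hom.rename_ne _ f ts) _ hGl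
      (fun q hq => hRn q (mem_append_left _ hq)), ← Hom.tree_eval, hτl]
  have hSr : S'.eval e'.rhs = R.tree τ := by
    rw [her, ← eval_relabel h00 hz00 (fun f ts => Hom.rename_ne _ f ts) _ hGr
      (fun q hq => hRn q (mem_append_right _ hq)), ← Hom.tree_eval, hτr]
  have hletters : ∀ q ∈ e'.letters, (q ∈ e.letters ∧ q.2 ≠ 1) ∨
      ∃ p ∈ L, q = (nu p.1 (formVal z p.2), 1) := by
    intro q hq
    rcases Eqn.mem_letters.1 hq with hq | hq
    · rw [hel] at hq
      exact (mem_letters_chainComp_inst hz00 _ hGl q hq).imp (fun h => ⟨hsl q h.1, h.2⟩)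
        fun ⟨p, hp, h⟩ => ⟨p, mem_append_left _ hp, h⟩
    · rw [her] at hq
      exact (mem_letters_chainComp_inst hz00 _ hGr q hq).imp (fun h => ⟨hsr q h.1, h.2⟩)
        fun ⟨p, hp, h⟩ => ⟨p, mem_append_right _ hp, h⟩
  have hGl' : ∀ a, (a, 1) ∈ ((sub Vs Cs e.lhs).inst z).letters → a ∈ G := by rwa [Term.letters_inst]
  have hGr' : ∀ a, (a, 1) ∈ ((sub Vs Cs e.rhs).inst z).letters → a ∈ G := by rwa [Term.letters_inst]
  have har : ∀ q ∈ e'.letters, q.2 ≤ k := by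
    intro q hq
    rcases Eqn.mem_letters.1 hq with hq | hq
    · rw [hel] at hq
      rcases mem_letters_chainComp hGl' hq with ⟨h1, _⟩ | ⟨a, l, h1, rfl⟩
      · rw [Term.letters_inst] at h1; exact h.ar q (hsl q h1)
      · grind
    · rw [her] at hq
      rcases mem_letters_chainComp hGr' hq with ⟨h1, _⟩ | ⟨a, l, h1, rfl⟩
      · rw [Term.letters_inst] at h1; exact h.ar q (hsr q h1)
      · grind
  -- weights
  let w' : ℕ × ℕ → ℕ := fun q => if q ∈ e'.letters then
    (if q.2 = 1 then (chainDecode nu q.1).weight w else w q) else 1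
  have hdecw : ∀ a l, (chainDecode nu (nu a l)).weight w = l * w (a, 1) := by
    intro a l
    rw [chainDecode_apply hnu, Ctx.up_weight]
    simp [Ctx.weight]
  have hw1 : ∀ q, 1 ≤ w' q := by
    intro q
    simp only [w']
    split_ifs with h1 h2
    · rcases hletters q h1 with ⟨_, h3⟩ | ⟨p, hp, rfl⟩
      · grind
      · rw [hdecw]
        exact Nat.mul_pos (formVal_pos hz1 (hLne p hp)) (h.one _)
    · exact h.one q
    · grind
  have hVar : ∀ x, (V x).Letters fun q => q.2 ≤ k := by
    intro x
    refine ⟨fun l hl => ?_, by simp [V, Vs, VTmpl.inst]⟩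
    simp only [V, Vs, VTmpl.inst, symLayers_inst] at hl
    rcases hp : pV x with _ | q
    · grind
    · have h1 := h.sol.1.1 x
      rw [← hfV x S1, Ctx.all_fill] at h1
      simp only [hp, Option.elim, mem_singleton] at hl
      rw [hl]
      refine layersCtx_all_of h1.1 ?_ q.1 q.2 (by simp [chainLayers, hp])
      intro a l hm
      simp only [chainLayers, hp, Option.elim, mem_singleton, Layer.pow.injEq] at hm
      grind
  have hCar : ∀ X, (C X).Letters fun q => q.2 ≤ k := by
    intro X l hl
    have h1 := h.sol.1.2 X
    rw [← hfC X S1, Ctx.all_comp_iff, Ctx.all_comp_iff] at h1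
    simp only [C, Cs, CTmpl.inst, symLayers_inst, mem_append] at hl
    rcases hl with hl | hl
    · rcases hp : pC X with _ | q
      · grind
      · simp only [hp, Option.elim, mem_singleton] at hl
        rw [hl]
        refine layersCtx_all_of h1.1 ?_ q.1 q.2 (by simp [chainLayers, hp])
        intro a l hm
        simp only [chainLayers, hp, Option.elim, mem_singleton, Layer.pow.injEq] at hm
        grind
    · rcases hp : qC X with _ | q
      · grind
      · simp only [hp, Option.elim, mem_singleton] at hl
        rw [hl]
        refine layersCtx_all_of h1.2.2 ?_ q.1 q.2 (by simp [chainLayers, hp])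
        intro a l hm
        simp only [chainLayers, hp, Option.elim, mem_singleton, Layer.pow.injEq] at hm
        grind
  have hd1 : ∀ x, (sV x).All fun q => q.2 ≤ k := fun x => by
    have h1 := h.sol.1.1 x
    rw [← hfV x S1, Ctx.all_fill] at h1
    exact h1.2
  have hd2 : ∀ X, (dC X).All fun q => q.2 ≤ k := fun X => by
    have h1 := h.sol.1.2 X
    rw [← hfC X S1, Ctx.all_comp_iff, Ctx.all_comp_iff] at h1
    grind
  -- The name is foreign to the old equation too, so that letters named `g` also have weight 1
  -- there.
  obtain ⟨g, hg⟩ := Infinite.exists_notMem_finset (e.letters.image Prod.fst ∪ e'.letters.image Prod.fst)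
  rw [Finset.mem_union, not_or] at hg
  have hg1 : ∀ m, (g, m) ∉ e.letters := fun m hm => hg.1 (Finset.mem_image_of_mem Prod.fst hm)
  have hg2 : ∀ m, (g, m) ∉ e'.letters := fun m hm => hg.2 (Finset.mem_image_of_mem Prod.fst hm)
  have hgood : Good k e' S' w' := by
    refine h.transfer (S' := S') (w' := w') ⟨?_, ?_⟩ har ⟨?_, ?_⟩ ?_ hw1 ?_ ?_ hg2 ?_
    · exact Hom.all_subst _ (fun f ts hp hts => Hom.rename_all _ f ts hp hts)
        ⟨fun x => Tree.chainComp_all _ (hd1 x), fun X => Ctx.chainComp_all _ (hd2 X)⟩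
    · grind
    · rw [hel]; exact Term.exps_chainComp _ hGl'
    · rw [her]; exact Term.exps_chainComp _ hGr'
    · intro X hX
      refine Hom.rename_cx_ne_hole _ (Ctx.chainComp_ne_hole ?_)
      have hX' : X ∈ (sub V C e.lhs).cvars ++ (sub V C e.rhs).cvars := by
        have e1 : e'.lhs.cvars = (sub V C e.lhs).cvars := by
          rw [hel, Term.cvars_chainComp _ hGl', inst_sub z Vs Cs e.lhs h.pf.1]
        have e2 : e'.rhs.cvars = (sub V C e.rhs).cvars := by
          rw [her, Term.cvars_chainComp _ hGr', inst_sub z Vs Cs e.rhs h.pf.2]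
        grind
      rw [cvars_sub, cvars_sub, mem_append, mem_filter, mem_filter] at hX'
      have hk : (C X).keep = true := hX'.elim And.right And.right
      simpa [C, Cs, CTmpl.inst] using hk
    · grind
    · rw [hSl]
      refine le_trans (Hom.weight_tree_le (w' := chainWeight w φ) _ ?_
        (Tree.chainComp_pair_pos (S.eval e.lhs))) (hφw.trans ?_)
      · intro f ts hp
        rcases length_one_cases ts with ⟨t, rfl⟩ | h1
        · have hpos := hp rfl
          simp only [R, Hom.rename_one, Tree.weight_node, chainWeight, length_singleton, if_true]
          refine Nat.add_le_add_right ?_ _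
          simp only [w']
          split_ifs
          · grind
          · exact Nat.mul_pos (h.one _) (hφ1 _ _ hpos)
        · simp only [R]
          rw [Hom.rename_ne _ _ _ h1, Tree.weight_node]
          refine Nat.add_le_add_right ?_ _
          simp only [w', chainWeight, h1, if_false]
          split_ifs
          · grind
          · exact h.one _
      -- Expanding the codes recovers the original value, whose weight is therefore that of `τ` with
      -- the true lengths.
      · let H0 : Hom := Hom.unary fun f => Ctx.up f.unpair.1 f.unpair.2 .hole
        have hG0 : ∀ a, (a, 1) ∈ (S.eval e.lhs).toTerm.letters → a ∈ G := by
          have := (Tree.all_iff_toTerm _).1 h.unary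
          exact fun a ha => Eqn.mem_unary.2 (this _ ha rfl)
        have h1 : H0.tree τ = S.eval e.lhs := by
          rw [← Hom.eval_toTerm H0 S, ← Tree.toTerm_chainComp _ hG0, Hom.eval_chainComp,
            Tree.eval_toTerm]
          · intro a l s
            simp only [H0, Hom.unary_node_one, Nat.unpair_pair, Ctx.fill_up, Ctx.fill]
          · exact hG0
          · exact fun f ts hts => Hom.unary_node_ne _ f ts hts
        rw [← h1]
        refine (Hom.weight_tree_eq H0 (fun f ts => ?_) τ).ge
        rcases length_one_cases ts with ⟨t, rfl⟩ | h1
        · simp only [H0, Hom.unary_node_one, Ctx.weight_fill, Ctx.up_weight, Ctx.weight, chainWeight,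
            length_singleton, if_true, map_singleton, sum_singleton, add_zero]
          grind
        · simp only [H0]
          rw [Hom.unary_node_ne _ _ _ h1, Tree.weight_node]
          simp [chainWeight, h1]
    · intro T' hT' hall
      have hl : ∀ S, (Hom.unary (chainDecode nu)).eval S e'.lhs = S.eval (sub V C e.lhs) := by
        intro S
        rw [hel, Hom.eval_chainComp, inst_sub z Vs Cs e.lhs h.pf.1]
        · intro a l s
          rw [Hom.unary_node_one, chainDecode_apply hnu, Ctx.fill_up, Ctx.fill]
        · exact hGl'
        · exact fun f ts hts => Hom.unary_node_ne _ f ts hts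
      have hr : ∀ S, (Hom.unary (chainDecode nu)).eval S e'.rhs = S.eval (sub V C e.rhs) := by
        intro S
        rw [her, Hom.eval_chainComp, inst_sub z Vs Cs e.rhs h.pf.2]
        · intro a l s
          rw [Hom.unary_node_one, chainDecode_apply hnu, Ctx.fill_up, Ctx.fill]
        · exact hGr'
        · exact fun f ts hts => Hom.unary_node_ne _ f ts hts
      obtain ⟨h1, h2⟩ := hT'.decode (e := e) (H := Hom.unary (chainDecode nu)) hVar hCar
        (Hom.unary_all fun hk f => chainDecode_all nu f hk) hl hr
      refine ⟨_, h1, ?_⟩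
      rw [h2]
      refine Hom.weight_tree_le _ (fun f ts hp => ?_) hall
      rcases length_one_cases ts with ⟨t, rfl⟩ | h3
      -- Competitors are normalized, so their unary letters are letters of the new equation.
      · have h4 : (f, 1) ∈ e'.letters := hp.resolve_right fun h => h.2 rfl
        rw [Hom.unary_node_one, Ctx.weight_fill]
        grind
      · rw [Hom.unary_node_ne _ _ _ h3, Tree.weight_node]
        refine Nat.add_le_add_right ?_ _
        rcases hp with hp | ⟨hp, _⟩
        · grind
        · simp only at hp
          rw [hp, h.off _ (hg1 _)]
          exact hw1 _
  have hpop : ∀ (p : Option (ℕ × ℕ)) (i : ℕ), (∀ q ∈ p, q.1 ∈ G) →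
      ChainPop G (24 * e.size) ((symLayers p i).map (Layer.inst z)) := by
    intro p i hp
    rw [symLayers_inst]
    rcases p with _ | q
    · exact Or.inl rfl
    · exact Or.inr ⟨q.1, hp q rfl, z i, hz1 i, hzle' i, rfl⟩
  refine ⟨V, C, nu, S', w', e', rfl, ⟨hnu, fun a b => hnuG (a, b)⟩, ?_, ?_, hgood, ?_, ?_, ?_, ?_⟩
  · exact fun x hx => ⟨rfl, hpop _ _ (hVG x hx)⟩
  · intro X hX
    refine ⟨hpop _ _ (hCG X hX).1, hpop _ _ (hCG X hX).2, fun hk => ?_⟩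
    -- A context variable that disappears without any pop would have had the empty value before.
    by_contra hcon
    rw [not_or, not_not, not_not] at hcon
    have hd : dC X = .hole := by simpa [C, Cs, CTmpl.inst] using hk
    have h1 : pC X = none := by
      rcases hp : pC X with _ | q
      · rfl
      · have := hcon.1
        simp [C, Cs, CTmpl.inst, hp, symLayers] at this
    have h2 : qC X = none := by
      rcases hp : qC X with _ | q
      · rfl
      · have := hcon.2
        simp [C, Cs, CTmpl.inst, hp, symLayers] at this
    refine h.ne X hX ?_
    rw [← hfC X S1, h1, h2, hd]
    rfl
  · grind
  · rw [hSl]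
    simp only [R]
    rw [Hom.rename_size]
    have hG0 : ∀ a, (a, 1) ∈ (S.eval e.lhs).toTerm.letters → a ∈ G := by
      have := (Tree.all_iff_toTerm _).1 h.unary
      exact fun a ha => Eqn.mem_unary.2 (this _ ha rfl)
    have := Term.size_chainComp (nu := Nat.pair) _ hG0
    rwa [Tree.toTerm_chainComp _ hG0, Tree.size_toTerm, Tree.size_toTerm] at this
  · intro p hp
    have : ∃ a l b m, a ≠ b ∧ p = (nu a l, nu b m) := by
      rcases mem_append.1 hp with hp | hp
      · rw [hel] at hp; exact Term.alternating_chainComp _ hGl' p hp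
      · rw [her] at hp; exact Term.alternating_chainComp _ hGr' p hp
    grind
  · intro p hp
    rw [hSl] at hp
    simp only [R] at hp
    rw [Hom.unaryPairs_rename, mem_map] at hp
    obtain ⟨q, hq, rfl⟩ := hp
    have hG0 : ∀ a, (a, 1) ∈ (S.eval e.lhs).toTerm.letters → a ∈ G := by
      have := (Tree.all_iff_toTerm _).1 h.unary
      exact fun a ha => Eqn.mem_unary.2 (this _ ha rfl)
    have := Term.alternating_chainComp (nu := Nat.pair) _ hG0 q (by
      rw [Tree.toTerm_chainComp _ hG0]; exact hq)
    -- The lengths may be identified by `φ`, but neighbouring chains have different letters `a` and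
    -- `b`, and the renaming keeps these apart.
    obtain ⟨a, l, b, m, hab, rfl⟩ := this
    simp only [Nat.unpair_pair]
    grind

/-- Goodness is preserved by a compression which is undone by the homomorphism `H`. -/
theorem Good.compress {S' : Subst} {w₀ : ℕ × ℕ → ℕ} (h : Good k e S w) (hS' : Solves k e' S')
    (ar : ∀ q ∈ e'.letters, q.2 ≤ k) (pf : e'.lhs.exps = [] ∧ e'.rhs.exps = [])
    (ne : ∀ X ∈ e'.cvarOcc, S'.ctx X ≠ .hole) (htree : H.tree (S'.eval e'.lhs) = S.eval e.lhs)
    (hw : ∀ f ts, (H.node f ts).weight w = w₀ (f, ts.length) + (ts.map (Tree.weight w)).sum)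
    (h1 : ∀ q, 1 ≤ w₀ q) (hg : ∀ m, (g, m) ∉ e'.letters) (hg1 : ∀ m, m ≠ 1 → w₀ (g, m) ≤ 1)
    (hdec : ∀ T, Solves k e' T → ∃ T', Solves k e T' ∧ T'.eval e.lhs = H.tree (T.eval e'.lhs)) :
    ∃ w', Good k e' S' w' := by
  refine ⟨fun q => if q ∈ e'.letters then w₀ q else 1, h.transfer hS' ar pf ne ?_ ?_ ?_ hg ?_⟩
  · grind
  · grind
  · rw [← htree, Hom.weight_tree_eq H hw]
    refine Tree.weight_le (p := fun _ => True) (fun q _ => ?_)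
      ((Tree.all_iff_toTerm _).2 fun _ _ => trivial)
    grind
  · intro T hT hall
    obtain ⟨T', h2, h3⟩ := hdec T hT
    refine ⟨T', h2, ?_⟩
    rw [h3, Hom.weight_tree_eq H hw]
    refine Tree.weight_le (fun q hq => ?_) hall
    grind

/-! ### Completeness of pair compression -/

theorem Ctx.exists_bot (h : c ≠ .hole) :
    ∃ (d : Ctx) (f : ℕ) (l r : List Tree), c = d.comp (.node f l .hole r) := by
  induction c with
  | hole => grind
  | node f l c r ih =>
    by_cases hc : c = .hole
    · exact ⟨.hole, f, l, r, by rw [hc]; rfl⟩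
    · obtain ⟨d, f', l', r', rfl⟩ := ih hc
      exact ⟨.node f l d r, f', l', r', rfl⟩

theorem Ctx.botUnary_comp (d : Ctx) {c : Ctx} (hc : c ≠ .hole) :
    (d.comp c).botUnary = c.botUnary := by
  induction d with
  | hole => rfl
  | node f l d r ih => rw [Ctx.comp, botUnary_node _ _ _ (by cases d <;> simp_all [Ctx.comp]), ih]

theorem Ctx.eq_of_topUnary {c : Ctx} {a : ℕ} (h : c.topUnary = some a) :
    ∃ d, c = .node a [] d [] := by
  rcases c with _ | ⟨f, _ | _, c, _ | _⟩ <;> simp_all [topUnary]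

/-- Popping a letter of `G2` up and a letter of `G1` down. -/
theorem Ctx.pairDecompose (G1 G2 : Finset ℕ) (c : Ctx) : ∃ (pre post : List Layer) (d : Ctx),
    (∃ o, PairPop G2 pre o) ∧ (∃ o, PairPop G1 post o) ∧
    (d ≠ .hole → PairPop G2 pre d.topUnary ∧ PairPop G1 post d.botUnary) ∧
    ∀ S : Subst, (layersCtx S pre).comp (d.comp (layersCtx S post)) = c := by
  -- The condition at the bottom is stated for every nonempty context with the same bottom letter,
  -- so that it survives the removal of a letter at the top.
  obtain ⟨post, d, hp, hd, h1⟩ : ∃ (post : List Layer) (d : Ctx), (∃ o, PairPop G1 post o) ∧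
      (∀ d' : Ctx, d' ≠ .hole → d'.botUnary = d.botUnary → PairPop G1 post d'.botUnary) ∧
      ∀ S : Subst, d.comp (layersCtx S post) = c := by
    by_cases h : ∃ a ∈ G1, c.botUnary = some a
    · obtain ⟨a, ha, h⟩ := h
      obtain ⟨d, f, l, r, rfl⟩ := c.exists_bot fun hc => by simp [hc, botUnary] at h
      rw [botUnary_comp _ (by simp)] at h
      have hlr : l.length + r.length = 0 := by
        grind
      obtain rfl : l = [] := length_eq_zero_iff.1 (by omega)
      obtain rfl : r = [] := length_eq_zero_iff.1 (by omega)
      obtain rfl : f = a := by simpa [botUnary] using h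
      exact ⟨[.nd f [] []], d, ⟨none, Or.inr ⟨f, ha, rfl⟩⟩, fun _ _ _ => Or.inr ⟨f, ha, rfl⟩,
        fun S => rfl⟩
    · refine ⟨[], c, ⟨none, Or.inl ⟨rfl, by simp⟩⟩, fun d' _ hd => Or.inl ⟨rfl, ?_⟩,
        fun S => comp_hole c⟩
      grind
  by_cases h : ∃ b ∈ G2, d.topUnary = some b
  · obtain ⟨b, hb, h⟩ := h
    obtain ⟨d', rfl⟩ := eq_of_topUnary h
    refine ⟨[.nd b [] []], post, d', ⟨none, Or.inr ⟨b, hb, rfl⟩⟩, hp, fun hne =>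
      ⟨Or.inr ⟨b, hb, rfl⟩, hd _ hne (botUnary_node _ _ _ hne).symm⟩, fun S => h1 S⟩
  · exact ⟨[], post, d, ⟨none, Or.inl ⟨rfl, by simp⟩⟩, hp, fun hne => ⟨Or.inl ⟨rfl, fun b hb hbb =>
      h ⟨b, hb, hbb⟩⟩, hd _ hne rfl⟩, fun S => h1 S⟩

theorem Tree.pairDecompose (G2 : Finset ℕ) (t : Tree) : ∃ (pre : List Layer) (s : Tree),
    PairPop G2 pre s.rootUnary ∧ ∀ S : Subst, (layersCtx S pre).fill s = t := by
  by_cases h : ∃ b ∈ G2, t.rootUnary = some b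
  · obtain ⟨b, hb, h⟩ := h
    obtain ⟨f, ts⟩ := t
    rcases length_one_cases ts with ⟨s, rfl⟩ | h1
    · obtain rfl : f = b := by simpa [rootUnary] using h
      exact ⟨[.nd f [] []], s, Or.inr ⟨f, hb, rfl⟩, fun S => rfl⟩
    · rw [rootUnary_ne _ _ h1] at h; simp at h
  · exact ⟨[], t, Or.inl ⟨rfl, fun b hb hbb => h ⟨b, hb, hbb⟩⟩, fun S => rfl⟩

theorem PairPop.layer {ls : List Layer} {o : Option ℕ} (h : PairPop G ls o) {L : Layer}
    (hL : L ∈ ls) : ∃ b ∈ G, L = .nd b [] [] := by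
  grind

theorem PairPop.size_le {ls : List Layer} {o : Option ℕ} (h : PairPop G ls o) :
    layersSize ls ≤ 1 := by
  grind

theorem Tree.pairComp_all (t : Tree) (h : t.All fun q => q.2 ≤ k) : (t.pairComp nu G1 G2).All fun q
    => q.2 ≤ k := by
  rw [all_iff_toTerm] at h ⊢
  rw [← toTerm_pairComp t]
  intro q hq
  rcases mem_letters_pairComp _ q hq with h1 | ⟨a, _, b, _, h1, rfl⟩
  · grind
  · grind

theorem Eqn.size_sub_le {p q : ℕ} (e : Eqn) (hV : ∀ x ∈ e.varOcc, layersSize (V x).pre ≤ p)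
    (hC : ∀ X ∈ e.cvarOcc, layersSize (C X).pre + layersSize (C X).post ≤ q) :
    (e.map (sub V C)).size ≤ e.size + p * e.varOcc.length + q * e.cvarOcc.length := by
  have h1 := ContextUnif.size_sub_le e.lhs (fun x hx => hV x (mem_append_left _ hx))
    (fun x hx => hC x (mem_append_left _ hx))
  have h2 := ContextUnif.size_sub_le e.rhs (fun x hx => hV x (mem_append_right _ hx))
    (fun x hx => hC x (mem_append_right _ hx))
  simp only [Eqn.size, Eqn.map, length_append, mul_add]
  omega

/-- A new letter weighs as much as the two letters it stands for, so decoding preserves weights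
exactly and `Good.compress` applies. By `Good.unary` the sets `G1` and `G2` cover all unary letters
of the value, which makes its compression decodable. -/
theorem Good.pair (h : Good k e S w) (hd : Disjoint G1 G2) (hG : G1 ∪ G2 = e.unary) :
    ∃ (V : ℕ → VTmpl) (C : ℕ → CTmpl) (nu : ℕ → ℕ → ℕ) (S' : Subst) (w' : ℕ × ℕ → ℕ) (e' : Eqn),
      e' = (e.map (sub V C)).map (Term.pairComp nu G1 G2) ∧ FreshNames (G1 ∪ G2) nu ∧
      (∀ x, (V x).const = none ∧ ∃ o, PairPop G2 (V x).pre o) ∧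
      (∀ X, (∃ o, PairPop G2 (C X).pre o) ∧ ∃ o, PairPop G1 (C X).post o) ∧
      (∀ X ∈ e.cvarOcc, (C X).keep = false → (C X).pre ≠ [] ∨ (C X).post ≠ []) ∧
      Good k e' S' w' ∧
      (∀ q ∈ e'.letters, q ∈ e.letters ∨ (q.2 = 1 ∧ q.1 ≤ 5 * e.size)) ∧
      S'.eval e'.lhs = (S.eval e.lhs).pairComp nu G1 G2 := by
  classical
  choose pV sV hpV hfV using fun x => Tree.pairDecompose G2 (S.var x)
  choose pC qC dC hpC hqC huC hfC using fun X => Ctx.pairDecompose G1 G2 (S.ctx X)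
  let V : ℕ → VTmpl := fun x => ⟨pV x, none⟩
  let C : ℕ → CTmpl := fun X => ⟨pC X, decide (dC X ≠ .hole), qC X⟩
  let S1 : Subst := ⟨sV, dC⟩
  have hC : ∀ X, ∀ L ∈ (C X).pre ++ (C X).post, ∃ b ∈ e.unary, L = .nd b [] [] := by
    grind
  have hV : ∀ x, ∀ L ∈ (V x).pre, ∃ b ∈ e.unary, L = .nd b [] [] := by
    grind
  have hVl : ∀ {p : ℕ × ℕ → Prop}, (∀ q ∈ e.letters, p q) → ∀ x, (V x).Letters p := by
    refine fun hp x => ⟨fun L hL => ?_, by simp [V]⟩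
    obtain ⟨b, hb, rfl⟩ := hV x L hL
    exact hp _ (Eqn.mem_unary.1 hb)
  have hCl : ∀ {p : ℕ × ℕ → Prop}, (∀ q ∈ e.letters, p q) → ∀ X, (C X).Letters p := by
    intro p hp X L hL
    obtain ⟨b, hb, rfl⟩ := hC X L hL
    exact hp _ (Eqn.mem_unary.1 hb)
  set e1 : Eqn := e.map (sub V C) with he1
  have hlet : ∀ q ∈ e1.letters, q ∈ e.letters :=
    Eqn.letters_sub (fun q hq => hq) (hVl fun q hq => hq) (hCl fun q hq => hq)
  have hS1 : ∀ t : Term, S1.eval (sub V C t) = S.eval t := by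
    intro t
    rw [eval_sub]
    refine eval_congr t (fun x _ => ?_) fun X _ => ?_
    · show S1.eval (wrap (pV x) (.var x)) = _
      rw [eval_wrap, Subst.eval]; exact hfV x S1
    · rw [← hfC X S1]
      simp only [pull, CTmpl.ctx, C]
      grind
  have hun : ∀ a, (a, 1) ∈ e1.letters → a ∈ G1 ∪ G2 := fun a ha => hG ▸ Eqn.mem_unary.2 (hlet _ ha)
  obtain ⟨nu, hinj, hB, hle⟩ := exists_small_names
    (e1.lhs.unaryPairs ++ e1.rhs.unaryPairs).toFinset (G1 ∪ G2)
  have hfresh : FreshNames (G1 ∪ G2) fun a b => nu (a, b) :=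
    ⟨fun a b a' b' hab => by simpa using hinj hab, fun a b => hB _⟩
  let nu' : ℕ → ℕ → ℕ := fun a b => nu (a, b)
  set e' := e1.map (Term.pairComp nu' G1 G2) with he'
  have hunc : ∀ t : Term, t.exps = [] →
      (S1.pairComp nu' G1 G2).eval ((sub V C t).pairComp nu' G1 G2) =
        (S.eval t).pairComp nu' G1 G2 := by
    intro t ht
    rw [← hS1 t]
    refine ((pairCommutes_sub hd hfresh.2 t ⟨fun x _ => ⟨rfl, hpV x⟩, fun X _ =>
      ⟨hpC X, hqC X, fun hk => ?_⟩⟩ ht).1).symm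
    grind
  have hSl := hunc e.lhs h.pf.1
  have hSr := hunc e.rhs h.pf.2
  have hletters : ∀ q ∈ e'.letters, q ∈ e.letters ∨ (q.2 = 1 ∧ q.1 ≤ 5 * e.size) := by
    have hsz := Eqn.size_sub_le (V := V) (C := C) (p := 1) (q := 2) e (fun x _ => (hpV x).size_le)
      (fun X _ => by
        obtain ⟨o, ho⟩ := hpC X
        obtain ⟨o', ho'⟩ := hqC X
        exact Nat.add_le_add ho.size_le ho'.size_le)
    rw [← he1] at hsz
    have hB' : (G1 ∪ G2).card ≤ e.size := hG ▸ e.card_unary_le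
    have hP := toFinset_card_le (e1.lhs.unaryPairs ++ e1.rhs.unaryPairs)
    rw [length_append] at hP
    have a1 := e1.lhs.unaryPairs_length_le
    have a2 := e1.rhs.unaryPairs_length_le
    have a3 := e1.lhs.letters_length_eq
    have a4 := e1.rhs.letters_length_eq
    have a5 := e1.lhs.size_eq
    have a6 := e1.rhs.size_eq
    have a7 := e.lhs.size_eq
    have a8 := e.rhs.size_eq
    have key : ∀ t : Term, (∀ q ∈ t.letters, q ∈ e1.letters) →
        (∀ p ∈ t.unaryPairs, p ∈ e1.lhs.unaryPairs ++ e1.rhs.unaryPairs) →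
        ∀ q ∈ (t.pairComp nu' G1 G2).letters, q ∈ e.letters ∨ (q.2 = 1 ∧ q.1 ≤ 5 * e.size) := by
      intro t ht hp q hq
      rcases Term.mem_letters_pairComp_pairs hd hfresh.2 t q hq with hq | ⟨p, hp1, rfl⟩
      · grind
      · refine Or.inr ⟨rfl, (hle p (mem_toFinset.2 (hp p hp1))).trans ?_⟩
        grind
    intro q hq
    rcases Eqn.mem_letters.1 hq with hq | hq
    · exact key _ (fun q hq => Eqn.mem_letters.2 (Or.inl hq)) (fun p => mem_append_left _) q hq
    · exact key _ (fun q hq => Eqn.mem_letters.2 (Or.inr hq)) (fun p => mem_append_right _) q hq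
  have hone : ∀ q ∈ e'.letters, q.2 ≤ k := by
    have : ∀ t : Term, (∀ q ∈ t.letters, q.2 ≤ k) →
        ∀ q ∈ (t.pairComp nu' G1 G2).letters, q.2 ≤ k := fun t ht q hq =>
      (mem_letters_pairComp t q hq).elim (ht q) fun ⟨_, _, _, _, h1, h2⟩ => h2 ▸ (ht _ h1 : 1 ≤ k)
    have hl1 : ∀ q ∈ e1.letters, q.2 ≤ k := fun q hq => h.ar q (hlet q hq)
    exact fun q hq => (Eqn.mem_letters.1 hq).elim
      (this _ (fun q hq => hl1 q (Eqn.mem_letters.2 (Or.inl hq))) q)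
      (this _ (fun q hq => hl1 q (Eqn.mem_letters.2 (Or.inr hq))) q)
  have hk : ∀ X, (dC X).All fun q => q.2 ≤ k := fun X => by
    have h1 := h.sol.1.2 X
    rw [← hfC X S1, Ctx.all_comp_iff, Ctx.all_comp_iff] at h1
    grind
  have hS'all : (S1.pairComp nu' G1 G2).All fun q => q.2 ≤ k := by
    refine ⟨fun x => Tree.pairComp_all _ ?_, fun X => ?_⟩
    · have h1 := h.sol.1.1 x
      rw [← hfV x S1, Ctx.all_fill] at h1
      exact h1.2
    · have h1 := Tree.pairComp_all (nu := nu') (G1 := G1) (G2 := G2) ((dC X).fill (.node 0 []))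
        ((Ctx.all_fill _ _).2 ⟨hk X, by simp [Tree.all_node]⟩)
      rw [Ctx.pairComp_fill hd hfresh.2 _ _ (by simp [Tree.rootUnary]), Ctx.all_fill] at h1
      exact h1.1
  have hexps : ∀ t : Term, t.exps = [] → ((sub V C t).pairComp nu' G1 G2).exps = [] := by
    intro t ht
    rw [(Term.vars_pairComp _).2.2, exps_sub, ht]
    · grind
    · grind
  obtain ⟨g, hg⟩ := Infinite.exists_notMem_finset
    (e.letters.image Prod.fst ∪ e'.letters.image Prod.fst)
  rw [Finset.mem_union, not_or] at hg
  have hmap : ∀ T : Subst, ∀ t : Term, (∀ q ∈ t.letters, q ∈ e1.letters) →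
      (Hom.unary (pairDecode nu' G1 G2)).eval T (t.pairComp nu' G1 G2) = T.eval t :=
    fun T t ht => eval_pairDecode hfresh t (fun a ha => hun a (ht _ ha)) T
  have hcomp : ∃ w', Good k e' (S1.pairComp nu' G1 G2) w' := by
    refine h.compress (e' := e') (S' := S1.pairComp nu' G1 G2) (g := g)
      (H := Hom.unary (pairDecode nu' G1 G2))
      (w₀ := fun q => if q.2 = 1 then (pairDecode nu' G1 G2 q.1).weight w else w q)
      ⟨hS'all, hSl.trans ((congrArg _ h.sol.2).trans hSr.symm)⟩ hone
      ⟨hexps _ h.pf.1, hexps _ h.pf.2⟩ ?_ ?_ ?_ ?_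
      (fun m hm => hg.2 (Finset.mem_image_of_mem Prod.fst hm)) ?_ ?_
    · intro X hX
      refine Ctx.pairComp_ne_hole ?_
      have hX' : X ∈ (sub V C e.lhs).cvars ++ (sub V C e.rhs).cvars := by
        simpa only [he', he1, Eqn.map, Eqn.cvarOcc, (Term.vars_pairComp _).2.1] using hX
      rw [cvars_sub, cvars_sub, mem_append, mem_filter, mem_filter] at hX'
      grind
    · have hτ := (Tree.all_iff_toTerm _).1 h.unary
      have : (S1.pairComp nu' G1 G2).eval e'.lhs = (S.eval e.lhs).pairComp nu' G1 G2 := hSl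
      rw [this, ← Hom.eval_toTerm _ S, ← Tree.toTerm_pairComp, eval_pairDecode hfresh,
        Tree.eval_toTerm]
      exact fun a ha => hG ▸ Eqn.mem_unary.2 (hτ _ ha rfl)
    · intro f ts
      rcases length_one_cases ts with ⟨t, rfl⟩ | h1
      · simp [Hom.unary_node_one, Ctx.weight_fill]
      · rw [Hom.unary_node_ne _ _ _ h1, Tree.weight_node]; simp [h1]
    · intro q
      split_ifs
      · unfold pairDecode
        split_ifs <;> simp only [Ctx.weight] <;> exact Nat.le_add_right_of_le
          (Nat.le_add_right_of_le (Nat.le_add_right_of_le (h.one _)))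
      · exact h.one q
    · intro m hm
      rw [if_neg hm, h.off _ fun hm => hg.1 (Finset.mem_image_of_mem Prod.fst hm)]
    · intro T hT
      exact ⟨_, hT.decode (e := e) (hVl h.ar) (hCl h.ar)
        (Hom.unary_all fun hk f => pairDecode_all nu' G1 G2 f hk)
        (fun T => hmap T _ fun q hq => Eqn.mem_letters.2 (Or.inl hq))
        (fun T => hmap T _ fun q hq => Eqn.mem_letters.2 (Or.inr hq))⟩
  obtain ⟨w', hw'⟩ := hcomp
  refine ⟨V, C, nu', _, w', e', rfl, hfresh, fun x => ⟨rfl, _, hpV x⟩, fun X => ⟨hpC X, hqC X⟩,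
      fun X hX hkeep => ?_, hw', hletters, hSl⟩
  by_contra hcon
  rw [not_or, not_not, not_not] at hcon
  have hdh : dC X = .hole := by simpa [C] using hkeep
  refine h.ne X hX ?_
  rw [← hfC X S1, hdh, show pC X = [] from hcon.1, show qC X = [] from hcon.2]
  rfl

/-! ### Completeness of leaf compression -/

/-- An argument of `X` then contains no variables at all. By `Owned` this means that `X` owns no
variables, so new ones may be introduced for it. -/
theorem Term.AppliedToConst.cargs (h : t.AppliedToConst X G0) :
    X ∈ t.cvars ∧ (X, []) ∈ t.cargs := by
  induction t with
  | hv x => grind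
  | hc Y t ih =>
    simp only [AppliedToConst] at h
    rcases h with ⟨rfl, h⟩ | h
    · obtain ⟨c, hc⟩ := Option.isSome_iff_exists.1 h
      rw [constIn_eq_some] at hc
      grind
    · grind
  | hn f ts ih =>
    grind
  | hp a l t ih =>
    grind

theorem Subst.All.eval (hS : S.All p) (t : Term) (ht : ∀ q ∈ t.letters, p q) : (S.eval t).All p :=
    by
  induction t with
  | hv x => simpa [Subst.eval] using hS.1 x
  | hc X t ih =>
    rw [Subst.eval, Ctx.all_fill]
    exact ⟨hS.2 X, ih fun q hq => ht q (by simpa [Term.letters] using hq)⟩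
  | hn f ts ih =>
    grind
  | hp a l t ih =>
    rw [Subst.eval, show S.eval t = Ctx.hole.fill (S.eval t) from rfl, ← Ctx.fill_up, Ctx.all_fill]
    exact ⟨Ctx.up_all (ht _ (by simp [Term.letters])) trivial,
      ih fun q hq => ht q (by simp [Term.letters, hq])⟩

/-- The generation of fathers: pop a letter down, with variables as its other arguments. -/
def GenPop (c : CTmpl) : Prop :=
  c = .triv ∨ ∃ f xs ys b, c = ⟨[], b, [.nd f xs ys]⟩

/-- Generating fathers creates no constant arguments: a popped letter has at least one child, and
the fresh variables sit below it, so replacing them by constants changes no root. -/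
theorem constIn_gen (hC : ∀ X, GenPop (C X)) (t : Term) (hV : ∀ x ∈ t.vars, V x = .triv) {c : ℕ}
    (h : (sub V (fun _ => .triv) (sub (fun _ => .triv) C t)).constIn G0 = some c) :
    t.constIn G0 = some c := by
  rw [constIn_eq_some] at h ⊢
  refine ⟨?_, h.2⟩
  have h := h.1
  rcases t with x | ⟨X, t⟩ | ⟨f, ts⟩ | ⟨a, l, t⟩
  · simp [sub, VTmpl.app, VTmpl.triv, wrap, hV x (by simp [vars])] at h
  · exfalso
    rcases hC X with hX | ⟨f, xs, ys, b, hX⟩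
    · simp [sub, CTmpl.app, hX, CTmpl.triv, wrap] at h
    · cases b <;> simp [sub, CTmpl.app, hX, CTmpl.triv, wrap, Layer.app] at h
  · simpa [sub] using h
  · grind

/-- Each context variable that was applied to a constant has popped a letter, and by `constIn_gen`
no new applications to constants arise. -/
theorem not_applied_gen (hC : ∀ X, GenPop (C X)) (hV0 : ∀ x, (V x).pre = []) (X : ℕ) (t : Term)
    (hV : ∀ x ∈ t.vars, V x = .triv) (ha : ∀ Y, t.AppliedToConst Y G0 → C Y ≠ .triv) :
    ¬ (sub V (fun _ => .triv) (sub (fun _ => .triv) C t)).AppliedToConst X G0 := by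
  have hvar : ∀ x, ¬ ((V x).app x).AppliedToConst X G0 := by
    intro x
    rcases hc : (V x).const with _ | c <;> simp [VTmpl.app, hV0, hc, wrap, Term.AppliedToConst]
  induction t with
  | hv x => simpa [sub, VTmpl.app, VTmpl.triv, wrap] using hvar x
  | hc Y t ih =>
    have hV' : ∀ x ∈ t.vars, V x = .triv := fun x hx => hV x (by simpa [vars] using hx)
    have ih := ih hV' fun Z hZ => ha Z (by simp [Term.AppliedToConst, hZ])
    rcases hC Y with hY | ⟨f, xs, ys, b, hY⟩
    · simp only [sub, CTmpl.app, hY, CTmpl.triv, wrap, foldr_nil, cond_true,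
        Term.AppliedToConst, not_or]
      refine ⟨fun h => ?_, ih⟩
      obtain ⟨c, hc⟩ := Option.isSome_iff_exists.1 h.2
      exact ha Y (by simp [Term.AppliedToConst, constIn_gen hC t hV' hc]) hY
    · have hn : ¬ (sub V (fun _ => .triv) (Layer.app (.nd f xs ys)
          (sub (fun _ => .triv) C t))).AppliedToConst X G0 := by
        grind
      cases b
      · grind
      · simp only [sub, CTmpl.app, hY, wrap, CTmpl.triv, foldr_nil, foldr_cons, cond_true,
          Term.AppliedToConst, not_or]
        refine ⟨fun h => ?_, hn⟩
        have := h.2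
        simp [Layer.app, sub, constIn] at this
  | hn f ts ih =>
    grind
  | hp a l t ih =>
    simp only [sub, Term.AppliedToConst]
    exact ih (fun x hx => hV x (by simpa [vars] using hx))
      fun Y hY => ha Y (by simpa [Term.AppliedToConst] using hY)

theorem Tree.constIn_eq_some {t : Tree} {c : ℕ} (h : t.constIn G0 = some c) :
    t = .node c [] ∧ c ∈ G0 := by
  rcases t with ⟨f, _ | ⟨s, ts⟩⟩
  · simp only [constIn] at h
    grind
  · simp [constIn] at h

theorem Tree.leafComp_all {nu : ℕ → List (Option ℕ) → ℕ} {G : Finset (ℕ × ℕ)}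
    (hG : ∀ q ∈ G, q.2 ≤ k) (t : Tree) (h : t.All fun q => q.2 ≤ k) :
    (t.leafComp nu G G0).All fun q => q.2 ≤ k := by
  rw [all_iff_toTerm] at h ⊢
  rw [← toTerm_leafComp t]
  intro q hq
  rcases mem_letters_leafComp _ q hq with h1 | ⟨f, p, h1, _, _, rfl⟩
  · grind
  · grind

/-- The letters for the leaf compression, with the same name for all new letters. -/
def Eqn.leafSet (e : Eqn) (k g0 : ℕ) : Finset (ℕ × ℕ) :=
  e.nonConsts ∪ (Finset.Ioc 1 k).image fun j => (g0, j)

theorem Eqn.mem_leafSet {g0 : ℕ} {q : ℕ × ℕ} :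
    q ∈ e.leafSet k g0 ↔ (q ∈ e.letters ∧ q.2 ≠ 0) ∨ (q.1 = g0 ∧ 1 < q.2 ∧ q.2 ≤ k) := by
  obtain ⟨f, m⟩ := q
  simp only [leafSet, Finset.mem_union, mem_nonConsts, Finset.mem_image, Finset.mem_Ioc,
    Prod.mk.injEq]
  grind

/-- The guesses of the leaf compression. -/
structure LeafPop (k M : ℕ) (e : Eqn) (g0 : ℕ) (V V' : ℕ → VTmpl) (C : ℕ → CTmpl) (own : ℕ → ℕ) :
    Prop where
  fresh : ∀ m, (g0, m) ∉ e.letters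
  g0_le : g0 ≤ M
  var : ∀ x, (V x).pre = [] ∧ ∀ c ∈ (V x).const, c ∈ insert g0 e.consts
  var' : ∀ x, (V' x).pre = [] ∧ ∀ c ∈ (V' x).const, c ∈ insert g0 e.consts
  old : ∀ x ∈ e.varOcc, V' x = .triv
  ctx : ∀ X, C X = .triv ∨
    (((e.map (sub V fun _ => .triv)).lhs.AppliedToConst X (insert g0 e.consts) ∨
      (e.map (sub V fun _ => .triv)).rhs.AppliedToConst X (insert g0 e.consts)) ∧
    ∃ f xs ys b, C X = ⟨[], b, [.nd f xs ys]⟩ ∧ (f, xs.length + 1 + ys.length) ∈ e.leafSet k g0 ∧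
      (xs ++ ys).Nodup ∧ ∀ x ∈ xs ++ ys, x ∉ e.varOcc ∧ x ≤ M ∧ own x = X)

/-- The value is normalized first, so that the chosen sets cover its letters. Crossing father-leaf
pairs are then removed in three rounds: variables with constant values (`V`), context variables
applied to constants (`C`), and the fresh variables with constant values (`V'`). A new letter weighs
as much as the father and the absorbed constants together. -/
theorem Good.leaf (h : Good k e S w) {M : ℕ} (hM : 2 * e.size + k * e.cvarOcc.length + 2 ≤ M) :
    ∃ (g0 : ℕ) (V V' : ℕ → VTmpl) (C : ℕ → CTmpl) (own : ℕ → ℕ) (nu : ℕ → List (Option ℕ) → ℕ)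
      (S' : Subst) (w' : ℕ × ℕ → ℕ) (e' : Eqn),
      e' = (((e.map (sub V fun _ => .triv)).map (sub (fun _ => .triv) C)).map
        (sub V' fun _ => .triv)).map (Term.leafComp nu (e.leafSet k g0) (insert g0 e.consts)) ∧
      FreshLeafNames (e.leafSet k g0) (insert g0 e.consts) nu ∧
      LeafPop k M e g0 V V' C own ∧ Good k e' S' w' ∧
      (∀ q ∈ e'.letters, q ∈ e.letters ∨ q.1 ≤ M) ∧
      e'.size + e.lhs.numConsts + e.rhs.numConsts ≤
        e.size + k * e.cvarOcc.length + e.cvarOcc.length + 2 ∧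
      (S'.eval e'.lhs).size + (S.eval e.lhs).toTerm.numConsts ≤
        (S.eval e.lhs).size + if (S.eval e.lhs).size = 1 then 1 else 0 := by
  classical
  -- the new constant and the normal form of the solution
  obtain ⟨γ, -, hγ, hγ'⟩ := exists_small_names {()} (e.letters.image Prod.fst)
  set g0 := γ () with hg0
  have hcl : (e.letters.image Prod.fst).card ≤ e.size := Finset.card_image_le.trans e.card_letters_le
  have hg0M : g0 ≤ e.size + 1 := by
    have := hγ' () (Finset.mem_singleton_self _)
    rw [Finset.card_singleton] at this
    omega
  have hfresh0 : ∀ m, (g0, m) ∉ e.letters := fun m hm => hγ () (Finset.mem_image_of_mem Prod.fst hm)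
  obtain ⟨S2, hg, hall, hsz, hnc⟩ := h.normalize hfresh0
  set G := e.leafSet k g0 with hG
  set G0 := insert g0 e.consts with hG0
  let Old : ℕ × ℕ → Prop := fun q => q ∈ G ∨ q.2 = 0 ∧ q.1 ∈ G0
  have hGk : ∀ q ∈ G, q.2 ≤ k := fun q hq =>
    (Eqn.mem_leafSet.1 hq).elim (fun h1 => h.ar q h1.1) fun h1 => h1.2.2
  have hOld : ∀ q ∈ e.letters, Old q := by
    intro q hq
    by_cases h0 : q.2 = 0
    · exact Or.inr ⟨h0, Finset.mem_insert_of_mem (Eqn.mem_consts.2 (h0 ▸ hq))⟩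
    · exact Or.inl (Eqn.mem_leafSet.2 (Or.inl ⟨hq, h0⟩))
  have hnorm : ∀ q : ℕ × ℕ, (q ∈ e.letters ∨ q.1 = g0 ∧ q.2 ≠ 1) → q.2 ≤ k → Old q := by
    rintro q (hq | ⟨hq, h1⟩) hk
    · exact hOld q hq
    · rcases Nat.lt_or_ge 1 q.2 with h2 | h2
      · exact Or.inl (Eqn.mem_leafSet.2 (Or.inr ⟨hq, h2, hk⟩))
      · exact Or.inr ⟨by omega, hq ▸ Finset.mem_insert_self _ _⟩
  have hparts := hg.parts_all (hall.mono hnorm)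
  -- the templates
  let T0 : ℕ → CTmpl := fun _ => .triv
  let U0 : ℕ → VTmpl := fun _ => .triv
  let V : ℕ → VTmpl := fun x => ⟨[], (S2.var x).constIn G0⟩
  set e1 := e.map (sub V T0) with he1
  let App : ℕ → Prop := fun X => e1.lhs.AppliedToConst X G0 ∨ e1.rhs.AppliedToConst X G0
  have hcv : ∀ t : Term, (sub V T0 t).cvars = t.cvars := fun t => by
    rw [cvars_sub]; exact filter_eq_self.2 fun _ _ => rfl
  have hApp : ∀ X, App X → X ∈ e.cvarOcc := by
    intro X hX
    have := hX.imp (fun h => (Term.AppliedToConst.cargs _ h).1)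
      fun h => (Term.AppliedToConst.cargs _ h).1
    simpa only [he1, Eqn.map, hcv, ← mem_append] using this
  -- The node just above the hole is split off. Its letter has positive arity, so it belongs to `G`.
  have hdec : ∀ X, ∃ (d : Ctx) (f : ℕ) (l r : List Tree), (d.All fun q => q.2 ≤ k) ∧
      (∀ t ∈ l ++ r, t.All fun q => q.2 ≤ k) ∧
      (App X → S2.ctx X = d.comp (.node f l .hole r) ∧ (f, l.length + 1 + r.length) ∈ G) := by
    intro X
    by_cases hX : App X
    · obtain ⟨d, f, l, r, hd⟩ := Ctx.exists_bot _ (hg.ne X (hApp X hX))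
      have h1 := hg.sol.1.2 X
      have h2 := hparts.2 X (hApp X hX)
      rw [hd, Ctx.all_comp_iff] at h1 h2
      refine ⟨d, f, l, r, h1.1, fun t ht => ?_, fun _ => ⟨hd, ?_⟩⟩
      · exact (mem_append.1 ht).elim (h1.2.2.1 t) (h1.2.2.2.2 t)
      · exact (h2.2.1 h1.2.1).resolve_right fun h => by simp at h
    · exact ⟨.hole, 0, [], [], trivial, by simp, fun h => absurd h hX⟩
  choose d f l r hdk hlr hctx using hdec
  -- `ν (X, i)` names the `i`-th sibling of the path in the node popped from `X`, so the owner of a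
  -- fresh variable can be recovered from its name.
  obtain ⟨ν, hν, hνB, hνM⟩ := exists_small_names
    (e.cvarOcc.toFinset ×ˢ Finset.range k) e.varOcc.toFinset
  let xs : ℕ → List ℕ := fun X => (List.range (l X).length).map fun i => ν (X, i)
  let ys : ℕ → List ℕ := fun X => (List.range (r X).length).map fun i => ν (X, (l X).length + i)
  let val : ℕ × ℕ → Tree := fun p => (l p.1 ++ r p.1).getD p.2 (.node 0 [])
  -- Fresh variables take the split-off subtrees as values; the default constant is met only at
  -- names that are not used.
  let σ : ℕ → Tree := fun y => if y ∈ e.varOcc then S2.var y else val (Function.invFun ν y)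
  let S3 : Subst := ⟨σ, fun X => if App X then d X else S2.ctx X⟩
  let V' : ℕ → VTmpl := fun y => if y ∈ e.varOcc then .triv else ⟨[], (σ y).constIn G0⟩
  let C : ℕ → CTmpl := fun X => if App X then
    ⟨[], decide (d X ≠ .hole), [.nd (f X) (xs X) (ys X)]⟩ else .triv
  have hσν : ∀ p, σ (ν p) = val p := fun p => by
    simp only [σ]
    rw [if_neg fun hm => hνB p (mem_toFinset.2 hm), Function.leftInverse_invFun hν]
  have hxs : ∀ X, (xs X).map σ = l X := by
    intro X
    refine ext_getElem (by simp [xs]) fun i h1 h2 => ?_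
    simp [xs, hσν, val, List.getElem?_append, h2]
  have hys : ∀ X, (ys X).map σ = r X := by
    intro X
    refine ext_getElem (by simp [ys]) fun i h1 h2 => ?_
    simp [ys, hσν, val, List.getElem?_append, h2]
  have hxy : ∀ X, xs X ++ ys X = (List.range ((l X).length + (r X).length)).map fun i => ν (X, i) := by
    intro X
    rw [range_add, map_append, map_map]; rfl
  have hnew : ∀ X, App X → ∀ x ∈ xs X ++ ys X, x ∉ e.varOcc ∧ x ≤ M ∧
      (Function.invFun ν x).1 = X := by
    intro X hX x hx
    rw [hxy, mem_map] at hx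
    obtain ⟨i, hi, rfl⟩ := hx
    refine ⟨fun hm => hνB _ (mem_toFinset.2 hm), ?_, by rw [Function.leftInverse_invFun hν]⟩
    have h1 := hGk _ (hctx X hX).2
    have h2 := hνM (X, i) (Finset.mem_product.2 ⟨mem_toFinset.2 (hApp X hX), by
      simp at hi h1 ⊢; omega⟩)
    rw [Finset.card_product, Finset.card_range] at h2
    have h3 := toFinset_card_le (e.cvarOcc)
    have h4 := toFinset_card_le (e.varOcc)
    have h5 := Nat.mul_le_mul_right k h3
    have a7 := e.lhs.size_eq
    have a8 := e.rhs.size_eq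
    rw [mul_comm _ k, mul_comm _ k] at h5
    rw [mul_comm _ k] at h2
    rw [length_append (as := e.lhs.vars)] at h4
    simp only [Eqn.size] at *
    omega
  have hlen : ∀ X, (xs X).length + 1 + (ys X).length = (l X).length + 1 + (r X).length := by
    simp [xs, ys]
  have hVc : ∀ t : Tree, ∀ c ∈ t.constIn G0, c ∈ G0 := fun t c hc => (Tree.constIn_eq_some hc).2
  have hpop : LeafPop k M e g0 V V' C fun y => (Function.invFun ν y).1 := by
    refine ⟨hfresh0, by omega, fun x => ⟨rfl, hVc _⟩, fun x => ?_, fun x hx => if_pos hx,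
      fun X => ?_⟩
    · simp only [V']
      split_ifs
      exacts [⟨rfl, by simp [VTmpl.triv]⟩, ⟨rfl, hVc _⟩]
    · by_cases hX : App X
      · refine Or.inr ⟨hX, f X, xs X, ys X, _, if_pos hX, ?_, ?_, hnew X hX⟩
        · rw [hlen]; exact (hctx X hX).2
        · rw [hxy]
          exact nodup_range.map fun i j hij => by simpa using hν hij
      · exact Or.inl (if_neg hX)
  set e3 := (e1.map (sub U0 C)).map (sub V' T0) with he3
  let F : Term → Term := fun t => sub V' T0 (sub U0 C (sub V T0 t))
  -- the solution of the uncrossed equation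
  have hbot : ∀ (T : Subst) X, (CTmpl.triv).ctx T X = T.ctx X := fun T X => by
    simp [CTmpl.ctx, CTmpl.triv, layersCtx, Ctx.comp_hole, Ctx.comp]
  have hcst : ∀ (T : Subst) y (s : Tree), T.var y = s →
      T.eval ((⟨[], s.constIn G0⟩ : VTmpl).app y) = s := by
    intro T y s hs
    rcases hc : s.constIn G0 with _ | c
    · simpa [VTmpl.app, wrap, Subst.eval] using hs
    · simp [VTmpl.app, wrap, Subst.eval, (Tree.constIn_eq_some hc).1]
  have hvar2 : ∀ y, (pull V' T0 S3).var y = σ y := by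
    intro y
    by_cases hy : y ∈ e.varOcc
    · show S3.eval ((V' y).app y) = σ y
      rw [show V' y = .triv from if_pos hy]
      simp [VTmpl.triv, VTmpl.app, wrap, Subst.eval, S3]
    · simp only [pull, V', hy, if_false]; exact hcst _ _ _ rfl
  have hS3 : ∀ t : Term, (∀ x ∈ t.vars, x ∈ e.varOcc) → S3.eval (F t) = S2.eval t := by
    intro t ht
    simp only [F]
    rw [eval_sub, eval_sub, eval_sub]
    refine eval_congr t (fun x hx => hcst _ _ _ ?_) fun X _ => ?_
    · simp only [pull, U0, VTmpl.app, VTmpl.triv, wrap, foldr_nil, Option.elim, Subst.eval]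
      exact (hvar2 x).trans (if_pos (ht x hx))
    · refine (hbot _ X).trans ?_
      by_cases hX : App X
      · have h1 : (pull V' T0 S3).ctx X = d X := (hbot _ X).trans (if_pos hX)
        have h2 : layersCtx (pull V' T0 S3) [.nd (f X) (xs X) (ys X)] =
            .node (f X) (l X) .hole (r X) := by
          have : (pull V' T0 S3).var = σ := funext hvar2
          simp only [layersCtx, foldr_cons, foldr_nil, Ctx.comp_hole, Layer.ctx, this, hxs, hys]
        rw [(hctx X hX).1]
        by_cases hd : d X = .hole
        · simp only [pull, C, hX, if_true, CTmpl.ctx, hd, ne_eq, not_true, decide_false, cond_false]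
          exact h2
        · simp only [pull, C, hX, if_true, CTmpl.ctx, hd, ne_eq, not_false_iff, decide_true, cond_true]
          have h3 := congrArg₂ Ctx.comp h1 h2
          exact h3
      · show (C X).ctx _ X = _
        simp only [C, hX, if_false]
        exact (hbot _ X).trans ((hbot _ X).trans (if_neg hX))
  have hGen : ∀ X, GenPop (C X) := fun X => by
    by_cases hX : App X
    · exact Or.inr ⟨_, _, _, _, if_pos hX⟩
    · exact Or.inl (if_neg hX)
  have hvars1 : ∀ t : Term, ∀ x ∈ (sub V T0 t).vars, x ∈ t.vars ∧ (S2.var x).constIn G0 = none := by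
    intro t x hx
    rcases mem_vars_sub.1 hx with ⟨y, hy, hxy⟩ | ⟨X, _, hX⟩
    · rcases hc : (S2.var y).constIn G0 with _ | c
      · simp only [V, hc, VTmpl.app, wrap, foldr_nil, Option.elim, Term.vars, mem_singleton] at hxy
        subst hxy
        exact ⟨hy, hc⟩
      · simp [V, hc, VTmpl.app, wrap, Term.vars] at hxy
    · simp [T0, CTmpl.triv, layersVars] at hX
  have hkeep : ∀ X, (C X).keep = true → X ∈ e.cvarOcc → S3.ctx X ≠ .hole := by
    intro X hk hX
    simp only [C, S3] at hk ⊢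
    split_ifs at hk ⊢
    · simpa using hk
    · exact hg.ne X hX
  have hcv3 : ∀ t : Term, ∀ X ∈ (F t).cvars, X ∈ t.cvars ∧ (C X).keep = true := by
    intro t X hX
    simp only [F, cvars_sub, mem_filter] at hX
    exact ⟨hX.1.1.1, hX.1.2⟩
  have hunc : ∀ t : Term, t = e.lhs ∨ t = e.rhs → LeafUncrossed G0 S3 (F t) := by
    intro t ht
    have htv : ∀ x ∈ t.vars, x ∈ e.varOcc := fun x hx => by rcases ht with rfl | rfl <;> simp [hx]
    have htc : ∀ x ∈ t.cvars, x ∈ e.cvarOcc := fun x hx => by rcases ht with rfl | rfl <;> simp [hx]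
    refine ⟨fun y hy => ?_, fun X hX => ⟨hkeep X (hcv3 t X hX).2 (htc X (hcv3 t X hX).1), ?_⟩⟩
    · show (σ y).constIn G0 = none
      rcases mem_vars_sub.1 hy with ⟨x, hx, hyx⟩ | ⟨X, _, hX⟩
      · by_cases hxe : x ∈ e.varOcc
        · simp only [V', hxe, if_true, VTmpl.triv, VTmpl.app, wrap, foldr_nil, Option.elim,
            Term.vars, mem_singleton] at hyx
          subst hyx
          simp only [σ, hxe, if_true]
          rcases mem_vars_sub.1 hx with ⟨z, hz, hyz⟩ | ⟨X, hX, hyX⟩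
          · have : y = z := by simpa [U0, VTmpl.triv, VTmpl.app, wrap, Term.vars] using hyz
            exact (hvars1 t y (this ▸ hz)).2
          · exfalso
            simp only [C] at hyX
            split_ifs at hyX with hA
            · refine (hnew X hA y ?_).1 hxe
              simpa [layersVars, Layer.vars] using hyX
            · simp [CTmpl.triv, layersVars] at hyX
        · rcases hc : (σ x).constIn G0 with _ | c
          · simp only [V', hxe, if_false, hc, VTmpl.app, wrap, foldr_nil, Option.elim,
              Term.vars, mem_singleton] at hyx
            rw [hyx, hc]
          · simp only [V', hxe, if_false, hc, VTmpl.app, wrap, foldr_nil, Option.elim,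
              Term.vars, map_nil, flatten_nil, not_mem_nil] at hyx
      · simp [T0, CTmpl.triv, layersVars] at hX
    · refine not_applied_gen hGen (fun x => (hpop.var' x).1) X _
        (fun x hx => hpop.old x (htv x (hvars1 t x hx).1)) fun Y hY => ?_
      have hA : App Y := ht.imp (fun h => by rw [h] at hY; exact hY) fun h => by rw [h] at hY; exact hY
      simp [C, hA, CTmpl.triv]
  -- the names of the new letters
  obtain ⟨g, hgB⟩ := Infinite.exists_notMem_finset (insert g0 (e.letters.image Prod.fst))
  -- The name `g` is kept away from the new letters: it will denote the foreign letters of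
  -- competitors, which must not be decoded as patterns.
  obtain ⟨n0, hn0, hnB, hnM⟩ := exists_small_names
    (e3.lhs.nodePats G0 ++ e3.rhs.nodePats G0).toFinset
    (insert g (insert g0 (e.letters.image Prod.fst)))
  let nu : ℕ → List (Option ℕ) → ℕ := fun f p => n0 (f, p)
  have hOldB : ∀ q, Old q → q.1 ∈ insert g0 (e.letters.image Prod.fst) := by
    rintro q (hq | ⟨_, hq⟩)
    · rcases Eqn.mem_leafSet.1 hq with hq | hq
      · exact Finset.mem_insert_of_mem (Finset.mem_image_of_mem _ hq.1)
      · exact hq.1 ▸ Finset.mem_insert_self _ _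
    · rcases Finset.mem_insert.1 hq with hq | hq
      · exact hq ▸ Finset.mem_insert_self _ _
      · exact Finset.mem_insert_of_mem (Finset.mem_image.2 ⟨_, Eqn.mem_consts.1 hq, rfl⟩)
  have hnu : FreshLeafNames G G0 nu := by
    refine ⟨fun f p f' p' hab => by simpa using hn0 hab, fun f p => ⟨fun hm => ?_, fun _ hm => ?_⟩⟩
    · exact hnB (f, p) (Finset.mem_insert_of_mem (hOldB _ (Or.inl hm)))
    · exact hnB (f, p) (Finset.mem_insert_of_mem (hOldB (_, 0) (Or.inr ⟨rfl, hm⟩)))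
  have hVl : ∀ (U : ℕ → VTmpl) {p : ℕ × ℕ → Prop}, (∀ x, (U x).pre = [] ∧ ∀ c ∈ (U x).const, c ∈ G0) →
      (∀ c ∈ G0, p (c, 0)) → ∀ x, (U x).Letters p := fun U p hU hp x =>
    ⟨by simp [(hU x).1], fun c hc => hp c ((hU x).2 c hc)⟩
  have hCl : ∀ {p : ℕ × ℕ → Prop}, (∀ q ∈ G, p q) → ∀ X, (C X).Letters p := by
    intro p hp X L hL
    simp only [C] at hL
    split_ifs at hL with hX
    · simp only [nil_append, mem_singleton] at hL
      rw [hL]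
      simp only [Layer.letter, hlen]
      exact hp _ (hctx X hX).2
    · simp [CTmpl.triv] at hL
  have hC0 : ∀ {p : ℕ × ℕ → Prop} X, (T0 X).Letters p := fun _ => CTmpl.letters_triv
  have hU0 : ∀ {p : ℕ × ℕ → Prop} X, (U0 X).Letters p := fun _ => VTmpl.letters_triv
  have hlet3 : ∀ q ∈ e3.letters, Old q := by
    have hO : ∀ c ∈ G0, Old (c, 0) := fun c hc => Or.inr ⟨rfl, hc⟩
    exact Eqn.letters_sub (Eqn.letters_sub (Eqn.letters_sub hOld (hVl V hpop.var hO) hC0) hU0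
      (hCl fun q hq => Or.inl hq)) (hVl V' hpop.var' hO) hC0
  set e' := e3.map (Term.leafComp nu G G0) with he'
  have hlet' : ∀ q ∈ e'.letters, Old q ∨ ∃ f p, (f, p.length) ∈ G ∧
      (f, p) ∈ e3.lhs.nodePats G0 ++ e3.rhs.nodePats G0 ∧ q = (nu f p, p.count none) := by
    intro q hq
    rcases Eqn.mem_letters.1 hq with hq | hq
    · exact (mem_letters_leafComp _ q hq).imp (fun h => hlet3 q (Eqn.mem_letters.2 (Or.inl h)))
        fun ⟨f, p, h1, _, h2, h3⟩ => ⟨f, p, h1, mem_append_left _ h2, h3⟩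
    · exact (mem_letters_leafComp _ q hq).imp (fun h => hlet3 q (Eqn.mem_letters.2 (Or.inr h)))
        fun ⟨f, p, h1, _, h2, h3⟩ => ⟨f, p, h1, mem_append_right _ h2, h3⟩
  have hexps : ∀ t : Term, t.exps = [] → (F t).exps = [] := by
    have hT : ∀ X, ∀ L ∈ (T0 X).pre ++ (T0 X).post, L.Plain := by simp [T0, CTmpl.triv]
    intro t ht
    simp only [F]
    rw [exps_sub (fun x => by simp [(hpop.var' x).1]) hT, exps_sub (by simp [U0, VTmpl.triv]),
      exps_sub (by simp [V]) hT, ht]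
    intro X L hL
    rcases hGen X with hX | ⟨_, _, _, _, hX⟩
    · simp [hX, CTmpl.triv] at hL
    · simp only [hX, nil_append, mem_singleton] at hL
      rw [hL]; trivial
  have hS : ∀ t : Term, t = e.lhs ∨ t = e.rhs → (S3.leafComp nu G G0).eval
      ((F t).leafComp nu G G0) = (S2.eval t).leafComp nu G G0 := by
    intro t ht
    rw [← hS3 t fun x hx => by rcases ht with rfl | rfl <;> simp [hx]]
    exact (leafCommutes _ (hunc t ht) (hexps t (by
      rcases ht with rfl | rfl
      exacts [h.pf.1, h.pf.2]))).1.symm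
  have hSl : (S3.leafComp nu G G0).eval e'.lhs = _ := hS e.lhs (Or.inl rfl)
  have hσk : ∀ y, (σ y).All fun q => q.2 ≤ k := by
    intro y
    simp only [σ]
    split_ifs
    · exact hg.sol.1.1 y
    · simp only [val]
      rcases Nat.lt_or_ge (Function.invFun ν y).2
        (l (Function.invFun ν y).1 ++ r (Function.invFun ν y).1).length with hlt | hge
      · rw [getD_eq_getElem _ _ hlt]
        exact hlr _ _ (getElem_mem hlt)
      · rw [getD_eq_default _ _ hge]; simp [Tree.all_node]
  have hS'k : (S3.leafComp nu G G0).All fun q => q.2 ≤ k := by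
    refine ⟨fun x => Tree.leafComp_all hGk _ (hσk x), fun X => ?_⟩
    -- A constant that is not absorbed is put into the hole, to transfer the arity bound from trees
    -- to contexts.
    obtain ⟨c, hc⟩ := Infinite.exists_notMem_finset G0
    have h0 : (S3.ctx X).All fun q => q.2 ≤ k := by
      simp only [S3]
      split_ifs
      exacts [hdk X, hg.sol.1.2 X]
    have h1 := Tree.leafComp_all (nu := nu) (G0 := G0) hGk ((S3.ctx X).fill (.node c []))
      ((Ctx.all_fill _ _).2 ⟨h0, by simp [Tree.all_node]⟩)
    rw [Ctx.leafComp_fill _ _ (by simp [Tree.constIn, hc]), Ctx.all_fill] at h1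
    exact h1.1
  have hτ : ∀ q ∈ (S2.eval e.lhs).toTerm.letters, Old q := by
    intro q hq
    have hk := (Tree.all_iff_toTerm _).1 (hg.sol.1.eval e.lhs fun q hq =>
      h.ar q (Eqn.mem_letters.2 (Or.inl hq))) q hq
    exact (Tree.all_iff_toTerm _).1 (hall.mono hnorm) q hq hk
  have hH : ∀ (T : Subst) (t : Term), (∀ q ∈ t.letters, Old q) →
      (Hom.ofPattern fun h m => some (leafDecode nu G h m)).eval T (t.leafComp nu G G0) = T.eval t :=
    fun T t ht => eval_leafDecode hnu t (fun f m hq => ht (f, m) hq) T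
  have hcomp : ∃ w', Good k e' (S3.leafComp nu G G0) w' := by
    refine hg.compress (g := g) (H := Hom.ofPattern fun h m => some (leafDecode nu G h m))
      -- The weight of the pattern: the father and the absorbed constants. On old letters the
      -- pattern has no constants, and this is the old weight.
      (w₀ := fun q => w ((leafDecode nu G q.1 q.2).1, (leafDecode nu G q.1 q.2).2.length) +
        ((leafDecode nu G q.1 q.2).2.map fun o => o.elim 0 fun c => w (c, 0)).sum)
      ⟨hS'k, ?_⟩ ?_ ⟨?_, ?_⟩ ?_ ?_ ?_ ?_ ?_ ?_ ?_
    · exact hSl.trans ((congrArg _ hg.sol.2).trans (hS e.rhs (Or.inr rfl)).symm)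
    · intro q hq
      rcases hlet' q hq with (hq | hq) | ⟨f, p, hp, _, rfl⟩
      exacts [hGk q hq, by omega, count_le_length.trans (hGk _ hp)]
    · exact ((Term.vars_leafComp _).2.2).trans (hexps _ h.pf.1)
    · exact ((Term.vars_leafComp _).2.2).trans (hexps _ h.pf.2)
    · intro X hX
      have hX' : X ∈ (F e.lhs).cvars ++ (F e.rhs).cvars := by
        simpa only [he', he3, he1, Eqn.map, Eqn.cvarOcc, (Term.vars_leafComp _).2.1] using hX
      refine Ctx.leafComp_ne_hole ?_
      rw [mem_append] at hX'
      refine hkeep X (hX'.elim (fun h => (hcv3 _ X h).2) fun h => (hcv3 _ X h).2)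
        (mem_append.2 (hX'.imp (fun h => (hcv3 _ X h).1) fun h => (hcv3 _ X h).1))
    · rw [hSl, ← Hom.eval_toTerm _ S, ← Tree.toTerm_leafComp, hH _ _ hτ, Tree.eval_toTerm]
    · intro f ts
      have hc := leafDecode_count nu G f ts.length
      rw [Hom.ofPattern_some (g := (leafDecode nu G f ts.length).1)
          (p := (leafDecode nu G f ts.length).2) rfl, Tree.weight_node,
        weave_length _ _ hc.symm, weave_weight _ _ _ hc.symm, add_assoc]
    · exact fun q => Nat.le_add_right_of_le (h.one _)
    · intro m hm
      rcases hlet' _ hm with hq | ⟨f, p, _, _, hq⟩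
      · exact hgB (hOldB _ hq)
      · have hgn : n0 (f, p) = g := (Prod.mk.inj hq).1.symm
        exact hnB (f, p) (by rw [hgn]; exact Finset.mem_insert_self _ _)
    · intro m _
      have : leafDecode nu G g m = (g, List.replicate m none) :=
        leafDecode_old fun f p _ hgp => hnB (f, p) (by
          rw [show n0 (f, p) = g from hgp]; exact Finset.mem_insert_self _ _)
      simp only [this, length_replicate, map_replicate, Option.elim, sum_replicate,
        smul_zero, add_zero]
      exact (h.off _ fun hm => hgB (Finset.mem_insert_of_mem
        (Finset.mem_image_of_mem Prod.fst hm))).le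
    · intro T hT
      have h1 := Solves.hom (e := e3) (Hom.ofPattern fun h m => some (leafDecode nu G h m)) hT
        (fun f ts hts hall => ?_) (hH _ _ fun q hq => hlet3 q (Eqn.mem_letters.2 (Or.inl hq)))
        (hH _ _ fun q hq => hlet3 q (Eqn.mem_letters.2 (Or.inr hq)))
      · have hk0 : ∀ c ∈ G0, (c, 0).2 ≤ k := fun c _ => Nat.zero_le k
        refine ⟨_, ((h1.pull (hVl V' hpop.var' hk0) hC0).pull hU0 (hCl hGk)).pull
          (hVl V hpop.var hk0) hC0, ?_⟩
        rw [← eval_sub, ← eval_sub, ← eval_sub, Hom.tree_eval]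
        exact (hH _ _ fun q hq => hlet3 q (Eqn.mem_letters.2 (Or.inl hq))).symm
      · have hc := leafDecode_count nu G f ts.length
        rw [Hom.ofPattern_some (g := (leafDecode nu G f ts.length).1)
          (p := (leafDecode nu G f ts.length).2) rfl, Tree.all_node,
          weave_length _ _ hc.symm]
        exact ⟨leafDecode_length nu hGk f _ hts, weave_all _ _ (fun c _ => Nat.zero_le k) hall⟩
  have hs3 : e3.size ≤ e.size + k * e.cvarOcc.length := by
    have b1 := Eqn.size_sub_le (V := V) (C := T0) (p := 0) (q := 0) e (by simp [V, layersSize])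
      (by simp [T0, CTmpl.triv, layersSize])
    have b2 := Eqn.size_sub_le (V := U0) (C := C) (p := 0) (q := k) e1
      (by simp [U0, VTmpl.triv, layersSize]) (fun X _ => by
        simp only [C]
        split_ifs with hX
        · have := hGk _ (hctx X hX).2
          have h6 := hlen X
          simp [layersSize, Layer.size] at this ⊢
          omega
        · simp [CTmpl.triv, layersSize])
    have b3 := Eqn.size_sub_le (V := V') (C := T0) (p := 0) (q := 0) (e1.map (sub U0 C))
      (by simp [(hpop.var' _).1, layersSize]) (by simp [T0, CTmpl.triv, layersSize])
    rw [← he3] at b3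
    rw [← he1] at b1
    have b4 : e1.cvarOcc = e.cvarOcc := by simp only [he1, Eqn.map, Eqn.cvarOcc, hcv]
    rw [b4] at b2
    omega
  have hconst : ∀ {m : ℕ}, (m, 0) ∉ G := fun h => by
    rcases Eqn.mem_leafSet.1 h with h | h
    exacts [h.2 rfl, by simp at h]
  have hside : ∀ t : Term, t.exps = [] → (∀ q ∈ (F t).letters, q ∈ e3.letters) →
      ((F t).leafComp nu G G0).size + t.numConsts ≤ (F t).size + t.cvars.length + 1 := by
    intro t ht hq
    have h1 := Term.size_leafComp (nu := nu) (F t) (hexps t ht)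
      (fun f m hm h0 => (hlet3 _ (hq _ hm)).resolve_right fun h => h0 h.1)
      (fun c hc => ((hlet3 _ (hq _ hc)).resolve_left hconst).2)
    have h2 : t.numConsts ≤ (F t).numConsts := (numConsts_sub_le _ _ _).trans
      ((numConsts_sub_le _ _ _).trans (numConsts_sub_le _ _ _))
    have h3 : (F t).cvars.length ≤ t.cvars.length := by
      simp only [F, cvars_sub]
      exact (length_filter_le _ _).trans ((length_filter_le _ _).trans (length_filter_le _ _))
    split_ifs at h1 <;> omega
  obtain ⟨w', hw'⟩ := hcomp
  refine ⟨g0, V, V', C, _, nu, _, w', e', rfl, hnu, hpop, hw', fun q hq => ?_, ?_, ?_⟩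
  · have hOld' : ∀ q, Old q → q ∈ e.letters ∨ q.1 = g0 := by
      rintro ⟨f, m⟩ (hq | ⟨h0, hq⟩)
      · exact (Eqn.mem_leafSet.1 hq).imp And.left And.left
      · rcases Finset.mem_insert.1 hq with hq | hq
        · exact Or.inr hq
        · simp only at h0
          exact Or.inl (h0 ▸ Eqn.mem_consts.1 hq)
    rcases hlet' q hq with hq | ⟨f, p, _, hp, rfl⟩
    · exact (hOld' q hq).imp id fun h => by omega
    · refine Or.inr ((hnM _ (mem_toFinset.2 hp)).trans ?_)
      have h1 := toFinset_card_le (e3.lhs.nodePats G0 ++ e3.rhs.nodePats G0)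
      rw [length_append] at h1
      have h2 := e3.lhs.nodePats_length_le (G0 := G0)
      have h3 := e3.rhs.nodePats_length_le (G0 := G0)
      have h4 := Finset.card_insert_le g (insert g0 (e.letters.image Prod.fst))
      have h5 := Finset.card_insert_le g0 (e.letters.image Prod.fst)
      have b5 : e3.size = e3.lhs.size + e3.rhs.size := rfl
      omega
  · have h1 := hside e.lhs h.pf.1 fun q hq => Eqn.mem_letters.2 (Or.inl hq)
    have h2 := hside e.rhs h.pf.2 fun q hq => Eqn.mem_letters.2 (Or.inr hq)
    change (F e.lhs).size + (F e.rhs).size ≤ _ at hs3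
    change ((F e.lhs).leafComp nu G G0).size + ((F e.rhs).leafComp nu G G0).size + _ + _ ≤ _
    rw [length_append] at hs3 ⊢
    omega
  · rw [hSl, ← Tree.size_toTerm, ← Tree.toTerm_leafComp, ← hnc]
    have h1 := Term.size_leafComp (nu := nu) (G := G) (G0 := G0) (S2.eval e.lhs).toTerm
      (Tree.symbols_toTerm _).2.2 (fun f m hq hm => (hτ _ hq).resolve_right fun h => hm h.1)
      (fun c hq => ((hτ _ hq).resolve_left hconst).2)
    · rw [(Tree.symbols_toTerm _).2.1] at h1
      have h2 := (S.eval e.lhs).one_le_size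
      split_ifs at h1 with hcst
      · obtain ⟨c, hc⟩ := hcst
        rw [Tree.size_toTerm] at h1
        have h3 : (S2.eval e.lhs).size = 1 := by rw [← Tree.size_toTerm, hc]; simp [Term.size]
        simp only [length_nil] at h1
        split_ifs <;> omega
      · rw [Tree.size_toTerm (S2.eval e.lhs)] at h1
        simp only [length_nil] at h1
        omega

/-! ### The number of variables -/

/-- Every variable introduced by the algorithm is owned by a context variable `X` and occurs in
each argument of `X`. -/
structure Owned (k : ℕ) (e0 e : Eqn) (own : ℕ → Option ℕ) : Prop where
  cvars : e.cvarOcc.Sublist e0.cvarOcc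
  args : ∀ q ∈ e.lhs.cargs ++ e.rhs.cargs, ∀ x ∈ e.varOcc, own x = some q.1 → x ∈ q.2
  owned : ∀ X, (e.varOcc.countP fun x => own x == some X) ≤ (k - 1) * e0.cvarOcc.count X
  free : (e.varOcc.countP fun x => own x == none) ≤ e0.varOcc.length

theorem sum_map_le_countP {l : List ℕ} {f : ℕ → ℕ} {p : ℕ → Bool} {c : ℕ}
    (h : ∀ x ∈ l, f x ≤ if p x then c else 0) : (l.map f).sum ≤ c * l.countP p := by
  induction l with
  | nil => simp
  | cons x l ih =>
    have h1 := h x (by simp)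
    have h2 := ih fun y hy => h y (by simp [hy])
    rw [map_cons, sum_cons, countP_cons, mul_add]
    grind

theorem countP_app_le {v : VTmpl} (h : layersVars v.pre = []) (p : ℕ → Bool) (x : ℕ) :
    (v.app x).vars.countP p ≤ if p x then 1 else 0 := by
  rw [VTmpl.app, vars_wrap, h]
  rcases v.const with _ | c <;> simp [vars, countP_cons]

theorem mem_vars_app {v : VTmpl} (h : layersVars v.pre = []) {x : ℕ} (hy : y ∈ (v.app x).vars) :
    y = x := by
  rw [VTmpl.app, mem_vars_wrap, h] at hy
  rcases hc : v.const with _ | c <;> simp_all [vars]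

/-- If `X` pops fresh variables down, then it owned none before, by the last clause of `hpost`;
afterwards it owns at most `k - 1` for each of its occurrences. In all other cases the numbers of
owned variables do not grow. -/
theorem Owned.sub {e0 : Eqn} {own own' : ℕ → Option ℕ} (h : Owned k e0 e own)
    (hV : ∀ x ∈ e.varOcc, layersVars (V x).pre = [])
    (hpre : ∀ X ∈ e.cvarOcc, layersVars (C X).pre = []) (hown : ∀ x ∈ e.varOcc, own' x = own x)
    (hpost : ∀ X ∈ e.cvarOcc, layersVars (C X).post = [] ∨ (layersVars (C X).post).length ≤ k - 1 ∧
      (∀ y ∈ layersVars (C X).post, own' y = some X) ∧ ∀ x ∈ e.varOcc, own x ≠ some X) :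
    Owned k e0 (e.map (sub V C)) own' := by
  have hcnt : ∀ p : ℕ → Bool, (e.map (ContextUnif.sub V C)).varOcc.countP p =
      (e.varOcc.map fun x => ((V x).app x).vars.countP p).sum +
      (e.cvarOcc.map fun X => (layersVars (C X).pre ++ layersVars (C X).post).countP p).sum := by
    intro p
    simp only [Eqn.map, countP_append, countP_vars_sub, map_append, sum_append]
    omega
  have hvar : ∀ o, (e.varOcc.map fun x => ((V x).app x).vars.countP fun x => own' x == o).sum ≤
      1 * e.varOcc.countP fun x => own x == o := fun o =>
    sum_map_le_countP fun x hx => (countP_app_le (hV x hx) _ x).trans (by rw [hown x hx])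
  have hpost' : ∀ X ∈ e.cvarOcc, ∀ y ∈ layersVars (C X).post, own' y = some X := by grind
  have hmem : ∀ y, y ∈ (e.map (ContextUnif.sub V C)).varOcc →
      (∃ x ∈ e.varOcc, y ∈ ((V x).app x).vars) ∨ ∃ X ∈ e.cvarOcc, y ∈ layersVars (C X).post := by
    intro y hy
    have : (∃ x ∈ e.varOcc, y ∈ ((V x).app x).vars) ∨
        ∃ X ∈ e.cvarOcc, y ∈ layersVars (C X).pre ++ layersVars (C X).post := by
      simp only [Eqn.map, mem_append (s := (ContextUnif.sub V C e.lhs).vars), mem_vars_sub,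
        mem_append (s := e.lhs.vars), mem_append (s := e.lhs.cvars)] at hy ⊢
      grind
    grind
  refine ⟨?_, ?_, fun X => ?_, ?_⟩
  · simp only [Eqn.map, Eqn.cvarOcc, cvars_sub, ← filter_append]
    exact filter_sublist.trans h.cvars
  · intro q hq y hy ho
    obtain ⟨vs, hvs, hX, hin⟩ : ∃ vs, (q.1, vs) ∈ e.lhs.cargs ++ e.rhs.cargs ∧ q.1 ∈ e.cvarOcc ∧
        ∀ y, (y ∈ layersVars (C q.1).post ∨ ∃ x ∈ vs, y ∈ ((V x).app x).vars) → y ∈ q.2 := by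
      have hcv : ∀ (t : Term) vs, (q.1, vs) ∈ t.cargs → q.1 ∈ t.cvars := by
        intro t vs ht
        induction t with
        | hv x => grind
        | hc Y t ih => grind
        | hn f ts ih =>
          grind
        | hp a l t ih => grind
      rcases mem_append.1 hq with hq | hq <;> obtain ⟨_, vs, h1, h2⟩ := cargs_sub V C _ q hq
      · grind
      · grind
    rcases hmem y hy with ⟨x, hx, hyx⟩ | ⟨Y, hY, hyY⟩
    · obtain rfl := mem_vars_app (hV x hx) hyx
      exact hin y (Or.inr ⟨y, h.args _ hvs y hx (hown y hx ▸ ho), hyx⟩)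
    · grind
  · rw [hcnt]
    have h1 := hvar (some X)
    have h2 := h.owned X
    -- The fresh variables popped from other context variables have other owners, so only the
    -- occurrences of `X` contribute.
    have h3 : ∀ c, (X ∈ e.cvarOcc → (layersVars (C X).post).length ≤ c) →
        (e.cvarOcc.map fun Y => (layersVars (C Y).pre ++ layersVars (C Y).post).countP
          fun x => own' x == some X).sum ≤ c * e.cvarOcc.count X := by
      intro c hc
      refine sum_map_le_countP fun Y hY => ?_
      rw [hpre Y hY, nil_append]
      split_ifs with hXY
      · grind
      · refine (countP_eq_zero.2 fun y hy => ?_).le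
        grind
    by_cases hX : X ∈ e.cvarOcc ∧ layersVars (C X).post ≠ []
    · obtain ⟨h4, _, h5⟩ := (hpost X hX.1).resolve_left hX.2
      have h6 : (e.varOcc.countP fun x => own x == some X) = 0 :=
        countP_eq_zero.2 fun x hx => by simpa using h5 x hx
      have h7 := h3 (k - 1) fun _ => h4
      have h8 := Nat.mul_le_mul_left (k - 1) (h.cvars.count_le X)
      omega
    · have h7 := h3 0 fun hm => by grind
      omega
  · rw [hcnt]
    have h1 := hvar none
    have h2 := h.free
    have h3 : (e.cvarOcc.map fun Y => (layersVars (C Y).pre ++ layersVars (C Y).post).countP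
        fun x => own' x == none).sum ≤ 0 * e.cvarOcc.countP fun _ => true :=
      sum_map_le_countP fun Y hY => by
        rw [hpre Y hY, nil_append]
        refine (countP_eq_zero.2 fun y hy => ?_).trans_le (Nat.zero_le _)
        grind
    omega

theorem Owned.congr {e0 : Eqn} {own : ℕ → Option ℕ} (h : Owned k e0 e own)
    (hF : ∀ t : Term, t = e.lhs ∨ t = e.rhs → (F t).vars = t.vars ∧ (F t).cvars = t.cvars ∧ (F
      t).cargs = t.cargs) :
    Owned k e0 (e.map F) own := by
  obtain ⟨h1, h2, h3⟩ := hF e.lhs (Or.inl rfl)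
  obtain ⟨h4, h5, h6⟩ := hF e.rhs (Or.inr rfl)
  obtain ⟨a, b, c, d⟩ := h
  refine ⟨?_, ?_, ?_, ?_⟩ <;> simpa only [Eqn.cvarOcc, Eqn.varOcc, Eqn.map, h1, h2, h3, h4, h5, h6]

theorem Owned.length_le {e0 : Eqn} {own : ℕ → Option ℕ} (h : Owned k e0 e own) :
    e.varOcc.length ≤ e0.varOcc.length + (k - 1) * e0.cvarOcc.length ∧
      e.cvarOcc.length ≤ e0.cvarOcc.length := by
  refine ⟨?_, h.cvars.length_le⟩
  -- The multiset of owners of the variable occurrences is contained in `k - 1` copies of the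
  -- multiset of original occurrences of context variables.
  have h1 : (e.varOcc.filterMap own).Subperm (List.replicate (k - 1) e0.cvarOcc).flatten := by
    rw [subperm_iff_count]
    intro X
    rw [count_filterMap, count_flatten, map_replicate, sum_replicate]
    exact h.owned X
  have h2 := h1.length_le
  rw [length_flatten, map_replicate, sum_replicate, smul_eq_mul] at h2
  have h3 : e.varOcc.length = (e.varOcc.countP fun x => own x == none) +
      (e.varOcc.filterMap own).length := by
    rw [length_filterMap_eq_countP, length_eq_countP_add_countP fun x => own x == none]
    congr 1
    exact countP_congr fun x _ => by cases own x <;> simp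
  have h4 := h.free
  omega

/-! ### Memory -/

def ListFits (Q : ℕ) (l : List ℕ) : Prop := l.length ≤ Q ∧ ∀ x ∈ l, x ≤ Q

def SetFits (Q : ℕ) (G : Finset ℕ) : Prop := G.card ≤ Q ∧ ∀ x ∈ G, x ≤ Q

def LetterFits (Q : ℕ) (G : Finset (ℕ × ℕ)) : Prop := G.card ≤ Q ∧ ∀ q ∈ G, q.1 ≤ Q ∧ q.2 ≤ Q

def Stage.Fits (Q : ℕ) : Stage → Prop
  | .prefC G l | .prefV G l | .suff G l => SetFits Q G ∧ ListFits Q l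
  | .chain G => SetFits Q G
  | .popDown G1 G2 l | .popUpC G1 G2 l | .popUpV G1 G2 l => SetFits Q G1 ∧ SetFits Q G2 ∧ ListFits Q l
  | .pair G1 G2 => SetFits Q G1 ∧ SetFits Q G2
  | .constV G G0 l | .constNew G G0 l => LetterFits Q G ∧ SetFits Q G0 ∧ ListFits Q l
  | .genDown G G0 l l' => LetterFits Q G ∧ SetFits Q G0 ∧ ListFits Q l ∧ ListFits Q l'
  | .leaf G G0 => LetterFits Q G ∧ SetFits Q G0
  | _ => True

def Eqn.Fits (Q : ℕ) (e : Eqn) : Prop := e.size ≤ Q ∧ e.lhs.Fits Q ∧ e.rhs.Fits Q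

def Config.Fits (Q : ℕ) (c : Config) : Prop := c.eqn.Fits Q ∧ c.stage.Fits Q

theorem ListFits.bits {l : List ℕ} (h : ListFits Q l) : listBits l ≤ (2 * Q + 2) * (Q + 1) := by
  have h1 := numBits_le h.1
  have h2 := sum_le_card_nsmul (l.map numBits) (2 * Q + 2) fun m hm => by
    obtain ⟨x, hx, rfl⟩ := mem_map.1 hm
    exact numBits_le (h.2 x hx)
  rw [length_map, smul_eq_mul] at h2
  have h3 := Nat.mul_le_mul_right (2 * Q + 2) h.1
  rw [listBits]
  linarith

theorem SetFits.bits (h : SetFits Q G) : setBits G ≤ (2 * Q + 2) * (Q + 1) := by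
  have h1 := numBits_le h.1
  have h2 := Finset.sum_le_card_nsmul G numBits (2 * Q + 2) fun x hx => numBits_le (h.2 x hx)
  rw [smul_eq_mul] at h2
  have h3 := Nat.mul_le_mul_right (2 * Q + 2) h.1
  rw [setBits]
  linarith

theorem LetterFits.bits {G : Finset (ℕ × ℕ)} (h : LetterFits Q G) :
    letterSetBits G ≤ 2 * ((2 * Q + 2) * (Q + 1)) := by
  have h1 := numBits_le h.1
  have h2 := Finset.sum_le_card_nsmul G (fun q => numBits q.1 + numBits q.2)
    ((2 * Q + 2) + (2 * Q + 2)) fun q hq =>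
      Nat.add_le_add (numBits_le (h.2 q hq).1) (numBits_le (h.2 q hq).2)
  rw [smul_eq_mul] at h2
  have h3 := Nat.mul_le_mul_right ((2 * Q + 2) + (2 * Q + 2)) h.1
  rw [letterSetBits]
  linarith

theorem Config.Fits.bits_le {c : Config} (h : c.Fits Q) : c.bits ≤ 24 * (Q + 1) ^ 2 := by
  obtain ⟨⟨hs, hl, hr⟩, h2⟩ := h
  have h1 := hl.bits_le
  have h3 := hr.bits_le
  have h4 := Nat.mul_le_mul_left (4 * Q + 8) hs
  rw [Eqn.size, mul_add] at h4
  have h5 : c.stage.bits ≤ 5 + 5 * ((2 * Q + 2) * (Q + 1)) := by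
    obtain ⟨i, s, e⟩ := c
    have hL := @ListFits.bits Q
    have hS := @SetFits.bits Q
    have hT := @LetterFits.bits Q
    cases s <;> simp only [Stage.Fits, Stage.bits] at h2 ⊢ <;> grind
  rw [Config.bits]
  nlinarith

/-! ### Runs -/

/-- A run through configurations with the property `P`, in which `m` phases begin before the last
configuration. -/
inductive Path (k : ℕ) (P : Config → Prop) : ℕ → Config → Config → Prop
  | refl (c : Config) : P c → Path k P 0 c c
  | cons (m : ℕ) (c d e : Config) : P c → Step k c d → Path k P m d e →
      Path k P (c.startsPhase.toNat + m) c e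

section Path
variable {k Q m m' : ℕ} {P : Config → Prop} {c d e : Config}

theorem Path.trans (h : Path k P m c d) (h' : Path k P m' d e) : Path k P (m + m') c e := by
  induction h with
  | refl c _ => rwa [zero_add]
  | cons m c d' _ hP hs _ ih => rw [add_assoc]; exact .cons _ _ _ _ hP hs (ih h')

theorem Path.step (h : Path k P m d e) (hc : P c) (hs : Step k c d)
    (h0 : c.stage ≠ .start := by nofun) : Path k P m c e := by
  have := Path.cons m c d e hc hs h
  rwa [show c.startsPhase = false by unfold Config.startsPhase; grind, Bool.toNat_false,
    zero_add] at this

/-- The last configuration is not counted by `Path`, whence the hypothesis `hd`. -/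
theorem Path.exists_run (h : Path k P m c d) (hd : d.startsPhase = false) : ∃ r : List Config,
    (c :: r).IsChain (Step k) ∧ (c :: r).getLast? = some d ∧ (∀ x ∈ c :: r, P x) ∧
      numPhases (c :: r) = m := by
  induction h with
  | refl c hc => exact ⟨[], by simp [numPhases, hd, hc]⟩
  | cons m c d' e hc hs _ ih =>
    obtain ⟨r, h1, h2, h3, h4⟩ := ih hd
    refine ⟨d' :: r, isChain_cons_cons.2 ⟨hs, h1⟩, by simpa using h2, by simp_all, ?_⟩
    rw [numPhases, countP_cons, ← numPhases, h4, add_comm]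
    grind

/-- `D` lists the processed entries in reverse order, so that `D` and the remaining list determine
the configuration. -/
theorem Path.loop {c : List ℕ → List ℕ → Config} {full : List ℕ}
    (hP : ∀ D T, D.reverse ++ T = full → P (c D T) ∧ (c D T).stage ≠ .start)
    (hs : ∀ D X T, D.reverse ++ X :: T = full → Step k (c D (X :: T)) (c (X :: D) T)) :
    Path k P 0 (c [] full) (c full.reverse []) := by
  suffices h : ∀ T D, D.reverse ++ T = full → Path k P 0 (c D T) (c full.reverse []) from
    h full [] rfl
  intro T
  induction T with
  | nil =>
    intro D hD
    obtain rfl : D = full.reverse := by simp [← hD]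
    exact .refl _ (hP _ _ hD).1
  | cons X T ih =>
    exact fun D hD => (ih (X :: D) (by simp [← hD])).step (hP _ _ hD).1 (hs D X T hD) (hP _ _ hD).2

end Path

/-! ### Loops -/

/-- The templates of the (context) variables that are already processed. -/
def onV (V : ℕ → VTmpl) (D : List ℕ) (x : ℕ) : VTmpl := if x ∈ D then V x else .triv

def onC (C : ℕ → CTmpl) (D : List ℕ) (X : ℕ) : CTmpl := if X ∈ D then C X else .triv

/-- The replacement of one variable and one context variable. -/
def pop (X : ℕ) (v : VTmpl) (c : CTmpl) : Term → Term :=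
  sub (update (fun _ => .triv) X v) (update (fun _ => .triv) X c)

theorem pop_triv (X : ℕ) (e : Eqn) : e.map (pop X .triv .triv) = e := by
  have : ∀ t : Term, pop X .triv .triv t = t := fun t => by
    rw [pop, update_eq_self_iff.2 rfl, update_eq_self_iff.2 rfl, sub_triv]
  simp [Eqn.map, this]

theorem mayDrop_pop {c : CTmpl} (e : Eqn) (h : ∀ t, F t = (⟨c.pre, true, c.post⟩ : CTmpl).app X t) :
    Eqn.MayDrop X (e.map (substC X F)) (e.map (pop X .triv c)) :=
  (mayDrop_iff h rfl e _).2 ⟨c.keep, by rw [pop, update_eq_self_iff.2 rfl]⟩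

theorem substV_pop (x : ℕ) (v : VTmpl) (e : Eqn) :
    e.map (substV x (v.app x)) = e.map (pop x v .triv) := by
  simp only [Eqn.map, pop, substV_eq_sub]
  rw [show update (fun _ => CTmpl.triv) x .triv = fun _ => .triv from update_eq_self_iff.2 rfl]

/-- Bounds for the templates. -/
structure TmplFits (Q p q : ℕ) (e : Eqn) (V : ℕ → VTmpl) (C : ℕ → CTmpl) : Prop where
  eqn : e.Fits Q
  size : e.size + p * e.varOcc.length + q * e.cvarOcc.length ≤ Q
  var : ∀ x ∈ e.varOcc, layersSize (V x).pre ≤ p ∧ (∀ L ∈ (V x).pre, L.Fits Q) ∧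
    ∀ c ∈ (V x).const, c ≤ Q
  ctx : ∀ X ∈ e.cvarOcc, layersSize (C X).pre + layersSize (C X).post ≤ q ∧
    ∀ L ∈ (C X).pre ++ (C X).post, L.Fits Q

section Pops
variable {Q p q k : ℕ} {e : Eqn} {V : ℕ → VTmpl} {C : ℕ → CTmpl}

theorem TmplFits.on (h : TmplFits Q p q e V C) (D : List ℕ) :
    TmplFits Q p q e (onV V D) (onC C D) := by
  refine ⟨h.eqn, h.size, fun x hx => ?_, fun X hX => ?_⟩
  · simp only [onV]
    split_ifs
    exacts [h.var x hx, by simp [VTmpl.triv, layersSize]]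
  · simp only [onC]
    split_ifs
    exacts [h.ctx X hX, by simp [CTmpl.triv, layersSize]]

theorem TmplFits.sub (h : TmplFits Q p q e V C) : (e.map (sub V C)).Fits Q :=
  ⟨(e.size_sub_le (fun x hx => (h.var x hx).1) fun X hX => (h.ctx X hX).1).trans h.size,
    fits_sub _ h.eqn.2.1 (fun x hx => (h.var x (mem_append_left _ hx)).2)
      fun X hX => (h.ctx X (mem_append_left _ hX)).2,
    fits_sub _ h.eqn.2.2 (fun x hx => (h.var x (mem_append_right _ hx)).2)
      fun X hX => (h.ctx X (mem_append_right _ hX)).2⟩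

theorem Eqn.map_sub_sub (hV : ∀ x ∈ e.varOcc, ∀ L ∈ (V x).pre, ∀ y ∈ L.vars, V' y = .triv)
    (hC : ∀ X ∈ e.cvarOcc, ∀ L ∈ (C X).pre ++ (C X).post, ∀ y ∈ L.vars, V' y = .triv) :
    (e.map (sub V C)).map (sub V' C') =
      e.map (sub (fun x => (V x).comp (V' x)) fun X => (C X).comp (C' X)) := by
  simp only [Eqn.map]
  rw [sub_sub _ _ _ _ _ (fun x hx => hV x (mem_append_left _ hx))
      fun X hX => hC X (mem_append_left _ hX),
    sub_sub _ _ _ _ _ (fun x hx => hV x (mem_append_right _ hx))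
      fun X hX => hC X (mem_append_right _ hX)]

theorem Eqn.map_sub_congr (hV : ∀ x ∈ e.varOcc, V x = V' x) (hC : ∀ X ∈ e.cvarOcc, C X = C' X) :
    e.map (sub V C) = e.map (sub V' C') := by
  simp only [Eqn.map]
  rw [sub_congr _ (fun x hx => hV x (mem_append_left _ hx)) fun X hX => hC X (mem_append_left _ hX),
    sub_congr _ (fun x hx => hV x (mem_append_right _ hx)) fun X hX => hC X (mem_append_right _ hX)]

theorem VTmpl.comp_triv (v : VTmpl) : v.comp .triv = v := by
  rcases v with ⟨a, _ | c⟩ <;> simp [comp, triv]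

theorem CTmpl.comp_triv (c : CTmpl) : c.comp .triv = c := by
  rcases c with ⟨a, _ | _, b⟩ <;> simp [comp, triv]

theorem VTmpl.triv_comp (v : VTmpl) : VTmpl.triv.comp v = v := by simp [comp, triv]

theorem CTmpl.triv_comp (c : CTmpl) : CTmpl.triv.comp c = c := by simp [comp, triv]

/-- One step of a loop adds the templates of `X` to the simultaneous substitution. This requires
that the variables of the popped layers have trivial templates themselves. -/
theorem map_on_cons {D : List ℕ} (hX : X ∉ D)
    (hV : ∀ x ∈ e.varOcc, ∀ L ∈ (V x).pre, ∀ y ∈ L.vars, V y = .triv)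
    (hC : ∀ X ∈ e.cvarOcc, ∀ L ∈ (C X).pre ++ (C X).post, ∀ y ∈ L.vars, V y = .triv) :
    (e.map (sub (onV V D) (onC C D))).map (pop X (V X) (C X)) =
      e.map (sub (onV V (X :: D)) (onC C (X :: D))) := by
  have hu : ∀ y, V y = .triv → update (fun _ => VTmpl.triv) X (V X) y = .triv := by grind
  refine (Eqn.map_sub_sub (fun x hx L hL y hy => ?_) fun Y hY L hL y hy => ?_).trans
    (Eqn.map_sub_congr (fun Y _ => ?_) fun Y _ => ?_)
  · simp only [onV] at hL
    grind
  · simp only [onC] at hL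
    grind
  · by_cases hY : Y = X
    · subst hY; simp [onV, hX, VTmpl.triv_comp]
    · simp [onV, hY, VTmpl.comp_triv]
  · by_cases hY : Y = X
    · subst hY; simp [onC, hX, CTmpl.triv_comp]
    · simp [onC, hY, CTmpl.comp_triv]

/-- A whole loop performs the simultaneous substitution. The intermediate equations fit into memory
because they arise from the same templates with some of them made trivial. -/
theorem Path.pops (h : TmplFits Q p q e V C) {i : Bool} {St : List ℕ → List ℕ → Stage}
    {full : List ℕ} (hn : full.Nodup) (hfV : ∀ x ∈ e.varOcc, x ∉ full → V x = .triv)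
    (hfC : ∀ X ∈ e.cvarOcc, X ∉ full → C X = .triv)
    (hV : ∀ x ∈ e.varOcc, ∀ L ∈ (V x).pre, ∀ y ∈ L.vars, V y = .triv)
    (hC : ∀ X ∈ e.cvarOcc, ∀ L ∈ (C X).pre ++ (C X).post, ∀ y ∈ L.vars, V y = .triv)
    (hSt : ∀ D T, D.reverse ++ T = full → (St D T).Fits Q ∧ St D T ≠ .start)
    (hs : ∀ D X T e', D.reverse ++ X :: T = full → e' = e.map (sub (onV V D) (onC C D)) →
      Step k ⟨i, St D (X :: T), e'⟩ ⟨i, St (X :: D) T, e'.map (pop X (V X) (C X))⟩) :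
    Path k (Config.Fits Q) 0 ⟨i, St [] full, e⟩ ⟨i, St full.reverse [], e.map (sub V C)⟩ := by
  have h1 := Path.loop (k := k) (P := Config.Fits Q) (full := full)
    (c := fun D T => ⟨i, St D T, e.map (ContextUnif.sub (onV V D) (onC C D))⟩)
    (fun D T hD => ⟨⟨(h.on D).sub, (hSt D T hD).1⟩, (hSt D T hD).2⟩) (fun D X T hD => by
      have h2 := hs D X T _ hD rfl
      rw [map_on_cons (fun hX => ?_) hV hC] at h2
      · exact h2
      · rw [← hD, nodup_append] at hn
        exact hn.2.2 X (by simpa using hX) X (by simp) rfl)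
  have a : onV V [] = fun _ => .triv := by funext x; simp [onV]
  have b : onC C [] = fun _ => .triv := by funext x; simp [onC]
  have e1 : e.map (ContextUnif.sub (onV V []) (onC C [])) = e := by simp [Eqn.map, a, b, sub_triv]
  have e2 : e.map (ContextUnif.sub (onV V full.reverse) (onC C full.reverse)) =
      e.map (ContextUnif.sub V C) := by
    refine Eqn.map_sub_congr (fun x hx => ?_) fun X hX => ?_
    · by_cases hf : x ∈ full
      · simp [onV, hf]
      · rw [hfV x hx hf]; simp [onV, hf]
    · by_cases hf : X ∈ full
      · simp [onC, hf]
      · rw [hfC X hX hf]; simp [onC, hf]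
  grind

end Pops

/-! ### Runs through chain and pair compression -/

section Stages
variable {Q p q k b b' v x : ℕ} {e e0 : Eqn} {V : ℕ → VTmpl} {C : ℕ → CTmpl} {i : Bool}

theorem Owned.refl (k : ℕ) (e : Eqn) : Owned k e e fun _ => none :=
  ⟨List.Sublist.refl _, by simp, by simp, countP_le_length⟩

/-- Layers without variables. -/
def LayersFit (Q p : ℕ) (ls : List Layer) : Prop :=
  layersSize ls ≤ p ∧ layersVars ls = [] ∧ ∀ L ∈ ls, L.Fits Q

theorem LayersFit.nil : LayersFit Q p [] := ⟨Nat.zero_le _, rfl, by simp⟩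

structure Fine (Q b v x : ℕ) (e : Eqn) : Prop where
  fits : e.Fits Q
  size : e.size ≤ b
  vars : e.varOcc.length ≤ v
  cvars : e.cvarOcc.length ≤ x

theorem Fine.sub (h : Fine Q b v x e) (hb : b + p * v + q * x ≤ b') (hQ : b' ≤ Q)
    (hV : ∀ y ∈ e.varOcc, LayersFit Q p (V y).pre ∧ ∀ c ∈ (V y).const, c ≤ Q)
    (hC : ∀ X ∈ e.cvarOcc, layersSize (C X).pre + layersSize (C X).post ≤ q ∧
      LayersFit Q q (C X).pre ∧ LayersFit Q q (C X).post) :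
    TmplFits Q p q e V C ∧ Fine Q b' v x (e.map (sub V C)) ∧
      (∀ y ∈ (e.map (sub V C)).varOcc, y ∈ e.varOcc) ∧
      ∀ Y ∈ (e.map (sub V C)).cvarOcc, Y ∈ e.cvarOcc := by
  have h1 := Nat.mul_le_mul_left p h.vars
  have h2 := Nat.mul_le_mul_left q h.cvars
  have h3 := h.size
  have hT : TmplFits Q p q e V C := ⟨h.fits, by omega,
    fun y hy => ⟨(hV y hy).1.1, (hV y hy).1.2.2, (hV y hy).2⟩, fun X hX => ⟨(hC X hX).1, fun L hL =>
      (mem_append.1 hL).elim ((hC X hX).2.1.2.2 L) ((hC X hX).2.2.2.2 L)⟩⟩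
  -- Templates without variables change no owner; with nobody owning anything, `Owned` just says
  -- that the occurrences do not become more numerous.
  have hO := ((Owned.refl 0 e).sub (own' := fun _ => none) (fun y hy => (hV y hy).1.2.1)
    (fun X hX => (hC X hX).2.1.2.1) (fun _ _ => rfl) fun X hX => Or.inl (hC X hX).2.2.2.1)
  refine ⟨hT, ⟨hT.sub, ?_, hO.length_le.1.trans ?_, hO.length_le.2.trans h.cvars⟩, ?_,
    fun Y hY => hO.cvars.subset hY⟩
  · have : (e.map (ContextUnif.sub V C)).size ≤ e.size + p * e.varOcc.length + q * e.cvarOcc.length :=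
      e.size_sub_le (fun y hy => (hV y hy).1.1) fun X hX => (hC X hX).1
    omega
  · simpa using h.vars
  · intro y hy
    have key : ∀ t : Term, (∀ y ∈ t.vars, y ∈ e.varOcc) → (∀ X ∈ t.cvars, X ∈ e.cvarOcc) →
        y ∈ (ContextUnif.sub V C t).vars → y ∈ e.varOcc := by
      intro t ht hc hy
      rcases mem_vars_sub.1 hy with ⟨z, hz, hyz⟩ | ⟨X, hX, hyX⟩
      · rw [mem_vars_app (hV z (ht z hz)).1.2.1 hyz]; exact ht z hz
      · rw [(hC X (hc X hX)).2.1.2.1, (hC X (hc X hX)).2.2.2.1] at hyX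
        simp at hyX
    grind

theorem Eqn.mem_vars : y ∈ e.vars ↔ y ∈ e.varOcc := mem_dedup

theorem Eqn.mem_cvars : y ∈ e.cvars ↔ y ∈ e.cvarOcc := mem_dedup

theorem Eqn.Fits.lists (h : e.Fits Q) : ListFits Q e.vars ∧ ListFits Q e.cvars := by
  have h1 := h.2.1.symbols.2
  have h2 := h.2.2.symbols.2
  have h3 := h.1
  rw [Eqn.size, Term.size_eq, Term.size_eq] at h3
  refine ⟨⟨(dedup_sublist _).length_le.trans ?_, fun y hy => ?_⟩,
    ⟨(dedup_sublist _).length_le.trans ?_, fun y hy => ?_⟩⟩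
  · grind
  · exact (mem_append.1 (Eqn.mem_vars.1 hy)).elim (h1.1 y) (h2.1 y)
  · grind
  · exact (mem_append.1 (Eqn.mem_cvars.1 hy)).elim (h1.2 y) (h2.2 y)

theorem ListFits.tail {D T full : List ℕ} (h : ListFits Q full) (hD : D.reverse ++ T = full) :
    ListFits Q T := by
  subst hD
  exact ⟨(by simp : T.length ≤ (D.reverse ++ T).length).trans h.1, fun y hy => h.2 y (by simp [hy])⟩

theorem Eqn.Fits.unary (h : e.Fits Q) : SetFits Q e.unary :=
  ⟨e.card_unary_le.trans h.1, fun a ha => (Eqn.mem_letters.1 (Eqn.mem_unary.1 ha)).elim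
    (fun h1 => h.2.1.symbols.1 _ h1) fun h1 => h.2.2.symbols.1 _ h1⟩

theorem Path.popsC (h : TmplFits Q 0 q e (fun _ => .triv) C) {St : List ℕ → List ℕ → Stage}
    (hSt : ∀ D T, D.reverse ++ T = e.cvars → (St D T).Fits Q ∧ St D T ≠ .start)
    (hs : ∀ D X T e', D.reverse ++ X :: T = e.cvars → X ∈ e.cvarOcc →
      e' = e.map (sub (onV (fun _ => .triv) D) (onC C D)) →
      Step k ⟨i, St D (X :: T), e'⟩ ⟨i, St (X :: D) T, e'.map (pop X .triv (C X))⟩) :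
    Path k (Config.Fits Q) 0 ⟨i, St [] e.cvars, e⟩
      ⟨i, St e.cvars.reverse [], e.map (sub (fun _ => .triv) C)⟩ :=
  Path.pops h (nodup_dedup _) (fun _ _ _ => rfl)
    (fun X hX hX' => absurd (Eqn.mem_cvars.2 hX) hX') (by intros; rfl) (by intros; rfl) hSt
    fun D X T e' hD he' => hs D X T e' hD (Eqn.mem_cvars.1 (by rw [← hD]; simp)) he'

theorem Path.popsV (h : TmplFits Q p 0 e V fun _ => .triv) {St : List ℕ → Stage} {full : List ℕ}
    (hn : full.Nodup) (hf : ∀ x ∈ e.varOcc, x ∉ full → V x = .triv)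
    (hV : ∀ x ∈ e.varOcc, layersVars (V x).pre = [])
    (hSt : ∀ T, (∃ D, D ++ T = full) → (St T).Fits Q ∧ St T ≠ .start)
    (hs : ∀ x T e', x ∈ full → Step k ⟨i, St (x :: T), e'⟩ ⟨i, St T, e'.map (pop x (V x) .triv)⟩) :
    Path k (Config.Fits Q) 0 ⟨i, St full, e⟩ ⟨i, St [], e.map (sub V fun _ => .triv)⟩ :=
  Path.pops (St := fun _ T => St T) h hn hf (fun _ _ _ => rfl) (fun x hx L hL y hy => by
      have : y ∈ layersVars (V x).pre := mem_flatten.2 ⟨_, mem_map_of_mem hL, hy⟩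
      simp [hV x hx] at this)
    (by simp [CTmpl.triv]) (fun D T hD => hSt T ⟨_, hD⟩)
    fun D X T e' hD _ => hs X T e' (by rw [← hD]; simp)

theorem ChainPop.fit {R : ℕ} {ls : List Layer} (h : ChainPop G R ls) (hG : SetFits Q G) (hR : R ≤ Q)
    : LayersFit Q 1 ls := by
  rcases h with rfl | ⟨a, ha, l, _, hl, rfl⟩
  · exact .nil
  · exact ⟨by simp [layersSize, Layer.size], rfl, by
      simpa [Layer.Fits] using ⟨hG.2 a ha, hl.trans (Nat.pow_le_pow_right (by omega) hR)⟩⟩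

theorem PairPop.fit {o : Option ℕ} {ls : List Layer} (h : PairPop G ls o) (hG : SetFits Q G)
    (hQ : 1 ≤ Q) : LayersFit Q 1 ls := by
  refine ⟨h.size_le, ?_, fun L hL => ?_⟩
  · grind
  · obtain ⟨b, hb, rfl⟩ := h.layer hL
    simpa [Layer.Fits] using ⟨hG.2 b hb, hQ⟩

/-- The templates of the two loops over context variables that together realize `c`. -/
def CTmpl.preFirst (c : CTmpl) : CTmpl := ⟨c.pre, c.keep || !c.post.isEmpty, []⟩

/-- A context variable may be removed only directly after a pop from it, so it is removed in the
last of the two loops in which it pops. If the first loop has removed it already, nothing is left to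
do in the second. -/
def CTmpl.postSecond (c : CTmpl) : CTmpl :=
  if c.keep || !c.post.isEmpty then ⟨[], c.keep, c.post⟩ else .triv

def CTmpl.postFirst (c : CTmpl) : CTmpl := ⟨[], c.keep || !c.pre.isEmpty, c.post⟩

def CTmpl.preSecond (c : CTmpl) : CTmpl :=
  if c.keep || !c.pre.isEmpty then ⟨c.pre, c.keep, []⟩ else .triv

/-- Three loops together realize the substitution `sub V C` suggested by the solution. The summand
`(!i).toNat` counts the phase that begins with its first subphase. -/
theorem Path.chain {R : ℕ} (he : Fine Q b v x e) (hb : b + v + 2 * x ≤ Q) (hR : R ≤ Q)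
    (hnu : FreshNames e.unary nu)
    (hV : ∀ y ∈ e.varOcc, (V y).const = none ∧ ChainPop e.unary R (V y).pre)
    (hC : ∀ X ∈ e.cvarOcc, ChainPop e.unary R (C X).pre ∧ ChainPop e.unary R (C X).post ∧ ((C
      X).keep = false → (C X).pre ≠ [] ∨ (C X).post ≠ []))
    (he' : e' = (e.map (sub V C)).map (Term.chainComp nu e.unary)) :
    Fine Q (b + x + v + x) v x (e.map (sub V C)) ∧
      ∀ m d, Path k (Config.Fits Q) m ⟨i, .part, e'⟩ d →
        Path k (Config.Fits Q) ((!i).toNat + m) ⟨i, .start, e⟩ d := by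
  subst he'
  have hG := he.fits.unary
  obtain ⟨t1, f1, v1, c1⟩ := he.sub (p := 0) (q := 1) (b' := b + x) (V := fun _ => .triv)
    (C := fun X => (C X).preFirst) (by omega) (by omega) (fun _ _ => ⟨.nil, by simp [VTmpl.triv]⟩)
    fun X hX => ⟨((hC X hX).1.fit hG hR).1, (hC X hX).1.fit hG hR, .nil⟩
  obtain ⟨t2, f2, _, c2⟩ := f1.sub (p := 1) (q := 0) (b' := b + x + v) (V := V)
    (C := fun _ => .triv) (by omega) (by omega)
    (fun y hy => ⟨(hV y (v1 y hy)).2.fit hG hR, by simp [(hV y (v1 y hy)).1]⟩)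
    fun X hX => ⟨le_rfl, .nil, .nil⟩
  obtain ⟨t3, f3, _, _⟩ := f2.sub (p := 0) (q := 1) (b' := b + x + v + x) (V := fun _ => .triv)
    (C := fun X => (C X).postSecond) (by omega) (by omega)
    (fun _ _ => ⟨.nil, by simp [VTmpl.triv]⟩) fun X hX => by
      have := (hC X (c1 X (c2 X hX))).2.1.fit hG hR
      rw [CTmpl.postSecond]
      split_ifs
      exacts [⟨by simpa [layersSize] using this.1, .nil, this⟩,
        ⟨by simp [layersSize, CTmpl.triv], .nil, .nil⟩]
  have e3 : ((e.map (sub (fun _ => .triv) fun X => (C X).preFirst)).map (sub V fun _ => .triv)).map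
      (sub (fun _ => .triv) fun X => (C X).postSecond) = e.map (sub V C) := by
    rw [Eqn.map_sub_sub (V' := fun _ => .triv) (by intros; rfl) (by intros; rfl),
      Eqn.map_sub_sub (by simp [VTmpl.triv])]
    · refine Eqn.map_sub_congr (fun y _ => by rw [VTmpl.triv_comp, VTmpl.comp_triv]) fun X _ => ?_
      rw [CTmpl.triv_comp]
      rcases h : C X with ⟨pre, _ | _, _ | _⟩ <;>
        simp [CTmpl.preFirst, CTmpl.postSecond, CTmpl.comp, CTmpl.triv]
    · intro X hX L hL y hy
      have : y ∈ layersVars (C X).pre :=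
        mem_flatten.2 ⟨_, mem_map_of_mem (by simpa [CTmpl.preFirst] using hL), hy⟩
      grind
  have l1 := Path.popsC (k := k) (i := i) (St := fun _ T => .prefC e.unary T) t1
    (fun D T hD => ⟨⟨hG, he.fits.lists.2.tail hD⟩, by simp⟩) fun D X T e' _ hX _ => by
      obtain ⟨h1, _, h2⟩ := hC X hX
      rcases h1 with h0 | ⟨a, ha, l, hl, _, h0⟩
      · rw [show (C X).preFirst = .triv by
          simp only [CTmpl.preFirst, h0, CTmpl.triv, CTmpl.mk.injEq, true_and, and_true]
          cases hk : (C X).keep <;> simp_all, pop_triv]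
        exact .prefCSkip ..
      · exact .prefCPop i e' _ _ X T a l ha hl (mayDrop_pop _ fun t => by
          simp [CTmpl.preFirst, h0, CTmpl.app, wrap, Layer.app])
  have l2 := Path.popsV (k := k) (i := i) (St := fun T => .prefV e.unary T) t2 (nodup_dedup _)
    (fun y hy hy' => absurd (Eqn.mem_vars.2 hy) hy')
    (fun y hy => ((hV y (v1 y hy)).2.fit hG hR).2.1)
    (fun T ⟨D, hD⟩ => ⟨⟨hG, f1.fits.lists.1.tail (D := D.reverse) (by
      rwa [reverse_reverse])⟩, by simp⟩)
    fun y T e' hy => by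
      obtain ⟨h1, h2⟩ := hV y (v1 y (Eqn.mem_vars.1 hy))
      rw [← substV_pop]
      rcases h2 with h0 | ⟨a, ha, l, hl, _, h0⟩
      · rw [show V y = .triv by rcases h : V y; simp_all [VTmpl.triv], substV_pop, pop_triv]
        exact .prefVSkip ..
      · rw [show (V y).app y = .pow a l (.var y) by simp [VTmpl.app, h1, h0, wrap, Layer.app]]
        exact .prefVPop _ _ _ _ _ _ _ ha hl
  have l3 := Path.popsC (k := k) (i := i) (St := fun _ T => .suff e.unary T) t3
    (fun D T hD => ⟨⟨hG, f2.fits.lists.2.tail hD⟩, by simp⟩) fun D X T e' _ hX _ => by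
      rcases (hC X (c1 X (c2 X hX))).2.1 with h0 | ⟨a, ha, l, hl, _, h0⟩
      · rw [show (C X).postSecond = .triv by
          cases hk : (C X).keep <;> simp [CTmpl.postSecond, h0, hk, CTmpl.triv], pop_triv]
        exact .suffSkip ..
      · exact .suffPop i e' _ _ X T a l ha hl (mayDrop_pop _ fun t => by
          simp [CTmpl.postSecond, h0, CTmpl.app, wrap, Layer.app])
  rw [e3] at l3
  rw [e3] at f3
  refine ⟨f3, fun m d hp => ?_⟩
  have := hp.step (c := ⟨i, .chain e.unary, _⟩) ⟨f3.fits, hG⟩ (.chain i _ _ nu hnu)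
  have := l3.trans (this.step ⟨f3.fits, hG, by simp [ListFits]⟩ (.suffDone ..))
  have := l2.trans (this.step ⟨f2.fits, hG, by simp [ListFits]⟩ (.prefVDone ..))
  have := l1.trans (this.step ⟨f1.fits, hG, by simp [ListFits]⟩ (.prefCDone ..))
  simp only [zero_add] at this
  have := Path.cons _ _ _ _ ⟨he.fits, trivial⟩ (.start i e) this
  cases i <;> exact this

theorem Path.pair (hd : Disjoint G1 G2) (hG : G1 ∪ G2 = e.unary) (he : Fine Q b v x e)
    (hb : b + v + 2 * x ≤ Q) (hQ : 1 ≤ Q) (hnu : FreshNames (G1 ∪ G2) nu)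
    (hV : ∀ y, (V y).const = none ∧ ∃ o, PairPop G2 (V y).pre o)
    (hC : ∀ X, (∃ o, PairPop G2 (C X).pre o) ∧ ∃ o, PairPop G1 (C X).post o)
    (hk : ∀ X ∈ e.cvarOcc, (C X).keep = false → (C X).pre ≠ [] ∨ (C X).post ≠ [])
    (he' : e' = (e.map (sub V C)).map (Term.pairComp nu G1 G2)) :
    Fine Q (b + x + x + v) v x (e.map (sub V C)) ∧
      ∀ m d, Path k (Config.Fits Q) m ⟨i, .choose, e'⟩ d →
        Path k (Config.Fits Q) m ⟨i, .part, e⟩ d := by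
  subst he'
  have hU := he.fits.unary
  have h1 : SetFits Q G1 := ⟨(Finset.card_le_card (by simp [← hG])).trans hU.1, fun a ha =>
    hU.2 a (by simp [← hG, ha])⟩
  have h2 : SetFits Q G2 := ⟨(Finset.card_le_card (by simp [← hG])).trans hU.1, fun a ha =>
    hU.2 a (by simp [← hG, ha])⟩
  have fV := fun y => (hV y).2.choose_spec.fit h2 hQ
  have fpre := fun X => (hC X).1.choose_spec.fit h2 hQ
  have fpost := fun X => (hC X).2.choose_spec.fit h1 hQ
  obtain ⟨t1, f1, v1, c1⟩ := he.sub (p := 0) (q := 1) (b' := b + x) (V := fun _ => .triv)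
    (C := fun X => (C X).postFirst) (by omega) (by omega) (fun _ _ => ⟨.nil, by simp [VTmpl.triv]⟩)
    fun X _ => ⟨by simpa [CTmpl.postFirst, layersSize] using (fpost X).1, .nil, fpost X⟩
  obtain ⟨t2, f2, _, c2⟩ := f1.sub (p := 0) (q := 1) (b' := b + x + x) (V := fun _ => .triv)
    (C := fun X => (C X).preSecond) (by omega) (by omega)
    (fun _ _ => ⟨.nil, by simp [VTmpl.triv]⟩) fun X hX => by
      rw [CTmpl.preSecond]
      split_ifs
      exacts [⟨(fpre X).1, fpre X, .nil⟩, ⟨by simp [layersSize, CTmpl.triv], .nil, .nil⟩]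
  obtain ⟨t3, f3, _, _⟩ := f2.sub (p := 1) (q := 0) (b' := b + x + x + v) (V := V)
    (C := fun _ => .triv) (by omega) (by omega) (fun y _ => ⟨fV y, by simp [(hV y).1]⟩)
    fun X hX => ⟨le_rfl, .nil, .nil⟩
  have e3 : ((e.map (sub (fun _ => .triv) fun X => (C X).postFirst)).map
      (sub (fun _ => .triv) fun X => (C X).preSecond)).map (sub V fun _ => .triv) =
        e.map (sub V C) := by
    rw [Eqn.map_sub_sub (V' := fun _ => .triv) (by intros; rfl) (by intros; rfl),
      Eqn.map_sub_sub (by simp [VTmpl.comp, VTmpl.triv])]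
    · refine Eqn.map_sub_congr (fun y _ => by rw [VTmpl.triv_comp, VTmpl.triv_comp]) fun X _ => ?_
      rw [CTmpl.comp_triv]
      rcases h : C X with ⟨_ | _, _ | _, _ | _⟩ <;>
        simp [CTmpl.postFirst, CTmpl.preSecond, CTmpl.comp, CTmpl.triv]
    · intro X hX L hL y hy
      have hL : L ∈ (C X).pre ++ (C X).post := by
        revert hL
        rcases C X with ⟨_ | _, _ | _, _⟩ <;>
          simp [CTmpl.postFirst, CTmpl.preSecond, CTmpl.comp, CTmpl.triv]
      grind
  have l1 := Path.popsC (k := k) (i := i) (St := fun _ T => .popDown G1 G2 T) t1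
    (fun D T hD => ⟨⟨h1, h2, he.fits.lists.2.tail hD⟩, by simp⟩) fun D X T e' _ hX _ => by
      rcases (hC X).2.choose_spec with ⟨h0, _⟩ | ⟨a, ha, h0⟩
      · rw [show (C X).postFirst = .triv by
          have := hk X hX
          simp only [CTmpl.postFirst, h0, CTmpl.triv, CTmpl.mk.injEq, true_and, and_true]
          cases hk : (C X).keep <;> simp_all, pop_triv]
        exact .popDownSkip ..
      · exact .popDownPop i e' _ _ _ X T a ha (mayDrop_pop _ fun t => by
          simp [CTmpl.postFirst, h0, CTmpl.app, wrap, Layer.app])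
  have l2 := Path.popsC (k := k) (i := i) (St := fun _ T => .popUpC G1 G2 T) t2
    (fun D T hD => ⟨⟨h1, h2, f1.fits.lists.2.tail hD⟩, by simp⟩) fun D X T e' _ hX _ => by
      rcases (hC X).1.choose_spec with ⟨h0, _⟩ | ⟨a, ha, h0⟩
      · rw [show (C X).preSecond = .triv by
          cases hk : (C X).keep <;> simp [CTmpl.preSecond, h0, hk, CTmpl.triv], pop_triv]
        exact .popUpCSkip ..
      · exact .popUpCPop i e' _ _ _ X T a ha (mayDrop_pop _ fun t => by
          simp [CTmpl.preSecond, h0, CTmpl.app, wrap, Layer.app])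
  have l3 := Path.popsV (k := k) (i := i) (St := fun T => .popUpV G1 G2 T) t3 (nodup_dedup _)
    (fun y hy hy' => absurd (Eqn.mem_vars.2 hy) hy') (fun y hy => (fV y).2.1)
    (fun T ⟨D, hD⟩ => ⟨⟨h1, h2, f2.fits.lists.1.tail (D := D.reverse) (by
      rwa [reverse_reverse])⟩, by simp⟩) fun y T e' hy => by
      have h1 := (hV y).1
      rw [← substV_pop]
      rcases (hV y).2.choose_spec with ⟨h0, _⟩ | ⟨a, ha, h0⟩
      · rw [show V y = .triv by rcases h : V y; simp_all [VTmpl.triv], substV_pop, pop_triv]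
        exact .popUpVSkip ..
      · rw [show (V y).app y = .node a [.var y] by simp [VTmpl.app, h1, h0, wrap, Layer.app]]
        exact .popUpVPop _ _ _ _ _ _ _ ha
  rw [e3] at l3 f3
  refine ⟨f3, fun m d hp => ?_⟩
  have := hp.step (c := ⟨i, .pair G1 G2, _⟩) ⟨f3.fits, h1, h2⟩ (.pair i _ _ _ nu hnu)
  have := l3.trans (this.step ⟨f3.fits, h1, h2, by simp [ListFits]⟩ (.popUpVDone ..))
  have := l2.trans (this.step ⟨f2.fits, h1, h2, by simp [ListFits]⟩ (.popUpCDone ..))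
  have := l1.trans (this.step ⟨f1.fits, h1, h2, by simp [ListFits]⟩ (.popDownDone ..))
  simp only [zero_add] at this
  exact this.step ⟨he.fits, trivial⟩ (.part i e G1 G2 hd hG)

end Stages

/-! ### Runs through leaf compression -/

theorem applied_wrap {t : Term} (h : t.AppliedToConst X G0) : (wrap ls t).AppliedToConst X G0 := by
  induction ls with
  | nil => exact h
  | cons L ls ih =>
    rw [wrap_cons]
    rcases L with ⟨a, l⟩ | ⟨f, xs, ys⟩ <;> simp only [Layer.app, Term.AppliedToConst]
    exacts [ih, ⟨_, by simp, ih⟩]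

/-- The algorithm tests whether `X` is applied to a constant when the turn of `X` comes. The earlier
pops from other context variables leave the constant arguments of `X` in place. -/
theorem applied_sub (hX : C X = .triv) (t : Term) (h : t.AppliedToConst X G0) :
    (sub (fun _ => .triv) C t).AppliedToConst X G0 := by
  induction t with
  | hv x => grind
  | hc Y t ih =>
    simp only [Term.AppliedToConst] at h
    rcases h with ⟨rfl, h⟩ | h
    · obtain ⟨c, hc⟩ := Option.isSome_iff_exists.1 h
      rw [(constIn_eq_some.1 hc).1] at h ⊢
      grind
    · rw [sub, CTmpl.app]
      refine applied_wrap _ ?_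
      cases (C Y).keep
      · exact applied_wrap _ (ih h)
      · simp only [cond_true, Term.AppliedToConst]
        exact Or.inr (applied_wrap _ (ih h))
  | hn f ts ih =>
    grind
  | hp a l t ih =>
    grind

section Leaf
variable {Q k b v x M g0 : ℕ} {e : Eqn} {V V' : ℕ → VTmpl} {C : ℕ → CTmpl} {own : ℕ → ℕ}
  {i : Bool}

theorem LeafPop.post (h : LeafPop k M e g0 V V' C own) (hy : y ∈ layersVars (C X).post) :
    y ∉ e.varOcc ∧ y ≤ M ∧ own y = X := by
  rcases h.ctx X with h | ⟨_, f, xs, ys, b, h, _, _, hx⟩ <;> rw [h] at hy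
  · grind
  · grind

theorem LeafPop.pre (h : LeafPop k M e g0 V V' C own) (X : ℕ) : (C X).pre = [] := by
  rcases h.ctx X with h | ⟨_, f, xs, ys, b, h, _⟩ <;> rw [h] <;> rfl

theorem LeafPop.size (h : LeafPop k M e g0 V V' C own) (hk : ∀ q ∈ e.letters, q.2 ≤ k) (X : ℕ) :
    layersSize (C X).post ≤ k ∧ (layersVars (C X).post).length ≤ k - 1 ∧
      (layersVars (C X).post).Nodup := by
  rcases h.ctx X with h | ⟨_, f, xs, ys, b, h, hl, hn, _⟩ <;> rw [h]
  · grind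
  · have : xs.length + 1 + ys.length ≤ k := by
      rcases Eqn.mem_leafSet.1 hl with h | h
      exacts [hk _ h.1, h.2.2]
    grind

/-- The variables which the generation of fathers for the context variables in `D` introduces. -/
def newVars (C : ℕ → CTmpl) (D : List ℕ) : List ℕ := (D.map fun X => layersVars (C X).post).flatten

theorem LeafPop.newVars_fits (h : LeafPop k M e g0 V V' C own) (hk : ∀ q ∈ e.letters, q.2 ≤ k)
    (hM : M ≤ Q) {D : List ℕ} (hD : k * D.length ≤ Q) : ListFits Q (newVars C D) := by
  refine ⟨?_, fun y hy => ?_⟩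
  · rw [newVars, length_flatten]
    refine (sum_le_card_nsmul _ k fun l hl => ?_).trans (by simpa [mul_comm] using hD)
    simp only [map_map, mem_map, Function.comp_apply] at hl
    obtain ⟨X, _, rfl⟩ := hl
    exact (h.size hk X).2.1.trans (by omega)
  · simp only [newVars, mem_flatten, mem_map] at hy
    obtain ⟨_, ⟨X, _, rfl⟩, hy⟩ := hy
    exact (h.post hy).2.1.trans hM

/-- The owner is a function of the variable, so different context variables introduce different
variables. -/
theorem LeafPop.newVars_nodup (h : LeafPop k M e g0 V V' C own) (hk : ∀ q ∈ e.letters, q.2 ≤ k)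
    {D : List ℕ} (hD : D.Nodup) : (newVars C D).Nodup := by
  rw [newVars, nodup_flatten]
  refine ⟨fun l hl => ?_, pairwise_map.2 (hD.imp fun {X Y} hXY y hX hY => hXY ?_)⟩
  · obtain ⟨X, _, rfl⟩ := mem_map.1 hl
    exact (h.size hk X).2.2
  · rw [← (h.post hX).2.2, (h.post hY).2.2]

theorem Path.leaf {nu : ℕ → List (Option ℕ) → ℕ} (he : Fine Q b v x e)
    (hk : ∀ q ∈ e.letters, q.2 ≤ k) (hL : LeafPop k M e g0 V V' C own) (hM : M ≤ Q)
    (hb : b + k * x + k + 1 ≤ Q) (hnu : FreshLeafNames (e.leafSet k g0) (insert g0 e.consts) nu)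
    (he' : e' = (((e.map (sub V fun _ => .triv)).map (sub (fun _ => .triv) C)).map (sub V' fun _ =>
      .triv)).map (Term.leafComp nu (e.leafSet k g0) (insert g0 e.consts))) :
    (((e.map (sub V fun _ => .triv)).map (sub (fun _ => .triv) C)).map
        (sub V' fun _ => .triv)).Fits Q ∧
      ∀ m d, Path k (Config.Fits Q) m (bif i then ⟨false, .test, e'⟩ else ⟨true, .start, e'⟩) d →
        Path k (Config.Fits Q) m ⟨i, .choose, e⟩ d := by
  subst he'
  have hcard := e.card_letters_le
  have hsz := he.size
  have hlet : ∀ q ∈ e.letters, q.1 ≤ Q := fun q hq => (Eqn.mem_letters.1 hq).elim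
    (fun h1 => he.fits.2.1.symbols.1 _ h1) fun h1 => he.fits.2.2.symbols.1 _ h1
  have hg := hL.g0_le.trans hM
  have hG : LetterFits Q (e.leafSet k g0) := by
    refine ⟨(Finset.card_union_le _ _).trans ((Nat.add_le_add (Finset.card_filter_le _ _)
      Finset.card_image_le).trans ?_), fun q hq => ?_⟩
    · rw [Nat.card_Ioc]; omega
    · rcases Eqn.mem_leafSet.1 hq with h | h
      · grind
      · grind
  have hG0 : SetFits Q (insert g0 e.consts) := by
    refine ⟨(Finset.card_insert_le _ _).trans ?_, fun c hc => ?_⟩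
    · have : e.consts.card ≤ e.letters.card :=
        Finset.card_image_le.trans (Finset.card_filter_le _ _)
      omega
    · rcases Finset.mem_insert.1 hc with rfl | hc
      · exact hg
      · obtain ⟨q, hq, rfl⟩ := Finset.mem_image.1 hc
        grind
  obtain ⟨t1, f1, v1, c1⟩ := he.sub (p := 0) (q := 0) (b' := b) (V := V) (C := fun _ => .triv)
    (by omega) (by omega) (fun y _ => ⟨by rw [(hL.var y).1]; exact .nil, fun c hc =>
      hG0.2 c ((hL.var y).2 c hc)⟩) fun X _ => ⟨le_rfl, .nil, .nil⟩
  set e1 := e.map (sub V fun _ => .triv) with he1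
  have hcl : e1.cvars.length ≤ x := (dedup_sublist _).length_le.trans f1.cvars
  have t2 : TmplFits Q 0 k e1 (fun _ => .triv) C := by
    refine ⟨f1.fits, ?_, fun y _ => by simp [VTmpl.triv, layersSize], fun X _ =>
      ⟨by simpa [hL.pre X, layersSize] using (hL.size hk X).1, fun L hL' => ?_⟩⟩
    · have := Nat.mul_le_mul_left k f1.cvars
      have := f1.size
      omega
    · rw [hL.pre X] at hL'
      rcases hL.ctx X with h | ⟨_, f, xs, ys, b, h, hl, _, hx⟩ <;> rw [h] at hL'
      · grind
      · obtain rfl : L = .nd f xs ys := by simpa using hL'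
        exact ⟨(hG.2 _ hl).1, (hG.2 _ hl).2, fun y hy => (hx y hy).2.1.trans hM⟩
  set e2 := e1.map (sub (fun _ => .triv) C) with he2
  have t3 : TmplFits Q 0 0 e2 V' fun _ => .triv := ⟨t2.sub, by simpa using t2.sub.1, fun y _ => by
    simpa [(hL.var' y).1, layersSize] using fun c hc => hG0.2 c ((hL.var' y).2 c hc),
    fun X _ => by simp [CTmpl.triv, layersSize]⟩
  have vtriv : ∀ y z : ℕ, z ∈ (VTmpl.triv.app y).vars → z = y := fun y z => by
    grind
  have hnew : ∀ D : List ℕ, (∀ X ∈ D, X ∈ e1.cvars) → D.Nodup → ListFits Q (newVars C D) :=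
    fun D hD hn => hL.newVars_fits hk hM (by
      have := (subperm_of_subset hn hD).length_le
      have := Nat.mul_le_mul_left k (this.trans hcl)
      omega)
  have hn1 : e1.cvars.Nodup := nodup_dedup _
  have l1 := Path.popsV (k := k) (i := i)
    (St := fun T => .constV (e.leafSet k g0) (insert g0 e.consts) T) t1 (nodup_dedup _)
    (fun y hy hy' => absurd (Eqn.mem_vars.2 hy) hy') (fun y _ => by rw [(hL.var y).1]; rfl)
    (fun T ⟨D, hD⟩ => ⟨⟨hG, hG0, he.fits.lists.1.tail (D := D.reverse) (by
      rwa [reverse_reverse])⟩, by simp⟩) fun y T e' _ => by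
      have h1 := (hL.var y).1
      rw [← substV_pop]
      rcases hc : (V y).const with _ | c
      · rw [show V y = .triv by rcases h : V y; simp_all [VTmpl.triv], substV_pop, pop_triv]
        exact .constVSkip ..
      · rw [show (V y).app y = .node c [] by simp [VTmpl.app, h1, hc, wrap]]
        exact .constVPop _ _ _ _ _ _ _ ((hL.var y).2 c hc)
  have l2 := Path.popsC (k := k) (i := i)
    (St := fun D T => .genDown (e.leafSet k g0) (insert g0 e.consts) T (newVars C D)) t2
    (fun D T hD => ⟨⟨hG, hG0, f1.fits.lists.2.tail hD, hnew D (fun X hX => by simp [← hD, hX])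
      (nodup_reverse.1 (hn1.sublist (hD ▸ sublist_append_left _ _)))⟩, by simp⟩)
    fun D X T e' hD hX he' => by
      have hXD : X ∉ D := fun h => by
        rw [← hD, nodup_append] at hn1
        exact hn1.2.2 X (by simpa using h) X (by simp) rfl
      rcases hL.ctx X with h | ⟨ha, f, xs, ys, b, h, hl, hn, hx⟩
      · rw [h, pop_triv, show newVars C (X :: D) = newVars C D by
          simp [newVars, h, CTmpl.triv, layersVars]]
        exact .genDownSkip ..
      · rw [show newVars C (X :: D) = xs ++ ys ++ newVars C D by
          simp [newVars, h, layersVars, Layer.vars]]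
        have hon : onV (fun _ => .triv) D = fun _ => .triv := by funext y; simp [onV]
        refine .genDownPop i e' _ _ _ X T _ f xs ys ?_ hl hn (fun y hy hy' => ?_)
          (mayDrop_pop _ fun t => by simp [h, CTmpl.app, wrap, Layer.app])
        · rw [he', hon]
          exact ha.imp (applied_sub (by simp [onC, hXD]) _) (applied_sub (by simp [onC, hXD]) _)
        -- The variables popped now do not occur yet: those introduced earlier in the loop have
        -- other owners.
        · have key : ∀ t : Term, (∀ z ∈ t.vars, z ∈ e1.varOcc) →
              y ∉ (sub (fun _ => .triv) (onC C D) t).vars := by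
            intro t ht hy'
            rcases mem_vars_sub.1 hy' with ⟨z, hz, hyz⟩ | ⟨Y, _, hyY⟩
            · grind
            · simp only [onC] at hyY
              split_ifs at hyY with hYD
              · rw [hL.pre Y] at hyY
                have := (hL.post (X := Y) (by simpa [layersVars] using hyY)).2.2
                grind
              · grind
          rw [he', hon] at hy'
          exact (mem_append.1 (Eqn.mem_vars.1 hy')).elim
            (key _ fun _ => mem_append_left _) (key _ fun _ => mem_append_right _)
  have hfull := hnew e1.cvars.reverse (by simp) (nodup_reverse.2 hn1)
  have l3 := Path.popsV (k := k) (i := i)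
    (St := fun T => .constNew (e.leafSet k g0) (insert g0 e.consts) T)
    (full := newVars C e1.cvars.reverse) t3
    (hL.newVars_nodup hk (nodup_reverse.2 hn1))
    (fun y hy hy' => by
      have key : ∀ t : Term, (∀ z ∈ t.vars, z ∈ e1.varOcc) → (∀ X ∈ t.cvars, X ∈ e1.cvarOcc) →
          y ∈ (sub (fun _ => .triv) C t).vars → y ∈ e.varOcc := by
        intro t ht hc h
        rcases mem_vars_sub.1 h with ⟨z, hz, hyz⟩ | ⟨Y, hY, hyY⟩
        · grind
        · refine absurd (mem_flatten.2 ⟨_, mem_map.2 ⟨Y, ?_, rfl⟩, ?_⟩) hy'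
          · exact mem_reverse.2 (Eqn.mem_cvars.2 (hc Y hY))
          · simpa [hL.pre Y, layersVars] using hyY
      exact hL.old y ((mem_append.1 hy).elim
        (key _ (fun _ => mem_append_left _) fun _ => mem_append_left _)
        (key _ (fun _ => mem_append_right _) fun _ => mem_append_right _)))
    (fun y _ => by rw [(hL.var' y).1]; rfl)
    (fun T ⟨D, hD⟩ => ⟨⟨hG, hG0, hfull.tail (D := D.reverse) (by
      rwa [reverse_reverse])⟩, by simp⟩) fun y T e' _ => by
      have h1 := (hL.var' y).1
      rw [← substV_pop]
      rcases hc : (V' y).const with _ | c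
      · rw [show V' y = .triv by rcases h : V' y; simp_all [VTmpl.triv], substV_pop, pop_triv]
        exact .constNewSkip ..
      · rw [show (V' y).app y = .node c [] by simp [VTmpl.app, h1, hc, wrap]]
        exact .constNewPop _ _ _ _ _ _ _ ((hL.var' y).2 c hc)
  have f3 := t3.sub
  refine ⟨f3, fun m d hp => ?_⟩
  have : Path k (Config.Fits Q) m ⟨i, .leaf (e.leafSet k g0) (insert g0 e.consts), _⟩ d :=
    hp.step ⟨f3, hG, hG0⟩ (by
      cases i
      exacts [.leafFirst _ _ _ nu hnu, .leafSecond _ _ _ nu hnu])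
  have := l3.trans (this.step ⟨f3, hG, hG0, by simp [ListFits]⟩ (.constNewDone ..))
  have := l2.trans (this.step ⟨t2.sub, hG, hG0, by simp [ListFits], hfull⟩ (.genDownDone ..))
  have := l1.trans (this.step ⟨f1.fits, hG, hG0, by simp [ListFits]⟩ (.constVDone ..))
  simp only [zero_add] at this
  -- A letter is a name together with an arity, so the single name `g0` serves for the new constant
  -- and the new letters of all arities.
  exact this.step ⟨he.fits, trivial⟩ (.choose i e (fun _ => g0) g0 (fun j _ _ => hL.fresh j)
    fun h => by
      obtain ⟨⟨_, j⟩, hq, rfl⟩ := Finset.mem_image.1 h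
      exact hL.fresh _ (Finset.mem_filter.1 hq).1)

end Leaf

/-! ### Effect of a subphase on the equation and on the value -/

theorem Term.mem_unaryPairs {t : Term} {p : ℕ × ℕ} (h : p ∈ t.unaryPairs) :
    (p.1, 1) ∈ t.letters ∧ (p.2, 1) ∈ t.letters := by
  induction t with
  | hv x => simp [unaryPairs] at h
  | hc X t ih => simpa [letters] using ih (by simpa [unaryPairs] using h)
  | hn f ts ih =>
    simp only [mem_letters_node]
    rcases length_one_cases ts with ⟨t, rfl⟩ | h1
    · rw [unaryPairs_one, mem_append] at h
      rcases h with h | h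
      · rcases hr : t.rootUnary with _ | b
        · grind
        · obtain rfl : p = (f, b) := by simpa [hr] using h
          obtain ⟨s, rfl⟩ := rootUnary_eq_some.1 hr
          simp [letters]
      · grind
    · rw [unaryPairs_ne f ts h1, mem_flatten] at h
      grind
  | hp a l t ih => simpa [letters] using (ih (by simpa [unaryPairs] using h)).imp Or.inr Or.inr

/-- Bounds for the numbers of occurrences of variables and context variables. -/
structure Bounds (k A : ℕ) (e0 : Eqn) : Prop where
  vars : e0.varOcc.length + (k - 1) * e0.cvarOcc.length ≤ A
  cvars : e0.cvarOcc.length ≤ A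
  mul : k * e0.cvarOcc.length ≤ A
  k_le : k ≤ A
  pos : 1 ≤ A

/-- What holds for the stored equation between the compression procedures. -/
structure State (k Q : ℕ) (e0 e : Eqn) (own : ℕ → Option ℕ) (S : Subst) (w : ℕ × ℕ → ℕ) : Prop where
  good : Good k e S w
  owned : Owned k e0 e own
  fits : e.Fits Q

section Subphase
variable {k Q A m : ℕ} {e0 e : Eqn} {own : ℕ → Option ℕ} {S : Subst} {w : ℕ × ℕ → ℕ}

theorem Owned.lengths (h : Owned k e0 e own) (hB : Bounds k A e0) :
    e.varOcc.length ≤ A ∧ e.cvarOcc.length ≤ A :=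
  ⟨h.length_le.1.trans hB.vars, h.length_le.2.trans hB.cvars⟩

theorem State.fine (h : State k Q e0 e own S w) (hB : Bounds k A e0) :
    Fine Q e.size A e0.cvarOcc.length e :=
  ⟨h.fits, le_rfl, (h.owned.lengths hB).1, h.owned.length_le.2⟩

theorem Owned.state (h : Owned k e0 e own)
    (hF : ∀ t : Term, t = e.lhs ∨ t = e.rhs → (F t).vars = t.vars ∧ (F t).cvars = t.cvars ∧ (F
      t).cargs = t.cargs) (he' : e' = e.map F) (hg : Good k e' S w) (he : e.Fits Q)
    (hs : e'.size ≤ Q) (hk : k ≤ Q) (hl : ∀ q ∈ e'.letters, q.1 ≤ Q) : State k Q e0 e' own S w := by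
  subst he'
  refine ⟨hg, h.congr hF, hs, Term.fits_of _ (fun q hq => ?_) ?_ ?_ hg.pf.1,
    Term.fits_of _ (fun q hq => ?_) ?_ ?_ hg.pf.2⟩
  · exact ⟨hl q (Eqn.mem_letters.2 (Or.inl hq)), (hg.ar q (Eqn.mem_letters.2 (Or.inl hq))).trans hk⟩
  · exact fun x hx => he.2.1.symbols.2.1 x ((hF _ (Or.inl rfl)).1 ▸ hx)
  · exact fun x hx => he.2.1.symbols.2.2 x ((hF _ (Or.inl rfl)).2.1 ▸ hx)
  · exact ⟨hl q (Eqn.mem_letters.2 (Or.inr hq)), (hg.ar q (Eqn.mem_letters.2 (Or.inr hq))).trans hk⟩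
  · exact fun x hx => he.2.2.symbols.2.1 x ((hF _ (Or.inr rfl)).1 ▸ hx)
  · exact fun x hx => he.2.2.symbols.2.2 x ((hF _ (Or.inr rfl)).2.1 ▸ hx)

theorem Eqn.Fits.letters (h : e.Fits Q) : ∀ q ∈ e.letters, q.1 ≤ Q := fun q hq =>
  (Eqn.mem_letters.1 hq).elim (h.2.1.symbols.1 q) (h.2.2.symbols.1 q)

theorem State.chain (h : State k Q e0 e own S w) (hB : Bounds k A e0) (hs : 24 * e.size ≤ Q)
    (hs' : e.size + 3 * A ≤ Q) : ∃ e' S' w', State k Q e0 e' own S' w' ∧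
      e'.size ≤ e.size + 3 * A ∧ (S'.eval e'.lhs).size ≤ (S.eval e.lhs).size ∧
      (∀ p ∈ e'.lhs.unaryPairs ++ e'.rhs.unaryPairs, p.1 ≠ p.2) ∧
      (∀ p ∈ (S'.eval e'.lhs).toTerm.unaryPairs, p.1 ≠ p.2) ∧
      ∀ i m d, Path k (Config.Fits Q) m ⟨i, .part, e'⟩ d →
        Path k (Config.Fits Q) ((!i).toNat + m) ⟨i, .start, e⟩ d := by
  obtain ⟨V, C, nu, S', w', e', he', hnu, hV, hC, hg, hl, ht, hp, hp'⟩ := h.good.chain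
  have hX := hB.cvars
  have hpath := fun i => Path.chain (k := k) (i := i) (h.fine hB) (by omega) hs hnu hV hC he'
  obtain ⟨f, -⟩ := hpath true
  have fV := fun y hy => (hV y hy).2.fit h.fits.unary hs
  have fC := fun X hX => (hC X hX).1.fit h.fits.unary hs
  have fC' := fun X hX => (hC X hX).2.1.fit h.fits.unary hs
  have hpop : ∀ ls, ChainPop e.unary (24 * e.size) ls →
      ∀ L ∈ ls, L.letter.2 = 1 → L.letter.1 ∈ e.unary := by
    grind
  have hG : ∀ t : Term, (∀ q ∈ t.letters, q ∈ e.letters) → (∀ y ∈ t.vars, y ∈ e.varOcc) →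
      (∀ X ∈ t.cvars, X ∈ e.cvarOcc) → ∀ a, (a, 1) ∈ (sub V C t).letters → a ∈ e.unary := by
    intro t h1 h2 h3 a ha
    refine (letters_sub_iff (p := fun q => q.2 = 1 → q.1 ∈ e.unary) V C t).2 ⟨?_, ?_, ?_⟩ _ ha rfl
    · rintro ⟨q, m⟩ hq rfl
      exact Eqn.mem_unary.2 (h1 _ hq)
    · grind
    · grind
  have hG' : ∀ t, t = (e.map (sub V C)).lhs ∨ t = (e.map (sub V C)).rhs →
      ∀ a, (a, 1) ∈ t.letters → a ∈ e.unary := by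
    rintro t (rfl | rfl)
    · exact hG _ (fun q hq => Eqn.mem_letters.2 (Or.inl hq)) (fun _ => mem_append_left _)
        fun _ => mem_append_left _
    · exact hG _ (fun q hq => Eqn.mem_letters.2 (Or.inr hq)) (fun _ => mem_append_right _)
        fun _ => mem_append_right _
  have hsz : e'.size ≤ e.size + 3 * A := by
    have h1 : e'.size ≤ (e.map (sub V C)).size := by
      rw [he']
      exact Nat.add_le_add (Term.size_chainComp _ (hG' _ (Or.inl rfl)))
        (Term.size_chainComp _ (hG' _ (Or.inr rfl)))
    have h2 := f.size
    omega
  refine ⟨e', S', w', ?_, hsz, ht, hp, hp', fun i => (hpath i).2⟩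
  refine (h.owned.sub (own' := own) (fun y hy => (fV y hy).2.1) (fun X hX => (fC X hX).2.1)
    (fun _ _ => rfl) fun X hX => Or.inl (fC' X hX).2.1).state (fun t ht => ⟨Term.vars_chainComp t
      (hG' t ht), Term.cvars_chainComp t (hG' t ht), Term.cargs_chainComp t (hG' t ht)⟩) he' hg
    f.fits (by omega) (hB.k_le.trans (by omega)) fun q hq => ?_
  rcases hl q hq with h1 | h1
  exacts [h.fits.letters q h1.1, by omega]

theorem State.pair (h : State k Q e0 e own S w) (hB : Bounds k A e0) (hs : 5 * e.size ≤ Q)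
    (hs' : e.size + 3 * A ≤ Q) (hd : Disjoint G1 G2) (hG : G1 ∪ G2 = e.unary) :
    ∃ e' S' w', State k Q e0 e' own S' w' ∧ e'.size + (e.lhs.unaryPairs ++ e.rhs.unaryPairs).countP
        (fun p => decide (p.1 ∈ G1 ∧ p.2 ∈ G2)) ≤ e.size + 3 * A ∧
      e.lhs.numConsts + e.rhs.numConsts ≤ e'.lhs.numConsts + e'.rhs.numConsts ∧
      (S'.eval e'.lhs).size + (S.eval e.lhs).toTerm.unaryPairs.countP
        (fun p => decide (p.1 ∈ G1 ∧ p.2 ∈ G2)) = (S.eval e.lhs).size ∧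
      (S'.eval e'.lhs).toTerm.numConsts = (S.eval e.lhs).toTerm.numConsts ∧
      ∀ i m d, Path k (Config.Fits Q) m ⟨i, .choose, e'⟩ d →
        Path k (Config.Fits Q) m ⟨i, .part, e⟩ d := by
  obtain ⟨V, C, nu, S', w', e', he', hnu, hV, hC, hk, hg, hl, ht⟩ := h.good.pair hd hG
  have hX := hB.cvars
  have hA := hB.pos
  have hpath := fun i => Path.pair (k := k) (i := i) hd hG (h.fine hB) (by omega) (by omega) hnu hV
    hC hk he'
  obtain ⟨f, -⟩ := hpath true
  have hU := h.fits.unary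
  have hvars : ∀ (G : Finset ℕ) ls, (∃ o, PairPop G ls o) → layersVars ls = [] := by
    grind
  have hsz := fun t : Term => Term.size_pairComp hd hnu.2 t
  refine ⟨e', S', w', ?_, ?_, ?_, ?_, ?_, fun i => (hpath i).2⟩
  · refine (h.owned.sub (own' := own) (fun y hy => hvars _ _ (hV y).2)
      (fun X hX => hvars _ _ (hC X).1) (fun _ _ => rfl)
      fun X hX => Or.inl (hvars _ _ (hC X).2)).state (fun t ht => ⟨(Term.vars_pairComp t).1,
        (Term.vars_pairComp t).2.1, Term.cargs_pairComp t⟩) he' hg f.fits ?_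
      (hB.k_le.trans (by omega)) fun q hq => ?_
    · have h1 : e'.size ≤ (e.map (sub V C)).size := by
        grind
      have := f.size
      omega
    · rcases hl q hq with h1 | h1
      exacts [h.fits.letters q h1, by omega]
  · have h1 := hsz (sub V C e.lhs)
    have h2 := hsz (sub V C e.rhs)
    have h3 := countP_unaryPairs_sub (fun p => decide (p.1 ∈ G1 ∧ p.2 ∈ G2)) V C e.lhs
    have h4 := countP_unaryPairs_sub (fun p => decide (p.1 ∈ G1 ∧ p.2 ∈ G2)) V C e.rhs
    have h5 := f.size
    grind
  · rw [he']
    simp only [Eqn.map, Term.numConsts_pairComp]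
    exact Nat.add_le_add (numConsts_sub_le _ _ _) (numConsts_sub_le _ _ _)
  · have := hsz (S.eval e.lhs).toTerm
    rwa [Tree.toTerm_pairComp, Tree.size_toTerm, Tree.size_toTerm, ← ht] at this
  · rw [ht, ← Tree.toTerm_pairComp, Term.numConsts_pairComp]

theorem State.leaf (h : State k Q e0 e own S w) (hB : Bounds k A e0)
    (hs : 2 * e.size + 2 * A + 2 ≤ Q) :
    ∃ e' S' w' own', State k Q e0 e' own' S' w' ∧
      e'.size + e.lhs.numConsts + e.rhs.numConsts ≤ e.size + 2 * A + 2 ∧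
      (S'.eval e'.lhs).size + (S.eval e.lhs).toTerm.numConsts ≤
        (S.eval e.lhs).size + (if (S.eval e.lhs).size = 1 then 1 else 0) ∧
      ∀ i m d, Path k (Config.Fits Q) m (bif i then ⟨false, .test, e'⟩ else ⟨true, .start, e'⟩) d →
        Path k (Config.Fits Q) m ⟨i, .choose, e⟩ d := by
  classical
  have hX := h.owned.length_le.2
  have hkX := Nat.mul_le_mul_left k hX
  have h1 := hB.mul
  have h2 := hB.k_le
  have h3 := hB.cvars
  obtain ⟨g0, V, V', C, ow, nu, S', w', e', he', hnu, hL, hg, hl, hsz, ht⟩ := h.good.leaf (M := Q)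
    (by omega)
  have hpath := fun i => Path.leaf (i := i) (h.fine hB) h.good.ar hL le_rfl (by omega) hnu he'
  obtain ⟨f, -⟩ := hpath true
  have O1 := h.owned.sub (own' := own) (V := V) (C := fun _ => .triv)
    (fun y _ => by rw [(hL.var y).1]; rfl) (fun _ _ => rfl) (fun _ _ => rfl) fun _ _ => Or.inl rfl
  -- Old variables keep their owners, and a fresh one is owned by the context variable that popped
  -- it.
  let own' : ℕ → Option ℕ := fun y => if y ∈ e.varOcc then own y else some (ow y)
  have hv1 : ∀ y ∈ (e.map (sub V fun _ => .triv)).varOcc, y ∈ e.varOcc := by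
    have key : ∀ (t : Term) y, y ∈ (sub V (fun _ => .triv) t).vars → y ∈ t.vars := by
      intro t y hy
      rcases mem_vars_sub.1 hy with ⟨z, hz, hyz⟩ | ⟨X, _, hyX⟩
      · rwa [mem_vars_app (by rw [(hL.var z).1]; rfl) hyz]
      · grind
    grind
  have O2 := O1.sub (own' := own') (V := fun _ => .triv) (C := C) (fun _ _ => rfl)
    (fun X _ => by rw [hL.pre X]; rfl) (fun y hy => if_pos (hv1 y hy)) fun X _ => by
      rcases hL.ctx X with hX | ⟨ha, -⟩
      · grind
      · refine Or.inr ⟨(hL.size h.good.ar X).2.1, fun y hy => ?_, fun y hy hX => ?_⟩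
        · obtain ⟨h4, _, h5⟩ := hL.post hy
          grind
        -- A variable owned by `X` would have to occur in the constant argument of `X`.
        · have := O1.args (X, []) (mem_append.2 (ha.imp (fun h => (Term.AppliedToConst.cargs _ h).2)
            fun h => (Term.AppliedToConst.cargs _ h).2)) y hy hX
          grind
  have O3 := O2.sub (own' := own') (V := V') (C := fun _ => .triv)
    (fun y _ => by rw [(hL.var' y).1]; rfl) (fun _ _ => rfl) (fun _ _ => rfl) fun _ _ => Or.inl rfl
  refine ⟨e', S', w', own', ?_, by omega, ht, fun i => (hpath i).2⟩
  refine O3.state (fun t ht => ⟨(Term.vars_leafComp t).1, (Term.vars_leafComp t).2.1,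
    Term.cargs_leafComp t⟩) he' hg f (by omega) (by omega) fun q hq => ?_
  exact (hl q hq).elim (h.fits.letters q) id

/-- Pairs and constants are what the compressions remove. Unary letters are bounded by the pairs and
the other symbols, letters of higher arity by the leaves; so a term with few variables has much to
remove. -/
theorem Term.size_le_pairs (ht : t.exps = []) :
    t.size ≤ t.unaryPairs.length + 4 * t.numConsts + 4 * t.vars.length + 2 * t.cvars.length := by
  have h1 := t.size_eq
  have h2 := t.letters_length_eq
  have h3 := t.numBranch_lt
  have h4 := t.numUnary_le ht
  omega

/-- A subphase. -/
theorem State.subphase (h : State k Q e0 e own S w) (hB : Bounds k A e0) (hs : e.size ≤ 84 * A)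
    (hQ : Q = 2100 * A) (i : Bool) :
    ∃ e' S' w' own', State k Q e0 e' own' S' w' ∧ e'.size ≤ e.size + 10 * A ∧
      (i = false → 4 * e'.size ≤ 3 * e.size + 43 * A) ∧
      (S'.eval e'.lhs).size ≤ (S.eval e.lhs).size ∧
      (i = true → 4 * (S'.eval e'.lhs).size ≤ 3 * max 2 (S.eval e.lhs).size) ∧
      ∀ m d, Path k (Config.Fits Q) m (bif i then ⟨false, .test, e'⟩ else ⟨true, .start, e'⟩) d →
        Path k (Config.Fits Q) ((!i).toNat + m) ⟨i, .start, e⟩ d := by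
  have hA := hB.pos
  obtain ⟨e1, S1, w1, h1, hs1, ht1, hp1, hp1', P1⟩ := h.chain hB (by omega) (by omega)
  -- The partition is adapted to the equation in the first subphase and to the value of its sides in
  -- the second.
  obtain ⟨G1, G2, hd, hG, hcov⟩ := exists_partition e1.unary
    (bif i then (S1.eval e1.lhs).toTerm.unaryPairs else e1.lhs.unaryPairs ++ e1.rhs.unaryPairs) (by
      cases i
      · refine fun p hp => ⟨hp1 p hp, ?_⟩
        simp only [Eqn.mem_unary, Eqn.mem_letters]
        rcases mem_append.1 hp with hp | hp <;> simp [Term.mem_unaryPairs hp]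
      · intro p hp
        have hu := (Tree.all_iff_toTerm _).1 h1.good.unary
        have := Term.mem_unaryPairs hp
        exact ⟨hp1' p hp, Eqn.mem_unary.2 (hu _ this.1 rfl), Eqn.mem_unary.2 (hu _ this.2 rfl)⟩)
  obtain ⟨e2, S2, w2, h2, hs2, hc2, ht2, hn2, P2⟩ := h1.pair hB (by omega) (by omega) hd hG
  obtain ⟨e3, S3, w3, own', h3, hs3, ht3, P3⟩ := h2.leaf hB (by omega)
  have hpos := (S3.eval e3.lhs).one_le_size
  have hb := (S1.eval e1.lhs).toTerm.numBranch_lt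
  rw [(Tree.symbols_toTerm _).1, length_nil] at hb
  refine ⟨e3, S3, w3, own', h3, by omega, ?_, ?_, ?_, fun m d hp => P1 i m d (P2 i m d (P3 i m d hp))⟩
  -- The covered pairs and the absorbed constants amount to a quarter of `e1.size - 6 * A` at least,
  -- and all pops together add at most `8 * A + 2` symbols.
  · rintro rfl
    have a1 := e1.lhs.size_le_pairs h1.good.pf.1
    have a2 := e1.rhs.size_le_pairs h1.good.pf.2
    have a3 := (h1.owned.lengths hB)
    grind
  · grind
  -- The value has no variables, so four times the covered pairs and constants account for all of
  -- it. The `max` covers a value that has become a single constant, which nothing absorbs.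
  · rintro rfl
    have a1 := (S1.eval e1.lhs).toTerm.size_le_pairs (Tree.symbols_toTerm _).2.2
    simp only [cond_true] at hcov
    rw [(Tree.symbols_toTerm _).1, (Tree.symbols_toTerm _).2.1, Tree.size_toTerm] at a1
    grind

end Subphase

/-! ### The main loop -/

theorem Tree.size_le_fill (t : Tree) :
    t.size ≤ (c.fill t).size ∧ (c ≠ .hole → t.size < (c.fill t).size) := by
  induction c with
  | hole => grind
  | node f l c r ih =>
    grind

/-- The values of context variables are nonempty, so every symbol contributes a node. In particular,
while a side has size greater than 1 its value has size at least 2. -/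
theorem Subst.size_le_eval (S : Subst) (t : Term) (ht : t.exps = [])
    (hS : ∀ X ∈ t.cvars, S.ctx X ≠ .hole) : t.size ≤ (S.eval t).size := by
  induction t with
  | hv x => simpa [Term.size, Subst.eval] using (S.var x).one_le_size
  | hc X t ih =>
    simp only [Term.cvars, forall_mem_cons, Term.exps] at hS ht
    have h1 := (Tree.size_le_fill (S.ctx X) (S.eval t)).2 hS.1
    grind
  | hn f ts ih =>
    simp only [Term.cvars, Term.exps, mem_flatten, mem_map, flatten_eq_nil_iff] at hS ht
    simp only [Term.size, Subst.eval, Tree.size, map_map]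
    exact Nat.add_le_add_right (sum_le_sum fun t h => ih t h (ht _ ⟨t, h, rfl⟩)
      fun X hX => hS X ⟨_, ⟨t, h, rfl⟩, hX⟩) 1
  | hp a l t ih => grind

/-- The main loop. -/
theorem State.run {A : ℕ} {e0 : Eqn} (hB : Bounds k A e0) (hQ : Q = 2100 * A) (N : ℕ) :
    ∀ {e : Eqn} {own : ℕ → Option ℕ} {S : Subst} {w : ℕ × ℕ → ℕ} (i : Bool),
      State k Q e0 e own S w → e.size ≤ 84 * A → (S.eval e.lhs).size = N →
      ∃ m d, Path k (Config.Fits Q) m ⟨i, .test, e⟩ d ∧ d.stage = .halt true ∧ 4 ^ m ≤ 3 ^ m * N := by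
  induction N using Nat.strong_induction_on with
  | _ N ih =>
  intro e own S w i h hs hN
  by_cases hbig : 1 < e.lhs.size ∨ 1 < e.rhs.size
  · have h2 : 2 ≤ N := by
      have h1 := S.size_le_eval e.lhs h.good.pf.1 fun X hX => h.good.ne X (by simp [hX])
      have h2 := S.size_le_eval e.rhs h.good.pf.2 fun X hX => h.good.ne X (by simp [hX])
      rw [← h.good.sol.2] at h2
      omega
    -- A phase reproduces the bound `84 * A`, since `(3 * 84 + 43) / 4 + 10 < 84`; and `24 * 84 ≤
    -- 2100` leaves room for the exponents of the chains.
    obtain ⟨e1, S1, w1, own1, h1, -, hs1, ht1, -, P1⟩ := h.subphase hB hs hQ false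
    have hs1 := hs1 rfl
    obtain ⟨e2, S2, w2, own2, h2, hs2, -, -, ht2, P2⟩ := h1.subphase hB (by omega) hQ true
    have ht2 := ht2 rfl
    obtain ⟨m, d, hp, hd, hm⟩ := ih (S2.eval e2.lhs).size (by omega) false h2 (by omega) rfl
    refine ⟨_, d, (P1 _ d (P2 m d hp)).step ⟨h.fits, trivial⟩ (.enter i e hbig), hd, ?_⟩
    rw [show (!false).toNat + ((!true).toNat + m) = m + 1 by simp [add_comm], pow_succ, pow_succ]
    have := Nat.mul_le_mul_left (3 ^ m) (show 4 * (S2.eval e2.lhs).size ≤ 3 * N by omega)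
    linarith
  · refine ⟨0, ⟨i, .halt true, e⟩, (Path.refl _ ⟨h.fits, trivial⟩).step ⟨h.fits, trivial⟩
      (.yes i e hbig ?_), rfl, by simpa [← hN] using (S.eval e.lhs).one_le_size⟩
    rw [not_or] at hbig
    rcases Term.size_one_cases hbig.1 with h1 | ⟨c, h1⟩
    · exact Or.inl h1
    · rcases Term.size_one_cases hbig.2 with h2 | ⟨c', h2⟩
      · exact Or.inr (Or.inl h2)
      · have := h.good.sol.2
        rw [h1, h2] at this
        exact Or.inr (Or.inr (by rw [h1, h2]; simpa [Subst.eval] using this))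

/-! ### Reading the input -/

theorem Term.symbols_load {rho : ℕ → ℕ → ℕ} {sig tau : ℕ → ℕ} {E : Finset ℕ} (ht : t.Over Sg) :
    (t.load rho sig tau E).size ≤ t.size ∧
      (∀ y ∈ (t.load rho sig tau E).vars, ∃ x ∈ t.vars, sig x = y) ∧
      (∀ Y ∈ (t.load rho sig tau E).cvars, ∃ X ∈ t.cvars, X ∉ E ∧ tau X = Y) ∧
      (t.load rho sig tau E).exps = [] := by
  induction t with
  | hv x => simp [load, vars, cvars, exps, size]
  | hc X t ih =>
    obtain ⟨h1, h2, h3, h4⟩ := ih (by simpa [Over] using ht)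
    by_cases hX : X ∈ E
    · simp only [load, if_pos hX, size, vars, cvars, mem_cons]
      grind
    · simp only [load, if_neg hX, size, vars, cvars, exps, mem_cons]
      grind
  | hn f ts ih =>
    simp only [Over] at ht
    have ih := fun t h => ih t h (ht.2 t h)
    simp only [load, size, vars, cvars, exps, map_map, mem_flatten, mem_map,
      flatten_eq_nil_iff, Function.comp_apply]
    refine ⟨Nat.add_le_add_right (sum_le_sum fun t h => (ih t h).1) 1, ?_, ?_, ?_⟩
    · grind
    · grind
    · grind
  | hp a l t ih => simp [Over] at ht

theorem exists_names (l : List ℕ) : ∃ nu : ℕ → ℕ, Injective nu ∧ ∀ a ∈ l, nu a ≤ l.length := by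
  obtain ⟨nu, h1, -, h2⟩ := exists_small_names l.toFinset ∅
  exact ⟨nu, h1, fun a ha => (h2 a (mem_toFinset.2 ha)).trans (by simpa using l.toFinset_card_le)⟩

/-- The run starts from a solution of least size among all solutions with letters of arity at most
`k`, the class in which decoding takes place. Its size is at most the least size over the signature.
All letters have weight 1 at this point, so it is minimal for the weight. -/
theorem exists_initial {u v : Term} (hu : u.Over Sg) (hv : v.Over Sg) (hS : IsSolution Sg u v S)
    (hQ : u.size + v.size ≤ Q) (hk : maxArity Sg ≤ Q) :
    ∃ e S' w, IsInitial u v ⟨false, .test, e⟩ ∧ e.size ≤ u.size + v.size ∧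
      State (maxArity Sg) Q e e (fun _ => none) S' w ∧ (S'.eval e.lhs).size ≤ (S.eval u).size := by
  classical
  set k := maxArity Sg
  have hmax : ∀ q ∈ Sg, q.2 ≤ k := fun q hq => Finset.le_sup (f := Prod.snd) hq
  have hex : ∃ N, ∃ T, Solves k ⟨u, v⟩ T ∧ (T.eval u).size = N := ⟨_, S,
    ⟨(Subst.over_iff_all.1 hS.1).imp (fun h x => (h x).mono hmax) fun h X => (h X).mono hmax, hS.2⟩,
    rfl⟩
  obtain ⟨S0, hS0, hN⟩ := Nat.find_spec hex
  have hmin : ∀ T, Solves k ⟨u, v⟩ T → (S0.eval u).size ≤ (T.eval u).size := fun T hT =>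
    hN ▸ Nat.find_min' hex ⟨T, hT, rfl⟩
  obtain ⟨ρ, hρ, hρ'⟩ := exists_names ((u.letters ++ v.letters).map Prod.fst)
  obtain ⟨sig, hsig, hsig'⟩ := exists_names (u.vars ++ v.vars)
  obtain ⟨tau, htau, htau'⟩ := exists_names (u.cvars ++ v.cvars)
  have hn1 := u.size_eq
  have hn2 := v.size_eq
  simp only [length_map, length_append] at hρ' hsig' htau'
  -- Exactly the context variables with empty values are removed, as the field `ne` of `Good`
  -- requires.
  let E := (u.cvars ++ v.cvars).toFinset.filter fun X => S0.ctx X = .hole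
  let L := load (fun _ => ρ) sig tau E
  let H := Hom.relabel fun _ => ρ
  let T : Subst := ⟨fun y => H.tree (S0.var (Function.invFun sig y)),
    fun Y => H.cx (S0.ctx (Function.invFun tau Y))⟩
  have hi1 := Function.leftInverse_invFun hsig
  have hi2 := Function.leftInverse_invFun htau
  have key : ∀ t : Term, t.Over Sg → T.eval (L t) = H.tree (S0.eval t) := by
    intro t ht
    rw [H.tree_eval]
    induction t with
    | hv x => simp [Subst.eval, L, load, Hom.eval, Hom.subst, T, hi1 x]
    | hc X t ih =>
      have ih := ih (by simpa [Term.Over] using ht)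
      by_cases hX : X ∈ E
      · simp only [L, load, hX, if_true, Hom.eval, Hom.subst, (Finset.mem_filter.1 hX).2]
        exact ih
      · simp only [L, load, hX, if_false, Subst.eval, Hom.eval, Hom.subst, T, hi2 X]
        rw [← Hom.subst, ← ih]
    | hn f ts ih =>
      simp only [Term.Over] at ht
      simp only [Subst.eval, L, load, Hom.eval, H, Hom.relabel, map_map]
      congr 1
      exact map_congr_left fun t h => ih t h (ht.2 t h)
    | hp a l t ih => simp [Term.Over] at ht
  have hsz : ∀ t : Term, t.Over Sg → (T.eval (L t)).size = (S0.eval t).size := fun t ht => by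
    rw [key t ht, Hom.relabel_size]
  have hl : ∀ t : Term, t.Over Sg → (∀ q ∈ t.letters, q ∈ u.letters ++ v.letters) →
      ∀ q ∈ (L t).letters, q.1 ≤ Q ∧ q.2 ≤ k := by
    intro t ht hq q hm
    obtain ⟨f, hf, h1⟩ := letters_load t q hm
    exact ⟨h1 ▸ (hρ' f (mem_map.2 ⟨(f, q.2), hq _ hf, rfl⟩)).trans (by omega),
      hmax (f, q.2) (over_letters ht _ hf)⟩
  have hlu := hl u hu fun q => mem_append_left _
  have hlv := hl v hv fun q => mem_append_right _
  have hLu := u.symbols_load (rho := fun _ => ρ) (sig := sig) (tau := tau) (E := E) hu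
  have hLv := v.symbols_load (rho := fun _ => ρ) (sig := sig) (tau := tau) (E := E) hv
  have hfit : ∀ t : Term, t.Over Sg → (∀ q ∈ (L t).letters, q.1 ≤ Q ∧ q.2 ≤ k) →
      (∀ x ∈ t.vars, x ∈ u.vars ++ v.vars) → (∀ X ∈ t.cvars, X ∈ u.cvars ++ v.cvars) →
      (L t).Fits Q := by
    intro t ht h1 h2 h3
    obtain ⟨_, h4, h5, h6⟩ := t.symbols_load (rho := fun _ => ρ) (sig := sig) (tau := tau) (E := E) ht
    refine fits_of _ (fun q hq => ⟨(h1 q hq).1, (h1 q hq).2.trans hk⟩) (fun y hy => ?_)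
      (fun Y hY => ?_) h6
    · grind
    · grind
  have hsize : (L u).size + (L v).size ≤ u.size + v.size := Nat.add_le_add hLu.1 hLv.1
  refine ⟨⟨L u, L v⟩, T, fun _ => 1, ⟨_, sig, tau, E, fun _ => hρ, hsig, htau, rfl⟩, hsize,
    ⟨⟨⟨⟨fun y => H.all_tree (Hom.relabel_all _) (hS0.1.1 _), fun Y => H.all_cx
        ⟨_, H.all_tree (Hom.relabel_all _) (hS0.1.1 0)⟩ (Hom.relabel_all _) (hS0.1.2 _)⟩, ?_⟩, ?_,
      ⟨hLu.2.2.2, hLv.2.2.2⟩, ?_, fun _ => le_rfl, fun _ _ => rfl, ?_⟩, Owned.refl _ _,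
      hsize.trans hQ, ?_, ?_⟩, ?_⟩
  · change T.eval (L u) = T.eval (L v)
    rw [key u hu, key v hv, hS0.2]
  · exact fun q hq => (Eqn.mem_letters.1 hq).elim (fun h => (hlu q h).2) fun h => (hlv q h).2
  · intro Y hY
    obtain ⟨X, hX, hXE, rfl⟩ : ∃ X ∈ u.cvars ++ v.cvars, X ∉ E ∧ tau X = Y := by grind
    have : S0.ctx X ≠ .hole := fun h => hXE (Finset.mem_filter.2 ⟨mem_toFinset.2 hX, h⟩)
    simp only [T, hi2 X]
    rcases hc : S0.ctx X with _ | ⟨f, l, c, r⟩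
    · grind
    · simp [Hom.cx, H, Hom.relabel]
  -- Undoing the renaming turns a competitor into a solution of `u = v` of the same size.
  · intro T' hT'
    obtain ⟨T2, h1, h2⟩ := hT'.of_load fun _ => hρ
    rw [← Tree.size_eq_weight, ← Tree.size_eq_weight]
    grind
  · grind
  · grind
  · change (T.eval (L u)).size ≤ _
    rw [hsz u hu]
    exact hmin S ⟨(Subst.over_iff_all.1 hS.1).imp (fun h x => (h x).mono hmax)
      fun h X => (h X).mono hmax, hS.2⟩

/-! ### Numerical bounds and the main theorem -/

theorem Eqn.bounds (e : Eqn) {n : ℕ} (h : e.size ≤ n) : Bounds k (n * max 1 k) e := by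
  have h1 := e.lhs.size_eq
  have h2 := e.rhs.size_eq
  have h3 := e.lhs.one_le_size
  have h4 : e.varOcc.length + e.cvarOcc.length ≤ n := by
    grind
  have h5 : 1 ≤ n := by rw [Eqn.size] at h; omega
  have hk : k ≤ max 1 k := le_max_right _ _
  have h1k : 1 ≤ max 1 k := le_max_left _ _
  have hx : e.cvarOcc.length ≤ n := by omega
  refine ⟨?_, by nlinarith, by nlinarith, by nlinarith, by nlinarith⟩
  have h6 := Nat.mul_le_mul_right (max 1 k) h4
  have h7 := Nat.mul_le_mul_right e.cvarOcc.length (show k - 1 ≤ max 1 k by omega)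
  have h8 := Nat.mul_le_mul_left e.varOcc.length h1k
  nlinarith

/-- Taking logarithms, the factor 4 comes from `log (4 / 3) ≥ 1 - 3 / 4`. -/
theorem le_log_of_pow_le {N : ℕ} (h : 4 ^ m ≤ 3 ^ m * N) : (m : ℝ) ≤ 4 * Real.log N := by
  have hN : 0 < N := Nat.pos_of_ne_zero fun h0 => by simp [h0] at h
  have h1 : (4 : ℝ) ^ m ≤ 3 ^ m * N := by exact_mod_cast h
  have h2 := Real.log_le_log (by positivity) h1
  rw [Real.log_mul (by positivity) (by positivity), Real.log_pow, Real.log_pow] at h2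
  have h3 : 1 - (4 / 3 : ℝ)⁻¹ ≤ Real.log (4 / 3) := Real.one_sub_inv_le_log_of_pos (by norm_num)
  rw [Real.log_div (by norm_num) (by norm_num)] at h3
  have := mul_le_mul_of_nonneg_left h3 (Nat.cast_nonneg (α := ℝ) m)
  grind

end ContextUnif

open ContextUnif in
theorem mainTheorem2 : ∃ C : ℕ, ∀ (Sg : Finset (ℕ × ℕ)) (u v : Term),
      (∃ c, (c, 0) ∈ Sg) → u.Over Sg → v.Over Sg →
      (¬ Satisfiable Sg u v →
        ∀ (r : List Config) (answer : Bool), IsRun Sg u v r → Returns r answer → answer = false) ∧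
      (Satisfiable Sg u v → ∃ S : Subst, IsSizeMinimal Sg u v S ∧
        ∃ r : List Config, IsRun Sg u v r ∧ Returns r true ∧
          (numPhases r : ℝ) ≤ C * Real.log (S.eval u).size ∧
          ∀ c ∈ r, c.eqn.size ≤ C * ((u.size + v.size) * max 1 (maxArity Sg)) ∧
            c.bits ≤ C * ((u.size + v.size) ^ 2 * max 1 (maxArity Sg) ^ 2)) := by
  -- With `Q = 2100 * A` a fitting configuration takes at most `24 * (Q + 1) ^ 2 ≤ 24 * (2101 * A) ^
  -- 2` bits; the bounds on the length and on the number of phases need far smaller constants.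
  refine ⟨24 * 2101 ^ 2, fun Sg u v hc hu hv => ⟨fun hns r answer hr ha => ?_, fun hsat => ?_⟩⟩
  · cases answer
    · rfl
    · exact absurd (run_sound hc hu hv hr ha) hns
  · classical
    have hex : ∃ N, ∃ S, IsSolution Sg u v S ∧ (S.eval u).size = N :=
      hsat.imp' (fun S => (S.eval u).size) fun S hS => ⟨S, hS, rfl⟩
    obtain ⟨S, hS, hN⟩ := Nat.find_spec hex
    refine ⟨S, ⟨hS, fun S' hS' => hN ▸ Nat.find_min' hex ⟨S', hS', rfl⟩⟩, ?_⟩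
    have hn := u.one_le_size
    generalize hA : (u.size + v.size) * max 1 (maxArity Sg) = A
    have hk1 : 1 ≤ max 1 (maxArity Sg) := le_max_left _ _
    have hk : maxArity Sg ≤ max 1 (maxArity Sg) := le_max_right _ _
    have hnA : u.size + v.size ≤ A := by nlinarith
    have hkA : maxArity Sg ≤ A := by nlinarith
    obtain ⟨e, S', w, hi, hs, hst, hle⟩ := exists_initial hu hv hS (Q := 2100 * A) (by omega)
      (by omega)
    obtain ⟨m, d, hp, hd, hm⟩ := State.run (hA ▸ e.bounds hs) rfl _ false hst (by omega) rfl
    obtain ⟨r, hr, hlast, hall, hph⟩ := hp.exists_run (by unfold Config.startsPhase; grind)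
    refine ⟨_ :: r, ⟨⟨_, rfl, hi⟩, hr⟩, ⟨d, hlast, hd⟩, ?_, fun c hcr => ⟨?_, ?_⟩⟩
    · rw [hph]
      have h1 : 4 ^ m ≤ 3 ^ m * (S.eval u).size := hm.trans (Nat.mul_le_mul_left _ hle)
      refine (le_log_of_pow_le h1).trans (mul_le_mul_of_nonneg_right (by norm_num) ?_)
      exact Real.log_natCast_nonneg _
    · have := (hall c hcr).1.1
      omega
    · rw [← mul_pow, hA]
      refine (hall c hcr).bits_le.trans ?_
      rw [mul_assoc, ← mul_pow]
      exact Nat.mul_le_mul_left _ (Nat.pow_le_pow_left (by omega) 2)
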